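/- Let $R\in(0,\infty]$, let $a(dy)$ be a non-negative locally finite Borel measure on $[0,R)$ with $a(\{0\})=0$, and let $b$ be a real Borel function on $[0,R)$ such that $b^2$ is locally integrable on $[0,R)$ and $a(dy)-b(y)^2dy$ is non-negative; we say that $L=a(dy)\partial_{xx}+2b(y)\partial_{xy}+\partial_{yy}$ is of class $\mathbb L^\star$. Put $B(y)=\int_0^y b(t)\,dt$. Functions are complex-valued, $L^2=L^2(\mathbb R)$, and $\hat f(\xi)=\int_{\mathbb R}e^{-i\xi x}f(x)\,dx$, extended continuously to $L^2$. *Harmonic functions.* A Borel function $u$ on $\mathbb R\times[0,R)$ is harmonic for $L$ if: (a) $u(\cdot,y)\in L^2$ for every $y\in[0,R)$, $y\mapsto u(\cdot,y)$ is continuous from $[0,R)$ to $L^2$, and $\|u(\cdot,y)\|_{L^2}$ is bounded in $y$ if $R=\infty$, while $u(\cdot,y)\to0$ in $L^2$ as $y\to R^-$ if $R<\infty$; (b) $\tilde u(x,y)=u(x+B(y),y)$ has a (locally integrable) weak derivative $\partial_y\tilde u$ on $\mathbb R\times(0,R)$, and $|\partial_y\tilde u|^2$ is integrable over $\mathbb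 R\times(y_1,y_2)$ whenever $0<y_1<y_2<R$; (c) $Lu=0$ weakly, that is, for every smooth compactly supported $v$ on $\mathbb R\times(0,R)$, $$\int_{(0,R)}\Bigl(\int_{\mathbb R} u\,\partial_{xx}v\,dx\Bigr)\bigl(a(dy)-2b(y)^2dy\bigr)-2\int_0^R\Bigl(\int_{\mathbb R}\partial_y\tilde u(x-B(y),y)\,\partial_xv(x,y)\,dx\Bigr)b(y)\,dy+\int_0^R\int_{\mathbb R}u\,\partial_{yy}v\,dx\,dy=0 .$$ *Symbol.* For $\xi>0$ let $\varphi_\xi$ be the unique solution on $[0,R)$ of $$\varphi''(dt)=\xi^2\varphi(t)\,a(dt)-2i\xi\, b(t)\varphi'(t)\,dt$$ (an equality of measures on $[0,R)$, where $\varphi$ is locally absolutely continuous and $\varphi'$ is left-continuous and locally of bounded variation, with $\varphi''([0,t))=\varphi'(t)-\varphi'(0)$) such that $\varphi_\xi(0)=1$ and $\varphi_\xi$ is bounded if $R=\infty$, respectively $\varphi_\xi(R^-)=0$ if $R<\infty$. Put $\varphi_\xi=\overline{\varphi_{-\xi}}$ for $\xi<0$, $\varphi_0=1$, and $k(\xi)=-\varphi_\xi'(0)$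 for $\xi\in\mathbb R$. *Statement.* Let $f\in L^2$ and let $u$ be harmonic for $L$ with $u(\cdot,0)=f$ almost everywhere. Then the limit $$\lim_{y\to0^+}\frac{u(\cdot,y)-u(\cdot,0)}{y}$$ exists in $L^2$ if and only if $k\hat f\in L^2$, and in this case the limit $g$ satisfies $\hat g(\xi)=-k(\xi)\hat f(\xi)$ for almost every $\xi$. Consequently the Dirichlet-to-Neumann operator $K$ of $L$, whose domain is the set of all $f\in L^2$ for which this limit exists for the harmonic function $u$ with boundary values $f$, and where $Kf$ is this limit, is a well-defined linear unbounded operator on $L^2$, equal to the Fourier multiplier with symbol $-k$: its domain is $\{f\in L^2: k\hat f\in L^2\}$ and $\widehat{Kf}=-k\hat f$. -/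

import Mathlib

open MeasureTheory Filter Topology Set
open scoped ENNReal NNReal ContDiff FourierTransform ComplexConjugate

noncomputable section

/-- The complex Hilbert space `L²(ℝ)`. -/
abbrev L2R : Type := Lp ℂ 2 (volume : Measure ℝ)

/-- The `L²` Fourier transform normalised as `f̂(ξ) = ∫ e^{-iξx} f(x) dx`
(Mathlib's `𝓕` uses the kernel `e^{-2πiξx}`), as a function defined up to null sets. -/
def hat (f : L2R) : ℝ → ℂ := fun ξ => (𝓕 f : L2R) (ξ / (2 * Real.pi))

/-- The operators `a(dy) ∂ₓₓ + 2 b(y) ∂ₓᵧ + ∂ᵧᵧ` of class `𝕃`, on `ℝ × [0, R)` with `0 < R ≤ ∞`.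
The measure `a` on `[0, R)` is regarded as a measure on `ℝ` that does not charge the complement,
and `b` as a Borel function on `ℝ` of which only the values on `[0, R)` matter. -/
structure OperatorL where
  R : EReal
  R_pos : 0 < R
  a : Measure ℝ
  a_compl : a {y : ℝ | 0 ≤ y ∧ (y : EReal) < R}ᶜ = 0
  a_locallyFinite : ∀ r : ℝ, 0 ≤ r → (r : EReal) < R → a (Icc 0 r) < ⊤
  b : ℝ → ℝ
  b_measurable : Measurable b
  b_sq_locallyIntegrable : ∀ r : ℝ, 0 ≤ r → (r : EReal) < R →
    IntegrableOn (fun y => b y ^ 2) (Icc 0 r) volume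
  /-- `a(dy) - b(y)² dy` is non-negative. -/
  b_sq_le : (volume.restrict {y : ℝ | 0 ≤ y ∧ (y : EReal) < R}).withDensity
    (fun y => ENNReal.ofReal (b y ^ 2)) ≤ a

namespace OperatorL

/-- The interval `[0, R)`. -/
def dom (L : OperatorL) : Set ℝ := {y : ℝ | 0 ≤ y ∧ (y : EReal) < L.R}

/-- The interval `(0, R)`. -/
def int (L : OperatorL) : Set ℝ := {y : ℝ | 0 < y ∧ (y : EReal) < L.R}

/-- `L` is of class `𝕃*`. -/
def IsStar (L : OperatorL) : Prop := L.a {0} = 0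

/-- `B(y) = ∫₀ʸ b(t) dt`. -/
def B (L : OperatorL) (y : ℝ) : ℝ := ∫ t in (0 : ℝ)..y, L.b t

/-! ### Harmonic functions -/

/-- `v` is a smooth, compactly supported function on `ℝ × (0, R)`. -/
structure IsTest (L : OperatorL) (v : ℝ → ℝ → ℂ) : Prop where
  smooth : ContDiff ℝ ∞ (fun p : ℝ × ℝ => v p.1 p.2)
  compact : HasCompactSupport (fun p : ℝ × ℝ => v p.1 p.2)
  supp : tsupport (fun p : ℝ × ℝ => v p.1 p.2) ⊆ univ ×ˢ L.int

/-- `w` is the weak derivative of `U` with respect to the second variable `y` on `ℝ × (0, R)`. -/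
structure IsWeakDerivY (L : OperatorL) (U w : ℝ → ℝ → ℂ) : Prop where
  measurable : Measurable (fun p : ℝ × ℝ => w p.1 p.2)
  locallyIntegrable :
    LocallyIntegrableOn (fun p : ℝ × ℝ => w p.1 p.2) (univ ×ˢ L.int) volume
  eq : ∀ v : ℝ → ℝ → ℂ, L.IsTest v →
    ∫ y in L.int, ∫ x : ℝ, w x y * v x y =
      -∫ y in L.int, ∫ x : ℝ, U x y * deriv (fun y' => v x y') y

/-- The weak form of `L u = 0` on `ℝ × (0, R)`, where `w = ∂ᵧ ũ` and `ũ(x, y) = u(x + B(y), y)`.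
Formally `w(x - B(y), y) = ∂ᵧ u + b ∂ₓ u`, so that the weak form
`∫∫ u ∂ₓₓv dx a(dy) - 2 ∫∫ (∂ᵧ u) ∂ₓv b dx dy + ∫∫ u ∂ᵧᵧv dx dy = 0` of the equation, with
`∂ᵧ u` replaced by `w(x - B(y), y) - b ∂ₓ u` and the last `∂ₓ` moved to `v`, is the equality
below. All the integrals in it converge. -/
def WeakEquation (L : OperatorL) (u w : ℝ → ℝ → ℂ) : Prop :=
  ∀ v : ℝ → ℝ → ℂ, L.IsTest v →
    (∫ y in L.int, (∫ x : ℝ, u x y * iteratedDeriv 2 (fun x' => v x' y) x) ∂L.a)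
    - 2 * (∫ y in L.int,
        (∫ x : ℝ, u x y * iteratedDeriv 2 (fun x' => v x' y) x) * ((L.b y : ℂ) ^ 2))
    - 2 * (∫ y in L.int,
        (∫ x : ℝ, w (x - L.B y) y * deriv (fun x' => v x' y) x) * (L.b y : ℂ))
    + (∫ y in L.int, ∫ x : ℝ, u x y * iteratedDeriv 2 (fun y' => v x y') y) = 0

/-- `u` is harmonic with respect to `L`. Only the values of `u` on `ℝ × [0, R)` matter; outside
this set `u` is an arbitrary Borel function. -/
structure IsHarmonic (L : OperatorL) (u : ℝ → ℝ → ℂ) : Prop where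
  measurable : Measurable (fun p : ℝ × ℝ => u p.1 p.2)
  memLp : ∀ y ∈ L.dom, MemLp (fun x => u x y) 2 volume
  continuous : ∀ y ∈ L.dom,
    Tendsto (fun z => eLpNorm (fun x => u x z - u x y) 2 volume) (𝓝[L.dom] y) (𝓝 0)
  bounded : L.R = ⊤ → ∃ C : ℝ≥0, ∀ y ∈ L.dom, eLpNorm (fun x => u x y) 2 volume ≤ C
  vanishing : L.R < ⊤ →
    Tendsto (fun y => eLpNorm (fun x => u x y) 2 volume) (𝓝[<] L.R.toReal) (𝓝 0)
  equation : ∃ w : ℝ → ℝ → ℂ,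
    L.IsWeakDerivY (fun x y => u (x + L.B y) y) w ∧
    (∀ y₁ y₂ : ℝ, 0 < y₁ → y₁ < y₂ → (y₂ : EReal) < L.R →
      IntegrableOn (fun p : ℝ × ℝ => ‖w p.1 p.2‖ ^ 2) (univ ×ˢ Ioo y₁ y₂) volume) ∧
    L.WeakEquation u w

/-- `u` is a harmonic function for `L` with boundary values `f`. -/
def IsHarmonicExtension (L : OperatorL) (f : L2R) (u : ℝ → ℝ → ℂ) : Prop :=
  L.IsHarmonic u ∧ (fun x => u x 0) =ᵐ[volume] f

/-! ### The ordinary differential equation and the symbol -/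

/-- `φ` is a solution on `[0, R)` of `φ''(dt) = ξ² a(dt) φ(t) - 2 i ξ b(t) φ'(t) dt`, and `dφ` is
its left-continuous derivative `φ'`. Since `dφ` is left-continuous, `φ''(dt)` is the measure on
`[0, R)` with `φ''([0, t)) = dφ(t) - dφ(0)` for all `t`; the equality of measures is expressed on
the intervals `[0, t)`. -/
structure IsODESolution (L : OperatorL) (ξ : ℝ) (φ dφ : ℝ → ℂ) : Prop where
  boundedVariation : LocallyBoundedVariationOn dφ L.dom
  leftContinuous : ∀ t ∈ L.dom, ContinuousWithinAt dφ (Icc 0 t) t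
  derivative : ∀ t ∈ L.dom, φ t = φ 0 + ∫ s in (0 : ℝ)..t, dφ s
  equation : ∀ t ∈ L.dom, dφ t - dφ 0 =
    (ξ : ℂ) ^ 2 * (∫ s in Ico 0 t, φ s ∂L.a)
      - 2 * Complex.I * ξ * ∫ s in (0 : ℝ)..t, (L.b s : ℂ) * dφ s

/-- The solution `φ` with `φ(0) = 1` that is bounded (if `R = ∞`) or vanishes at `R` (if
`R < ∞`), together with its left-continuous derivative. -/
structure IsWeylSolution (L : OperatorL) (ξ : ℝ) (φ dφ : ℝ → ℂ) : Prop where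
  solution : L.IsODESolution ξ φ dφ
  initial : φ 0 = 1
  bounded : L.R = ⊤ → ∃ C : ℝ, ∀ t ∈ L.dom, ‖φ t‖ ≤ C
  vanishing : L.R < ⊤ → Tendsto φ (𝓝[<] L.R.toReal) (𝓝 0)

/-- The pair `(φ_ξ, φ_ξ')`: for `ξ > 0` the (unique) solution of `IsWeylSolution`, for `ξ < 0` the
complex conjugate of the one for `-ξ`, and for `ξ = 0` the constant solution `1`. -/
def phi (L : OperatorL) (ξ : ℝ) : (ℝ → ℂ) × (ℝ → ℂ) :=
  if 0 < ξ then
    Classical.epsilon fun p : (ℝ → ℂ) × (ℝ → ℂ) => L.IsWeylSolution ξ p.1 p.2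
  else if ξ < 0 then
    let p := Classical.epsilon fun p : (ℝ → ℂ) × (ℝ → ℂ) => L.IsWeylSolution (-ξ) p.1 p.2
    (fun t => conj (p.1 t), fun t => conj (p.2 t))
  else (fun _ => 1, fun _ => 0)

/-- `k(ξ) = -φ_ξ'(0)`. -/
def k (L : OperatorL) (ξ : ℝ) : ℂ := -(L.phi ξ).2 0

end OperatorL

/-! ### The Dirichlet-to-Neumann operator -/

/-- `(u(·, y) - u(·, 0)) / y` converges to `g` in `L²(ℝ)` as `y → 0⁺`. -/
def HasNormalDerivative (u : ℝ → ℝ → ℂ) (g : L2R) : Prop :=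
  Tendsto (fun y : ℝ => eLpNorm (fun x => (u x y - u x 0) / (y : ℂ) - g x) 2 volume)
    (𝓝[>] 0) (𝓝 0)

/-- The unbounded operator `K` on `L²(ℝ)` is the Dirichlet-to-Neumann operator associated to
`L u = 0` (for `L` of class `𝕃*`): `f` is in the domain of `K` and `K f = g` if and only if `g` is
the normal derivative at the boundary of the harmonic function with boundary values `f`. -/
def OperatorL.IsDirichletToNeumann (L : OperatorL) (K : L2R →ₗ.[ℂ] L2R) : Prop :=
  ∀ f g : L2R, (f, g) ∈ K.graph ↔ ∃ u, L.IsHarmonicExtension f u ∧ HasNormalDerivative u g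

/-- `K` is the (maximal) Fourier multiplier with symbol `m` on `L²(ℝ)`. -/
def IsFourierMultiplier (K : L2R →ₗ.[ℂ] L2R) (m : ℝ → ℂ) : Prop :=
  (∀ f : L2R, f ∈ K.domain ↔ MemLp (fun ξ => m ξ * hat f ξ) 2 volume) ∧
  ∀ f : K.domain, hat (K f) =ᵐ[volume] fun ξ => m ξ * hat (f : L2R) ξ

end

/-! A partial Fourier transform in x turns L u = 0 into the ordinary differential equation of φ_ξ at
each frequency, so the harmonic function with boundary values f has û(ξ, y) = φ_ξ(y) f̂(ξ). The
difference quotient of u at the boundary then has transform (φ_ξ(y) - 1)/y · f̂(ξ), and everything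
rests on two facts: (φ_ξ(y) - 1)/y tends to φ_ξ'(0) = -k(ξ) as y → 0⁺, and its modulus is at most
|k(ξ)|. If k f̂ ∈ L², dominated convergence gives the limit in L². Conversely, an L² limit is an
almost everywhere limit along a subsequence, so it must be -k f̂.

The tool for the differential equation is convexity. For a solution H of H'' = M² H a - 2ib M H'
with values in a Hilbert space, M bounded and symmetric, the increments of Re⟨H, H'⟩ are at least
∫‖H' + ib M H‖², because a dominates b² dy (`energy_le`). Hence ‖H‖² is convex (`norm_sq_convex`).
With M = ξ on ℂ this yields φ_ξ as the limit of the solutions that vanish at r, as r ↑ R, together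
with its uniqueness and |φ_ξ| ≤ 1. The bound |φ_ξ'| ≤ |k(ξ)| (`norm_dweyl_le`) comes from the
integrating factor e^{2iξB}: apart from the care needed at atoms, |e^{2iξB} φ'|² has differential
2ξ² Re(φ' φ̄) a(dy), which is non-positive since |φ|² decreases. The assumption a({0}) = 0 makes φ'
right-continuous at 0 (`tendsto_dweyl_zero`).

To prove û = φ f̂ (`fslice_eq`), the weak equation is tested with products p(x) q(y). This gives an
identity for almost every frequency, with an exceptional set depending on q, so the equation is read
as one for an L²-valued function of y. Cutting off to the frequencies with |ξ| ≤ N and |k(ξ)| ≤ N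
makes multiplication by ξ a bounded operator and makes the truncation of φ f̂ a solution of the same
equation. The difference of the two solutions vanishes at 0 and is bounded, or vanishes at R, so
convexity forces it to be zero.

For K to have the full domain {k f̂ ∈ L²}, a harmonic extension must exist for each such f. It is
defined by prescribing û = φ f̂, and ∂ᵧũ by its transform e^{iξB}(φ' + ibξφ) f̂. The energy bound
∫|φ' + ibξφ|² ≤ Re k makes the latter square integrable, since |k| |f̂|² is a product of two L²
functions.

Computations use the transform with kernel e^{-2πiηx}, so that ξ = 2πη. The function `symbol`,
defined through the limit in r, agrees with k away from ξ = 0. -/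

noncomputable section

/-! ### Integration by parts for integrals against measures -/

section ByParts

variable {E F G : Type*} [NormedAddCommGroup E] [NormedSpace ℝ E] [CompleteSpace E]
  [NormedAddCommGroup F] [NormedSpace ℝ F] [CompleteSpace F]
  [NormedAddCommGroup G] [NormedSpace ℝ G] [CompleteSpace G]

/-- Integration by parts for a pair of left-continuous functions of bounded variation that are
given by integrals against two measures, which may have common atoms. -/
theorem integral_bilin_by_parts (T : E →L[ℝ] F →L[ℝ] G) {α β : Measure ℝ} [SFinite α] [SFinite β]
    {s t : ℝ} {f : ℝ → E} {g : ℝ → F} (hf : IntegrableOn f (Ico s t) α)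
    (hg : IntegrableOn g (Ico s t) β) (f₀ : E) (g₀ : F) :
    T (f₀ + ∫ x in Ico s t, f x ∂α) (g₀ + ∫ y in Ico s t, g y ∂β) =
      T f₀ g₀ + (∫ x in Ico s t, T (f x) (g₀ + ∫ y in Ico s x, g y ∂β) ∂α)
        + ∫ y in Ico s t, T (f₀ + ∫ x in Icc s y, f x ∂α) (g y) ∂β := by
  set α' := α.restrict (Ico s t) with hα'
  set β' := β.restrict (Ico s t) with hβ'
  have hf' : Integrable f α' := hf
  have hg' : Integrable g β' := hg
  have hK : Integrable (fun z : ℝ × ℝ => T (f z.1) (g z.2)) (α'.prod β') :=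
    hf'.op_fst_snd (by fun_prop) ⟨‖T‖, T.le_opNorm₂⟩ hg'
  -- Fubini on the square, split along the diagonal. The diagonal, which has positive mass at common
  -- atoms, goes entirely to the complement; this is why one inner integral is over `Ico` and the
  -- other over `Icc`.
  have hS : MeasurableSet {z : ℝ × ℝ | z.2 < z.1} := measurableSet_lt measurable_snd measurable_fst
  have h1 := integral_add_compl hS hK
  rw [integral_prod_bilin T hf' hg'] at h1
  have e1 : ∫ z in {z : ℝ × ℝ | z.2 < z.1}, T (f z.1) (g z.2) ∂(α'.prod β')
      = ∫ x, T (f x) (∫ y in Ico s x, g y ∂β) ∂α' := by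
    rw [← integral_indicator hS, integral_prod _ (hK.indicator hS)]
    refine integral_congr_ae ?_
    filter_upwards [ae_restrict_mem (measurableSet_Ico (a := s) (b := t))] with x hx
    have : ∀ y, ({z : ℝ × ℝ | z.2 < z.1}).indicator (fun z : ℝ × ℝ => T (f z.1) (g z.2)) (x, y)
        = (Iio x).indicator (fun y => T (f x) (g y)) y := fun y => by
      simp [indicator]
    simp_rw [this]
    rw [integral_indicator measurableSet_Iio, hβ', Measure.restrict_restrict measurableSet_Iio]
    have h2 : Iio x ∩ Ico s t = Ico s x := by ext y; simp; grind
    rw [h2]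
    exact (T (f x)).integral_comp_comm (hg.mono_set (Ico_subset_Ico_right hx.2.le))
  have e2 : ∫ z in {z : ℝ × ℝ | z.2 < z.1}ᶜ, T (f z.1) (g z.2) ∂(α'.prod β')
      = ∫ y, T (∫ x in Icc s y, f x ∂α) (g y) ∂β' := by
    rw [← integral_indicator hS.compl, integral_prod_symm _ (hK.indicator hS.compl)]
    refine integral_congr_ae ?_
    filter_upwards [ae_restrict_mem (measurableSet_Ico (a := s) (b := t))] with y hy
    have : ∀ x, ({z : ℝ × ℝ | z.2 < z.1}ᶜ).indicator (fun z : ℝ × ℝ => T (f z.1) (g z.2)) (x, y)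
        = (Iic y).indicator (fun x => T.flip (g y) (f x)) x := fun x => by
      simp [indicator]
    simp_rw [this]
    rw [integral_indicator measurableSet_Iic, hα', Measure.restrict_restrict measurableSet_Iic]
    have h2 : Iic y ∩ Ico s t = Icc s y := by ext x; simp; grind
    rw [h2]
    exact (T.flip (g y)).integral_comp_comm (hf.mono_set (Icc_subset_Ico_right hy.2))
  have hi1 : Integrable (fun x => T (f x) (∫ y in Ico s x, g y ∂β)) α' := by
    have := (hK.indicator hS).integral_prod_left
    refine this.congr ?_
    filter_upwards [ae_restrict_mem (measurableSet_Ico (a := s) (b := t))] with x hx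
    have : ∀ y, ({z : ℝ × ℝ | z.2 < z.1}).indicator (fun z : ℝ × ℝ => T (f z.1) (g z.2)) (x, y)
        = (Iio x).indicator (fun y => T (f x) (g y)) y := fun y => by
      simp [indicator]
    simp_rw [this]
    rw [integral_indicator measurableSet_Iio, hβ', Measure.restrict_restrict measurableSet_Iio]
    have h2 : Iio x ∩ Ico s t = Ico s x := by ext y; simp; grind
    rw [h2]
    exact (T (f x)).integral_comp_comm (hg.mono_set (Ico_subset_Ico_right hx.2.le))
  have hi2 : Integrable (fun y => T (∫ x in Icc s y, f x ∂α) (g y)) β' := by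
    have := (hK.indicator hS.compl).integral_prod_right
    refine this.congr ?_
    filter_upwards [ae_restrict_mem (measurableSet_Ico (a := s) (b := t))] with y hy
    have : ∀ x, ({z : ℝ × ℝ | z.2 < z.1}ᶜ).indicator (fun z : ℝ × ℝ => T (f z.1) (g z.2)) (x, y)
        = (Iic y).indicator (fun x => T.flip (g y) (f x)) x := fun x => by
      simp [indicator]
    simp_rw [this]
    rw [integral_indicator measurableSet_Iic, hα', Measure.restrict_restrict measurableSet_Iic]
    have h2 : Iic y ∩ Ico s t = Icc s y := by ext x; simp; grind
    rw [h2]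
    exact (T.flip (g y)).integral_comp_comm (hf.mono_set (Icc_subset_Ico_right hy.2))
  simp only [map_add, add_apply]
  rw [integral_add _ hi1, integral_add _ hi2, ← h1, e1, e2]
  · have a1 : ∫ x, T (f x) g₀ ∂α' = T (∫ x, f x ∂α') g₀ := (T.flip g₀).integral_comp_comm hf'
    have a2 : ∫ y, T f₀ (g y) ∂β' = T f₀ (∫ y, g y ∂β') := (T f₀).integral_comp_comm hg'
    rw [a1, a2]
    abel
  · exact (T f₀).integrable_comp hg'
  · exact (T.flip g₀).integrable_comp hf'

/-- Integration by parts when one of the functions is absolutely continuous. -/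
theorem integral_bilin_by_parts_mixed (T : E →L[ℝ] F →L[ℝ] G) {α : Measure ℝ} [SFinite α]
    {s t : ℝ} (hst : s ≤ t) {u f : ℝ → E} {v g₁ g₂ : ℝ → F}
    (hu : ∀ y ∈ Icc s t, u y = u s + ∫ r in Ico s y, f r)
    (hv : ∀ y ∈ Icc s t, v y = v s + (∫ r in Ico s y, g₁ r ∂α) + ∫ r in Ico s y, g₂ r)
    (hf : IntegrableOn f (Ico s t)) (hg₁ : IntegrableOn g₁ (Ico s t) α)
    (hg₂ : IntegrableOn g₂ (Ico s t)) :
    T (u t) (v t) = T (u s) (v s) + (∫ r in Ico s t, T (f r) (v r))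
      + (∫ r in Ico s t, T (u r) (g₁ r) ∂α) + ∫ r in Ico s t, T (u r) (g₂ r) := by
  have h1 := integral_bilin_by_parts T hf hg₁ (u s) (v s)
  have h2 := integral_bilin_by_parts T hf hg₂ (u s) 0
  -- Lebesgue measure has no atoms, so the closed inner integral is again a value of u.
  have hI : ∀ y ∈ Ico s t, u s + ∫ r in Icc s y, f r = u y := fun y hy => by
    rw [hu y ⟨hy.1, hy.2.le⟩, integral_Icc_eq_integral_Ico]
  rw [setIntegral_congr_fun (μ := α) measurableSet_Ico
    (f := fun y => T (u s + ∫ r in Icc s y, f r) (g₁ y)) (g := fun y => T (u y) (g₁ y))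
    (fun y hy => by simp only [hI y hy])] at h1
  rw [setIntegral_congr_fun measurableSet_Ico (f := fun y => T (u s + ∫ r in Icc s y, f r) (g₂ y))
    (g := fun y => T (u y) (g₂ y)) (fun y hy => by simp only [hI y hy])] at h2
  -- Splitting the integral of T(f, v) needs each half integrable. The primitive is measurable as a
  -- parameter integral of g cut off at x, and it is bounded by the total integral of ‖g‖.
  have hj : ∀ (β : Measure ℝ) [SFinite β] (g : ℝ → F) (c : F), IntegrableOn g (Ico s t) β →
      IntegrableOn (fun x => T (f x) (c + ∫ y in Ico s x, g y ∂β)) (Ico s t) := by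
    intro β _ g c hg
    obtain ⟨w, hw, hwe⟩ : ∃ w : ℝ → F, AEStronglyMeasurable w (volume.restrict (Ico s t)) ∧
        (∀ x ∈ Ico s t, w x = c + ∫ y in Ico s x, g y ∂β) := by
      refine ⟨fun x => c + ∫ y in Ico s t, (Iio x).indicator g y ∂β, ?_, fun x hx => ?_⟩
      · refine aestronglyMeasurable_const.add ?_
        have hm : AEStronglyMeasurable (fun z : ℝ × ℝ =>
            ({z : ℝ × ℝ | z.2 < z.1}).indicator (fun z => g z.2) z)
            ((volume.restrict (Ico s t)).prod (β.restrict (Ico s t))) :=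
          (hg.aestronglyMeasurable.comp_snd).indicator
            (measurableSet_lt measurable_snd measurable_fst)
        have := hm.integral_prod_right'
        convert! this using 1
      · beta_reduce
        rw [setIntegral_indicator measurableSet_Iio]
        congr 3
        ext y; simp; grind
    refine IntegrableOn.congr_fun (f := fun x => T (f x) (w x)) ?_
      (fun x hx => by simp only [hwe x hx]) measurableSet_Ico
    refine Integrable.mono' (g := fun x => ‖T‖ * ‖f x‖ * (‖c‖ + ∫ y in Ico s t, ‖g y‖ ∂β))
      ((hf.norm.const_mul _).mul_const _)
      (T.aestronglyMeasurable_comp₂ hf.aestronglyMeasurable hw) ?_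
    filter_upwards [ae_restrict_mem (measurableSet_Ico (a := s) (b := t))] with x hx
    refine (T.le_opNorm₂ _ _).trans ?_
    gcongr
    rw [hwe x hx]
    refine (norm_add_le _ _).trans ?_
    gcongr
    refine (norm_integral_le_integral_norm _).trans ?_
    exact setIntegral_mono_set hg.norm (ae_of_all _ fun y => norm_nonneg _)
      (Ico_subset_Ico_right hx.2.le).eventuallyLE
  have e3 : ∫ r in Ico s t, T (f r) (v r) = (∫ x in Ico s t, T (f x) (v s + ∫ y in Ico s x, g₁ y ∂α))
      + ∫ x in Ico s t, T (f x) (0 + ∫ y in Ico s x, g₂ y) := by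
    rw [← integral_add (hj α g₁ _ hg₁) (hj volume g₂ 0 hg₂)]
    refine setIntegral_congr_fun measurableSet_Ico fun x hx => ?_
    simp only [← map_add, zero_add]
    rw [hv x ⟨hx.1, hx.2.le⟩]
  rw [e3, hu t ⟨hst, le_rfl⟩]
  nth_rewrite 1 [hv t ⟨hst, le_rfl⟩]
  rw [map_add]
  rw [zero_add] at h2
  rw [h1, h2, map_zero]
  abel

end ByParts

/-! ### Chain rule along an absolutely continuous primitive -/

theorem AbsolutelyContinuousOnInterval.lipschitzWith_comp {X Y : Type*} [PseudoMetricSpace X]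
    [PseudoMetricSpace Y] {f : ℝ → X} {g : X → Y} {K : ℝ≥0} {a b : ℝ} (hg : LipschitzWith K g)
    (hf : AbsolutelyContinuousOnInterval f a b) :
    AbsolutelyContinuousOnInterval (fun x => g (f x)) a b := by
  refine squeeze_zero (fun t ↦ ?_) (fun t ↦ ?_) (by simpa using Tendsto.const_mul (K : ℝ) hf)
  · exact Finset.sum_nonneg (fun i hi ↦ by positivity)
  · simp only [Finset.mul_sum]
    exact Finset.sum_le_sum fun i _ => hg.dist_le_mul _ _

/-- The chain rule for `g (∫ b)`, where `b` is merely integrable. -/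
theorem integral_mul_deriv_comp_integral {b g g' : ℝ → ℝ} {t : ℝ} {K : ℝ≥0}
    (hb : IntervalIntegrable b volume 0 t) (hg : LipschitzWith K g)
    (hg' : ∀ x, HasDerivAt g (g' x) x) :
    ∫ s in (0 : ℝ)..t, b s * g' (∫ r in (0 : ℝ)..s, b r) = g (∫ s in (0 : ℝ)..t, b s) - g 0 := by
  have hBac : AbsolutelyContinuousOnInterval (fun s => ∫ r in (0 : ℝ)..s, b r) 0 t :=
    hb.absolutelyContinuousOnInterval_intervalIntegral (c := 0) (by simp)
  have h1 := (hBac.lipschitzWith_comp hg).integral_deriv_eq_sub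
  simp only [intervalIntegral.integral_same] at h1
  rw [← h1]
  refine intervalIntegral.integral_congr_ae ?_
  filter_upwards [hb.ae_hasDerivAt_integral] with x hx1 hx
  have d1 := hx1 (uIoc_subset_uIcc hx) 0 (by simp)
  rw [mul_comm]
  exact ((hg' _).comp x d1).deriv.symm

/-- The chain rule for `exp (i c ∫ b)`, where `b` is merely integrable. -/
theorem exp_integral_mul_I {b : ℝ → ℝ} {t : ℝ} (hb : IntervalIntegrable b volume 0 t) (c : ℝ) :
    Complex.exp (c * (∫ s in (0 : ℝ)..t, b s : ℝ) * Complex.I) = 1 +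
      ∫ s in (0 : ℝ)..t, (c * b s * Complex.I) *
        Complex.exp (c * (∫ r in (0 : ℝ)..s, b r : ℝ) * Complex.I) := by
  -- The real chain rule needs a Lipschitz outer function, so it is applied to cos(cx) and sin(cx)
  -- separately; both are |c|-Lipschitz.
  have hlip : ∀ g : ℝ → ℝ, LipschitzWith 1 g → LipschitzWith (Real.toNNReal |c|)
      (fun x => g (c * x)) := fun g hg => by
    refine LipschitzWith.of_dist_le_mul fun x y => ?_
    rw [Real.coe_toNNReal _ (abs_nonneg c)]
    refine (hg.dist_le_mul _ _).trans ?_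
    simp only [Real.dist_eq, ← mul_sub, abs_mul]
    simp
  have h1 := integral_mul_deriv_comp_integral hb (hlip _ Real.lipschitzWith_cos)
    (g' := fun x => - Real.sin (c * x) * c)
    (fun x => by simpa using ((hasDerivAt_id x).const_mul c).cos)
  have h2 := integral_mul_deriv_comp_integral hb (hlip _ Real.lipschitzWith_sin)
    (g' := fun x => Real.cos (c * x) * c)
    (fun x => by simpa using ((hasDerivAt_id x).const_mul c).sin)
  have hcont : ContinuousOn (fun s => ∫ r in (0 : ℝ)..s, b r) (uIcc 0 t) :=
    (hb.absolutelyContinuousOnInterval_intervalIntegral (c := 0) (by simp)).continuousOn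
  have i1 : IntervalIntegrable (fun s => b s * (- Real.sin (c * ∫ r in (0 : ℝ)..s, b r) * c))
      volume 0 t :=
    hb.mul_continuousOn (by fun_prop)
  have i2 : IntervalIntegrable (fun s => b s * (Real.cos (c * ∫ r in (0 : ℝ)..s, b r) * c))
      volume 0 t :=
    hb.mul_continuousOn (by fun_prop)
  have i1' : IntervalIntegrable (fun s => ((b s * (- Real.sin (c * ∫ r in (0 : ℝ)..s, b r) * c)
      : ℝ) : ℂ)) volume 0 t := ⟨i1.1.ofReal, i1.2.ofReal⟩
  have i2' : IntervalIntegrable (fun s => ((b s * (Real.cos (c * ∫ r in (0 : ℝ)..s, b r) * c)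
      : ℝ) : ℂ) * Complex.I) volume 0 t :=
    IntervalIntegrable.mul_const ⟨i2.1.ofReal, i2.2.ofReal⟩ _
  have key : ∀ x : ℝ, Complex.exp (c * x * Complex.I)
      = (Real.cos (c * x) : ℂ) + (Real.sin (c * x) : ℂ) * Complex.I := fun x => by
    rw [Complex.exp_mul_I]; push_cast; rfl
  have e : ∀ s, (c * b s * Complex.I) * Complex.exp (c * (∫ r in (0 : ℝ)..s, b r : ℝ) * Complex.I)
      = ((b s * (- Real.sin (c * ∫ r in (0 : ℝ)..s, b r) * c) : ℝ) : ℂ)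
      + ((b s * (Real.cos (c * ∫ r in (0 : ℝ)..s, b r) * c) : ℝ) : ℂ) * Complex.I := fun s => by
    rw [key]
    push_cast
    linear_combination (c * b s * Complex.sin (c * (∫ r in (0 : ℝ)..s, b r : ℝ))) * Complex.I_sq
  simp_rw [e]
  rw [intervalIntegral.integral_add i1' i2', intervalIntegral.integral_mul_const,
    intervalIntegral.integral_ofReal, intervalIntegral.integral_ofReal, h1, h2, key]
  simp
  ring

/-! ### Elementary properties of the coefficients -/

namespace OperatorL

variable (L : OperatorL)

theorem zero_mem_dom : (0 : ℝ) ∈ L.dom := ⟨le_rfl, by simpa using L.R_pos⟩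

variable {L}

theorem mem_dom_of_le {s t : ℝ} (ht : t ∈ L.dom) (hs : 0 ≤ s) (hst : s ≤ t) : s ∈ L.dom :=
  ⟨hs, lt_of_le_of_lt (by exact_mod_cast hst) ht.2⟩

theorem Icc_subset_dom {s t : ℝ} (hs : 0 ≤ s) (ht : t ∈ L.dom) : Icc s t ⊆ L.dom :=
  fun _ hr => mem_dom_of_le ht (hs.trans hr.1) hr.2

theorem int_subset_dom : L.int ⊆ L.dom := fun _ h => ⟨h.1.le, h.2⟩

theorem exists_gt_mem_dom {t : ℝ} (ht : t ∈ L.dom) : ∃ r ∈ L.dom, t < r := by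
  obtain ⟨r, h1, h2⟩ := EReal.lt_iff_exists_real_btwn.1 ht.2
  exact ⟨r, ⟨ht.1.trans (by exact_mod_cast h1.le), h2⟩, by exact_mod_cast h1⟩

variable (L)

theorem isOpen_int : IsOpen L.int :=
  (isOpen_lt continuous_const continuous_id).inter
    (isOpen_lt continuous_coe_real_ereal continuous_const)

theorem measurableSet_int : MeasurableSet L.int := L.isOpen_int.measurableSet

theorem measurableSet_dom : MeasurableSet L.dom :=
  (measurableSet_le measurable_const measurable_id).inter
    (isOpen_lt continuous_coe_real_ereal continuous_const).measurableSet

/-- An increasing sequence in `(0, R)` that exhausts `[0, R)`. -/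
theorem exists_seq_tendsto_R : ∃ r : ℕ → ℝ, StrictMono r ∧ (∀ n, r n ∈ L.int) ∧
    ∀ t ∈ L.dom, ∃ n, t < r n := by
  obtain ⟨u, hu, hu', hlim⟩ := exists_seq_strictMono_tendsto' L.R_pos
  have hfin : ∀ n, ((u n).toReal : EReal) = u n := fun n =>
    EReal.coe_toReal (ne_top_of_lt (hu' n).2) (ne_bot_of_gt (hu' n).1)
  refine ⟨fun n => (u n).toReal, fun m n hmn => ?_, fun n => ⟨?_, ?_⟩, fun t ht => ?_⟩
  · have := hu hmn
    rw [← hfin m, ← hfin n] at this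
    exact_mod_cast this
  · have := (hu' n).1
    rw [← hfin n] at this
    exact_mod_cast this
  · rw [hfin]; exact (hu' n).2
  · obtain ⟨n, hn⟩ := (hlim.eventually (lt_mem_nhds ht.2)).exists
    rw [← hfin n] at hn
    exact ⟨n, by exact_mod_cast hn⟩

instance sigmaFinite_a : SigmaFinite L.a := by
  obtain ⟨r, -, hr, hr'⟩ := L.exists_seq_tendsto_R
  refine ⟨⟨⟨fun n => Icc 0 (r n) ∪ L.domᶜ, fun _ => trivial, fun n => ?_, ?_⟩⟩⟩
  · refine (measure_union_le _ _).trans_lt ?_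
    have : L.a L.domᶜ = 0 := L.a_compl
    rw [this, add_zero]
    exact L.a_locallyFinite _ (hr n).1.le (hr n).2
  · refine eq_univ_of_forall fun x => ?_
    by_cases hx : x ∈ L.dom
    · obtain ⟨n, hn⟩ := hr' x hx
      exact mem_iUnion.2 ⟨n, Or.inl ⟨hx.1, hn.le⟩⟩
    · exact mem_iUnion.2 ⟨0, Or.inr hx⟩

variable {L}

theorem a_Icc_lt_top {s t : ℝ} (hs : 0 ≤ s) (ht : t ∈ L.dom) : L.a (Icc s t) < ⊤ :=
  (measure_mono (Icc_subset_Icc_left hs)).trans_lt (L.a_locallyFinite t ht.1 ht.2)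

theorem a_Ico_lt_top {s t : ℝ} (hs : 0 ≤ s) (ht : t ∈ L.dom) : L.a (Ico s t) < ⊤ :=
  (measure_mono Ico_subset_Icc_self).trans_lt (a_Icc_lt_top hs ht)

theorem integrableOn_b_sq {s t : ℝ} (hs : 0 ≤ s) (ht : t ∈ L.dom) :
    IntegrableOn (fun y => L.b y ^ 2) (Icc s t) :=
  (L.b_sq_locallyIntegrable t ht.1 ht.2).mono_set (Icc_subset_Icc_left hs)

theorem integrableOn_b {s t : ℝ} (hs : 0 ≤ s) (ht : t ∈ L.dom) : IntegrableOn L.b (Icc s t) := by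
  refine Integrable.mono' (g := fun y => 1 + L.b y ^ 2)
    ((integrable_const _).add (integrableOn_b_sq hs ht)) L.b_measurable.aestronglyMeasurable
    (ae_of_all _ fun y => ?_)
  rw [Real.norm_eq_abs]
  nlinarith [sq_nonneg (|L.b y| - 1), sq_abs (L.b y)]

theorem intervalIntegrable_b {t : ℝ} (ht : t ∈ L.dom) : IntervalIntegrable L.b volume 0 t := by
  rw [intervalIntegrable_iff, uIoc_of_le ht.1]
  exact (integrableOn_b le_rfl ht).mono_set Ioc_subset_Icc_self

/-- This is where the non-negativity of a(dy) - b² dy enters: in the energy identity it allows the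
a-integral to be replaced by a b²-integral, which completes a square. -/
theorem setIntegral_b_sq_mul_le {s t : ℝ} (hs : 0 ≤ s) (ht : t ∈ L.dom) {g : ℝ → ℝ}
    (hg : ∀ y, 0 ≤ g y) (hgi : IntegrableOn g (Ico s t) L.a) :
    IntegrableOn (fun y => L.b y ^ 2 * g y) (Ico s t) ∧
    ∫ y in Ico s t, L.b y ^ 2 * g y ≤ ∫ y in Ico s t, g y ∂L.a := by
  set ν := (volume.restrict (Ico s t)).withDensity (fun y => ENNReal.ofReal (L.b y ^ 2)) with hν
  have hsub : Ico s t ⊆ L.dom := Ico_subset_Icc_self.trans (Icc_subset_dom hs ht)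
  have hle : ν ≤ L.a.restrict (Ico s t) := by
    have := Measure.restrict_mono (subset_refl (Ico s t)) L.b_sq_le
    rw [restrict_withDensity measurableSet_Ico, Measure.restrict_restrict measurableSet_Ico] at this
    have e : Ico s t ∩ {y : ℝ | 0 ≤ y ∧ (y : EReal) < L.R} = Ico s t :=
      inter_eq_left.2 hsub
    rwa [e] at this
  have hm : Measurable fun y => ENNReal.ofReal (L.b y ^ 2) :=
    (L.b_measurable.pow_const 2).ennreal_ofReal
  have hfin : ∀ᵐ y ∂(volume.restrict (Ico s t)), ENNReal.ofReal (L.b y ^ 2) < ⊤ :=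
    ae_of_all _ fun _ => ENNReal.ofReal_lt_top
  have hi : Integrable g ν := Integrable.mono_measure hgi hle
  have e : ∀ y, (ENNReal.ofReal (L.b y ^ 2)).toReal • g y = L.b y ^ 2 * g y := fun y => by
    rw [ENNReal.toReal_ofReal (sq_nonneg _), smul_eq_mul]
  constructor
  · have := (integrable_withDensity_iff_integrable_smul' hm hfin).1 hi
    simp only [e] at this
    exact this
  · have h := integral_mono_measure hle (ae_of_all _ hg) hgi
    rw [hν, integral_withDensity_eq_integral_toReal_smul hm hfin] at h
    simpa only [e] using h

end OperatorL

/-! ### Hilbert-space valued solutions of the ordinary differential equation -/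

section Hilbert

variable {X : Type*} [NormedAddCommGroup X] [InnerProductSpace ℂ X] [NormedSpace ℝ X]

variable (X) in
/-- The complex inner product, as a real bilinear map. -/
def innerRealL [IsScalarTower ℝ ℂ X] : X →L[ℝ] X →L[ℝ] ℂ :=
  LinearMap.mkContinuous₂ (LinearMap.mk₂ ℝ (fun x y => inner ℂ x y)
    (fun x y z => inner_add_left x y z)
    (fun c x y => by
      rw [← algebraMap_smul ℂ c x, inner_smul_left]; simp)
    (fun x y z => inner_add_right x y z)
    (fun c x y => by
      rw [← algebraMap_smul ℂ c y, inner_smul_right]; simp)) 1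
    (fun x y => by simpa using norm_inner_le_norm x y)

theorem innerRealL_apply [IsScalarTower ℝ ℂ X] (x y : X) : innerRealL X x y = inner ℂ x y := rfl

/-- `H` is a solution of `H'' = M² H a - 2 i b M H'` on the interval `[s, t]`, with values in a
Hilbert space, and `h` is the left-continuous derivative of `H`. -/
structure OperatorL.SolvesOn (L : OperatorL) (M : X →L[ℂ] X) (H h : ℝ → X) (s t : ℝ) : Prop where
  aestronglyMeasurable : AEStronglyMeasurable h (volume.restrict (Icc s t))
  bounded : ∃ C, ∀ y ∈ Icc s t, ‖h y‖ ≤ C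
  eq_fst : ∀ y ∈ Icc s t, H y = H s + ∫ r in Ico s y, h r
  eq_snd : ∀ y ∈ Icc s t, h y = h s + (∫ r in Ico s y, M (M (H r)) ∂L.a)
    + ∫ r in Ico s y, (-(2 * Complex.I * L.b r)) • M (h r)

namespace OperatorL.SolvesOn

variable {L : OperatorL} {M : X →L[ℂ] X} {H h : ℝ → X} {s t : ℝ}

theorem integrableOn_snd (S : L.SolvesOn M H h s t) : IntegrableOn h (Icc s t) := by
  obtain ⟨C, hC⟩ := S.bounded
  exact Integrable.of_bound S.aestronglyMeasurable C
    (ae_restrict_of_forall_mem measurableSet_Icc hC)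

theorem sub_eq [CompleteSpace X] (S : L.SolvesOn M H h s t) {y z : ℝ} (hy : s ≤ y) (hyz : y ≤ z)
    (hz : z ≤ t) : H z = H y + ∫ r in Ico y z, h r := by
  rw [S.eq_fst z ⟨hy.trans hyz, hz⟩, S.eq_fst y ⟨hy, hyz.trans hz⟩, add_assoc,
    ← setIntegral_union (Ico_disjoint_Ico_same) measurableSet_Ico
      (S.integrableOn_snd.mono_set (Ico_subset_Icc_self.trans (Icc_subset_Icc_right (hyz.trans hz))))
      (S.integrableOn_snd.mono_set (Ico_subset_Icc_self.trans (Icc_subset_Icc hy hz))),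
    Ico_union_Ico_eq_Ico hy hyz]

theorem lipschitz [CompleteSpace X] (S : L.SolvesOn M H h s t) :
    ∃ C : ℝ≥0, LipschitzOnWith C H (Icc s t) := by
  obtain ⟨C, hC⟩ := S.bounded
  refine ⟨C.toNNReal, LipschitzOnWith.of_dist_le_mul ?_⟩
  have key : ∀ y ∈ Icc s t, ∀ z ∈ Icc s t, y ≤ z → dist (H y) (H z) ≤ C.toNNReal * dist y z := by
    intro y hy z hz hyz
    rw [dist_comm, dist_eq_norm, S.sub_eq hy.1 hyz hz.2, add_sub_cancel_left]
    refine (norm_setIntegral_le_of_norm_le_const (C := C.toNNReal) (by simp) fun r hr => ?_).trans ?_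
    · exact (hC r ⟨hy.1.trans hr.1, hr.2.le.trans hz.2⟩).trans (Real.le_coe_toNNReal C)
    · rw [Real.dist_eq, abs_sub_comm, abs_of_nonneg (sub_nonneg.2 hyz)]
      simp [hyz]
  intro y hy z hz
  rcases le_total y z with h | h
  · exact key y hy z hz h
  · rw [dist_comm, dist_comm y]; exact key z hz y hy h

theorem continuousOn [CompleteSpace X] (S : L.SolvesOn M H h s t) : ContinuousOn H (Icc s t) :=
  S.lipschitz.choose_spec.continuousOn

theorem integrableOn_a [CompleteSpace X] (S : L.SolvesOn M H h s t) (hs : 0 ≤ s) (ht : t ∈ L.dom) :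
    IntegrableOn (fun r => M (M (H r))) (Icc s t) L.a := by
  have : IsFiniteMeasure (L.a.restrict (Icc s t)) := ⟨by
    rw [Measure.restrict_apply_univ]; exact a_Icc_lt_top hs ht⟩
  have hc : ContinuousOn (fun r => M (M (H r))) (Icc s t) :=
    M.continuous.comp_continuousOn (M.continuous.comp_continuousOn S.continuousOn)
  obtain ⟨C, hC⟩ := isCompact_Icc.exists_bound_of_continuousOn hc
  exact Integrable.of_bound (hc.aestronglyMeasurable measurableSet_Icc) C
    (ae_restrict_of_forall_mem measurableSet_Icc hC)

theorem integrableOn_b_smul (S : L.SolvesOn M H h s t) (hs : 0 ≤ s) (ht : t ∈ L.dom) :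
    IntegrableOn (fun r => (-(2 * Complex.I * L.b r)) • M (h r)) (Icc s t) := by
  obtain ⟨C, hC⟩ := S.bounded
  refine Integrable.mono' (g := fun r => 2 * |L.b r| * (‖M‖ * C))
    (((integrableOn_b hs ht).abs.const_mul 2).mul_const _) ?_ ?_
  · refine AEStronglyMeasurable.smul ?_ (M.continuous.comp_aestronglyMeasurable
      S.aestronglyMeasurable)
    have := L.b_measurable
    exact (by fun_prop : Measurable fun r => -(2 * Complex.I * (L.b r : ℂ))).aestronglyMeasurable
  · filter_upwards [ae_restrict_mem (measurableSet_Icc (a := s) (b := t))] with r hr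
    rw [norm_smul]
    simp only [norm_neg, norm_mul, Complex.norm_I, Complex.norm_real, Real.norm_eq_abs]
    norm_num
    gcongr
    exact M.le_of_opNorm_le_of_le le_rfl (hC r hr)

theorem mono [CompleteSpace X] (S : L.SolvesOn M H h s t) (hs : 0 ≤ s) (ht : t ∈ L.dom)
    {s' t' : ℝ} (hss : s ≤ s') (hst : s' ≤ t') (htt : t' ≤ t) : L.SolvesOn M H h s' t' := by
  have hsub : Icc s' t' ⊆ Icc s t := Icc_subset_Icc hss htt
  refine ⟨S.aestronglyMeasurable.mono_measure (Measure.restrict_mono hsub le_rfl), ?_,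
    fun y hy => S.sub_eq hss hy.1 (hy.2.trans htt), fun y hy => ?_⟩
  · obtain ⟨C, hC⟩ := S.bounded
    exact ⟨C, fun y hy => hC y (hsub hy)⟩
  · have hu : Ico s y = Ico s s' ∪ Ico s' y := (Ico_union_Ico_eq_Ico hss hy.1).symm
    have h1 : Ico s s' ⊆ Icc s t :=
      Ico_subset_Icc_self.trans (Icc_subset_Icc_right (hst.trans htt))
    have h2 : Ico s' y ⊆ Icc s t :=
      Ico_subset_Icc_self.trans (Icc_subset_Icc hss (hy.2.trans htt))
    rw [S.eq_snd y (hsub hy), S.eq_snd s' ⟨hss, hst.trans htt⟩, hu,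
      setIntegral_union Ico_disjoint_Ico_same measurableSet_Ico
        ((S.integrableOn_a hs ht).mono_set h1) ((S.integrableOn_a hs ht).mono_set h2),
      setIntegral_union Ico_disjoint_Ico_same measurableSet_Ico
        ((S.integrableOn_b_smul hs ht).mono_set h1) ((S.integrableOn_b_smul hs ht).mono_set h2)]
    abel

theorem sub [CompleteSpace X] {H' h' : ℝ → X} (S : L.SolvesOn M H h s t)
    (S' : L.SolvesOn M H' h' s t) (hs : 0 ≤ s) (ht : t ∈ L.dom) :
    L.SolvesOn M (fun y => H y - H' y) (fun y => h y - h' y) s t := by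
  have hI : ∀ y ∈ Icc s t, Ico s y ⊆ Icc s t := fun y hy =>
    Ico_subset_Icc_self.trans (Icc_subset_Icc_right hy.2)
  refine ⟨S.aestronglyMeasurable.sub S'.aestronglyMeasurable, ?_, fun y hy => ?_, fun y hy => ?_⟩
  · obtain ⟨C, hC⟩ := S.bounded
    obtain ⟨C', hC'⟩ := S'.bounded
    exact ⟨C + C', fun y hy => (norm_sub_le _ _).trans (add_le_add (hC y hy) (hC' y hy))⟩
  · rw [integral_sub (S.integrableOn_snd.mono_set (hI y hy))
      (S'.integrableOn_snd.mono_set (hI y hy)), S.eq_fst y hy, S'.eq_fst y hy]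
    abel
  · simp only [map_sub, smul_sub]
    rw [integral_sub ((S.integrableOn_a hs ht).mono_set (hI y hy))
      ((S'.integrableOn_a hs ht).mono_set (hI y hy)),
      integral_sub ((S.integrableOn_b_smul hs ht).mono_set (hI y hy))
      ((S'.integrableOn_b_smul hs ht).mono_set (hI y hy)), S.eq_snd y hy, S'.eq_snd y hy]
    abel

/-- The energy inequality. -/
theorem energy_le [CompleteSpace X] [IsScalarTower ℝ ℂ X] (S : L.SolvesOn M H h s t) (hs : 0 ≤ s)
    (ht : t ∈ L.dom) (hst : s ≤ t) (hM : ∀ x y, inner ℂ (M x) y = inner ℂ x (M y)) :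
    IntegrableOn (fun r => ‖h r + (Complex.I * L.b r) • M (H r)‖ ^ 2) (Ico s t) ∧
    ∫ r in Ico s t, ‖h r + (Complex.I * L.b r) • M (H r)‖ ^ 2 ≤
      (inner ℂ (H t) (h t)).re - (inner ℂ (H s) (h s)).re := by
  have hI : Ico s t ⊆ Icc s t := Ico_subset_Icc_self
  obtain ⟨C, hC⟩ := S.bounded
  have hHc := S.continuousOn
  obtain ⟨D, hD⟩ := isCompact_Icc.exists_bound_of_continuousOn hHc
  have hMc : ContinuousOn (fun r => M (H r)) (Icc s t) := M.continuous.comp_continuousOn hHc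
  have hfa : IsFiniteMeasure (L.a.restrict (Ico s t)) := ⟨by
    rw [Measure.restrict_apply_univ]; exact a_Ico_lt_top hs ht⟩
  have hmem : ∀ᵐ r ∂(volume.restrict (Ico s t)), r ∈ Icc s t :=
    (ae_restrict_mem measurableSet_Ico).mono fun r hr => hI hr
  have hmema : ∀ᵐ r ∂(L.a.restrict (Ico s t)), r ∈ Icc s t :=
    (ae_restrict_mem measurableSet_Ico).mono fun r hr => hI hr
  have hsm : AEStronglyMeasurable h (volume.restrict (Ico s t)) :=
    S.aestronglyMeasurable.mono_measure (Measure.restrict_mono hI le_rfl)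
  have hHm : ∀ μ : Measure ℝ, AEStronglyMeasurable H (μ.restrict (Ico s t)) := fun μ =>
    (hHc.mono hI).aestronglyMeasurable measurableSet_Ico
  -- The differential of ⟨H, h⟩ is ‖h‖² dr + ‖MH‖² a(dr) + ⟨H, -2ib M h⟩ dr, using the symmetry of M
  -- in the middle term.
  have key := integral_bilin_by_parts_mixed (innerRealL X) hst S.eq_fst S.eq_snd
    (S.integrableOn_snd.mono_set hI) ((S.integrableOn_a hs ht).mono_set hI)
    ((S.integrableOn_b_smul hs ht).mono_set hI)
  simp only [innerRealL_apply] at key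
  have i1 : IntegrableOn (fun r => inner ℂ (h r) (h r)) (Ico s t) := by
    refine Integrable.of_bound (hsm.inner hsm) (C * C) ?_
    filter_upwards [hmem] with r hr
    exact (norm_inner_le_norm _ _).trans (mul_le_mul (hC r hr) (hC r hr) (norm_nonneg _)
      ((norm_nonneg _).trans (hC r hr)))
  have i2 : IntegrableOn (fun r => inner ℂ (H r) (M (M (H r)))) (Ico s t) L.a := by
    obtain ⟨K, hK⟩ := isCompact_Icc.exists_bound_of_continuousOn
      (hHc.inner (𝕜 := ℂ) (M.continuous.comp_continuousOn hMc))
    exact Integrable.of_bound ((hHm _).inner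
      (M.continuous.comp_aestronglyMeasurable (M.continuous.comp_aestronglyMeasurable (hHm _)))) K
      (hmema.mono hK)
  have i3 : IntegrableOn (fun r => inner ℂ (H r) ((-(2 * Complex.I * L.b r)) • M (h r)))
      (Ico s t) := by
    refine Integrable.mono' (((S.integrableOn_b_smul hs ht).mono_set hI).norm.const_mul D)
      ((hHm _).inner ((S.integrableOn_b_smul hs ht).mono_set hI).aestronglyMeasurable) ?_
    filter_upwards [hmem] with r hr
    exact (norm_inner_le_norm _ _).trans (mul_le_mul_of_nonneg_right (hD r hr) (norm_nonneg _))
  have r1 : (∫ r in Ico s t, inner ℂ (h r) (h r)).re = ∫ r in Ico s t, ‖h r‖ ^ 2 := by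
    rw [← Complex.reCLM_apply, ← Complex.reCLM.integral_comp_comm i1]
    refine integral_congr_ae (ae_of_all _ fun r => ?_)
    simp only [Complex.reCLM_apply]
    exact inner_self_eq_norm_sq (𝕜 := ℂ) (h r)
  have e2 : ∀ r, (inner ℂ (H r) (M (M (H r)))).re = ‖M (H r)‖ ^ 2 := fun r => by
    rw [← hM]; exact inner_self_eq_norm_sq (𝕜 := ℂ) _
  have r2 : (∫ r in Ico s t, inner ℂ (H r) (M (M (H r))) ∂L.a).re
      = ∫ r in Ico s t, ‖M (H r)‖ ^ 2 ∂L.a := by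
    rw [← Complex.reCLM_apply, ← Complex.reCLM.integral_comp_comm i2]
    exact integral_congr_ae (ae_of_all _ e2)
  have r3 : (∫ r in Ico s t, inner ℂ (H r) ((-(2 * Complex.I * L.b r)) • M (h r))).re
      = ∫ r in Ico s t, (inner ℂ (H r) ((-(2 * Complex.I * L.b r)) • M (h r))).re := by
    rw [← Complex.reCLM_apply, ← Complex.reCLM.integral_comp_comm i3]
    rfl
  have j1 : IntegrableOn (fun r => ‖h r‖ ^ 2) (Ico s t) := by
    refine (Complex.reCLM.integrable_comp i1).congr (ae_of_all _ fun r => ?_)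
    exact inner_self_eq_norm_sq (𝕜 := ℂ) (h r)
  have j2 : IntegrableOn (fun r => ‖M (H r)‖ ^ 2) (Ico s t) L.a :=
    (Complex.reCLM.integrable_comp i2).congr (ae_of_all _ e2)
  have j3 := Complex.reCLM.integrable_comp i3
  -- The only inequality of the proof: ‖MH‖² a(dr) is bounded below by b² ‖MH‖² dr.
  obtain ⟨j4, hle⟩ := setIntegral_b_sq_mul_le hs ht (fun r => sq_nonneg ‖M (H r)‖) j2
  -- Completing the square: the first order term of the equation is exactly the cross term, by the
  -- symmetry of M.
  have pt : ∀ r, ‖h r + (Complex.I * L.b r) • M (H r)‖ ^ 2 = ‖h r‖ ^ 2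
      + L.b r ^ 2 * ‖M (H r)‖ ^ 2
      + (inner ℂ (H r) ((-(2 * Complex.I * L.b r)) • M (h r))).re := fun r => by
    have h1 := norm_add_sq (𝕜 := ℂ) (h r) ((Complex.I * L.b r) • M (H r))
    have h2 : inner ℂ (H r) (M (h r)) = conj (inner ℂ (h r) (M (H r))) := by
      rw [← hM, inner_conj_symm]
    rw [h1, norm_smul, inner_smul_right, inner_smul_right, h2]
    generalize inner ℂ (h r) (M (H r)) = z
    simp [Complex.mul_re, Complex.mul_im, mul_pow]
    ring
  have hint : IntegrableOn (fun r => ‖h r + (Complex.I * L.b r) • M (H r)‖ ^ 2) (Ico s t) :=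
    ((j1.add j4).add j3).congr (ae_of_all _ fun r => (pt r).symm)
  refine ⟨hint, ?_⟩
  have htot : ∫ r in Ico s t, ‖h r + (Complex.I * L.b r) • M (H r)‖ ^ 2
      = (∫ r in Ico s t, ‖h r‖ ^ 2) + (∫ r in Ico s t, L.b r ^ 2 * ‖M (H r)‖ ^ 2)
      + ∫ r in Ico s t, (inner ℂ (H r) ((-(2 * Complex.I * L.b r)) • M (h r))).re := by
    have a1 := integral_add j1 j4
    have a2 := integral_add (j1.add j4) j3
    simp only [Pi.add_apply, Complex.reCLM_apply] at a1 a2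
    rw [← a1, ← a2]
    exact integral_congr_ae (ae_of_all _ pt)
  have key' := congrArg Complex.re key
  simp only [Complex.add_re, r1, r2, r3] at key'
  linarith

theorem norm_sq_eq [CompleteSpace X] [IsScalarTower ℝ ℂ X] (S : L.SolvesOn M H h s t) {y : ℝ}
    (hy : y ∈ Icc s t) :
    ‖H y‖ ^ 2 = ‖H s‖ ^ 2 + 2 * ∫ r in Ico s y, (inner ℂ (H r) (h r)).re := by
  have hI : Ico s y ⊆ Icc s t := Ico_subset_Icc_self.trans (Icc_subset_Icc_right hy.2)
  have hi := S.integrableOn_snd.mono_set hI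
  -- H is absolutely continuous, so both factors are primitives for Lebesgue measure and the
  -- singular measure is taken to be zero.
  have key := integral_bilin_by_parts_mixed (α := 0) (innerRealL X) hy.1 (v := H) (g₁ := 0)
    (g₂ := h) (fun z hz => S.eq_fst z ⟨hz.1, hz.2.trans hy.2⟩)
    (fun z hz => by simpa using S.eq_fst z ⟨hz.1, hz.2.trans hy.2⟩) hi
    (by simp [IntegrableOn]) hi
  simp only [innerRealL_apply] at key
  obtain ⟨D, hD⟩ := isCompact_Icc.exists_bound_of_continuousOn S.continuousOn
  have hHm : AEStronglyMeasurable H (volume.restrict (Ico s y)) :=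
    (S.continuousOn.mono hI).aestronglyMeasurable measurableSet_Ico
  have hmem : ∀ᵐ r ∂(volume.restrict (Ico s y)), r ∈ Icc s t :=
    (ae_restrict_mem measurableSet_Ico).mono fun r hr => hI hr
  have i1 : IntegrableOn (fun r => inner ℂ (H r) (h r)) (Ico s y) := by
    refine Integrable.mono' (hi.norm.const_mul D) (hHm.inner hi.aestronglyMeasurable) ?_
    filter_upwards [hmem] with r hr
    exact (norm_inner_le_norm _ _).trans (mul_le_mul_of_nonneg_right (hD r hr) (norm_nonneg _))
  have i2 : IntegrableOn (fun r => inner ℂ (h r) (H r)) (Ico s y) := by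
    refine Integrable.mono' (hi.norm.const_mul D) (hi.aestronglyMeasurable.inner hHm) ?_
    filter_upwards [hmem] with r hr
    rw [mul_comm]
    exact (norm_inner_le_norm _ _).trans (mul_le_mul_of_nonneg_left (hD r hr) (norm_nonneg _))
  have r1 := Complex.reCLM.integral_comp_comm i1
  have r2 := Complex.reCLM.integral_comp_comm i2
  have e : ∀ r, (inner ℂ (h r) (H r)).re = (inner ℂ (H r) (h r)).re := fun r => by
    rw [← inner_conj_symm, Complex.conj_re]
  simp only [Complex.reCLM_apply, e] at r1 r2
  have key' := congrArg Complex.re key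
  simp only [Complex.add_re] at key'
  have n1 : (inner ℂ (H y) (H y)).re = ‖H y‖ ^ 2 := inner_self_eq_norm_sq (𝕜 := ℂ) _
  have n2 : (inner ℂ (H s) (H s)).re = ‖H s‖ ^ 2 := inner_self_eq_norm_sq (𝕜 := ℂ) _
  rw [n1, n2, ← r1, ← r2] at key'
  simp at key'
  linarith

/-- The increments are bounded below by the integral of a square. Since Re⟨H, h⟩ is half the
derivative of ‖H‖², this is the convexity of ‖H‖². -/
theorem monotoneOn_re_inner [CompleteSpace X] [IsScalarTower ℝ ℂ X] (S : L.SolvesOn M H h s t)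
    (hs : 0 ≤ s) (ht : t ∈ L.dom) (hM : ∀ x y, inner ℂ (M x) y = inner ℂ x (M y)) :
    MonotoneOn (fun y => (inner ℂ (H y) (h y)).re) (Icc s t) := by
  intro y hy z hz hyz
  have h1 := (S.mono hs ht hy.1 hyz hz.2).energy_le (hs.trans hy.1)
    (mem_dom_of_le ht (hs.trans hz.1) hz.2) hyz hM
  have h2 : 0 ≤ ∫ r in Ico y z, ‖h r + (Complex.I * L.b r) • M (H r)‖ ^ 2 :=
    integral_nonneg fun r => sq_nonneg _
  exact sub_nonneg.1 (h2.trans h1.2)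

/-- The two slope bounds for a convex function on a chord, obtained by integrating the monotone
function 2 Re⟨H, h⟩. -/
theorem le_norm_sq_sub [CompleteSpace X] [IsScalarTower ℝ ℂ X] (S : L.SolvesOn M H h s t)
    (hs : 0 ≤ s) (ht : t ∈ L.dom) (hM : ∀ x y, inner ℂ (M x) y = inner ℂ x (M y)) {y z : ℝ}
    (hy : s ≤ y) (hyz : y ≤ z) (hz : z ≤ t) :
    2 * (z - y) * (inner ℂ (H y) (h y)).re ≤ ‖H z‖ ^ 2 - ‖H y‖ ^ 2 ∧
    ‖H z‖ ^ 2 - ‖H y‖ ^ 2 ≤ 2 * (z - y) * (inner ℂ (H z) (h z)).re := by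
  have S' := S.mono hs ht hy hyz hz
  have hm := S'.monotoneOn_re_inner (hs.trans hy)
    (mem_dom_of_le ht (hs.trans (hy.trans hyz)) hz) hM
  have e := S'.norm_sq_eq (right_mem_Icc.2 hyz)
  have hint : IntegrableOn (fun r => (inner ℂ (H r) (h r)).re) (Ico y z) :=
    (hm.integrableOn_isCompact isCompact_Icc).mono_set Ico_subset_Icc_self
  have c : ∀ c : ℝ, ∫ _ in Ico y z, c = (z - y) * c := fun c => by simp [hyz]
  have h1 : (z - y) * (inner ℂ (H y) (h y)).re ≤ ∫ r in Ico y z, (inner ℂ (H r) (h r)).re := by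
    rw [← c]
    exact setIntegral_mono_on (integrableOn_const (by simp)) hint measurableSet_Ico fun r hr =>
      hm (left_mem_Icc.2 hyz) ⟨hr.1, hr.2.le⟩ hr.1
  have h2 : ∫ r in Ico y z, (inner ℂ (H r) (h r)).re ≤ (z - y) * (inner ℂ (H z) (h z)).re := by
    rw [← c]
    exact setIntegral_mono_on hint (integrableOn_const (by simp)) measurableSet_Ico fun r hr =>
      hm ⟨hr.1, hr.2.le⟩ (right_mem_Icc.2 hyz) hr.2.le
  constructor <;> linarith

/-- Convexity of the squared norm of a solution. -/
theorem norm_sq_convex [CompleteSpace X] [IsScalarTower ℝ ℂ X] (S : L.SolvesOn M H h s t)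
    (hs : 0 ≤ s) (ht : t ∈ L.dom) (hM : ∀ x y, inner ℂ (M x) y = inner ℂ x (M y)) {y : ℝ}
    (hy : y ∈ Icc s t) :
    (t - s) * ‖H y‖ ^ 2 ≤ (t - y) * ‖H s‖ ^ 2 + (y - s) * ‖H t‖ ^ 2 := by
  -- The upper bound on [s, y] and the lower bound on [y, t] contain the same slope at y; the
  -- weights t - y and y - s eliminate it.
  have h1 := (S.le_norm_sq_sub hs ht hM le_rfl hy.1 hy.2).2
  have h2 := (S.le_norm_sq_sub hs ht hM hy.1 hy.2 le_rfl).1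
  have h3 := mul_le_mul_of_nonneg_left h1 (sub_nonneg.2 hy.2)
  have h4 := mul_le_mul_of_nonneg_left h2 (sub_nonneg.2 hy.1)
  linarith

end OperatorL.SolvesOn

end Hilbert

/-! ### Iterated integrals over simplices -/

/-- The iterated integral `μⁿ {0 ≤ s₁ < s₂ < ⋯ < sₙ < t}`. -/
def simplexIntegral (μ : Measure ℝ) : ℕ → ℝ → ℝ≥0∞
  | 0 => fun _ => 1
  | n + 1 => fun t => ∫⁻ s in Ico 0 t, simplexIntegral μ n s ∂μ

theorem simplexIntegral_monotone (μ : Measure ℝ) (n : ℕ) : Monotone (simplexIntegral μ n) := by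
  cases n with
  | zero => exact monotone_const
  | succ n => exact fun s t hst => lintegral_mono_set (Ico_subset_Ico_right hst)

/-- The right side for n + 1 is the double integral of the n-th simplex integral at x over the
square. The diagonal, which atoms may charge, is discarded: the half y < x contributes at least n +
1 copies of the (n + 2)-th simplex integral by induction, the half x < y exactly one more. -/
theorem succ_mul_simplexIntegral_le (μ : Measure ℝ) [SFinite μ] (n : ℕ) (t : ℝ) :
    (n + 1) * simplexIntegral μ (n + 1) t ≤ μ (Ico 0 t) * simplexIntegral μ n t := by
  induction n generalizing t with
  | zero => simp [simplexIntegral]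
  | succ n ih =>
    have hm : Measurable (simplexIntegral μ n) := (simplexIntegral_monotone μ n).measurable
    have hm' : Measurable (simplexIntegral μ (n + 1)) := (simplexIntegral_monotone μ _).measurable
    have hF : Measurable fun t => μ (Ico 0 t) :=
      Monotone.measurable fun s t hst => measure_mono (Ico_subset_Ico_right hst)
    have h1 : μ (Ico 0 t) * simplexIntegral μ (n + 1) t
        = ∫⁻ x in Ico 0 t, ∫⁻ y in Ico 0 t, simplexIntegral μ n x ∂μ ∂μ := by
      simp only [lintegral_const, Measure.restrict_apply_univ]
      rw [lintegral_mul_const _ hm, mul_comm]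
      rfl
    have hA : Measurable fun z : ℝ × ℝ => ({z : ℝ × ℝ | z.1 < z.2}).indicator
        (fun z => simplexIntegral μ n z.1) z :=
      (hm.comp measurable_fst).indicator (measurableSet_lt measurable_fst measurable_snd)
    have h2 : ∫⁻ x in Ico 0 t, simplexIntegral μ n x * μ (Ico 0 x) ∂μ
        + ∫⁻ y in Ico 0 t, simplexIntegral μ (n + 1) y ∂μ
        ≤ ∫⁻ x in Ico 0 t, ∫⁻ y in Ico 0 t, simplexIntegral μ n x ∂μ ∂μ := by
      have e2 : ∫⁻ y in Ico 0 t, simplexIntegral μ (n + 1) y ∂μ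
          = ∫⁻ x in Ico 0 t, ∫⁻ y in Ico 0 t, (Ioi x).indicator
            (fun _ => simplexIntegral μ n x) y ∂μ ∂μ := by
        have hsw := lintegral_lintegral_swap (μ := μ.restrict (Ico 0 t))
          (ν := μ.restrict (Ico 0 t)) (f := fun x y => (Ioi x).indicator
            (fun _ => simplexIntegral μ n x) y) (by
              convert! hA.aemeasurable using 1)
        rw [hsw]
        refine setLIntegral_congr_fun measurableSet_Ico fun y hy => ?_
        have : ∀ x, (Ioi x).indicator (fun _ => simplexIntegral μ n x) y
            = (Iio y).indicator (simplexIntegral μ n) x := fun x => by simp [indicator]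
        simp only [this]
        rw [lintegral_indicator measurableSet_Iio, Measure.restrict_restrict measurableSet_Iio]
        have e : Iio y ∩ Ico 0 t = Ico 0 y := by
          ext x; have := hy.2; simp; grind
        rw [e]; rfl
      rw [e2, ← lintegral_add_left (f := fun x => simplexIntegral μ n x * μ (Ico 0 x)) (hm.mul hF)]
      refine setLIntegral_mono' measurableSet_Ico fun x hx => ?_
      have e3 : simplexIntegral μ n x * μ (Ico 0 x) = ∫⁻ y in Ico 0 t, (Iio x).indicator
            (fun _ => simplexIntegral μ n x) y ∂μ := by
        rw [lintegral_indicator measurableSet_Iio, Measure.restrict_restrict measurableSet_Iio]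
        have e : Iio x ∩ Ico 0 t = Ico 0 x := by
          ext y; have := hx.2; simp; grind
        rw [e]; simp
      rw [e3, ← lintegral_add_left (measurable_const.indicator measurableSet_Iio)]
      refine lintegral_mono fun y => ?_
      rcases lt_trichotomy y x with h | h | h <;> simp [indicator, h, h.le, not_lt.2]
    rw [h1]
    refine le_trans ?_ h2
    have h3 : (n + 1 : ℝ≥0∞) * ∫⁻ y in Ico 0 t, simplexIntegral μ (n + 1) y ∂μ
        ≤ ∫⁻ x in Ico 0 t, simplexIntegral μ n x * μ (Ico 0 x) ∂μ := by
      rw [← lintegral_const_mul _ hm']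
      exact lintegral_mono fun x => (ih x).trans_eq (mul_comm _ _)
    calc ((n + 1 : ℕ) + 1 : ℝ≥0∞) * simplexIntegral μ (n + 1 + 1) t
        = (n + 1 : ℝ≥0∞) * (∫⁻ y in Ico 0 t, simplexIntegral μ (n + 1) y ∂μ)
          + ∫⁻ y in Ico 0 t, simplexIntegral μ (n + 1) y ∂μ := by
          push_cast
          rw [add_mul, one_mul]; rfl
      _ ≤ _ := by gcongr

/-- The factor 1/n! makes the Picard series converge on every [0, t] inside [0, R), for every ξ,
without any smallness. -/
theorem factorial_mul_simplexIntegral_le (μ : Measure ℝ) [SFinite μ] (n : ℕ) (t : ℝ) :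
    (n.factorial : ℝ≥0∞) * simplexIntegral μ n t ≤ μ (Ico 0 t) ^ n := by
  induction n with
  | zero => simp [simplexIntegral]
  | succ n ih =>
    calc ((n + 1).factorial : ℝ≥0∞) * simplexIntegral μ (n + 1) t
        = n.factorial * ((n + 1) * simplexIntegral μ (n + 1) t) := by
          rw [Nat.factorial_succ]; push_cast; ring
      _ ≤ n.factorial * (μ (Ico 0 t) * simplexIntegral μ n t) := by
          exact mul_le_mul' le_rfl (succ_mul_simplexIntegral_le μ n t)
      _ = μ (Ico 0 t) * (n.factorial * simplexIntegral μ n t) := by ring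
      _ ≤ μ (Ico 0 t) * μ (Ico 0 t) ^ n := by gcongr
      _ = _ := by rw [pow_succ']

/-- Measurability is kept jointly in frequency and position, so that the symbol and the Weyl
solutions are measurable in ξ and can serve as multipliers. -/
theorem stronglyMeasurable_setIntegral_Ico {α : Measure ℝ} [SFinite α] {g : ℝ × ℝ → ℂ}
    (hg : StronglyMeasurable g) :
    StronglyMeasurable fun p : ℝ × ℝ => ∫ s in Ico 0 p.2, g (p.1, s) ∂α := by
  have h : StronglyMeasurable fun q : (ℝ × ℝ) × ℝ =>
      ({q : (ℝ × ℝ) × ℝ | 0 ≤ q.2 ∧ q.2 < q.1.2}).indicator (fun q => g (q.1.1, q.2)) q := by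
    refine StronglyMeasurable.indicator (hg.comp_measurable (by fun_prop)) ?_
    exact (measurableSet_le measurable_const measurable_snd).inter
      (measurableSet_lt measurable_snd (by fun_prop))
  have := h.integral_prod_right' (ν := α)
  convert! this using 1
  ext p
  rw [← integral_indicator measurableSet_Ico]
  rfl

/-! ### The initial value problem -/

namespace OperatorL

variable (L : OperatorL)

/-- The Picard iterates for the initial value problem `φ(0) = c`, `φ'(0) = d`, for all `ξ` at
once. -/
def picard (c d : ℂ) : ℕ → (ℝ × ℝ → ℂ) × (ℝ × ℝ → ℂ)
  | 0 => (fun _ => c, fun _ => d)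
  -- The initial values enter only at stage 0: the iterates are the successive increments, and the
  -- solution is their sum.
  | n + 1 => (fun p => ∫ s in Ico 0 p.2, (picard c d n).2 (p.1, s),
      fun p => (p.1 : ℂ) ^ 2 * (∫ s in Ico 0 p.2, (picard c d n).1 (p.1, s) ∂L.a)
        - 2 * Complex.I * p.1 * ∫ s in Ico 0 p.2, (L.b s : ℂ) * (picard c d n).2 (p.1, s))

theorem stronglyMeasurable_picard (c d : ℂ) (n : ℕ) :
    StronglyMeasurable (L.picard c d n).1 ∧ StronglyMeasurable (L.picard c d n).2 := by
  induction n with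
  | zero => exact ⟨stronglyMeasurable_const, stronglyMeasurable_const⟩
  | succ n ih =>
    have hb : StronglyMeasurable fun p : ℝ × ℝ => (L.b p.2 : ℂ) := by
      have := L.b_measurable
      exact (by fun_prop : Measurable fun p : ℝ × ℝ => (L.b p.2 : ℂ)).stronglyMeasurable
    have hx : StronglyMeasurable fun p : ℝ × ℝ => (p.1 : ℂ) :=
      (by fun_prop : Measurable fun p : ℝ × ℝ => (p.1 : ℂ)).stronglyMeasurable
    refine ⟨stronglyMeasurable_setIntegral_Ico ih.2, ?_⟩
    exact ((hx.pow 2).mul (stronglyMeasurable_setIntegral_Ico ih.1)).sub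
      ((stronglyMeasurable_const.mul hx).mul (stronglyMeasurable_setIntegral_Ico (hb.mul ih.2)))

/-- A measure dominating all the coefficients of the equation. -/
def dominating : Measure ℝ := L.a + volume.withDensity fun y => ENNReal.ofReal (1 + |L.b y|)

instance sFinite_dominating : SFinite L.dominating := by unfold dominating; infer_instance

variable {L}

theorem dominating_Ico_lt_top {t : ℝ} (ht : t ∈ L.dom) : L.dominating (Ico 0 t) < ⊤ := by
  rw [dominating, Measure.add_apply, withDensity_apply _ measurableSet_Ico]
  refine ENNReal.add_lt_top.2 ⟨a_Ico_lt_top le_rfl ht, ?_⟩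
  have : IntegrableOn (fun y => 1 + |L.b y|) (Ico 0 t) :=
    IntegrableOn.mono_set (Integrable.add (integrable_const _) (integrableOn_b le_rfl ht).abs)
      Ico_subset_Icc_self
  exact this.lintegral_lt_top

theorem lintegral_dominating {g : ℝ → ℝ≥0∞} (hg : Measurable g) (t : ℝ) :
    ∫⁻ s in Ico 0 t, g s ∂L.dominating = (∫⁻ s in Ico 0 t, g s ∂L.a)
      + ∫⁻ s in Ico 0 t, ENNReal.ofReal (1 + |L.b s|) * g s := by
  have hm : Measurable fun y => ENNReal.ofReal (1 + |L.b y|) :=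
    (measurable_const.add L.b_measurable.abs).ennreal_ofReal
  rw [dominating, Measure.restrict_add, lintegral_add_measure, restrict_withDensity
    measurableSet_Ico, lintegral_withDensity_eq_lintegral_mul _ hm hg]
  rfl

/-- One Picard step is at most K = 1 + ξ² + 2|ξ| times integration against the dominating measure,
since K majorises the coefficients 1, ξ² and 2|ξ|, while the density 1 + |b| accounts for both
Lebesgue integrals. Iteration gives the simplex integrals. -/
theorem enorm_picard_le (c d : ℂ) (ξ : ℝ) (n : ℕ) (t : ℝ) :
    ‖(L.picard c d n).1 (ξ, t)‖ₑ + ‖(L.picard c d n).2 (ξ, t)‖ₑ ≤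
      (‖c‖ₑ + ‖d‖ₑ) * ENNReal.ofReal (1 + ξ ^ 2 + 2 * |ξ|) ^ n * simplexIntegral L.dominating n t := by
  induction n generalizing t with
  | zero => simp [picard, simplexIntegral]
  | succ n ih =>
    set K := ENNReal.ofReal (1 + ξ ^ 2 + 2 * |ξ|) with hK
    have hmp := L.stronglyMeasurable_picard c d n
    have m1 : Measurable fun s => ‖(L.picard c d n).1 (ξ, s)‖ₑ :=
      (hmp.1.measurable.comp (by fun_prop : Measurable fun s : ℝ => (ξ, s))).enorm
    have m2 : Measurable fun s => ‖(L.picard c d n).2 (ξ, s)‖ₑ :=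
      (hmp.2.measurable.comp (by fun_prop : Measurable fun s : ℝ => (ξ, s))).enorm
    have mb : Measurable fun s => ENNReal.ofReal (1 + |L.b s|) :=
      (measurable_const.add L.b_measurable.abs).ennreal_ofReal
    have mS : Measurable (simplexIntegral L.dominating n) :=
      (simplexIntegral_monotone _ n).measurable
    have hK1 : 1 ≤ K := by
      rw [hK, ← ENNReal.ofReal_one]
      exact ENNReal.ofReal_le_ofReal (by nlinarith [sq_nonneg ξ, abs_nonneg ξ])
    have k1 : ‖(L.picard c d (n + 1)).1 (ξ, t)‖ₑ
        ≤ ∫⁻ s in Ico 0 t, ‖(L.picard c d n).2 (ξ, s)‖ₑ := enorm_integral_le_lintegral_enorm _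
    have k2 : ‖(L.picard c d (n + 1)).2 (ξ, t)‖ₑ
        ≤ ENNReal.ofReal (ξ ^ 2) * (∫⁻ s in Ico 0 t, ‖(L.picard c d n).1 (ξ, s)‖ₑ ∂L.a)
        + ENNReal.ofReal (2 * |ξ|) *
          ∫⁻ s in Ico 0 t, ENNReal.ofReal |L.b s| * ‖(L.picard c d n).2 (ξ, s)‖ₑ := by
      refine (enorm_sub_le).trans ?_
      rw [enorm_mul, enorm_mul]
      have e1 : ‖(ξ : ℂ) ^ 2‖ₑ = ENNReal.ofReal (ξ ^ 2) := by
        rw [← ofReal_norm]; simp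
      have e2 : ‖2 * Complex.I * (ξ : ℂ)‖ₑ = ENNReal.ofReal (2 * |ξ|) := by
        rw [← ofReal_norm]; simp
      rw [e1, e2]
      gcongr
      · exact enorm_integral_le_lintegral_enorm _
      · refine (enorm_integral_le_lintegral_enorm _).trans_eq ?_
        refine lintegral_congr fun s => ?_
        rw [enorm_mul, ← ofReal_norm (L.b s : ℂ), Complex.norm_real, Real.norm_eq_abs]
    have hKa : ENNReal.ofReal (ξ ^ 2) ≤ K :=
      ENNReal.ofReal_le_ofReal (by nlinarith [sq_nonneg ξ, abs_nonneg ξ])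
    have hKb : ENNReal.ofReal (2 * |ξ|) ≤ K :=
      ENNReal.ofReal_le_ofReal (by nlinarith [sq_nonneg ξ, abs_nonneg ξ])
    have k3 : ‖(L.picard c d (n + 1)).1 (ξ, t)‖ₑ + ‖(L.picard c d (n + 1)).2 (ξ, t)‖ₑ
        ≤ K * ∫⁻ s in Ico 0 t, (‖(L.picard c d n).1 (ξ, s)‖ₑ + ‖(L.picard c d n).2 (ξ, s)‖ₑ)
          ∂L.dominating := by
      rw [lintegral_dominating (g := fun s => ‖(L.picard c d n).1 (ξ, s)‖ₑ
        + ‖(L.picard c d n).2 (ξ, s)‖ₑ) (m1.add m2)]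
      have s1 : (∫⁻ s in Ico 0 t, ‖(L.picard c d n).2 (ξ, s)‖ₑ)
          + ∫⁻ s in Ico 0 t, ENNReal.ofReal |L.b s| * ‖(L.picard c d n).2 (ξ, s)‖ₑ
          ≤ ∫⁻ s in Ico 0 t, ENNReal.ofReal (1 + |L.b s|) *
            (‖(L.picard c d n).1 (ξ, s)‖ₑ + ‖(L.picard c d n).2 (ξ, s)‖ₑ) := by
        rw [← lintegral_add_left m2]
        refine lintegral_mono fun s => ?_
        rw [ENNReal.ofReal_add zero_le_one (abs_nonneg _), ENNReal.ofReal_one, mul_add]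
        refine le_trans (le_of_eq ?_) le_add_self
        ring
      calc _ ≤ K * (∫⁻ s in Ico 0 t, ‖(L.picard c d n).2 (ξ, s)‖ₑ)
            + (K * (∫⁻ s in Ico 0 t, ‖(L.picard c d n).1 (ξ, s)‖ₑ ∂L.a)
            + K * ∫⁻ s in Ico 0 t, ENNReal.ofReal |L.b s| * ‖(L.picard c d n).2 (ξ, s)‖ₑ) := by
            refine add_le_add (k1.trans (le_mul_of_one_le_left' hK1)) (k2.trans ?_)
            gcongr
        _ = K * ((∫⁻ s in Ico 0 t, ‖(L.picard c d n).1 (ξ, s)‖ₑ ∂L.a)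
            + ((∫⁻ s in Ico 0 t, ‖(L.picard c d n).2 (ξ, s)‖ₑ)
            + ∫⁻ s in Ico 0 t, ENNReal.ofReal |L.b s| * ‖(L.picard c d n).2 (ξ, s)‖ₑ)) := by ring
        _ ≤ _ := by
            gcongr
            exact le_self_add
    refine k3.trans ?_
    calc _ ≤ K * ∫⁻ s in Ico 0 t, (‖c‖ₑ + ‖d‖ₑ) * K ^ n * simplexIntegral L.dominating n s
          ∂L.dominating := by
          gcongr with s
          exact ih s
      _ = (‖c‖ₑ + ‖d‖ₑ) * K ^ (n + 1) * simplexIntegral L.dominating (n + 1) t := by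
          rw [lintegral_const_mul _ mS]
          simp only [simplexIntegral]
          ring

/-- The radius in the exponential bound for the Picard iterates. -/
def picardRadius (L : OperatorL) (ξ t : ℝ) : ℝ :=
  (1 + ξ ^ 2 + 2 * |ξ|) * (L.dominating (Ico 0 t)).toReal

theorem norm_picard_le (c d : ℂ) (ξ : ℝ) (n : ℕ) {s t : ℝ} (ht : t ∈ L.dom) (hst : s ≤ t) :
    ‖(L.picard c d n).1 (ξ, s)‖ ≤ (‖c‖ + ‖d‖) * (L.picardRadius ξ t ^ n / n.factorial) ∧
    ‖(L.picard c d n).2 (ξ, s)‖ ≤ (‖c‖ + ‖d‖) * (L.picardRadius ξ t ^ n / n.factorial) := by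
  have h0 : 0 ≤ 1 + ξ ^ 2 + 2 * |ξ| := by nlinarith [sq_nonneg ξ, abs_nonneg ξ]
  have hR : 0 ≤ L.picardRadius ξ t := mul_nonneg h0 ENNReal.toReal_nonneg
  have key : ‖(L.picard c d n).1 (ξ, s)‖ₑ + ‖(L.picard c d n).2 (ξ, s)‖ₑ
      ≤ ENNReal.ofReal ((‖c‖ + ‖d‖) * (L.picardRadius ξ t ^ n / n.factorial)) := by
    refine (enorm_picard_le c d ξ n s).trans ?_
    have h1 : simplexIntegral L.dominating n s ≤
        ENNReal.ofReal ((L.dominating (Ico 0 t)).toReal ^ n / n.factorial) := by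
      refine (simplexIntegral_monotone _ n hst).trans ?_
      have h2 := factorial_mul_simplexIntegral_le L.dominating n t
      rw [ENNReal.ofReal_div_of_pos (by positivity), ENNReal.ofReal_pow ENNReal.toReal_nonneg,
        ENNReal.ofReal_toReal (dominating_Ico_lt_top ht).ne, ENNReal.ofReal_natCast]
      rw [ENNReal.le_div_iff_mul_le (by simp [Nat.factorial_ne_zero]) (by simp), mul_comm]
      exact h2
    rw [← ofReal_norm, ← ofReal_norm, ← ENNReal.ofReal_add (norm_nonneg _)
      (norm_nonneg _), ← ENNReal.ofReal_pow h0, ← ENNReal.ofReal_mul (by positivity)]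
    refine (mul_le_mul' le_rfl h1).trans_eq ?_
    rw [← ENNReal.ofReal_mul (by positivity), picardRadius, mul_pow]
    ring_nf
  have hnn : 0 ≤ (‖c‖ + ‖d‖) * (L.picardRadius ξ t ^ n / n.factorial) := by positivity
  constructor
  · have := le_self_add.trans key
    rwa [← ofReal_norm, ENNReal.ofReal_le_ofReal_iff hnn] at this
  · have := le_add_self.trans key
    rwa [← ofReal_norm, ENNReal.ofReal_le_ofReal_iff hnn] at this

theorem summable_picard_bound (c d : ℂ) (ξ t : ℝ) :
    Summable fun n : ℕ => (‖c‖ + ‖d‖) * (L.picardRadius ξ t ^ n / n.factorial) :=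
  (Real.summable_pow_div_factorial _).mul_left _

variable (L) in
/-- The solution of the initial value problem `φ(0) = c`, `φ'(0) = d` on `[0, R)`, together with its
derivative, as functions of `(ξ, t)`. -/
def ivp (c d : ℂ) : (ℝ × ℝ → ℂ) × (ℝ × ℝ → ℂ) :=
  (fun p => (univ ×ˢ L.dom).indicator (fun p => ∑' n, (L.picard c d n).1 p) p,
   fun p => (univ ×ˢ L.dom).indicator (fun p => ∑' n, (L.picard c d n).2 p) p)

theorem hasSum_ivp (c d : ℂ) (ξ : ℝ) {t : ℝ} (ht : t ∈ L.dom) :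
    HasSum (fun n => (L.picard c d n).1 (ξ, t)) ((L.ivp c d).1 (ξ, t)) ∧
    HasSum (fun n => (L.picard c d n).2 (ξ, t)) ((L.ivp c d).2 (ξ, t)) := by
  have hmem : (ξ, t) ∈ univ ×ˢ L.dom := ⟨trivial, ht⟩
  simp only [ivp, indicator_of_mem hmem]
  exact ⟨(Summable.of_norm_bounded (summable_picard_bound c d ξ t)
      fun n => (norm_picard_le c d ξ n ht le_rfl).1).hasSum,
    (Summable.of_norm_bounded (summable_picard_bound c d ξ t)
      fun n => (norm_picard_le c d ξ n ht le_rfl).2).hasSum⟩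

variable (L) in
theorem stronglyMeasurable_ivp (c d : ℂ) :
    StronglyMeasurable (L.ivp c d).1 ∧ StronglyMeasurable (L.ivp c d).2 := by
  have hS : MeasurableSet (univ ×ˢ L.dom : Set (ℝ × ℝ)) :=
    MeasurableSet.univ.prod L.measurableSet_dom
  constructor
  · refine stronglyMeasurable_of_tendsto atTop (f := fun N p => (univ ×ˢ L.dom).indicator
      (fun p => ∑ n ∈ Finset.range N, (L.picard c d n).1 p) p) (fun N => ?_) ?_
    · exact (Finset.stronglyMeasurable_fun_sum _ fun n _ =>
        (L.stronglyMeasurable_picard c d n).1).indicator hS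
    · refine tendsto_pi_nhds.2 fun p => ?_
      by_cases hp : p ∈ univ ×ˢ L.dom
      · simp only [indicator_of_mem hp]
        exact (hasSum_ivp c d p.1 hp.2).1.tendsto_sum_nat
      · simp only [ivp, indicator_of_notMem hp]
        exact tendsto_const_nhds
  · refine stronglyMeasurable_of_tendsto atTop (f := fun N p => (univ ×ˢ L.dom).indicator
      (fun p => ∑ n ∈ Finset.range N, (L.picard c d n).2 p) p) (fun N => ?_) ?_
    · exact (Finset.stronglyMeasurable_fun_sum _ fun n _ =>
        (L.stronglyMeasurable_picard c d n).2).indicator hS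
    · refine tendsto_pi_nhds.2 fun p => ?_
      by_cases hp : p ∈ univ ×ˢ L.dom
      · simp only [indicator_of_mem hp]
        exact (hasSum_ivp c d p.1 hp.2).2.tendsto_sum_nat
      · simp only [ivp, indicator_of_notMem hp]
        exact tendsto_const_nhds

theorem norm_ivp_le (c d : ℂ) (ξ : ℝ) {t : ℝ} (ht : t ∈ L.dom) : ∃ C, ∀ s ∈ Icc 0 t,
    ‖(L.ivp c d).1 (ξ, s)‖ ≤ C ∧ ‖(L.ivp c d).2 (ξ, s)‖ ≤ C := by
  refine ⟨∑' n : ℕ, (‖c‖ + ‖d‖) * (L.picardRadius ξ t ^ n / n.factorial), fun s hs => ?_⟩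
  have hsd := mem_dom_of_le ht hs.1 hs.2
  obtain ⟨h1, h2⟩ := hasSum_ivp c d ξ hsd
  rw [← h1.tsum_eq, ← h2.tsum_eq]
  exact ⟨tsum_of_norm_bounded (summable_picard_bound c d ξ t).hasSum
      fun n => (norm_picard_le c d ξ n ht hs.2).1,
    tsum_of_norm_bounded (summable_picard_bound c d ξ t).hasSum
      fun n => (norm_picard_le c d ξ n ht hs.2).2⟩

/-- Summation of the Picard recursion; the exponential series dominates, so sums and integrals may
be interchanged. -/
theorem ivp_eq (c d : ℂ) (ξ : ℝ) {t : ℝ} (ht : t ∈ L.dom) :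
    (L.ivp c d).1 (ξ, t) = c + (∫ s in Ico 0 t, (L.ivp c d).2 (ξ, s)) ∧
    (L.ivp c d).2 (ξ, t) = d + ((ξ : ℂ) ^ 2 * (∫ s in Ico 0 t, (L.ivp c d).1 (ξ, s) ∂L.a)
        - 2 * Complex.I * ξ * ∫ s in Ico 0 t, (L.b s : ℂ) * (L.ivp c d).2 (ξ, s)) := by
  have hfa : IsFiniteMeasure (L.a.restrict (Ico 0 t)) := ⟨by
    rw [Measure.restrict_apply_univ]; exact a_Ico_lt_top le_rfl ht⟩
  have hms : Measurable fun s : ℝ => (ξ, s) := by fun_prop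
  have hb : AEStronglyMeasurable (fun s => (L.b s : ℂ)) (volume.restrict (Ico 0 t)) := by
    have := L.b_measurable
    exact (by fun_prop : Measurable fun s : ℝ => (L.b s : ℂ)).aestronglyMeasurable
  have hsm := fun n => L.stronglyMeasurable_picard c d n
  have hsb := summable_picard_bound (L := L) c d ξ t
  have hbi : IntegrableOn (fun s => |L.b s|) (Ico 0 t) :=
    IntegrableOn.mono_set (integrableOn_b le_rfl ht).abs Ico_subset_Icc_self
  have i1 : HasSum (fun n => ∫ s in Ico 0 t, (L.picard c d n).2 (ξ, s))
      (∫ s in Ico 0 t, (L.ivp c d).2 (ξ, s)) := by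
    refine hasSum_integral_of_dominated_convergence
      (fun n _ => (‖c‖ + ‖d‖) * (L.picardRadius ξ t ^ n / n.factorial))
      (fun n => ((hsm n).2.comp_measurable hms).aestronglyMeasurable) (fun n => ?_)
      (ae_of_all _ fun _ => hsb) (integrable_const _) ?_
    · exact ae_restrict_of_forall_mem measurableSet_Ico fun s hs =>
        (norm_picard_le c d ξ n ht hs.2.le).2
    · exact ae_restrict_of_forall_mem measurableSet_Ico fun s hs =>
        (hasSum_ivp c d ξ (mem_dom_of_le ht hs.1 hs.2.le)).2
  have i2 : HasSum (fun n => ∫ s in Ico 0 t, (L.picard c d n).1 (ξ, s) ∂L.a)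
      (∫ s in Ico 0 t, (L.ivp c d).1 (ξ, s) ∂L.a) := by
    refine hasSum_integral_of_dominated_convergence
      (fun n _ => (‖c‖ + ‖d‖) * (L.picardRadius ξ t ^ n / n.factorial))
      (fun n => ((hsm n).1.comp_measurable hms).aestronglyMeasurable) (fun n => ?_)
      (ae_of_all _ fun _ => hsb) (integrable_const _) ?_
    · exact ae_restrict_of_forall_mem measurableSet_Ico fun s hs =>
        (norm_picard_le c d ξ n ht hs.2.le).1
    · exact ae_restrict_of_forall_mem measurableSet_Ico fun s hs =>
        (hasSum_ivp c d ξ (mem_dom_of_le ht hs.1 hs.2.le)).1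
  have i3 : HasSum (fun n => ∫ s in Ico 0 t, (L.b s : ℂ) * (L.picard c d n).2 (ξ, s))
      (∫ s in Ico 0 t, (L.b s : ℂ) * (L.ivp c d).2 (ξ, s)) := by
    refine hasSum_integral_of_dominated_convergence
      (fun n s => |L.b s| * ((‖c‖ + ‖d‖) * (L.picardRadius ξ t ^ n / n.factorial)))
      (fun n => hb.mul ((hsm n).2.comp_measurable hms).aestronglyMeasurable) (fun n => ?_)
      (ae_of_all _ fun s => hsb.mul_left _) ?_ ?_
    · refine ae_restrict_of_forall_mem measurableSet_Ico fun s hs => ?_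
      rw [norm_mul, Complex.norm_real, Real.norm_eq_abs]
      exact mul_le_mul_of_nonneg_left (norm_picard_le c d ξ n ht hs.2.le).2 (abs_nonneg _)
    · simp only [tsum_mul_left]
      exact hbi.mul_const _
    · exact ae_restrict_of_forall_mem measurableSet_Ico fun s hs =>
        (hasSum_ivp c d ξ (mem_dom_of_le ht hs.1 hs.2.le)).2.mul_left _
  obtain ⟨h1, h2⟩ := hasSum_ivp c d ξ ht
  constructor
  · rw [h1.tsum_eq.symm, h1.summable.tsum_eq_zero_add, ← i1.tsum_eq]
    rfl
  · rw [h2.tsum_eq.symm, h2.summable.tsum_eq_zero_add,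
      ← ((i2.mul_left ((ξ : ℂ) ^ 2)).sub (i3.mul_left (2 * Complex.I * ξ))).tsum_eq]
    rfl

end OperatorL

/-! ### The Weyl solution -/

namespace OperatorL

section

variable {X : Type*} [NormedAddCommGroup X] [InnerProductSpace ℂ X] [NormedSpace ℝ X]
  {L : OperatorL} {M : X →L[ℂ] X} {H h : ℝ → X} {s t : ℝ}

theorem SolvesOn.const_smul [SMulCommClass ℝ ℂ X] (S : L.SolvesOn M H h s t) (c : ℂ) :
    L.SolvesOn M (fun y => c • H y) (fun y => c • h y) s t := by
  refine ⟨S.aestronglyMeasurable.const_smul c, ?_, fun y hy => ?_, fun y hy => ?_⟩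
  · obtain ⟨C, hC⟩ := S.bounded
    exact ⟨‖c‖ * C, fun y hy => by rw [norm_smul]; gcongr; exact hC y hy⟩
  · rw [integral_smul, S.eq_fst y hy, smul_add]
  · simp only [map_smul]
    simp_rw [smul_comm _ c]
    rw [integral_smul, integral_smul, S.eq_snd y hy, smul_add, smul_add]

/-- Lebesgue differentiation gives h = 0 only almost everywhere. The equation then shows that h is
constant, and on an interval of positive length the constant must be zero. -/
theorem SolvesOn.snd_eq_zero [CompleteSpace X] (S : L.SolvesOn M H h s t) (hst : s < t)
    (hH : ∀ y ∈ Icc s t, H y = 0) : ∀ y ∈ Icc s t, h y = 0 := by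
  have hint : IntervalIntegrable h volume s t := by
    rw [intervalIntegrable_iff, uIoc_of_le hst.le]
    exact S.integrableOn_snd.mono_set Ioc_subset_Icc_self
  have hae : ∀ᵐ x, x ∈ Ioo s t → h x = 0 := by
    filter_upwards [hint.ae_hasDerivAt_integral] with x hx hxm
    have d1 := hx (by rw [uIcc_of_le hst.le]; exact Ioo_subset_Icc_self hxm) s (by simp)
    have d2 : HasDerivAt (fun x => ∫ r in s..x, h r) 0 x := by
      refine (hasDerivAt_const x (0 : X)).congr_of_eventuallyEq ?_
      filter_upwards [Ioo_mem_nhds hxm.1 hxm.2] with z hz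
      have := S.eq_fst z (Ioo_subset_Icc_self hz)
      rw [hH z (Ioo_subset_Icc_self hz), hH s (left_mem_Icc.2 hst.le), zero_add] at this
      rw [intervalIntegral.integral_of_le hz.1.le, integral_Ioc_eq_integral_Ioo,
        ← integral_Ico_eq_integral_Ioo, ← this]
    exact d1.unique d2
  have hc : ∀ y ∈ Icc s t, h y = h s := fun y hy => by
    have e1 : ∫ r in Ico s y, M (M (H r)) ∂L.a = 0 :=
      setIntegral_eq_zero_of_forall_eq_zero fun r hr => by
        rw [hH r ⟨hr.1, hr.2.le.trans hy.2⟩]; simp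
    have e2 : ∫ r in Ico s y, (-(2 * Complex.I * L.b r)) • M (h r) = 0 := by
      rw [integral_Ico_eq_integral_Ioo]
      refine integral_eq_zero_of_ae ((ae_restrict_iff' measurableSet_Ioo).2 ?_)
      filter_upwards [hae] with r hr hrm
      simp [hr ⟨hrm.1, hrm.2.trans_le hy.2⟩]
    rw [S.eq_snd y hy, e1, e2, add_zero, add_zero]
  have h0 : h s = 0 := by
    by_contra hne
    have : volume (Ioo s t) = 0 := by
      refine measure_mono_null (fun x hx => ?_) hae
      simp only [mem_compl_iff, mem_ofPred_eq, Classical.not_imp]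
      exact ⟨hx, by rw [hc x (Ioo_subset_Icc_self hx)]; exact hne⟩
    simp only [Real.volume_Ioo, ENNReal.ofReal_eq_zero] at this
    linarith
  exact fun y hy => (hc y hy).trans h0

end

/-- Multiplication by `ξ` on `ℂ`. -/
def mulC (ξ : ℝ) : ℂ →L[ℂ] ℂ := (ξ : ℂ) • ContinuousLinearMap.id ℂ ℂ

theorem mulC_apply (ξ : ℝ) (z : ℂ) : mulC ξ z = ξ * z := rfl

theorem mulC_symm (ξ : ℝ) (x y : ℂ) : inner ℂ (mulC ξ x) y = inner ℂ x (mulC ξ y) := by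
  simp [mulC_apply]; ring

variable {L : OperatorL}

theorem solvesOn_of_eq {ξ t : ℝ} {φ dφ : ℝ → ℂ}
    (hm : AEStronglyMeasurable dφ (volume.restrict (Icc 0 t))) (hb : ∃ C, ∀ y ∈ Icc 0 t, ‖dφ y‖ ≤ C)
    (h1 : ∀ y ∈ Icc 0 t, φ y = φ 0 + ∫ r in Ico 0 y, dφ r)
    (h2 : ∀ y ∈ Icc 0 t, dφ y = dφ 0 + ((ξ : ℂ) ^ 2 * (∫ s in Ico 0 y, φ s ∂L.a)
        - 2 * Complex.I * ξ * ∫ s in Ico 0 y, (L.b s : ℂ) * dφ s)) :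
    L.SolvesOn (mulC ξ) φ dφ 0 t := by
  refine ⟨hm, hb, h1, fun y hy => (h2 y hy).trans ?_⟩
  simp only [mulC_apply, smul_eq_mul]
  rw [add_assoc, sub_eq_add_neg, ← neg_mul, ← integral_const_mul, ← integral_const_mul]
  congr 3
  · ext r; ring
  · ext r; ring

theorem solvesOn_ivp (c d : ℂ) (ξ : ℝ) {t : ℝ} (ht : t ∈ L.dom) :
    L.SolvesOn (mulC ξ) (fun y => (L.ivp c d).1 (ξ, y)) (fun y => (L.ivp c d).2 (ξ, y)) 0 t := by
  have h0 := ivp_eq (L := L) c d ξ L.zero_mem_dom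
  simp only [Ico_self, Measure.restrict_empty, integral_zero_measure, add_zero, mul_zero,
    sub_zero] at h0
  refine solvesOn_of_eq ?_ ?_ (fun y hy => ?_) (fun y hy => ?_)
  · exact ((L.stronglyMeasurable_ivp c d).2.comp_measurable (by fun_prop)).aestronglyMeasurable
  · obtain ⟨C, hC⟩ := norm_ivp_le c d ξ ht
    exact ⟨C, fun y hy => (hC y hy).2⟩
  · rw [(ivp_eq c d ξ (mem_dom_of_le ht hy.1 hy.2)).1, h0.1]
  · rw [(ivp_eq c d ξ (mem_dom_of_le ht hy.1 hy.2)).2, h0.2]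

theorem ivp_zero (c d : ℂ) (ξ : ℝ) : (L.ivp c d).1 (ξ, 0) = c ∧ (L.ivp c d).2 (ξ, 0) = d := by
  have h0 := ivp_eq (L := L) c d ξ L.zero_mem_dom
  simpa using h0

/-- A convex non-negative function that vanishes at 0 and at r vanishes in between, which
contradicts the derivative 1 at 0. -/
theorem ivp_zero_one_ne_zero (ξ : ℝ) {r : ℝ} (hr : r ∈ L.int) : (L.ivp 0 1).1 (ξ, r) ≠ 0 := by
  intro h
  have S := solvesOn_ivp (L := L) 0 1 ξ (int_subset_dom hr)
  have hz : ∀ y ∈ Icc 0 r, (L.ivp 0 1).1 (ξ, y) = 0 := fun y hy => by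
    have := S.norm_sq_convex le_rfl (int_subset_dom hr) (mulC_symm ξ) hy
    rw [h, (ivp_zero 0 1 ξ).1] at this
    simp only [norm_zero, sub_zero] at this
    have h2 : ‖(L.ivp 0 1).1 (ξ, y)‖ ^ 2 ≤ 0 := by
      by_contra hc
      push Not at hc
      nlinarith [mul_pos hr.1 hc]
    simpa using le_antisymm h2 (sq_nonneg _)
  have := S.snd_eq_zero hr.1 hz 0 ⟨le_rfl, hr.1.le⟩
  rw [(ivp_zero 0 1 ξ).2] at this
  exact one_ne_zero this

variable (L) in
/-- The coefficient `κ` for which `φ_N - κ φ_D` vanishes at `r`. -/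
def truncSymbol (ξ r : ℝ) : ℂ := (L.ivp 1 0).1 (ξ, r) / (L.ivp 0 1).1 (ξ, r)

/-- The solution with `φ(0) = 1` and `φ'(0) = -κ`. -/
theorem solvesOn_comb (κ : ℂ) (ξ : ℝ) {t : ℝ} (ht : t ∈ L.dom) :
    L.SolvesOn (mulC ξ) (fun y => (L.ivp 1 0).1 (ξ, y) - κ * (L.ivp 0 1).1 (ξ, y))
      (fun y => (L.ivp 1 0).2 (ξ, y) - κ * (L.ivp 0 1).2 (ξ, y)) 0 t :=
  (solvesOn_ivp 1 0 ξ ht).sub ((solvesOn_ivp 0 1 ξ ht).const_smul κ) le_rfl ht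

/-- Convexity between the value 1 at 0 and the value 0 at r. -/
theorem norm_sq_trunc_le (ξ : ℝ) {r : ℝ} (hr : r ∈ L.int) {y : ℝ} (hy : y ∈ Icc 0 r) :
    ‖(L.ivp 1 0).1 (ξ, y) - L.truncSymbol ξ r * (L.ivp 0 1).1 (ξ, y)‖ ^ 2 ≤ 1 - y / r := by
  have S := solvesOn_comb (L := L) (L.truncSymbol ξ r) ξ (int_subset_dom hr)
  have h := S.norm_sq_convex le_rfl (int_subset_dom hr) (mulC_symm ξ) hy
  have h1 : (L.ivp 1 0).1 (ξ, r) - L.truncSymbol ξ r * (L.ivp 0 1).1 (ξ, r) = 0 := by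
    rw [truncSymbol, div_mul_cancel₀ _ (ivp_zero_one_ne_zero ξ hr), sub_self]
  simp only [h1, (ivp_zero (L := L) 1 0 ξ).1, (ivp_zero (L := L) 0 1 ξ).1] at h
  simp only [mul_zero, sub_zero, norm_one, one_pow, mul_one, norm_zero] at h
  have hr0 : 0 < r := hr.1
  have e : 1 - y / r = (r - y) / r := by field_simp
  rw [e, le_div_iff₀ hr0]
  linarith

/-- A positive slope at y would keep the convex squared modulus from reaching 0 at r. -/
theorem re_inner_trunc_nonpos (ξ : ℝ) {r : ℝ} (hr : r ∈ L.int) {y : ℝ} (hy : 0 ≤ y) (hyr : y < r) :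
    (inner ℂ ((L.ivp 1 0).1 (ξ, y) - L.truncSymbol ξ r * (L.ivp 0 1).1 (ξ, y))
      ((L.ivp 1 0).2 (ξ, y) - L.truncSymbol ξ r * (L.ivp 0 1).2 (ξ, y))).re ≤ 0 := by
  have S := solvesOn_comb (L := L) (L.truncSymbol ξ r) ξ (int_subset_dom hr)
  have h := (S.le_norm_sq_sub le_rfl (int_subset_dom hr) (mulC_symm ξ) hy hyr.le le_rfl).1
  have h1 : (L.ivp 1 0).1 (ξ, r) - L.truncSymbol ξ r * (L.ivp 0 1).1 (ξ, r) = 0 := by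
    rw [truncSymbol, div_mul_cancel₀ _ (ivp_zero_one_ne_zero ξ hr), sub_self]
  rw [h1] at h
  by_contra hc
  push Not at hc
  have h2 := mul_pos (mul_pos two_pos (sub_pos.2 hyr)) hc
  simp only [norm_zero] at h
  nlinarith [sq_nonneg ‖(L.ivp 1 0).1 (ξ, y) - L.truncSymbol ξ r * (L.ivp 0 1).1 (ξ, y)‖]

/-- Evaluate at r the solution that vanishes at r': up to sign it is the difference of the two
coefficients times the Dirichlet solution, and its square is at most 1 - r/r'. By convexity the
squared Dirichlet solution grows at least linearly from s to r, so one may divide. -/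
theorem norm_sq_truncSymbol_sub_le (ξ : ℝ) {s r r' : ℝ} (hs : 0 < s) (hsr : s ≤ r) (hrr : r ≤ r')
    (hr' : r' ∈ L.int) :
    ‖L.truncSymbol ξ r' - L.truncSymbol ξ r‖ ^ 2 ≤
      s / ‖(L.ivp 0 1).1 (ξ, s)‖ ^ 2 * (1 / r - 1 / r') := by
  have hr0 : 0 < r := hs.trans_le hsr
  have hr : r ∈ L.int := ⟨hr0, lt_of_le_of_lt (by exact_mod_cast hrr) hr'.2⟩
  have hsi : s ∈ L.int := ⟨hs, lt_of_le_of_lt (by exact_mod_cast hsr) hr.2⟩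
  have S := solvesOn_ivp (L := L) 0 1 ξ (int_subset_dom hr)
  have h1 := S.norm_sq_convex le_rfl (int_subset_dom hr) (mulC_symm ξ) ⟨hs.le, hsr⟩
  simp only [(ivp_zero (L := L) 0 1 ξ).1] at h1
  simp only [sub_zero, norm_zero, ne_eq, OfNat.ofNat_ne_zero, not_false_eq_true, zero_pow,
    mul_zero, zero_add] at h1
  have h2 := norm_sq_trunc_le ξ hr' (y := r) ⟨hr0.le, hrr⟩
  have e : (L.ivp 1 0).1 (ξ, r) - L.truncSymbol ξ r' * (L.ivp 0 1).1 (ξ, r)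
      = -((L.truncSymbol ξ r' - L.truncSymbol ξ r) * (L.ivp 0 1).1 (ξ, r)) := by
    have : L.truncSymbol ξ r * (L.ivp 0 1).1 (ξ, r) = (L.ivp 1 0).1 (ξ, r) := by
      rw [truncSymbol, div_mul_cancel₀ _ (ivp_zero_one_ne_zero ξ hr)]
    rw [sub_mul, this]; ring
  rw [e, norm_neg, norm_mul, mul_pow] at h2
  have hD : 0 < ‖(L.ivp 0 1).1 (ξ, s)‖ ^ 2 :=
    pow_pos (norm_pos_iff.2 (ivp_zero_one_ne_zero ξ hsi)) 2
  have hr0' : 0 < r' := hr0.trans_le hrr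
  set A := ‖L.truncSymbol ξ r' - L.truncSymbol ξ r‖ ^ 2
  have hA : 0 ≤ A := sq_nonneg _
  rw [div_mul_eq_mul_div, le_div_iff₀ hD]
  have h3 : A * (r * ‖(L.ivp 0 1).1 (ξ, s)‖ ^ 2) ≤ A * (s * ‖(L.ivp 0 1).1 (ξ, r)‖ ^ 2) :=
    mul_le_mul_of_nonneg_left h1 hA
  have h4 := mul_le_mul_of_nonneg_left h2 hs.le
  have e2 : s * (1 / r - 1 / r') = s * (1 - r / r') / r := by field_simp
  rw [e2, le_div_iff₀ hr0]
  linarith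

variable (L) in
/-- A fixed increasing sequence in `(0, R)` that exhausts `[0, R)`. -/
def exhaustion : ℕ → ℝ := L.exists_seq_tendsto_R.choose

theorem exhaustion_strictMono : StrictMono L.exhaustion := L.exists_seq_tendsto_R.choose_spec.1

theorem exhaustion_mem (n : ℕ) : L.exhaustion n ∈ L.int := L.exists_seq_tendsto_R.choose_spec.2.1 n

theorem eventually_lt_exhaustion {t : ℝ} (ht : t ∈ L.dom) :
    ∀ᶠ n in atTop, t < L.exhaustion n := by
  obtain ⟨n, hn⟩ := L.exists_seq_tendsto_R.choose_spec.2.2 t ht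
  filter_upwards [eventually_ge_atTop n] with m hm
  exact hn.trans_le (exhaustion_strictMono.monotone hm)

/-- The squared differences are controlled by those of 1/r along the exhaustion, a decreasing
sequence bounded below. Finite and infinite R are treated alike. -/
theorem cauchySeq_truncSymbol (ξ : ℝ) : CauchySeq fun n => L.truncSymbol ξ (L.exhaustion n) := by
  have hpos : ∀ n, 0 < L.exhaustion n := fun n => (exhaustion_mem n).1
  have hanti : Antitone fun n => 1 / L.exhaustion n := fun m n hmn =>
    one_div_le_one_div_of_le (hpos m) (exhaustion_strictMono.monotone hmn)
  have hc : CauchySeq fun n => 1 / L.exhaustion n :=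
    (tendsto_atTop_ciInf hanti ⟨0, by rintro _ ⟨n, rfl⟩; exact (one_div_pos.2 (hpos n)).le⟩).cauchySeq
  set C := L.exhaustion 0 / ‖(L.ivp 0 1).1 (ξ, L.exhaustion 0)‖ ^ 2 with hC
  have hC0 : 0 ≤ C := div_nonneg (hpos 0).le (sq_nonneg _)
  rw [Metric.cauchySeq_iff'] at hc ⊢
  intro ε hε
  obtain ⟨N, hN⟩ := hc (ε ^ 2 / (C + 1)) (by positivity)
  refine ⟨N, fun n hn => ?_⟩
  have h1 := norm_sq_truncSymbol_sub_le (L := L) ξ (hpos 0)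
    (exhaustion_strictMono.monotone (Nat.zero_le N)) (exhaustion_strictMono.monotone hn)
    (exhaustion_mem n)
  rw [dist_eq_norm]
  have h2 := hN n hn
  rw [Real.dist_eq, abs_sub_comm, lt_div_iff₀ (by positivity)] at h2
  have h3 : 1 / L.exhaustion N - 1 / L.exhaustion n ≤ |1 / L.exhaustion N - 1 / L.exhaustion n| :=
    le_abs_self _
  have h4 : ‖L.truncSymbol ξ (L.exhaustion n) - L.truncSymbol ξ (L.exhaustion N)‖ ^ 2 < ε ^ 2 := by
    refine h1.trans_lt ?_
    nlinarith [abs_nonneg (1 / L.exhaustion N - 1 / L.exhaustion n),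
      mul_le_mul_of_nonneg_left h3 hC0]
  exact lt_of_pow_lt_pow_left₀ 2 hε.le h4

variable (L) in
/-- The symbol, as the limit of the symbols of the problems with a Dirichlet condition at `r`. -/
def symbol (ξ : ℝ) : ℂ := limUnder atTop fun n => L.truncSymbol ξ (L.exhaustion n)

theorem tendsto_symbol (ξ : ℝ) :
    Tendsto (fun n => L.truncSymbol ξ (L.exhaustion n)) atTop (𝓝 (L.symbol ξ)) :=
  (cauchySeq_truncSymbol ξ).tendsto_limUnder

variable (L) in
theorem measurable_symbol : Measurable L.symbol := by
  refine (StronglyMeasurable.limUnder fun n => ?_).measurable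
  have h := fun c d => (L.stronglyMeasurable_ivp c d).1.measurable.comp
    (by fun_prop : Measurable fun ξ : ℝ => (ξ, L.exhaustion n))
  exact ((h 1 0).div (h 0 1)).stronglyMeasurable

variable (L) in
/-- The Weyl solution and its derivative, as functions of `(ξ, t)`. -/
def weyl (p : ℝ × ℝ) : ℂ := (L.ivp 1 0).1 p - L.symbol p.1 * (L.ivp 0 1).1 p

variable (L) in
/-- The derivative of the Weyl solution. -/
def dweyl (p : ℝ × ℝ) : ℂ := (L.ivp 1 0).2 p - L.symbol p.1 * (L.ivp 0 1).2 p

variable (L) in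
theorem measurable_weyl : Measurable L.weyl :=
  (L.stronglyMeasurable_ivp 1 0).1.measurable.sub
    ((L.measurable_symbol.comp measurable_fst).mul (L.stronglyMeasurable_ivp 0 1).1.measurable)

variable (L) in
theorem measurable_dweyl : Measurable L.dweyl :=
  (L.stronglyMeasurable_ivp 1 0).2.measurable.sub
    ((L.measurable_symbol.comp measurable_fst).mul (L.stronglyMeasurable_ivp 0 1).2.measurable)

theorem weyl_zero (ξ : ℝ) : L.weyl (ξ, 0) = 1 := by simp [weyl, ivp_zero]

theorem dweyl_zero (ξ : ℝ) : L.dweyl (ξ, 0) = -L.symbol ξ := by simp [dweyl, ivp_zero]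

theorem solvesOn_weyl (ξ : ℝ) {t : ℝ} (ht : t ∈ L.dom) :
    L.SolvesOn (mulC ξ) (fun y => L.weyl (ξ, y)) (fun y => L.dweyl (ξ, y)) 0 t :=
  solvesOn_comb (L.symbol ξ) ξ ht

theorem tendsto_weyl (p : ℝ × ℝ) : Tendsto (fun n => (L.ivp 1 0).1 p
    - L.truncSymbol p.1 (L.exhaustion n) * (L.ivp 0 1).1 p) atTop (𝓝 (L.weyl p)) :=
  tendsto_const_nhds.sub ((tendsto_symbol p.1).mul_const _)

theorem tendsto_dweyl (p : ℝ × ℝ) : Tendsto (fun n => (L.ivp 1 0).2 p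
    - L.truncSymbol p.1 (L.exhaustion n) * (L.ivp 0 1).2 p) atTop (𝓝 (L.dweyl p)) :=
  tendsto_const_nhds.sub ((tendsto_symbol p.1).mul_const _)

theorem norm_weyl_le_one (ξ : ℝ) {y : ℝ} (hy : y ∈ L.dom) : ‖L.weyl (ξ, y)‖ ≤ 1 := by
  have h : ‖L.weyl (ξ, y)‖ ^ 2 ≤ 1 := by
    refine le_of_tendsto ((tendsto_weyl (ξ, y)).norm.pow 2) ?_
    filter_upwards [eventually_lt_exhaustion hy] with n hn
    refine (norm_sq_trunc_le ξ (exhaustion_mem n) ⟨hy.1, hn.le⟩).trans ?_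
    have := div_nonneg hy.1 (exhaustion_mem (L := L) n).1.le
    linarith
  exact (sq_le_one_iff₀ (norm_nonneg _)).1 h

/-- The decay at a finite R is uniform in the frequency, which gives the decay in L² of the harmonic
extension. -/
theorem norm_sq_weyl_le (hR : L.R < ⊤) (ξ : ℝ) {y : ℝ} (hy : y ∈ L.dom) :
    ‖L.weyl (ξ, y)‖ ^ 2 ≤ 1 - y / L.R.toReal := by
  have hfin : ((L.R.toReal : ℝ) : EReal) = L.R :=
    EReal.coe_toReal hR.ne (ne_bot_of_gt L.R_pos)
  refine le_of_tendsto ((tendsto_weyl (ξ, y)).norm.pow 2) ?_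
  filter_upwards [eventually_lt_exhaustion hy] with n hn
  refine (norm_sq_trunc_le ξ (exhaustion_mem n) ⟨hy.1, hn.le⟩).trans ?_
  have h2 : L.exhaustion n ≤ L.R.toReal := by
    have := (exhaustion_mem (L := L) n).2
    rw [← hfin] at this
    exact (by exact_mod_cast this : L.exhaustion n < L.R.toReal).le
  have := div_le_div_of_nonneg_left hy.1 (exhaustion_mem (L := L) n).1 h2
  linarith

theorem re_inner_weyl_nonpos (ξ : ℝ) {y : ℝ} (hy : y ∈ L.dom) :
    (inner ℂ (L.weyl (ξ, y)) (L.dweyl (ξ, y))).re ≤ 0 := by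
  refine le_of_tendsto ((Complex.continuous_re.tendsto _).comp
    ((tendsto_weyl (ξ, y)).inner (tendsto_dweyl (ξ, y)))) ?_
  filter_upwards [eventually_lt_exhaustion hy] with n hn
  exact re_inner_trunc_nonpos ξ (exhaustion_mem n) hy.1 hn

/-- In the energy inequality the boundary term at t is non-positive because |φ|² decreases, and the
one at 0 is Re k. This bound gives the square integrability of ∂ᵧũ for the harmonic extension. -/
theorem weyl_energy_le (ξ : ℝ) {t : ℝ} (ht : t ∈ L.dom) :
    IntegrableOn (fun r => ‖L.dweyl (ξ, r) + Complex.I * L.b r * (ξ * L.weyl (ξ, r))‖ ^ 2)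
      (Ico 0 t) ∧
    ∫ r in Ico 0 t, ‖L.dweyl (ξ, r) + Complex.I * L.b r * (ξ * L.weyl (ξ, r))‖ ^ 2
      ≤ (L.symbol ξ).re := by
  obtain ⟨h1, h2⟩ := (solvesOn_weyl ξ ht).energy_le le_rfl ht ht.1 (mulC_symm ξ)
  refine ⟨h1, h2.trans ?_⟩
  have h3 := re_inner_weyl_nonpos ξ ht
  simp only [weyl_zero, dweyl_zero]
  simp at h3 ⊢
  linarith

end OperatorL

/-! ### The integrating factor, and the bound of φ' by its initial value -/

namespace OperatorL

variable {L : OperatorL}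

variable (L) in
/-- The unimodular function `e^{iξB(y)}`. -/
def phase (ξ y : ℝ) : ℂ := Complex.exp (ξ * L.B y * Complex.I)

theorem norm_phase (ξ y : ℝ) : ‖L.phase ξ y‖ = 1 := by
  have := Complex.norm_exp_ofReal_mul_I (ξ * L.B y)
  push_cast at this
  exact this

theorem phase_zero (ξ : ℝ) : L.phase ξ 0 = 1 := by simp [phase, B]

theorem continuousOn_B {t : ℝ} (ht : t ∈ L.dom) : ContinuousOn L.B (Icc 0 t) := by
  have := ((intervalIntegrable_b ht).absolutelyContinuousOnInterval_intervalIntegral (c := 0)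
    (by simp)).continuousOn
  rwa [uIcc_of_le ht.1] at this

theorem continuousOn_phase (ξ : ℝ) {t : ℝ} (ht : t ∈ L.dom) :
    ContinuousOn (L.phase ξ) (Icc 0 t) := by
  have := continuousOn_B ht
  unfold phase
  fun_prop

theorem intervalIntegral_eq_Ico {E : Type*} [NormedAddCommGroup E] [NormedSpace ℝ E] {f : ℝ → E}
    {s y : ℝ} (hy : s ≤ y) : ∫ r in s..y, f r = ∫ r in Ico s y, f r := by
  rw [intervalIntegral.integral_of_le hy, integral_Ioc_eq_integral_Ioo,
    integral_Ico_eq_integral_Ioo]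

theorem phase_eq (ξ : ℝ) {t : ℝ} (ht : t ∈ L.dom) : L.phase ξ t = L.phase ξ 0 +
    ∫ r in Ico 0 t, ξ * L.b r * Complex.I * L.phase ξ r := by
  rw [phase_zero, ← intervalIntegral_eq_Ico ht.1]
  exact exp_integral_mul_I (intervalIntegrable_b ht) ξ

theorem integrableOn_phase_deriv (ξ : ℝ) {t : ℝ} (ht : t ∈ L.dom) :
    IntegrableOn (fun r => ξ * L.b r * Complex.I * L.phase ξ r) (Ico 0 t) := by
  have hb : IntegrableOn (fun r => |ξ| * |L.b r|) (Ico 0 t) :=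
    IntegrableOn.mono_set ((integrableOn_b le_rfl ht).abs.const_mul _) Ico_subset_Icc_self
  refine Integrable.mono' hb ?_ (ae_of_all _ fun r => ?_)
  · refine AEStronglyMeasurable.mul ?_
      (((continuousOn_phase ξ ht).mono Ico_subset_Icc_self).aestronglyMeasurable measurableSet_Ico)
    have := L.b_measurable
    exact (by fun_prop : Measurable fun r => (ξ : ℂ) * L.b r * Complex.I).aestronglyMeasurable
  · simp [norm_phase]

/-- The integrating factor removes the first order term. -/
theorem SolvesOn.phase_mul_eq {ξ t : ℝ} {φ h : ℝ → ℂ} (S : L.SolvesOn (mulC ξ) φ h 0 t)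
    (ht : t ∈ L.dom) {y : ℝ} (hy : y ∈ Icc 0 t) :
    L.phase (2 * ξ) y * h y = h 0 + ∫ r in Ico 0 y, L.phase (2 * ξ) r * (ξ * (ξ * φ r)) ∂L.a := by
  have hyd : y ∈ L.dom := mem_dom_of_le ht hy.1 hy.2
  have hI : Ico 0 y ⊆ Icc 0 t := Ico_subset_Icc_self.trans (Icc_subset_Icc_right hy.2)
  have key := integral_bilin_by_parts_mixed (ContinuousLinearMap.mul ℝ ℂ) hy.1
    (fun z hz => phase_eq (L := L) (2 * ξ) (mem_dom_of_le hyd hz.1 hz.2))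
    (fun z hz => S.eq_snd z ⟨hz.1, hz.2.trans hy.2⟩)
    (integrableOn_phase_deriv (2 * ξ) hyd) ((S.integrableOn_a le_rfl ht).mono_set hI)
    ((S.integrableOn_b_smul le_rfl ht).mono_set hI)
  simp only [ContinuousLinearMap.mul_apply', phase_zero, one_mul, mulC_apply, smul_eq_mul] at key
  have e : ∀ r, L.phase (2 * ξ) r * (-(2 * Complex.I * L.b r) * (ξ * h r))
      = -(((2 * ξ : ℝ) : ℂ) * L.b r * Complex.I * L.phase (2 * ξ) r * h r) := fun r => by
    push_cast; ring
  simp only [e, integral_neg] at key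
  rw [key]
  ring

/-- The function θ = e^{2iξB} φ' has the modulus of φ' and satisfies dθ = g da with g = ξ² e^{2iξB}
φ. Since Re⟨g, θ⟩ = ξ² Re⟨φ, φ'⟩ ≤ 0, the modulus of θ cannot increase. This produces the dominating
function for the difference quotients. -/
theorem norm_dweyl_le (ξ : ℝ) {t : ℝ} (ht : t ∈ L.dom) : ‖L.dweyl (ξ, t)‖ ≤ ‖L.symbol ξ‖ := by
  obtain ⟨T, hT, htT⟩ := exists_gt_mem_dom ht
  have S := solvesOn_weyl (L := L) ξ hT
  set θ : ℝ → ℂ := fun y => L.phase (2 * ξ) y * L.dweyl (ξ, y) with hθ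
  set g : ℝ → ℂ := fun r => L.phase (2 * ξ) r * (ξ * (ξ * L.weyl (ξ, r))) with hg
  have hgc : ContinuousOn g (Icc 0 T) :=
    (continuousOn_phase _ hT).mul (continuousOn_const.mul (continuousOn_const.mul S.continuousOn))
  have hgi : IntegrableOn g (Icc 0 T) L.a := by
    have : IsFiniteMeasure (L.a.restrict (Icc 0 T)) := ⟨by
      rw [Measure.restrict_apply_univ]; exact a_Icc_lt_top le_rfl hT⟩
    obtain ⟨C, hC⟩ := isCompact_Icc.exists_bound_of_continuousOn hgc
    exact Integrable.of_bound (hgc.aestronglyMeasurable measurableSet_Icc) C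
      (ae_restrict_of_forall_mem measurableSet_Icc hC)
  have hθeq : ∀ y ∈ Icc 0 T, θ y = L.dweyl (ξ, 0) + ∫ r in Ico 0 y, g r ∂L.a := fun y hy =>
    S.phase_mul_eq hT hy
  have hsign : ∀ y ∈ Icc 0 T, (inner ℂ (g y) (θ y)).re ≤ 0 := fun y hy => by
    have h1 := re_inner_weyl_nonpos (L := L) ξ (mem_dom_of_le hT hy.1 hy.2)
    have e : inner ℂ (g y) (θ y) = (ξ ^ 2 : ℝ) * inner ℂ (L.weyl (ξ, y)) (L.dweyl (ξ, y)) := by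
      have hn : L.phase (2 * ξ) y * conj (L.phase (2 * ξ) y) = 1 := by
        rw [Complex.mul_conj, Complex.normSq_eq_norm_sq, norm_phase]; simp
      simp only [hg, hθ, RCLike.inner_apply, map_mul, Complex.conj_ofReal]
      push_cast
      linear_combination (L.dweyl (ξ, y) * (ξ * (ξ * conj (L.weyl (ξ, y))))) * hn
    rw [e, Complex.re_ofReal_mul]
    exact mul_nonpos_of_nonneg_of_nonpos (sq_nonneg ξ) h1
  -- At an atom of a, the product rule for |θ|² also involves the right limit θ(y+), which is the
  -- integral over the closed interval [0, y]. Its sign is the limit of the signs at points z n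
  -- decreasing to y.
  have hplus : ∀ y ∈ Ico 0 t,
      (inner ℂ (L.dweyl (ξ, 0) + ∫ r in Icc 0 y, g r ∂L.a) (g y)).re ≤ 0 := fun y hy => by
    have hyT : y < T := hy.2.trans htT
    set z : ℕ → ℝ := fun n => y + (T - y) / (n + 1) with hz
    have hz1 : ∀ n, y < z n := fun n => by
      have : 0 < (T - y) / (n + 1) := div_pos (sub_pos.2 hyT) (by positivity)
      simp only [hz]; linarith
    have hz2 : ∀ n, z n ≤ T := fun n => by
      have : (T - y) / (n + 1) ≤ T - y := div_le_self (sub_pos.2 hyT).le (by simp)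
      simp only [hz]; linarith
    have hzt : Tendsto z atTop (𝓝 y) := by
      have := tendsto_const_div_atTop_nhds_zero_nat (T - y)
      have h2 := (tendsto_add_atTop_iff_nat 1).2 this
      have h3 := h2.const_add y
      simpa [hz] using h3
    have hanti : Antitone z := fun m n hmn => by
      have hcast : (m : ℝ) ≤ n := by exact_mod_cast hmn
      have : (T - y) / (n + 1) ≤ (T - y) / (m + 1) :=
        div_le_div_of_nonneg_left (sub_pos.2 hyT).le (by positivity) (by linarith)
      simp only [hz]; linarith
    have hinter : ⋂ n, Ico 0 (z n) = Icc 0 y := by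
      ext x
      simp only [mem_iInter, mem_Ico, mem_Icc]
      constructor
      · intro h
        exact ⟨(h 0).1, ge_of_tendsto' hzt fun n => (h n).2.le⟩
      · exact fun h n => ⟨h.1, h.2.trans_lt (hz1 n)⟩
    have hlim := tendsto_setIntegral_of_antitone (f := g) (μ := L.a)
      (fun n => measurableSet_Ico (a := (0 : ℝ)) (b := z n))
      (fun m n hmn => Ico_subset_Ico_right (hanti hmn))
      ⟨0, hgi.mono_set (Ico_subset_Icc_self.trans (Icc_subset_Icc_right (hz2 0)))⟩
    rw [hinter] at hlim
    have hgl : Tendsto (fun n => g (z n)) atTop (𝓝 (g y)) :=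
      (hgc y ⟨hy.1, hyT.le⟩).tendsto.comp (tendsto_nhdsWithin_iff.2
        ⟨hzt, Eventually.of_forall fun n => ⟨hy.1.trans (hz1 n).le, hz2 n⟩⟩)
    have := (Complex.continuous_re.tendsto _).comp ((hlim.const_add (L.dweyl (ξ, 0))).inner hgl)
    refine le_of_tendsto' this fun n => ?_
    have hm : z n ∈ Icc 0 T := ⟨hy.1.trans (hz1 n).le, hz2 n⟩
    simp only [Function.comp]
    rw [← hθeq _ hm, ← inner_conj_symm, Complex.conj_re]
    exact hsign _ hm
  have hI : Ico 0 t ⊆ Icc 0 T := Ico_subset_Icc_self.trans (Icc_subset_Icc_right htT.le)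
  have key := integral_bilin_by_parts (innerRealL ℂ) (hgi.mono_set hI) (hgi.mono_set hI)
    (L.dweyl (ξ, 0)) (L.dweyl (ξ, 0))
  simp only [innerRealL_apply] at key
  rw [← hθeq t ⟨ht.1, htT.le⟩, dweyl_zero] at key
  -- For a non-integrable function the integral is 0 by convention, so integrability need not be
  -- checked.
  have re_int : ∀ f : ℝ → ℂ, (∀ y ∈ Ico 0 t, (f y).re ≤ 0) → (∫ y in Ico 0 t, f y ∂L.a).re ≤ 0 := by
    intro f hf
    by_cases hfi : IntegrableOn f (Ico 0 t) L.a
    · rw [← Complex.reCLM_apply, ← Complex.reCLM.integral_comp_comm hfi]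
      exact setIntegral_nonpos measurableSet_Ico hf
    · rw [integral_undef hfi]; simp
  have s1 := re_int (fun x => inner ℂ (g x) (-L.symbol ξ + ∫ y in Ico 0 x, g y ∂L.a)) fun y hy => by
    rw [← dweyl_zero, ← hθeq y (hI hy)]
    exact hsign y (hI hy)
  have s2 := re_int (fun y => inner ℂ (-L.symbol ξ + ∫ x in Icc 0 y, g x ∂L.a) (g y)) fun y hy => by
    rw [← dweyl_zero]
    exact hplus y hy
  have key' := congrArg Complex.re key
  simp only [Complex.add_re] at key'
  have n1 : (inner ℂ (θ t) (θ t)).re = ‖θ t‖ ^ 2 := inner_self_eq_norm_sq (𝕜 := ℂ) (θ t)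
  have n2 : (inner ℂ (-L.symbol ξ) (-L.symbol ξ)).re = ‖-L.symbol ξ‖ ^ 2 :=
    inner_self_eq_norm_sq (𝕜 := ℂ) (-L.symbol ξ)
  have n3 : ‖θ t‖ = ‖L.dweyl (ξ, t)‖ := by simp [hθ, norm_phase]
  rw [n1, n2, n3, norm_neg] at key'
  refine le_of_sq_le_sq ?_ (norm_nonneg _)
  linarith

/-! ### Uniqueness, and identification of the symbol -/

theorem IsODESolution.solvesOn {ξ : ℝ} {φ dφ : ℝ → ℂ} (h : L.IsODESolution ξ φ dφ) {t : ℝ}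
    (ht : t ∈ L.dom) : L.SolvesOn (mulC ξ) φ dφ 0 t := by
  have hsub : Icc 0 t ⊆ L.dom := Icc_subset_dom le_rfl ht
  refine solvesOn_of_eq ?_ ?_ (fun y hy => ?_) (fun y hy => ?_)
  -- Measurability of φ': its real and imaginary parts have locally bounded variation, hence are
  -- differences of monotone functions.
  · have hre : LocallyBoundedVariationOn (fun y => (dφ y).re) L.dom :=
      (LipschitzWith.of_dist_le_mul (K := 1) fun x y => by
        simpa [Real.dist_eq, dist_eq_norm] using Complex.abs_re_le_norm (x - y)
        : LipschitzWith 1 Complex.re).comp_locallyBoundedVariationOn h.boundedVariation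
    have him : LocallyBoundedVariationOn (fun y => (dφ y).im) L.dom :=
      (LipschitzWith.of_dist_le_mul (K := 1) fun x y => by
        simpa [Real.dist_eq, dist_eq_norm] using Complex.abs_im_le_norm (x - y)
        : LipschitzWith 1 Complex.im).comp_locallyBoundedVariationOn h.boundedVariation
    have hm : ∀ f : ℝ → ℝ, LocallyBoundedVariationOn f L.dom →
        AEMeasurable f (volume.restrict (Icc 0 t)) := fun f hf => by
      obtain ⟨p, q, hp, hq, rfl⟩ := hf.exists_monotoneOn_sub_monotoneOn
      exact (aemeasurable_restrict_of_monotoneOn measurableSet_Icc (hp.mono hsub)).sub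
        (aemeasurable_restrict_of_monotoneOn measurableSet_Icc (hq.mono hsub))
    have e : dφ = fun y => (((dφ y).re : ℝ) : ℂ) + (((dφ y).im : ℝ) : ℂ) * Complex.I := by
      ext y; exact (Complex.re_add_im _).symm
    rw [e]
    exact (((hm _ hre).complex_ofReal).add
      ((hm _ him).complex_ofReal.mul_const _)).aestronglyMeasurable
  · have hbv : BoundedVariationOn dφ (L.dom ∩ Icc 0 t) :=
      h.boundedVariation 0 t L.zero_mem_dom ht
    refine ⟨‖dφ 0‖ + (eVariationOn dφ (L.dom ∩ Icc 0 t)).toReal, fun y hy => ?_⟩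
    have := hbv.dist_le (x := y) (y := 0) ⟨hsub hy, hy⟩ ⟨L.zero_mem_dom, ⟨le_rfl, ht.1⟩⟩
    rw [dist_eq_norm] at this
    calc ‖dφ y‖ = ‖dφ 0 + (dφ y - dφ 0)‖ := by congr 1; ring
      _ ≤ _ := (norm_add_le _ _).trans (by gcongr)
  · rw [h.derivative y (hsub hy), intervalIntegral_eq_Ico hy.1]
  · have := h.equation y (hsub hy)
    rw [intervalIntegral_eq_Ico hy.1] at this
    linear_combination this

/-- If a difference of two solutions vanishes at the left end and satisfies the boundary condition
at the right end, it vanishes. -/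
theorem eq_zero_of_convex {G : ℝ → ℝ} (hG : ∀ y, 0 ≤ G y)
    (hconv : ∀ t ∈ L.dom, ∀ y ∈ Icc 0 t, t * G y ≤ y * G t)
    (hbdd : L.R = ⊤ → ∃ C : ℝ, ∀ t ∈ L.dom, G t ≤ C)
    (hvan : L.R < ⊤ → Tendsto G (𝓝[<] L.R.toReal) (𝓝 0)) : ∀ y ∈ L.dom, G y = 0 := by
  intro y hy
  refine le_antisymm ?_ (hG y)
  rcases eq_or_lt_of_le (le_top : L.R ≤ ⊤) with hR | hR
  · obtain ⟨C, hC⟩ := hbdd hR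
    have hdom : ∀ t : ℝ, 0 ≤ t → t ∈ L.dom := fun t ht => ⟨ht, by rw [hR]; exact EReal.coe_lt_top t⟩
    -- Convexity from the value 0 at 0 gives G(y) ≤ yC/t for all large t, so bounded growth forces
    -- G(y) = 0.
    have hlim : Tendsto (fun t : ℝ => y * C / t) atTop (𝓝 0) :=
      tendsto_const_nhds.div_atTop tendsto_id
    refine ge_of_tendsto hlim ?_
    filter_upwards [eventually_gt_atTop (max y 0)] with t ht
    have ht0 : 0 < t := (le_max_right _ _).trans_lt ht
    have hyt : y ≤ t := (le_max_left _ _).trans ht.le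
    rw [le_div_iff₀ ht0]
    have := hconv t (hdom t ht0.le) y ⟨hy.1, hyt⟩
    nlinarith [mul_le_mul_of_nonneg_left (hC t (hdom t ht0.le)) hy.1]
  · have hfin : ((L.R.toReal : ℝ) : EReal) = L.R := EReal.coe_toReal hR.ne (ne_bot_of_gt L.R_pos)
    have hyR : y < L.R.toReal := by
      have := hy.2
      rw [← hfin] at this
      exact_mod_cast this
    have h1 : Tendsto (fun t => t * G y) (𝓝[<] L.R.toReal) (𝓝 (L.R.toReal * G y)) :=
      (tendsto_id.mono_left nhdsWithin_le_nhds).mul_const _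
    have h2 : Tendsto (fun t => y * G t) (𝓝[<] L.R.toReal) (𝓝 (y * 0)) := (hvan hR).const_mul y
    have h3 : L.R.toReal * G y ≤ y * 0 := by
      refine le_of_tendsto_of_tendsto h1 h2 ?_
      filter_upwards [Ioo_mem_nhdsLT hyR] with t ht
      refine hconv t ⟨hy.1.trans ht.1.le, ?_⟩ y ⟨hy.1, ht.1.le⟩
      rw [← hfin]
      exact_mod_cast ht.2
    have h4 : 0 < L.R.toReal := hy.1.trans_lt hyR
    rw [mul_zero] at h3
    by_contra hc
    push Not at hc
    nlinarith [mul_pos h4 hc]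

theorem tendsto_weyl_R (hR : L.R < ⊤) (ξ : ℝ) :
    Tendsto (fun y => L.weyl (ξ, y)) (𝓝[<] L.R.toReal) (𝓝 0) := by
  have hfin : ((L.R.toReal : ℝ) : EReal) = L.R := EReal.coe_toReal hR.ne (ne_bot_of_gt L.R_pos)
  have hpos : 0 < L.R.toReal := by
    have := L.R_pos
    rw [← hfin] at this
    exact_mod_cast this
  have h1 : Tendsto (fun y => 1 - y / L.R.toReal) (𝓝[<] L.R.toReal) (𝓝 0) := by
    have : Tendsto (fun y => 1 - y / L.R.toReal) (𝓝 L.R.toReal)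
        (𝓝 (1 - L.R.toReal / L.R.toReal)) := tendsto_const_nhds.sub (tendsto_id.div_const _)
    rw [div_self hpos.ne', sub_self] at this
    exact this.mono_left nhdsWithin_le_nhds
  have h2 : Tendsto (fun y => ‖L.weyl (ξ, y)‖ ^ 2) (𝓝[<] L.R.toReal) (𝓝 0) := by
    refine squeeze_zero' (Eventually.of_forall fun y => sq_nonneg _) ?_ h1
    filter_upwards [Ioo_mem_nhdsLT hpos] with y hy
    refine norm_sq_weyl_le hR ξ ⟨hy.1.le, ?_⟩
    rw [← hfin]
    exact_mod_cast hy.2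
  have h3 := h2.sqrt
  simp only [Real.sqrt_sq (norm_nonneg _), Real.sqrt_zero] at h3
  exact tendsto_zero_iff_norm_tendsto_zero.2 h3

/-- The squared modulus of the difference of two Weyl solutions is convex and zero at 0, and is
bounded or tends to 0 at R; hence it vanishes. The derivatives then agree as well. -/
theorem IsWeylSolution.eq_weyl {ξ : ℝ} {φ dφ : ℝ → ℂ} (h : L.IsWeylSolution ξ φ dφ) {y : ℝ}
    (hy : y ∈ L.dom) : φ y = L.weyl (ξ, y) ∧ dφ y = L.dweyl (ξ, y) := by
  have S : ∀ t ∈ L.dom, L.SolvesOn (mulC ξ) (fun y => φ y - L.weyl (ξ, y))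
      (fun y => dφ y - L.dweyl (ξ, y)) 0 t := fun t ht =>
    (h.solution.solvesOn ht).sub (solvesOn_weyl ξ ht) le_rfl ht
  have h0 : ∀ y ∈ L.dom, φ y - L.weyl (ξ, y) = 0 := by
    have := eq_zero_of_convex (L := L) (G := fun y => ‖φ y - L.weyl (ξ, y)‖ ^ 2)
      (fun y => sq_nonneg _) (fun t ht y hy => ?_) (fun hR => ?_) (fun hR => ?_)
    · intro y hy
      simpa using this y hy
    · have := (S t ht).norm_sq_convex le_rfl ht (mulC_symm ξ) hy
      simpa [h.initial, weyl_zero] using this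
    · obtain ⟨C, hC⟩ := h.bounded hR
      refine ⟨(C + 1) ^ 2, fun t ht => ?_⟩
      gcongr
      exact (norm_sub_le _ _).trans (add_le_add (hC t ht) (norm_weyl_le_one ξ ht))
    · simpa using (((h.vanishing hR).sub (tendsto_weyl_R hR ξ)).norm).pow 2
  obtain ⟨t, ht, hyt⟩ := exists_gt_mem_dom hy
  refine ⟨sub_eq_zero.1 (h0 y hy), sub_eq_zero.1 ?_⟩
  exact (S t ht).snd_eq_zero (hy.1.trans_lt hyt) (fun z hz => h0 z (Icc_subset_dom le_rfl ht hz)) y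
    ⟨hy.1, hyt.le⟩

theorem locallyBoundedVariationOn_of_dist_le {f : ℝ → ℂ} {F : ℝ → ℝ} {s : Set ℝ}
    (hF : MonotoneOn F s) (h : ∀ x ∈ s, ∀ y ∈ s, x ≤ y → dist (f x) (f y) ≤ F y - F x) :
    LocallyBoundedVariationOn f s := by
  intro a b ha hb
  refine ne_top_of_le_ne_top (hF.locallyBoundedVariationOn a b ha hb) ?_
  refine iSup_mono fun p => Finset.sum_le_sum fun i _ => ?_
  have h1 := (p.2.2.2 i).1
  have h2 := (p.2.2.2 (i + 1)).1
  have h3 := p.2.2.1 (Nat.le_succ i)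
  rw [edist_comm, edist_comm (F _), edist_dist, edist_dist]
  refine ENNReal.ofReal_le_ofReal ((h _ h1 _ h2 h3).trans ?_)
  rw [dist_comm, Real.dist_eq]
  exact le_abs_self _

/-- The integral form of the equation controls the increments of φ' by those of a monotone function,
whence bounded variation. Left-continuity holds because the integrals run over half-open intervals
[0, y). -/
theorem isODESolution_weyl (ξ : ℝ) :
    L.IsODESolution ξ (fun y => L.weyl (ξ, y)) (fun y => L.dweyl (ξ, y)) := by
  have hms : Measurable fun s : ℝ => (ξ, s) := by fun_prop
  have hint : ∀ t ∈ L.dom, IntegrableOn (fun r => ‖(ξ : ℂ) * (ξ * L.weyl (ξ, r))‖) (Icc 0 t) L.a :=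
    fun t ht => ((solvesOn_weyl ξ ht).integrableOn_a le_rfl ht).norm
  have hint2 : ∀ t ∈ L.dom, IntegrableOn
      (fun r => ‖-(2 * Complex.I * L.b r) • mulC ξ (L.dweyl (ξ, r))‖) (Icc 0 t) :=
    fun t ht => ((solvesOn_weyl ξ ht).integrableOn_b_smul le_rfl ht).norm
  have hstep : ∀ x ∈ L.dom, ∀ y ∈ L.dom, x ≤ y → dist (L.dweyl (ξ, x)) (L.dweyl (ξ, y)) ≤
      (∫ r in Ico x y, ‖(ξ : ℂ) * (ξ * L.weyl (ξ, r))‖ ∂L.a)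
        + ∫ r in Ico x y, ‖-(2 * Complex.I * L.b r) • mulC ξ (L.dweyl (ξ, r))‖ := by
    intro x hx y hy hxy
    have S := (solvesOn_weyl (L := L) ξ hy).mono le_rfl hy hx.1 hxy le_rfl
    rw [dist_comm, dist_eq_norm, S.eq_snd y ⟨hxy, le_rfl⟩, add_assoc, add_sub_cancel_left]
    exact (norm_add_le _ _).trans (add_le_add (norm_integral_le_integral_norm _)
      (norm_integral_le_integral_norm _))
  have hsplit : ∀ x ∈ L.dom, ∀ y ∈ L.dom, x ≤ y →
      (∫ r in Ico x y, ‖(ξ : ℂ) * (ξ * L.weyl (ξ, r))‖ ∂L.a)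
        + ∫ r in Ico x y, ‖-(2 * Complex.I * L.b r) • mulC ξ (L.dweyl (ξ, r))‖
      = ((∫ r in Ico 0 y, ‖(ξ : ℂ) * (ξ * L.weyl (ξ, r))‖ ∂L.a)
        + ∫ r in Ico 0 y, ‖-(2 * Complex.I * L.b r) • mulC ξ (L.dweyl (ξ, r))‖)
      - ((∫ r in Ico 0 x, ‖(ξ : ℂ) * (ξ * L.weyl (ξ, r))‖ ∂L.a)
        + ∫ r in Ico 0 x, ‖-(2 * Complex.I * L.b r) • mulC ξ (L.dweyl (ξ, r))‖) := by
    intro x hx y hy hxy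
    have hu : Ico 0 y = Ico 0 x ∪ Ico x y := (Ico_union_Ico_eq_Ico hx.1 hxy).symm
    have s1 : Ico 0 x ⊆ Icc 0 y := Ico_subset_Icc_self.trans (Icc_subset_Icc_right hxy)
    have s2 : Ico x y ⊆ Icc 0 y := Ico_subset_Icc_self.trans (Icc_subset_Icc_left hx.1)
    rw [hu, setIntegral_union Ico_disjoint_Ico_same measurableSet_Ico ((hint y hy).mono_set s1)
      ((hint y hy).mono_set s2), setIntegral_union Ico_disjoint_Ico_same measurableSet_Ico
      ((hint2 y hy).mono_set s1) ((hint2 y hy).mono_set s2)]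
    ring
  refine ⟨locallyBoundedVariationOn_of_dist_le (F := fun y =>
      (∫ r in Ico 0 y, ‖(ξ : ℂ) * (ξ * L.weyl (ξ, r))‖ ∂L.a)
        + ∫ r in Ico 0 y, ‖-(2 * Complex.I * L.b r) • mulC ξ (L.dweyl (ξ, r))‖) ?_ ?_,
    fun t ht => ?_, fun t ht => ?_, fun t ht => ?_⟩
  · intro x hx y hy hxy
    have := hsplit x hx y hy hxy
    have h0 : 0 ≤ (∫ r in Ico x y, ‖(ξ : ℂ) * (ξ * L.weyl (ξ, r))‖ ∂L.a)
        + ∫ r in Ico x y, ‖-(2 * Complex.I * L.b r) • mulC ξ (L.dweyl (ξ, r))‖ :=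
      add_nonneg (integral_nonneg fun r => norm_nonneg _) (integral_nonneg fun r => norm_nonneg _)
    rw [this] at h0
    exact sub_nonneg.1 h0
  · intro x hx y hy hxy
    rw [← hsplit x hx y hy hxy]
    exact hstep x hx y hy hxy
  · have S := solvesOn_weyl (L := L) ξ ht
    -- The moving endpoint is put into a strict indicator on a fixed interval, so that dominated
    -- convergence applies. As y ↑ t these indicators converge at every point, including an atom at
    -- t.
    have hfun : ∀ y ∈ Icc 0 t, L.dweyl (ξ, y) = L.dweyl (ξ, 0)
        + (∫ r in Icc 0 t, (Iio y).indicator (fun r => mulC ξ (mulC ξ (L.weyl (ξ, r)))) r ∂L.a)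
        + ∫ r in Icc 0 t, (Iio y).indicator
          (fun r => -(2 * Complex.I * L.b r) • mulC ξ (L.dweyl (ξ, r))) r := fun y hy => by
      rw [setIntegral_indicator measurableSet_Iio, setIntegral_indicator measurableSet_Iio]
      have e : Icc 0 t ∩ Iio y = Ico 0 y := by
        ext r; have := hy.2; simp; grind
      rw [e]
      exact S.eq_snd y hy
    have hlim : ∀ (μ : Measure ℝ) (f : ℝ → ℂ), IntegrableOn f (Icc 0 t) μ →
        Tendsto (fun y => ∫ r in Icc 0 t, (Iio y).indicator f r ∂μ) (𝓝[Icc 0 t] t)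
          (𝓝 (∫ r in Icc 0 t, (Iio t).indicator f r ∂μ)) := fun μ f hf => by
      refine tendsto_integral_filter_of_dominated_convergence (fun r => ‖f r‖)
        (Eventually.of_forall fun y => hf.aestronglyMeasurable.indicator measurableSet_Iio)
        (Eventually.of_forall fun y => ae_of_all _ fun r => norm_indicator_le_norm_self _ _)
        hf.norm (ae_of_all _ fun r => ?_)
      refine tendsto_nhds_of_eventually_eq ?_
      by_cases hr : r < t
      · filter_upwards [mem_nhdsWithin_of_mem_nhds (Ioi_mem_nhds hr)] with y hy
        have hy' : r < y := hy
        simp [indicator, hr, hy']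
      · filter_upwards [self_mem_nhdsWithin] with y hy
        have hy' : ¬ r < y := fun h => hr (h.trans_le hy.2)
        simp [indicator, hr, hy']
    have := (tendsto_const_nhds (x := L.dweyl (ξ, 0)) (f := 𝓝[Icc 0 t] t)).add
      (hlim L.a _ (S.integrableOn_a le_rfl ht)) |>.add
      (hlim volume _ (S.integrableOn_b_smul le_rfl ht))
    rw [← hfun t ⟨ht.1, le_rfl⟩] at this
    refine Tendsto.congr' ?_ this
    filter_upwards [self_mem_nhdsWithin] with y hy
    exact (hfun y hy).symm
  · rw [intervalIntegral_eq_Ico ht.1]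
    exact (solvesOn_weyl ξ ht).eq_fst t ⟨ht.1, le_rfl⟩
  · have := (solvesOn_weyl (L := L) ξ ht).eq_snd t ⟨ht.1, le_rfl⟩
    simp only [mulC_apply, smul_eq_mul] at this
    rw [this, intervalIntegral_eq_Ico ht.1, ← integral_const_mul, ← integral_const_mul]
    have e1 : ∀ r, (ξ : ℂ) * (ξ * L.weyl (ξ, r)) = (ξ : ℂ) ^ 2 * L.weyl (ξ, r) := fun r => by ring
    have e2 : ∀ r, -(2 * Complex.I * L.b r) * (ξ * L.dweyl (ξ, r))
        = -(2 * Complex.I * ξ * (L.b r * L.dweyl (ξ, r))) := fun r => by ring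
    simp only [e1, e2, integral_neg]
    ring

theorem isWeylSolution_weyl (ξ : ℝ) :
    L.IsWeylSolution ξ (fun y => L.weyl (ξ, y)) (fun y => L.dweyl (ξ, y)) :=
  ⟨isODESolution_weyl ξ, weyl_zero ξ, fun _ => ⟨1, fun _ ht => norm_weyl_le_one ξ ht⟩,
    fun hR => tendsto_weyl_R hR ξ⟩

/-- Conjugation reverses the sign of iξ and preserves the real coefficients; this is why negative
frequencies can be defined by conjugation. -/
theorem IsWeylSolution.conj {ξ : ℝ} {φ dφ : ℝ → ℂ} (h : L.IsWeylSolution (-ξ) φ dφ) :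
    L.IsWeylSolution ξ (fun t => conj (φ t)) (fun t => conj (dφ t)) := by
  refine ⟨⟨?_, fun t ht => ?_, fun t ht => ?_, fun t ht => ?_⟩, by simp [h.initial], fun hR => ?_,
    fun hR => ?_⟩
  · exact (Complex.isometry_conj.lipschitz).comp_locallyBoundedVariationOn
      h.solution.boundedVariation
  · exact Complex.continuous_conj.continuousAt.comp_continuousWithinAt
      (h.solution.leftContinuous t ht)
  · rw [h.solution.derivative t ht, intervalIntegral_eq_Ico ht.1, intervalIntegral_eq_Ico ht.1,
      integral_conj, map_add]
  · have := congrArg conj (h.solution.equation t ht)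
    rw [intervalIntegral_eq_Ico ht.1] at this ⊢
    simp only [map_sub, map_mul, map_pow, Complex.conj_ofReal, ← integral_conj, Complex.conj_I,
      map_ofNat] at this
    rw [this]
    push_cast
    ring
  · obtain ⟨C, hC⟩ := h.bounded hR
    exact ⟨C, fun t ht => by rw [RCLike.norm_conj]; exact hC t ht⟩
  · have := (Complex.continuous_conj.tendsto _).comp (h.vanishing hR)
    rw [map_zero] at this
    exact this

/-- Uniqueness identifies the solution picked by choice with the constructed one. At ξ = 0 the two
may differ: `k` is 0 by convention, while the limit construction yields 1/R for finite R. -/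
theorem k_eq_symbol {ξ : ℝ} (hξ : ξ ≠ 0) : L.k ξ = L.symbol ξ := by
  have hex : ∀ ξ : ℝ, L.IsWeylSolution ξ
      (Classical.epsilon fun p : (ℝ → ℂ) × (ℝ → ℂ) => L.IsWeylSolution ξ p.1 p.2).1
      (Classical.epsilon fun p : (ℝ → ℂ) × (ℝ → ℂ) => L.IsWeylSolution ξ p.1 p.2).2 := fun ξ =>
    Classical.epsilon_spec (p := fun p : (ℝ → ℂ) × (ℝ → ℂ) => L.IsWeylSolution ξ p.1 p.2)
      ⟨(_, _), isWeylSolution_weyl ξ⟩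
  rw [k, phi]
  rcases hξ.lt_or_gt with h | h
  · simp only [not_lt.2 h.le, h, if_false, if_true]
    have := (hex (-ξ)).conj.eq_weyl L.zero_mem_dom
    rw [this.2, dweyl_zero, neg_neg]
  · simp only [h, if_true]
    have := (hex ξ).eq_weyl L.zero_mem_dom
    rw [this.2, dweyl_zero, neg_neg]

end OperatorL

/-! ### Vector-valued functions with values in `L²(ℝ)` -/

/-- In a second countable space every open set is a countable union of balls, and preimages of balls
are sublevel sets of distance functions. -/
theorem measurable_of_measurable_edist {Y X : Type*} [MeasurableSpace Y] [PseudoEMetricSpace X]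
    [SecondCountableTopology X] [MeasurableSpace X] [BorelSpace X] {F : Y → X}
    (h : ∀ g, Measurable fun y => edist (F y) g) : Measurable F := by
  refine measurable_of_isOpen fun U hU => ?_
  have hball : ∀ x ∈ U, ∃ r > 0, Metric.eball x r ⊆ U := fun x hx => EMetric.isOpen_iff.1 hU x hx
  choose! r hr hrU using hball
  obtain ⟨T, hTc, hTU⟩ := TopologicalSpace.isOpen_iUnion_countable
    (fun x : U => Metric.eball (x : X) (r x)) fun x => Metric.isOpen_eball
  have hU' : U = ⋃ x ∈ T, Metric.eball (x : X) (r x) := by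
    rw [hTU]
    refine Subset.antisymm (fun x hx => mem_iUnion.2 ⟨⟨x, hx⟩, ?_⟩) (iUnion_subset fun x => hrU x x.2)
    exact Metric.mem_eball_self (hr x hx)
  rw [hU', preimage_iUnion₂]
  exact MeasurableSet.biUnion hTc fun x _ => measurableSet_lt (h x) measurable_const

open scoped Classical in
/-- The class in `L²(ℝ)` of a square integrable function (and zero for other functions). -/
def toL2 (g : ℝ → ℂ) : L2R := if h : MemLp g 2 volume then h.toLp g else 0

theorem coeFn_toL2 {g : ℝ → ℂ} (h : MemLp g 2 volume) : toL2 g =ᵐ[volume] g := by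
  rw [toL2, dif_pos h]
  exact h.coeFn_toLp

theorem toL2_of_not_memLp {g : ℝ → ℂ} (h : ¬MemLp g 2 volume) : toL2 g = 0 := dif_neg h

theorem toL2_congr {g g' : ℝ → ℂ} (h : g =ᵐ[volume] g') : toL2 g = toL2 g' := by
  by_cases hg : MemLp g 2 volume
  · have hg' : MemLp g' 2 volume := (memLp_congr_ae h).1 hg
    exact Lp.ext (((coeFn_toL2 hg).trans h).trans (coeFn_toL2 hg').symm)
  · rw [toL2_of_not_memLp hg, toL2_of_not_memLp fun h' => hg ((memLp_congr_ae h).2 h')]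

@[simp] theorem toL2_coeFn (f : L2R) : toL2 f = f := Lp.ext (coeFn_toL2 (Lp.memLp f))

theorem enorm_toL2 {g : ℝ → ℂ} (h : MemLp g 2 volume) : ‖toL2 g‖ₑ = eLpNorm g 2 volume := by
  rw [Lp.enorm_def, eLpNorm_congr_ae (coeFn_toL2 h)]

theorem enorm_toL2_sub {g g' : ℝ → ℂ} (h : MemLp g 2 volume) (h' : MemLp g' 2 volume) :
    ‖toL2 g - toL2 g'‖ₑ = eLpNorm (fun x => g x - g' x) 2 volume := by
  rw [Lp.enorm_def]
  refine eLpNorm_congr_ae ?_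
  filter_upwards [Lp.coeFn_sub (toL2 g) (toL2 g'), coeFn_toL2 h, coeFn_toL2 h'] with x h1 h2 h3
  rw [h1, Pi.sub_apply, h2, h3]

theorem eLpNorm_two_eq (g : ℝ → ℂ) :
    eLpNorm g 2 volume = (∫⁻ x, ‖g x‖ₑ ^ 2) ^ (1 / 2 : ℝ) := by
  rw [eLpNorm_eq_lintegral_rpow_enorm_toReal (by simp) (by simp)]
  simp

theorem norm_sq_eq_integral (f : L2R) : ‖f‖ ^ 2 = ∫ x, ‖f x‖ ^ 2 := by
  have h := inner_self_eq_norm_sq (𝕜 := ℂ) f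
  rw [← h, L2.inner_def]
  have : (∫ x, inner ℂ (f x) (f x)) = ((∫ x, ‖f x‖ ^ 2 : ℝ) : ℂ) := by
    rw [← integral_complex_ofReal]
    refine integral_congr_ae (Eventually.of_forall fun x => ?_)
    simp
  rw [this]
  simp

theorem measurable_slice {Φ : ℝ → ℝ → ℂ} (hΦ : Measurable fun p : ℝ × ℝ => Φ p.1 p.2) (y : ℝ) :
    Measurable fun x => Φ x y :=
  hΦ.comp measurable_prodMk_right

theorem measurable_eLpNorm_slice {Φ : ℝ → ℝ → ℂ} (hΦ : Measurable fun p : ℝ × ℝ => Φ p.1 p.2) :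
    Measurable fun y => eLpNorm (fun x => Φ x y) 2 volume := by
  simp only [eLpNorm_two_eq]
  exact (Measurable.lintegral_prod_left' (hΦ.enorm.pow_const 2)).pow_const _

theorem measurableSet_memLp_slice {Φ : ℝ → ℝ → ℂ} (hΦ : Measurable fun p : ℝ × ℝ => Φ p.1 p.2) :
    MeasurableSet {y | MemLp (fun x => Φ x y) 2 volume} := by
  have : {y | MemLp (fun x => Φ x y) 2 volume} = {y | eLpNorm (fun x => Φ x y) 2 volume < ⊤} := by
    ext y
    exact ⟨fun h => h.2, fun h => ⟨(measurable_slice hΦ y).aestronglyMeasurable, h⟩⟩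
  rw [this]
  exact measurableSet_lt (measurable_eLpNorm_slice hΦ) measurable_const

/-- The distance from a slice to a fixed element of L² is a power of a Tonelli integral, hence
measurable in y; L² is separable. -/
theorem stronglyMeasurable_toL2 {Φ : ℝ → ℝ → ℂ} (hΦ : Measurable fun p : ℝ × ℝ => Φ p.1 p.2) :
    StronglyMeasurable fun y => toL2 fun x => Φ x y := by
  classical
  have : SecondCountableTopology L2R := by
    have : Fact ((2 : ℝ≥0∞) ≠ ⊤) := ⟨by simp⟩
    infer_instance
  borelize L2R
  refine Measurable.stronglyMeasurable (measurable_of_measurable_edist fun g => ?_)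
  have hS := measurableSet_memLp_slice hΦ
  have : (fun y => edist (toL2 fun x => Φ x y) g) = fun y =>
      if y ∈ {y | MemLp (fun x => Φ x y) 2 volume} then
        eLpNorm (fun x => Φ x y - g x) 2 volume else ‖g‖ₑ := by
    ext y
    split_ifs with hy
    · rw [edist_eq_enorm_sub, ← enorm_toL2_sub hy (Lp.memLp g), toL2_coeFn]
    · rw [toL2_of_not_memLp hy, edist_comm, edist_zero_right]
  rw [this]
  refine Measurable.ite hS ?_ measurable_const
  exact measurable_eLpNorm_slice (Φ := fun x y => Φ x y - g x)
    (hΦ.sub ((Lp.stronglyMeasurable g).measurable.comp measurable_fst))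

theorem inner_eq_integral (P f : L2R) : inner ℂ P f = ∫ x, conj (P x) * f x := by
  rw [L2.inner_def]
  exact integral_congr_ae (Eventually.of_forall fun x => by simp [mul_comm])

theorem integrable_conj_mul (P f : L2R) : Integrable fun x => conj (P x) * f x := by
  have := L2.integrable_inner (𝕜 := ℂ) P f
  refine this.congr (Eventually.of_forall fun x => by simp [mul_comm])

theorem integrable_norm_mul_norm (P f : L2R) : Integrable fun x => ‖P x‖ * ‖f x‖ := by
  refine (integrable_conj_mul P f).norm.congr (Eventually.of_forall fun x => by simp)

theorem integral_norm_mul_norm_le (P f : L2R) : ∫ x, ‖P x‖ * ‖f x‖ ≤ ‖P‖ * ‖f‖ := by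
  have hP : MemLp (fun x => (‖P x‖ : ℂ)) 2 volume := (Lp.memLp P).norm.ofReal
  have hf : MemLp (fun x => (‖f x‖ : ℂ)) 2 volume := (Lp.memLp f).norm.ofReal
  have nP : ‖toL2 fun x => (‖P x‖ : ℂ)‖ = ‖P‖ := by
    rw [← toReal_enorm, ← toReal_enorm P]
    refine congrArg ENNReal.toReal ?_
    rw [enorm_toL2 hP, Lp.enorm_def]
    exact eLpNorm_congr_norm_ae (Eventually.of_forall fun x => by simp)
  have nf : ‖toL2 fun x => (‖f x‖ : ℂ)‖ = ‖f‖ := by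
    rw [← toReal_enorm, ← toReal_enorm f]
    refine congrArg ENNReal.toReal ?_
    rw [enorm_toL2 hf, Lp.enorm_def]
    exact eLpNorm_congr_norm_ae (Eventually.of_forall fun x => by simp)
  rw [← nP, ← nf]
  have h := norm_inner_le_norm (𝕜 := ℂ) (toL2 fun x => (‖P x‖ : ℂ)) (toL2 fun x => (‖f x‖ : ℂ))
  refine le_trans (le_of_eq ?_) h
  rw [inner_eq_integral]
  have : (∫ x, conj ((toL2 fun x => (‖P x‖ : ℂ)) x) * (toL2 fun x => (‖f x‖ : ℂ)) x) =
      ((∫ x, ‖P x‖ * ‖f x‖ : ℝ) : ℂ) := by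
    rw [← integral_complex_ofReal]
    refine integral_congr_ae ?_
    filter_upwards [coeFn_toL2 hP, coeFn_toL2 hf] with x h1 h2
    rw [h1, h2]
    simp
  rw [this, Complex.norm_real, Real.norm_of_nonneg]
  exact integral_nonneg fun x => by positivity

/-- The Bochner integral of an `L²`-valued function can be evaluated pointwise. -/
theorem integral_toL2_eq {Φ : ℝ → ℝ → ℂ} (hΦ : Measurable fun p : ℝ × ℝ => Φ p.1 p.2)
    {μ : Measure ℝ} [SFinite μ] {F : ℝ → L2R} (hF : Integrable F μ)
    (hFΦ : ∀ᵐ y ∂μ, F y =ᵐ[volume] fun x => Φ x y) {G : L2R}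
    (hG : ∀ᵐ x, G x = ∫ y, Φ x y ∂μ) : ∫ y, F y ∂μ = G := by
  -- Both sides are tested against P ∈ L², which reduces the claim to Fubini; Cauchy–Schwarz
  -- supplies the joint integrability.
  refine ext_inner_left ℂ fun P => ?_
  have h1 : inner ℂ P (∫ y, F y ∂μ) = ∫ y, inner ℂ P (F y) ∂μ := by
    simpa using ((innerSL ℂ P).integral_comp_comm hF).symm
  have hmeas : Measurable fun p : ℝ × ℝ => conj (P p.2) * Φ p.2 p.1 :=
    (Complex.continuous_conj.measurable.comp
      ((Lp.stronglyMeasurable P).measurable.comp measurable_snd)).mul (hΦ.comp measurable_swap)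
  have hint : Integrable (fun p : ℝ × ℝ => conj (P p.2) * Φ p.2 p.1) (μ.prod volume) := by
    rw [integrable_prod_iff hmeas.aestronglyMeasurable]
    refine ⟨?_, ?_⟩
    · filter_upwards [hFΦ] with y hy
      refine (integrable_conj_mul P (F y)).congr ?_
      filter_upwards [hy] with x hx
      rw [hx]
    · refine Integrable.mono' (hF.norm.const_mul ‖P‖) ?_ ?_
      · exact (StronglyMeasurable.integral_prod_right hmeas.norm.stronglyMeasurable).aestronglyMeasurable
      · filter_upwards [hFΦ] with y hy
        rw [Real.norm_of_nonneg (integral_nonneg fun x => norm_nonneg _)]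
        refine le_trans (le_of_eq (integral_congr_ae ?_)) (integral_norm_mul_norm_le P (F y))
        filter_upwards [hy] with x hx
        simp [hx]
  rw [h1, inner_eq_integral]
  calc ∫ y, inner ℂ P (F y) ∂μ = ∫ y, (∫ x, conj (P x) * Φ x y) ∂μ := by
        refine integral_congr_ae ?_
        filter_upwards [hFΦ] with y hy
        rw [inner_eq_integral]
        refine integral_congr_ae ?_
        filter_upwards [hy] with x hx
        rw [hx]
    _ = ∫ x, (∫ y, conj (P x) * Φ x y ∂μ) := integral_integral_swap hint
    _ = ∫ x, conj (P x) * G x := by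
        refine integral_congr_ae ?_
        filter_upwards [hG] with x hx
        rw [hx, integral_const_mul]

/-! ### Multiplication operators -/

/-- The function `m` is measurable and bounded. -/
def IsBddMeas (m : ℝ → ℂ) : Prop := Measurable m ∧ ∃ C, ∀ x, ‖m x‖ ≤ C

theorem IsBddMeas.memLp_mul {m : ℝ → ℂ} (hm : IsBddMeas m) {f : ℝ → ℂ} (hf : MemLp f 2 volume) :
    MemLp (fun x => m x * f x) 2 volume := by
  obtain ⟨hm, C, hC⟩ := hm
  refine hf.of_le_mul (c := C) (hm.aestronglyMeasurable.mul hf.1) (Eventually.of_forall fun x => ?_)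
  rw [norm_mul]
  exact mul_le_mul_of_nonneg_right (hC x) (norm_nonneg _)

theorem norm_toL2_mul_le {m : ℝ → ℂ} {C : ℝ} (hm : Measurable m) (hC : ∀ x, ‖m x‖ ≤ C) (f : L2R) :
    ‖toL2 fun x => m x * f x‖ ≤ C * ‖f‖ := by
  have h := coeFn_toL2 (IsBddMeas.memLp_mul ⟨hm, C, hC⟩ (Lp.memLp f))
  refine Lp.norm_le_mul_norm_of_ae_le_mul ?_
  filter_upwards [h] with x hx
  rw [hx, norm_mul]
  exact mul_le_mul_of_nonneg_right (hC x) (norm_nonneg _)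

open scoped Classical in
/-- Multiplication by a bounded measurable function, as an operator on `L²(ℝ)`. -/
def mulL2 (m : ℝ → ℂ) : L2R →L[ℂ] L2R :=
  if h : IsBddMeas m then
    LinearMap.mkContinuousOfExistsBound
      { toFun := fun f => toL2 fun x => m x * f x
        map_add' := fun f g => by
          refine Lp.ext ?_
          filter_upwards [coeFn_toL2 (h.memLp_mul (Lp.memLp (f + g))),
            coeFn_toL2 (h.memLp_mul (Lp.memLp f)), coeFn_toL2 (h.memLp_mul (Lp.memLp g)),
            Lp.coeFn_add f g, Lp.coeFn_add (toL2 fun x => m x * f x) (toL2 fun x => m x * g x)]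
            with x h1 h2 h3 h4 h5
          rw [h1, h5, Pi.add_apply, h2, h3, h4, Pi.add_apply, mul_add]
        map_smul' := fun c f => by
          refine Lp.ext ?_
          filter_upwards [coeFn_toL2 (h.memLp_mul (Lp.memLp (c • f))),
            coeFn_toL2 (h.memLp_mul (Lp.memLp f)), Lp.coeFn_smul c f,
            Lp.coeFn_smul c (toL2 fun x => m x * f x)] with x h1 h2 h3 h4
          rw [h1, RingHom.id_apply, h4, Pi.smul_apply, h2, h3, Pi.smul_apply, smul_eq_mul,
            smul_eq_mul, mul_left_comm] }
      ⟨h.2.choose, norm_toL2_mul_le h.1 h.2.choose_spec⟩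
  else 0

theorem mulL2_apply {m : ℝ → ℂ} (h : IsBddMeas m) (f : L2R) :
    mulL2 m f = toL2 fun x => m x * f x := by
  rw [mulL2, dif_pos h]
  rfl

theorem coeFn_mulL2 {m : ℝ → ℂ} (h : IsBddMeas m) (f : L2R) :
    mulL2 m f =ᵐ[volume] fun x => m x * f x := by
  rw [mulL2_apply h]
  exact coeFn_toL2 (h.memLp_mul (Lp.memLp f))

theorem norm_mulL2_apply_le {m : ℝ → ℂ} {C : ℝ} (hm : Measurable m) (hC : ∀ x, ‖m x‖ ≤ C)
    (f : L2R) : ‖mulL2 m f‖ ≤ C * ‖f‖ := by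
  rw [mulL2_apply ⟨hm, C, hC⟩]
  exact norm_toL2_mul_le hm hC f

theorem inner_mulL2_left {m : ℝ → ℂ} (h : IsBddMeas m) (P f : L2R) :
    inner ℂ (mulL2 m P) f = inner ℂ P (mulL2 (fun x => conj (m x)) f) := by
  have h' : IsBddMeas fun x => conj (m x) :=
    ⟨Complex.continuous_conj.measurable.comp h.1, h.2.choose, fun x => by simpa using h.2.choose_spec x⟩
  rw [inner_eq_integral, inner_eq_integral]
  refine integral_congr_ae ?_
  filter_upwards [coeFn_mulL2 h P, coeFn_mulL2 h' f] with x h1 h2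
  rw [h1, h2, map_mul]
  ring

theorem IsBddMeas.mul {m m' : ℝ → ℂ} (h : IsBddMeas m) (h' : IsBddMeas m') :
    IsBddMeas fun x => m x * m' x := by
  obtain ⟨h, C, hC⟩ := h
  obtain ⟨h', C', hC'⟩ := h'
  refine ⟨h.mul h', C * C', fun x => ?_⟩
  rw [norm_mul]
  exact mul_le_mul (hC x) (hC' x) (norm_nonneg _) ((norm_nonneg _).trans (hC x))

theorem mulL2_mulL2 {m m' : ℝ → ℂ} (h : IsBddMeas m) (h' : IsBddMeas m') (f : L2R) :
    mulL2 m (mulL2 m' f) = mulL2 (fun x => m x * m' x) f := by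
  refine Lp.ext ?_
  filter_upwards [coeFn_mulL2 h (mulL2 m' f), coeFn_mulL2 h' f, coeFn_mulL2 (h.mul h') f]
    with x h1 h2 h3
  rw [h1, h2, h3, mul_assoc]

/-! ### Fourier inversion integrals of test functions -/

open scoped SchwartzMap

/-- The integral `∫ e^{2πiηx} p(x) dx`. -/
def invFT (p : ℝ → ℂ) (η : ℝ) : ℂ :=
  ∫ x : ℝ, Complex.exp (((2 * Real.pi * η : ℝ) : ℂ) * x * Complex.I) * p x

theorem invFT_eq_fourierInv (p : ℝ → ℂ) (η : ℝ) : invFT p η = 𝓕⁻ p η := by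
  rw [Real.fourierInv_eq', invFT]
  refine integral_congr_ae (Eventually.of_forall fun x => ?_)
  simp only [smul_eq_mul]
  congr 2
  simp
  ring

theorem invFT_sub_right (p : ℝ → ℂ) (c η : ℝ) : invFT (fun x => p (x - c)) η =
    Complex.exp (((2 * Real.pi * η : ℝ) : ℂ) * c * Complex.I) * invFT p η := by
  rw [invFT, invFT, ← integral_const_mul]
  rw [← integral_sub_right_eq_self (μ := volume) (fun x : ℝ =>
    Complex.exp (((2 * Real.pi * η : ℝ) : ℂ) * c * Complex.I) *
      (Complex.exp (((2 * Real.pi * η : ℝ) : ℂ) * x * Complex.I) * p x)) c]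
  refine integral_congr_ae (Eventually.of_forall fun x => ?_)
  simp only
  rw [← mul_assoc, ← Complex.exp_add]
  congr 2
  push_cast
  ring

theorem invFT_deriv {p : ℝ → ℂ} (hp : Integrable p) (hd : Differentiable ℝ p)
    (hp' : Integrable (deriv p)) (η : ℝ) :
    invFT (deriv p) η = -(((2 * Real.pi * η : ℝ) : ℂ) * Complex.I) * invFT p η := by
  rw [invFT_eq_fourierInv, invFT_eq_fourierInv, Real.fourierInv_eq_fourier_neg,
    Real.fourierInv_eq_fourier_neg, Real.fourier_deriv hp hd hp']
  simp only [smul_eq_mul]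
  push_cast
  ring

theorem norm_invFT_le (p : ℝ → ℂ) (η : ℝ) : ‖invFT p η‖ ≤ ∫ x, ‖p x‖ := by
  refine (norm_integral_le_integral_norm _).trans (le_of_eq ?_)
  refine integral_congr_ae (Eventually.of_forall fun x => ?_)
  simp only [norm_mul]
  rw [← Complex.ofReal_mul, Complex.norm_exp_ofReal_mul_I, one_mul]

theorem integral_mul_eq_inner (f : L2R) {q : ℝ → ℂ} (hq : MemLp q 2 volume) :
    ∫ x, f x * q x = inner ℂ (toL2 fun x => conj (q x)) f := by
  rw [inner_eq_integral]
  refine integral_congr_ae ?_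
  filter_upwards [coeFn_toL2 (g := fun x => conj (q x)) hq.star] with x hx
  rw [hx, Complex.conj_conj, mul_comm]

/-- Both sides are continuous in f ∈ L², so it suffices to take f Schwartz, where this is the
multiplication formula for the Fourier transform. -/
theorem integral_mul_schwartz (f : L2R) (p : 𝓢(ℝ, ℂ)) :
    ∫ x, f x * p x = ∫ η, (𝓕 f : L2R) η * invFT p η := by
  have hq : ∀ η, invFT p η = (𝓕⁻ p : 𝓢(ℝ, ℂ)) η := fun η => by
    rw [invFT_eq_fourierInv, SchwartzMap.fourierInv_coe]
  simp only [hq]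
  rw [integral_mul_eq_inner f (p.memLp 2), integral_mul_eq_inner (𝓕 f) ((𝓕⁻ p).memLp 2)]
  have hdense := SchwartzMap.denseRange_toLpCLM (F := ℂ) (E := ℝ) (p := 2) (μ := volume) (by simp)
  have hF : Continuous fun f : L2R => (𝓕 f : L2R) := (Lp.fourierTransformₗᵢ ℝ ℂ).continuous
  refine congrFun (DenseRange.equalizer hdense (g := fun f : L2R => inner ℂ (toL2 fun x => conj (p x)) f)
    (h := fun f : L2R => inner ℂ (toL2 fun x => conj ((𝓕⁻ p : 𝓢(ℝ, ℂ)) x)) (𝓕 f : L2R))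
    (by fun_prop) (by fun_prop) (funext fun g => ?_)) f
  simp only [Function.comp_apply, SchwartzMap.toLpCLM_apply]
  rw [← integral_mul_eq_inner _ (p.memLp 2), ← integral_mul_eq_inner _ ((𝓕⁻ p).memLp 2),
    SchwartzMap.toLp_fourier_eq]
  have h := SchwartzMap.integral_fourier_mul_eq g (𝓕⁻ p)
  rw [FourierTransform.fourier_fourierInv_eq] at h
  calc _ = ∫ x, g x * p x := integral_congr_ae (by
        filter_upwards [g.coeFn_toLp 2] with x hx; rw [hx])
    _ = _ := h.symm
    _ = _ := integral_congr_ae (by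
        filter_upwards [(𝓕 g).coeFn_toLp 2] with x hx; rw [hx])

theorem integral_mul_test (f : L2R) {p : ℝ → ℂ} (hp : ContDiff ℝ ∞ p) (hc : HasCompactSupport p) :
    ∫ x, f x * p x = ∫ η, (𝓕 f : L2R) η * invFT p η :=
  integral_mul_schwartz f (hc.toSchwartzMap hp)

theorem memLp_invFT {p : ℝ → ℂ} (hp : ContDiff ℝ ∞ p) (hc : HasCompactSupport p) :
    MemLp (invFT p) 2 volume := by
  have : invFT p = (𝓕⁻ (hc.toSchwartzMap hp) : 𝓢(ℝ, ℂ)) := funext fun η => by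
    rw [invFT_eq_fourierInv, SchwartzMap.fourierInv_coe]
    rfl
  rw [this]
  exact SchwartzMap.memLp _ 2 volume

theorem invFT_deriv_test {p : ℝ → ℂ} (hp : ContDiff ℝ ∞ p) (hc : HasCompactSupport p) (η : ℝ) :
    invFT (deriv p) η = -(((2 * Real.pi * η : ℝ) : ℂ) * Complex.I) * invFT p η :=
  invFT_deriv (hp.continuous.integrable_of_hasCompactSupport hc) (hp.differentiable (by simp))
    ((hp.continuous_deriv (by simp)).integrable_of_hasCompactSupport hc.deriv) η

theorem contDiff_deriv_infty {p : ℝ → ℂ} (hp : ContDiff ℝ ∞ p) : ContDiff ℝ ∞ (deriv p) :=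
  (contDiff_infty_iff_deriv.1 hp).2

/-- If an `L²` function annihilates `p - c p''` for all test functions `p`, then the same is true
for all Schwartz functions. -/
theorem integral_mul_sub_deriv_deriv_eq_zero (z : L2R) (c : ℂ)
    (h : ∀ p : ℝ → ℂ, ContDiff ℝ ∞ p → HasCompactSupport p →
      ∫ x, z x * (p x - c * deriv (deriv p) x) = 0) (p : 𝓢(ℝ, ℂ)) :
    ∫ x, z x * (p x - c * deriv (deriv p) x) = 0 := by
  -- Approximation of p by χ(εx) p(x): each derivative falling on the cut-off brings a factor ε, so
  -- only p and p'' survive in the limit.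
  let χ : ContDiffBump (0 : ℝ) := ⟨1, 2, one_pos, one_lt_two⟩
  have hχ : ContDiff ℝ ∞ χ := χ.contDiff
  have hχ1 : ContDiff ℝ ∞ (deriv χ) := (contDiff_infty_iff_deriv.1 hχ).2
  have hχ2 : ContDiff ℝ ∞ (deriv (deriv χ)) := (contDiff_infty_iff_deriv.1 hχ1).2
  obtain ⟨C1, hC1⟩ := hχ1.continuous.bounded_above_of_compact_support χ.hasCompactSupport.deriv
  obtain ⟨C2, hC2⟩ :=
    hχ2.continuous.bounded_above_of_compact_support χ.hasCompactSupport.deriv.deriv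
  let p1 : 𝓢(ℝ, ℂ) := SchwartzMap.derivCLM ℂ ℂ p
  let p2 : 𝓢(ℝ, ℂ) := SchwartzMap.derivCLM ℂ ℂ p1
  have hd0 : ∀ x, HasDerivAt p (p1 x) x := fun x => p.hasDerivAt x
  have hd1 : ∀ x, HasDerivAt p1 (p2 x) x := fun x => p1.hasDerivAt x
  have hp1 : deriv p = p1 := funext fun x => (hd0 x).deriv
  have hp2 : deriv (deriv p) = p2 := by rw [hp1]; exact funext fun x => (hd1 x).deriv
  -- the cut-off functions
  let ε : ℕ → ℝ := fun n => 1 / ((n : ℝ) + 1)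
  have hε0 : ∀ n, 0 < ε n := fun n => by positivity
  have hε1 : ∀ n, ε n ≤ 1 := fun n => by
    simp only [ε]
    rw [div_le_one (by positivity)]
    linarith [n.cast_nonneg (α := ℝ)]
  have hεt : Tendsto ε atTop (𝓝 0) := tendsto_one_div_add_atTop_nhds_zero_nat
  let θ : ℕ → ℝ → ℂ := fun n x => ((χ (ε n * x) : ℝ) : ℂ)
  let θ1 : ℕ → ℝ → ℂ := fun n x => ((ε n * deriv χ (ε n * x) : ℝ) : ℂ)
  let θ2 : ℕ → ℝ → ℂ := fun n x => ((ε n * (ε n * deriv (deriv χ) (ε n * x)) : ℝ) : ℂ)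
  have hlin : ∀ n x, HasDerivAt (fun x : ℝ => ε n * x) (ε n) x := fun n x => by
    simpa using (hasDerivAt_id x).const_mul (ε n)
  have hθ1 : ∀ n x, HasDerivAt (θ n) (θ1 n x) x := fun n x => by
    have := ((hχ.differentiable (by simp) (ε n * x)).hasDerivAt.comp x (hlin n x)).ofReal_comp
    simpa [θ, θ1, mul_comm] using this
  have hθ2 : ∀ n x, HasDerivAt (θ1 n) (θ2 n x) x := fun n x => by
    have := ((((hχ1.differentiable (by simp) (ε n * x)).hasDerivAt.comp x
      (hlin n x))).const_mul (ε n)).ofReal_comp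
    simpa [θ1, θ2, mul_comm] using this
  have hq1 : ∀ n, deriv (fun x => θ n x * p x) = fun x => θ1 n x * p x + θ n x * p1 x :=
    fun n => funext fun x => ((hθ1 n x).mul (hd0 x)).deriv
  have hq2 : ∀ n, deriv (deriv fun x => θ n x * p x) = fun x =>
      (θ2 n x * p x + θ1 n x * p1 x) + (θ1 n x * p1 x + θ n x * p2 x) := fun n => by
    rw [hq1]
    exact funext fun x => (((hθ2 n x).mul (hd0 x)).add ((hθ1 n x).mul (hd1 x))).deriv
  have hzero : ∀ n, ∫ x, z x * (θ n x * p x - c * ((θ2 n x * p x + θ1 n x * p1 x) +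
      (θ1 n x * p1 x + θ n x * p2 x))) = 0 := fun n => by
    have hsm : ContDiff ℝ ∞ (fun x => θ n x * p x) := by
      refine ContDiff.mul ?_ (p.smooth ⊤)
      exact Complex.ofRealCLM.contDiff.comp (hχ.comp (contDiff_const.mul contDiff_id))
    have hcs : HasCompactSupport (fun x => θ n x * p x) := by
      have h1 : HasCompactSupport fun x => χ (ε n * x) :=
        χ.hasCompactSupport.comp_homeomorph (Homeomorph.mulLeft₀ (ε n) (hε0 n).ne')
      have h2 : HasCompactSupport (θ n) := h1.comp_left (g := fun r : ℝ => (r : ℂ)) (by simp)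
      exact h2.mul_right
    have := h _ hsm hcs
    rw [hq2] at this
    exact this
  have hθb : ∀ n x, ‖θ n x‖ ≤ 1 := fun n x => by
    simp only [θ, Complex.norm_real, Real.norm_of_nonneg χ.nonneg]
    exact χ.le_one
  have hθ1b : ∀ n x, ‖θ1 n x‖ ≤ ε n * C1 := fun n x => by
    simp only [θ1, Complex.norm_real, norm_mul, Real.norm_of_nonneg (hε0 n).le]
    exact mul_le_mul_of_nonneg_left (hC1 _) (hε0 n).le
  have hθ2b : ∀ n x, ‖θ2 n x‖ ≤ ε n * (ε n * C2) := fun n x => by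
    simp only [θ2, Complex.norm_real, norm_mul, Real.norm_of_nonneg (hε0 n).le]
    exact mul_le_mul_of_nonneg_left (mul_le_mul_of_nonneg_left (hC2 _) (hε0 n).le) (hε0 n).le
  have hC1' : 0 ≤ C1 := (norm_nonneg _).trans (hC1 0)
  have hC2' : 0 ≤ C2 := (norm_nonneg _).trans (hC2 0)
  have hθ1b' : ∀ n x, ‖θ1 n x‖ ≤ C1 := fun n x =>
    (hθ1b n x).trans (mul_le_of_le_one_left hC1' (hε1 n))
  have hθ2b' : ∀ n x, ‖θ2 n x‖ ≤ C2 := fun n x =>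
    (hθ2b n x).trans ((mul_le_of_le_one_left (mul_nonneg (hε0 n).le hC2') (hε1 n)).trans
      (mul_le_of_le_one_left hC2' (hε1 n)))
  have hθt : ∀ x, Tendsto (fun n => θ n x) atTop (𝓝 1) := fun x => by
    have h1 : Tendsto (fun n => ε n * x) atTop (𝓝 0) := by simpa using hεt.mul_const x
    have h2 : Tendsto (fun n => χ (ε n * x)) atTop (𝓝 (χ 0)) :=
      (χ.continuous.tendsto 0).comp h1
    rw [χ.one_of_mem_closedBall (by simp [χ])] at h2
    have h3 := (Complex.continuous_ofReal.tendsto 1).comp h2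
    rw [Complex.ofReal_one] at h3
    exact h3
  have hθ1t : ∀ x, Tendsto (fun n => θ1 n x) atTop (𝓝 0) := fun x =>
    squeeze_zero_norm (hθ1b · x) (by simpa using hεt.mul_const C1)
  have hθ2t : ∀ x, Tendsto (fun n => θ2 n x) atTop (𝓝 0) := fun x =>
    squeeze_zero_norm (hθ2b · x) (by simpa using hεt.mul (hεt.mul_const C2))
  have hint : ∀ q : 𝓢(ℝ, ℂ), Integrable fun x => ‖z x‖ * ‖q x‖ := fun q => by
    refine (integrable_norm_mul_norm z (q.toLp 2)).congr ?_
    filter_upwards [q.coeFn_toLp 2] with x hx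
    rw [hx]
  rw [hp2]
  have hcont : ∀ n, Continuous fun x => θ n x * p x - c * ((θ2 n x * p x + θ1 n x * p1 x) +
      (θ1 n x * p1 x + θ n x * p2 x)) := fun n => by
    have c1 : Continuous (θ n) := continuous_iff_continuousAt.2 fun x => (hθ1 n x).continuousAt
    have c2 : Continuous (θ1 n) := continuous_iff_continuousAt.2 fun x => (hθ2 n x).continuousAt
    have c3 : Continuous (θ2 n) := by
      have := hχ2.continuous
      simp only [θ2]
      fun_prop
    have := p.continuous
    have := p1.continuous
    have := p2.continuous
    fun_prop
  have lim := tendsto_integral_of_dominated_convergence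
    (F := fun n x => z x * (θ n x * p x - c * ((θ2 n x * p x + θ1 n x * p1 x) +
      (θ1 n x * p1 x + θ n x * p2 x)))) (f := fun x => z x * (p x - c * p2 x)) (μ := volume)
    (fun x => (1 + ‖c‖ * C2) * (‖z x‖ * ‖p x‖) + (‖c‖ * (2 * C1)) * (‖z x‖ * ‖p1 x‖) +
      ‖c‖ * (‖z x‖ * ‖p2 x‖))
    (fun n => (Lp.aestronglyMeasurable z).mul (hcont n).aestronglyMeasurable)
    ((((hint p).const_mul _).add ((hint p1).const_mul _)).add ((hint p2).const_mul _))
    (fun n => Eventually.of_forall fun x => ?_) (Eventually.of_forall fun x => ?_)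
  · simp only [hzero] at lim
    exact (tendsto_nhds_unique lim tendsto_const_nhds)
  · have e1 : ‖θ n x * p x - c * ((θ2 n x * p x + θ1 n x * p1 x) +
        (θ1 n x * p1 x + θ n x * p2 x))‖ ≤
        1 * ‖p x‖ + ‖c‖ * ((C2 * ‖p x‖ + C1 * ‖p1 x‖) + (C1 * ‖p1 x‖ + 1 * ‖p2 x‖)) := by
      refine (norm_sub_le _ _).trans (add_le_add ?_ ?_)
      · rw [norm_mul]
        exact mul_le_mul_of_nonneg_right (hθb n x) (norm_nonneg _)
      · rw [norm_mul]
        refine mul_le_mul_of_nonneg_left ?_ (norm_nonneg _)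
        refine (norm_add_le _ _).trans (add_le_add ((norm_add_le _ _).trans (add_le_add ?_ ?_))
          ((norm_add_le _ _).trans (add_le_add ?_ ?_)))
        all_goals rw [norm_mul]; refine mul_le_mul_of_nonneg_right ?_ (norm_nonneg _)
        · exact hθ2b' n x
        · exact hθ1b' n x
        · exact hθ1b' n x
        · exact hθb n x
    rw [norm_mul]
    refine (mul_le_mul_of_nonneg_left e1 (norm_nonneg _)).trans (le_of_eq ?_)
    ring
  · have := ((hθt x).mul_const (p x)).sub (((((hθ2t x).mul_const (p x)).add
      ((hθ1t x).mul_const (p1 x))).add (((hθ1t x).mul_const (p1 x)).add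
      ((hθt x).mul_const (p2 x)))).const_mul c)
    simpa using this.const_mul (z x)

/-- A function with `L²` coefficients of `1`, `η` and `η²` that annihilates the Fourier transforms
of all test functions vanishes almost everywhere. -/
theorem ae_eq_zero_of_integral_mul_invFT_eq_zero (G₀ G₁ G₂ : L2R)
    (h : ∀ p : ℝ → ℂ, ContDiff ℝ ∞ p → HasCompactSupport p →
      ∫ η : ℝ, (G₀ η + η * G₁ η + η ^ 2 * G₂ η) * invFT p η = 0) :
    ∀ᵐ η : ℝ, G₀ η + η * G₁ η + η ^ 2 * G₂ η = 0 := by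
  set g : ℝ → ℂ := fun η => G₀ η + η * G₁ η + η ^ 2 * G₂ η with hg
  have hmeas : Measurable g := by
    have h0 := (Lp.stronglyMeasurable G₀).measurable
    have h1 := (Lp.stronglyMeasurable G₁).measurable
    have h2 := (Lp.stronglyMeasurable G₂).measurable
    fun_prop
  have hpos : ∀ η : ℝ, (0 : ℝ) < 1 + η ^ 2 := fun η => by positivity
  have hne : ∀ η : ℝ, (1 + (η : ℂ) ^ 2) ≠ 0 := fun η => by
    have := (hpos η).ne'
    exact_mod_cast this
  have hbdd : ∀ e : ℝ → ℂ, Measurable e → (∀ η, ‖e η‖ ≤ 1 + η ^ 2) →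
      IsBddMeas fun η : ℝ => (1 + (η : ℂ) ^ 2)⁻¹ * e η := fun e he hb =>
    ⟨by fun_prop, 1, fun η => by
      have : ‖(1 + (η : ℂ) ^ 2)‖ = 1 + η ^ 2 := by
        rw [← Complex.ofReal_one, ← Complex.ofReal_pow, ← Complex.ofReal_add, Complex.norm_real,
          Real.norm_of_nonneg (hpos η).le]
      rw [norm_mul, norm_inv, this, inv_mul_le_iff₀ (hpos η), mul_one]
      exact hb η⟩
  have hZ : MemLp (fun η : ℝ => (1 + (η : ℂ) ^ 2)⁻¹ * g η) 2 volume := by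
    have m0 := (hbdd (fun _ => 1) measurable_const fun η => by simp; positivity).memLp_mul
      (Lp.memLp G₀)
    have m1 := (hbdd (fun η => η) (by fun_prop) fun η => by
      rw [Complex.norm_real, Real.norm_eq_abs]
      nlinarith [sq_nonneg (|η| - 1), sq_abs η]).memLp_mul (Lp.memLp G₁)
    have m2 := (hbdd (fun η => (η : ℂ) ^ 2) (by fun_prop) fun η => by
      rw [norm_pow, Complex.norm_real, Real.norm_eq_abs, sq_abs]
      linarith).memLp_mul (Lp.memLp G₂)
    refine ((m0.add m1).add m2).ae_eq (Eventually.of_forall fun η => ?_)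
    simp only [hg, Pi.add_apply]
    ring
  -- Division by 1 + η² brings the function back to L². On the other side of the Fourier transform,
  -- the factor 1 + η² becomes the operator 1 - c ∂² with c = 1/(2π)².
  set Z : L2R := toL2 fun η : ℝ => (1 + (η : ℂ) ^ 2)⁻¹ * g η with hZdef
  have hZae := coeFn_toL2 hZ
  have hFZ : (𝓕 (𝓕⁻ Z : L2R) : L2R) = Z := FourierTransform.fourier_fourierInv_eq Z
  set c : ℂ := ((1 / (2 * Real.pi) ^ 2 : ℝ) : ℂ) with hc
  have hpi : (2 * (Real.pi : ℂ)) ≠ 0 := by simp [Real.pi_ne_zero]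
  have hcη : ∀ η : ℝ, 1 - c * ((-(((2 * Real.pi * η : ℝ) : ℂ) * Complex.I)) *
      (-(((2 * Real.pi * η : ℝ) : ℂ) * Complex.I))) = 1 + (η : ℂ) ^ 2 := fun η => by
    rw [hc]
    push_cast
    field_simp
    ring_nf
    simp
  have hinv : ∀ p : 𝓢(ℝ, ℂ), ∀ η, invFT (p - c • SchwartzMap.derivCLM ℂ ℂ
      (SchwartzMap.derivCLM ℂ ℂ p) : 𝓢(ℝ, ℂ)) η = (1 + (η : ℂ) ^ 2) * invFT p η := fun p η => by
    set p1 := SchwartzMap.derivCLM ℂ ℂ p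
    set p2 := SchwartzMap.derivCLM ℂ ℂ p1
    have i1 : invFT p1 η = _ := invFT_deriv p.integrable p.differentiable p1.integrable η
    have i2 : invFT p2 η = _ := invFT_deriv p1.integrable p1.differentiable p2.integrable η
    have i3 : invFT (p - c • p2 : 𝓢(ℝ, ℂ)) η = invFT p η - c * invFT p2 η := by
      have hi : ∀ q : 𝓢(ℝ, ℂ), Integrable fun x : ℝ =>
          Complex.exp (((2 * Real.pi * η : ℝ) : ℂ) * x * Complex.I) * q x := fun q => by
        refine q.integrable.norm.mono' (Continuous.aestronglyMeasurable
          (Continuous.mul (by fun_prop) q.continuous)) (Eventually.of_forall fun x => ?_)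
        rw [norm_mul, ← Complex.ofReal_mul, Complex.norm_exp_ofReal_mul_I, one_mul]
      rw [invFT, invFT, invFT, ← integral_const_mul, ← integral_sub (hi p) ((hi p2).const_mul c)]
      refine integral_congr_ae (Eventually.of_forall fun x => ?_)
      simp only [sub_apply, smul_apply, smul_eq_mul]
      ring
    rw [i3, i2, i1, ← hcη η]
    ring
  have hkey := integral_mul_sub_deriv_deriv_eq_zero (𝓕⁻ Z : L2R) c fun p hp hpc => by
    have h1 := integral_mul_schwartz (𝓕⁻ Z : L2R) ((hpc.toSchwartzMap hp) - c •
      SchwartzMap.derivCLM ℂ ℂ (SchwartzMap.derivCLM ℂ ℂ (hpc.toSchwartzMap hp)))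
    refine Eq.trans ?_ (h1.trans ?_)
    · rfl
    rw [hFZ, ← h p hp hpc]
    refine integral_congr_ae ?_
    filter_upwards [hZae] with η hη
    rw [hinv, hη]
    have := hne η
    field_simp
    rfl
  have hZ0 : ∀ᵐ η, (Z : ℝ → ℂ) η = 0 := by
    -- To test Z against ψ, take for p the Fourier transform of ψ/(1 + η²). It is Schwartz but need
    -- not have compact support, hence the preceding extension to Schwartz functions.
    refine ae_eq_zero_of_integral_contDiff_smul_eq_zero
      ((Lp.memLp Z).locallyIntegrable (by norm_num)) fun ψ hψ hψc => ?_
    have hsm : ContDiff ℝ ∞ fun η : ℝ => (1 + (η : ℂ) ^ 2)⁻¹ * (ψ η : ℂ) := by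
      refine ContDiff.mul (ContDiff.inv ?_ hne) (Complex.ofRealCLM.contDiff.comp hψ)
      exact contDiff_const.add (Complex.ofRealCLM.contDiff.pow 2)
    have hcs : HasCompactSupport fun η : ℝ => (1 + (η : ℂ) ^ 2)⁻¹ * (ψ η : ℂ) :=
      (hψc.comp_left (g := fun r : ℝ => (r : ℂ)) (by simp)).mul_left
    set ψ' := hcs.toSchwartzMap hsm
    have h1 := hkey (𝓕 ψ')
    have h2 := integral_mul_schwartz (𝓕⁻ Z : L2R) ((𝓕 ψ') - c •
      SchwartzMap.derivCLM ℂ ℂ (SchwartzMap.derivCLM ℂ ℂ (𝓕 ψ')))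
    have h3 : ∫ η, ψ η • Z η = ∫ η, (𝓕 (𝓕⁻ Z : L2R) : L2R) η * invFT ((𝓕 ψ') - c •
      SchwartzMap.derivCLM ℂ ℂ (SchwartzMap.derivCLM ℂ ℂ (𝓕 ψ')) : 𝓢(ℝ, ℂ)) η := by
      rw [hFZ]
      refine integral_congr_ae (Eventually.of_forall fun η => ?_)
      simp only
      rw [hinv, invFT_eq_fourierInv, ← SchwartzMap.fourierInv_coe,
        FourierTransform.fourierInv_fourier_eq]
      have := hne η
      simp only [ψ', HasCompactSupport.toSchwartzMap_toFun]
      rw [Complex.real_smul]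
      field_simp
    rw [h3, ← h2, ← h1]
    rfl
  filter_upwards [hZ0, hZae] with η h1 h2
  rw [h1] at h2
  have := mul_eq_zero.1 h2.symm
  exact this.resolve_left (inv_ne_zero (hne η))

/-! ### The fundamental lemma of the calculus of variations -/

section DuBoisReymond

variable {X : Type*} [NormedAddCommGroup X] [NormedSpace ℝ X]

/-- `q` is a real test function on the interval `(s, t)`. -/
structure IsTestOn (q : ℝ → ℝ) (s t : ℝ) : Prop where
  smooth : ContDiff ℝ ∞ q
  compact : HasCompactSupport q
  supp : tsupport q ⊆ Ioo s t

namespace IsTestOn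

variable {q : ℝ → ℝ} {s t : ℝ}

theorem eq_zero (hq : IsTestOn q s t) {y : ℝ} (hy : y ∉ Ioo s t) : q y = 0 :=
  image_eq_zero_of_notMem_tsupport fun h => hy (hq.supp h)

protected theorem deriv (hq : IsTestOn q s t) : IsTestOn (deriv q) s t :=
  ⟨(contDiff_infty_iff_deriv.1 hq.smooth).2, hq.compact.deriv,
    (tsupport_deriv_subset).trans hq.supp⟩

protected theorem hasDerivAt (hq : IsTestOn q s t) (y : ℝ) : HasDerivAt q (_root_.deriv q y) y :=
  (hq.smooth.differentiable (by simp) y).hasDerivAt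

protected theorem continuous (hq : IsTestOn q s t) : Continuous q := hq.smooth.continuous

theorem eq_integral (hq : IsTestOn q s t) {y : ℝ} (hy : s ≤ y) :
    q y = q s + ∫ r in Ico s y, _root_.deriv q r := by
  rw [← OperatorL.intervalIntegral_eq_Ico hy, intervalIntegral.integral_eq_sub_of_hasDerivAt
    (fun r _ => hq.hasDerivAt r) (hq.deriv.continuous.intervalIntegrable _ _)]
  ring

theorem exists_bound (hq : IsTestOn q s t) : ∃ C, ∀ y, ‖q y‖ ≤ C :=
  hq.continuous.bounded_above_of_compact_support hq.compact

theorem integrableOn_smul (hq : IsTestOn q s t) {μ : Measure ℝ} {g : ℝ → X} {S : Set ℝ}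
    (hg : IntegrableOn g S μ) : IntegrableOn (fun y => q y • g y) S μ := by
  obtain ⟨C, hC⟩ := hq.exists_bound
  exact Integrable.bdd_smul hg C hq.continuous.aestronglyMeasurable (ae_of_all _ hC)

/-- Integration by parts against a primitive. -/
theorem integral_deriv_smul [CompleteSpace X] (hq : IsTestOn q s t) {α : Measure ℝ} [SFinite α]
    (hst : s ≤ t) {v g₁ g₂ : ℝ → X}
    (hv : ∀ y ∈ Icc s t, v y = v s + (∫ r in Ico s y, g₁ r ∂α) + ∫ r in Ico s y, g₂ r)
    (hg₁ : IntegrableOn g₁ (Ico s t) α) (hg₂ : IntegrableOn g₂ (Ico s t)) :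
    ∫ y in Ico s t, _root_.deriv q y • v y =
      -((∫ y in Ico s t, q y • g₁ y ∂α) + ∫ y in Ico s t, q y • g₂ y) := by
  have := integral_bilin_by_parts_mixed (ContinuousLinearMap.lsmul ℝ ℝ : ℝ →L[ℝ] X →L[ℝ] X) hst
    (fun y hy => hq.eq_integral hy.1) hv
    ((hq.deriv.continuous.integrable_of_hasCompactSupport hq.deriv.compact).integrableOn) hg₁ hg₂
  simp only [ContinuousLinearMap.lsmul_apply] at this
  rw [hq.eq_zero (y := t) (by simp), hq.eq_zero (y := s) (by simp), zero_smul, zero_smul,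
    zero_add, add_assoc] at this
  exact eq_neg_of_add_eq_zero_left this.symm

end IsTestOn

/-- A primitive of a test function with integral zero is a test function. -/
theorem IsTestOn.exists_primitive {r : ℝ → ℝ} {s t : ℝ} (hst : s < t) (hr : IsTestOn r s t)
    (h0 : ∫ y, r y = 0) : ∃ q, IsTestOn q s t ∧ deriv q = r := by
  set q : ℝ → ℝ := fun y => ∫ x in s..y, r x with hq
  have hd : ∀ y, HasDerivAt q (r y) y := fun y =>
    intervalIntegral.integral_hasDerivAt_right (hr.continuous.intervalIntegrable _ _)
      (hr.continuous.stronglyMeasurableAtFilter _ _) hr.continuous.continuousAt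
  have hdq : deriv q = r := funext fun y => (hd y).deriv
  have hsm : ContDiff ℝ ∞ q :=
    contDiff_infty_iff_deriv.2 ⟨fun y => (hd y).differentiableAt, hdq ▸ hr.smooth⟩
  -- The support of r is compact in the open interval, so it stays away from s and t. The primitive
  -- vanishes to the left of it trivially, and to the right because r has integral zero.
  obtain ⟨s', t', hs', ht', hsub⟩ : ∃ s' t', s < s' ∧ t' < t ∧ tsupport r ⊆ Icc s' t' := by
    rcases (tsupport r).eq_empty_or_nonempty with he | hne
    · exact ⟨(s + t) / 2, (s + t) / 2, by linarith, by linarith, by simp [he]⟩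
    · obtain ⟨x, hx, hxl⟩ := hr.compact.isCompact.exists_isLeast hne
      obtain ⟨z, hz, hzl⟩ := hr.compact.isCompact.exists_isGreatest hne
      exact ⟨x, z, (hr.supp hx).1, (hr.supp hz).2, fun y hy => ⟨hxl hy, hzl hy⟩⟩
  have hzero : ∀ y, y ∉ Icc s' t' → r y = 0 := fun y hy =>
    image_eq_zero_of_notMem_tsupport fun h => hy (hsub h)
  have hsupp : Function.support q ⊆ Icc s' t' := by
    intro y hy
    by_contra hy'
    refine hy ?_
    rcases lt_or_ge y s' with h | h
    · refine intervalIntegral.integral_zero_ae (ae_of_all _ fun x hx => hzero x fun hx' => ?_)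
      rcases le_total s y with h2 | h2
      · rw [uIoc_of_le h2] at hx
        linarith [hx.2, hx'.1]
      · rw [uIoc_of_ge h2] at hx
        linarith [hx.2, hx'.1]
    · have hty : t' < y := not_le.1 fun h2 => hy' ⟨h, h2⟩
      have : q y = ∫ x, r x := intervalIntegral.integral_eq_integral_of_support_subset fun x hx => by
        have := hsub (subset_tsupport r hx)
        exact ⟨hs'.trans_le this.1, this.2.trans hty.le⟩
      rw [this, h0]
  have hts : tsupport q ⊆ Icc s' t' := closure_minimal hsupp isClosed_Icc
  exact ⟨q, ⟨hsm, isCompact_Icc.of_isClosed_subset (isClosed_tsupport q) hts,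
    hts.trans fun y hy => ⟨hs'.trans_le hy.1, hy.2.trans_lt ht'⟩⟩, hdq⟩

/-- Every test function is the derivative of a test function plus its integral times a fixed bump q₀
of integral 1. Hence g acts on test functions as the constant ∫ q₀ g. -/
theorem ae_eq_const_of_integral_deriv_smul_eq_zero [CompleteSpace X] {s t : ℝ} (hst : s < t)
    {g : ℝ → X} (hg : IntegrableOn g (Ico s t))
    (h : ∀ q, IsTestOn q s t → ∫ y in Ico s t, deriv q y • g y = 0) :
    ∃ c, ∀ᵐ y ∂volume.restrict (Ico s t), g y = c := by
  have hsupp : ∀ q, IsTestOn q s t → ∀ g : ℝ → X,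
      ∫ y in Ico s t, q y • g y = ∫ y, q y • g y := fun q hq g =>
    setIntegral_eq_integral_of_forall_compl_eq_zero fun y hy => by
      rw [hq.eq_zero fun hy' => hy (Ioo_subset_Ico_self hy'), zero_smul]
  let χ : ContDiffBump ((s + t) / 2) := ⟨(t - s) / 8, (t - s) / 4, by linarith, by linarith⟩
  let q₀ : ℝ → ℝ := χ.normed volume
  have hq₀ : IsTestOn q₀ s t := ⟨χ.contDiff_normed, χ.hasCompactSupport_normed, by
    rw [χ.tsupport_normed_eq, Real.closedBall_eq_Icc]
    intro y hy
    simp only [χ] at hy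
    constructor <;> linarith [hy.1, hy.2]⟩
  have hi₀ : ∫ y, q₀ y = 1 := χ.integral_normed
  refine ⟨∫ y in Ico s t, q₀ y • g y, ?_⟩
  set c := ∫ y in Ico s t, q₀ y • g y with hc
  rw [ae_restrict_iff' measurableSet_Ico]
  have key := isOpen_Ioo.ae_eq_zero_of_integral_contDiff_smul_eq_zero (U := Ioo s t) (μ := volume)
    (f := fun y => g y - c) (((hg.mono_set Ioo_subset_Ico_self).sub
      (integrableOn_const (by simp))).locallyIntegrableOn) fun q hq1 hq2 hq3 => ?_
  · have hne : ∀ᵐ y : ℝ, y ≠ s := by simp [ae_iff]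
    filter_upwards [key, hne] with y h1 h2 hy
    exact sub_eq_zero.1 (h1 ⟨lt_of_le_of_ne hy.1 h2.symm, hy.2⟩)
  · have hq : IsTestOn q s t := ⟨hq1, hq2, hq3⟩
    have hr : IsTestOn (fun y => q y - (∫ x, q x) * q₀ y) s t := by
      refine ⟨hq1.sub (contDiff_const.mul hq₀.smooth), hq2.sub hq₀.compact.mul_left, ?_⟩
      refine (tsupport_sub _ _).trans (union_subset hq3 ?_)
      exact (tsupport_mul_subset_right).trans hq₀.supp
    obtain ⟨Q, hQ, hQd⟩ := hr.exists_primitive hst (by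
      rw [integral_sub (hq.continuous.integrable_of_hasCompactSupport hq2)
        ((hq₀.continuous.integrable_of_hasCompactSupport hq₀.compact).const_mul _),
        integral_const_mul, hi₀, mul_one, sub_self])
    have h1 := h Q hQ
    rw [hQd] at h1
    simp only [sub_smul, mul_smul] at h1
    have hi2 : IntegrableOn (fun y => (∫ x, q x) • q₀ y • g y) (Ico s t) :=
      (hq₀.integrableOn_smul hg).smul _
    rw [integral_sub (hq.integrableOn_smul hg) hi2, integral_smul, ← hc] at h1
    have h2 : ∫ y, q y • (g y - c) = ∫ y in Ico s t, (q y • g y - q y • c) := by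
      rw [← hsupp q hq]
      simp only [smul_sub]
    rw [h2, integral_sub (hq.integrableOn_smul hg)
      (hq.integrableOn_smul (integrableOn_const (by simp))), integral_smul_const]
    have h3 : ∫ y in Ico s t, q y = ∫ y, q y :=
      setIntegral_eq_integral_of_forall_compl_eq_zero fun y hy =>
        hq.eq_zero fun hy' => hy (Ioo_subset_Ico_self hy')
    rw [h3]
    exact h1

end DuBoisReymond

/-! ### From the weak to the integrated form of the differential equation -/

section Hilbert

variable {X : Type*} [NormedAddCommGroup X] [InnerProductSpace ℂ X] [NormedSpace ℝ X]

/-- Weak solutions of the differential equation are solutions. -/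
theorem OperatorL.exists_solvesOn_of_weak [CompleteSpace X] [IsScalarTower ℝ ℂ X] {L : OperatorL}
    {M : X →L[ℂ] X} {H h : ℝ → X} {s t : ℝ} (hs : 0 ≤ s) (hst : s < t) (ht : t ∈ L.dom)
    (hHc : ContinuousOn H (Icc s t)) (hh : IntegrableOn h (Ico s t))
    (hbh : IntegrableOn (fun r => (-(2 * Complex.I * L.b r)) • M (h r)) (Ico s t))
    (hH : ∀ y ∈ Icc s t, H y = H s + ∫ r in Ico s y, h r)
    (hweak : ∀ q, IsTestOn q s t → ∫ y in Ico s t, deriv q y • h y =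
      -((∫ y in Ico s t, q y • M (M (H y)) ∂L.a) +
        ∫ y in Ico s t, q y • (-(2 * Complex.I * L.b y)) • M (h y))) :
    ∃ h', L.SolvesOn M H h' s t := by
  have hfin : IsFiniteMeasure (L.a.restrict (Icc s t)) := ⟨by
    rw [Measure.restrict_apply_univ]; exact a_Icc_lt_top hs ht⟩
  have hMH : IntegrableOn (fun r => M (M (H r))) (Icc s t) L.a := by
    have hc : ContinuousOn (fun r => M (M (H r))) (Icc s t) :=
      M.continuous.comp_continuousOn (M.continuous.comp_continuousOn hHc)
    obtain ⟨C, hC⟩ := isCompact_Icc.exists_bound_of_continuousOn hc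
    exact Integrable.of_bound (hc.aestronglyMeasurable measurableSet_Icc) C
      (ae_restrict_of_forall_mem measurableSet_Icc hC)
  have hMH' : IntegrableOn (fun r => M (M (H r))) (Ico s t) L.a := hMH.mono_set Ico_subset_Icc_self
  -- N is the primitive of the right-hand side, so h - N has zero weak derivative and is almost
  -- everywhere a constant c.
  set N : ℝ → X := fun y => (∫ r in Ico s y, M (M (H r)) ∂L.a)
    + ∫ r in Ico s y, (-(2 * Complex.I * L.b r)) • M (h r) with hN
  have hNs : N s = 0 := by simp [hN]
  have hNeq : ∀ y ∈ Icc s t, N y = N s + (∫ r in Ico s y, M (M (H r)) ∂L.a)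
      + ∫ r in Ico s y, (-(2 * Complex.I * L.b r)) • M (h r) := fun y _ => by
    rw [hNs, zero_add]
  have hI : ∀ y ∈ Icc s t, Ico s y ⊆ Ico s t := fun y hy => Ico_subset_Ico_right hy.2
  obtain ⟨C, hC⟩ : ∃ C, ∀ y ∈ Icc s t, ‖N y‖ ≤ C := by
    refine ⟨(∫ r in Ico s t, ‖M (M (H r))‖ ∂L.a) +
      ∫ r in Ico s t, ‖(-(2 * Complex.I * L.b r)) • M (h r)‖, fun y hy => ?_⟩
    refine (norm_add_le _ _).trans (add_le_add ?_ ?_)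
    · exact (norm_integral_le_integral_norm _).trans (setIntegral_mono_set hMH'.norm
        (ae_of_all _ fun _ => norm_nonneg _) (hI y hy).eventuallyLE)
    · exact (norm_integral_le_integral_norm _).trans (setIntegral_mono_set hbh.norm
        (ae_of_all _ fun _ => norm_nonneg _) (hI y hy).eventuallyLE)
  have hNm : AEStronglyMeasurable N (volume.restrict (Icc s t)) := by
    have hprim : ∀ (μ : Measure ℝ) [SFinite μ] (g : ℝ → X), IntegrableOn g (Ico s t) μ →
        AEStronglyMeasurable (fun y => ∫ r in Ico s y, g r ∂μ) (volume.restrict (Icc s t)) := by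
      intro μ _ g hg
      obtain ⟨g', hg', hgg'⟩ := hg.1
      have hm : StronglyMeasurable fun p : ℝ × ℝ =>
          ({p : ℝ × ℝ | s ≤ p.2 ∧ p.2 < p.1}).indicator (fun p => g' p.2) p := by
        refine StronglyMeasurable.indicator (hg'.comp_measurable measurable_snd) ?_
        exact (measurableSet_le measurable_const measurable_snd).inter
          (measurableSet_lt measurable_snd measurable_fst)
      refine ⟨fun y => ∫ r, ({p : ℝ × ℝ | s ≤ p.2 ∧ p.2 < p.1}).indicator (fun p => g' p.2) (y, r) ∂μ,
        hm.integral_prod_right', ?_⟩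
      refine ae_restrict_of_forall_mem measurableSet_Icc fun y hy => ?_
      have e1 : ∫ r in Ico s y, g r ∂μ = ∫ r in Ico s y, g' r ∂μ :=
        integral_congr_ae (ae_restrict_of_ae_restrict_of_subset (hI y hy) hgg')
      simp only
      rw [e1, ← integral_indicator measurableSet_Ico]
      rfl
    exact (hprim _ _ hMH').add (hprim _ _ hbh)
  have hNi' : IntegrableOn N (Icc s t) :=
    Integrable.of_bound hNm C (ae_restrict_of_forall_mem measurableSet_Icc hC)
  have hNi : IntegrableOn N (Ico s t) := hNi'.mono_set Ico_subset_Icc_self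
  obtain ⟨c, hc⟩ := ae_eq_const_of_integral_deriv_smul_eq_zero hst (hh.sub hNi) fun q hq => by
    have h1 := hq.integral_deriv_smul hst.le hNeq hMH' hbh
    simp only [Pi.sub_apply, smul_sub]
    rw [integral_sub (hq.deriv.integrableOn_smul hh) (hq.deriv.integrableOn_smul hNi), hweak q hq,
      h1, sub_self]
  have hae : ∀ᵐ y ∂volume.restrict (Ico s t), h y = c + N y := by
    filter_upwards [hc] with y hy
    rw [← hy, Pi.sub_apply, sub_add_cancel]
  have hae' : ∀ y ∈ Icc s t, ∀ᵐ r ∂volume.restrict (Ico s y), h r = c + N r := fun y hy =>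
    ae_restrict_of_ae_restrict_of_subset (hI y hy) hae
  -- The bounded left-continuous representative c + N replaces h; the integrals of h against
  -- Lebesgue measure do not change.
  refine ⟨fun y => c + N y, aestronglyMeasurable_const.add hNm, ⟨‖c‖ + C, fun y hy =>
    (norm_add_le _ _).trans (by gcongr; exact hC y hy)⟩, fun y hy => ?_, fun y hy => ?_⟩
  · rw [hH y hy, integral_congr_ae (hae' y hy)]
  · have e : ∫ r in Ico s y, (-(2 * Complex.I * L.b r)) • M (h r) =
        ∫ r in Ico s y, (-(2 * Complex.I * L.b r)) • M (c + N r) := by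
      refine integral_congr_ae ?_
      filter_upwards [hae' y hy] with r hr
      rw [hr]
    rw [hNs, add_zero, add_assoc, ← e]

end Hilbert

/-! ### Calculus of multiplication operators -/

/-- Dominated convergence for the squared difference, which is at most (2D)². The first form serves
the normal derivative, the second the strong continuity of multipliers. -/
theorem tendsto_toL2_of_dominated {ι : Type*} {l : Filter ι} [l.IsCountablyGenerated]
    {Φ : ι → ℝ → ℂ} {Φ₀ : ℝ → ℂ} {D : ℝ → ℝ} (hD : MemLp D 2 volume)
    (hΦ : ∀ i, Measurable (Φ i)) (hle : ∀ᶠ i in l, ∀ᵐ x, ‖Φ i x‖ ≤ D x)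
    (hΦ₀ : Measurable Φ₀) (hle₀ : ∀ᵐ x, ‖Φ₀ x‖ ≤ D x)
    (hlim : ∀ᵐ x, Tendsto (fun i => Φ i x) l (𝓝 (Φ₀ x))) :
    Tendsto (fun i => eLpNorm (fun x => Φ i x - Φ₀ x) 2 volume) l (𝓝 0) ∧
      Tendsto (fun i => toL2 (Φ i)) l (𝓝 (toL2 Φ₀)) := by
  have hlint : Tendsto (fun i => ∫⁻ x, ‖Φ i x - Φ₀ x‖ₑ ^ 2) l (𝓝 (∫⁻ _ : ℝ, 0)) := by
    have hD2 : ∫⁻ x, (2 * ‖D x‖ₑ) ^ 2 ≠ ⊤ := by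
      have h1 : MemLp (fun x => ((2 * D x : ℝ) : ℂ)) 2 volume := (hD.const_mul 2).ofReal
      have h2 := h1.2
      rw [eLpNorm_two_eq] at h2
      have h3 := (ENNReal.rpow_lt_top_iff_of_pos (by norm_num)).1 h2
      refine (lt_of_le_of_lt (le_of_eq ?_) h3).ne
      refine lintegral_congr fun x => ?_
      congr 1
      rw [← ofReal_norm, ← ofReal_norm, Complex.norm_real, norm_mul, ENNReal.ofReal_mul (by simp)]
      simp
    refine tendsto_lintegral_filter_of_dominated_convergence (fun x => (2 * ‖D x‖ₑ) ^ 2) ?_ ?_ hD2 ?_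
    · filter_upwards with i
      exact ((hΦ i).sub hΦ₀).enorm.pow_const 2
    · filter_upwards [hle] with i hi
      filter_upwards [hi, hle₀] with x h1 h2
      refine pow_le_pow_left' ?_ 2
      have h3 : ‖Φ i x - Φ₀ x‖ ≤ 2 * ‖D x‖ := by
        refine (norm_sub_le _ _).trans ?_
        have := le_abs_self (D x)
        rw [Real.norm_eq_abs]
        linarith
      rw [← ofReal_norm, ← ofReal_norm, ← ENNReal.ofReal_ofNat 2, ← ENNReal.ofReal_mul (by simp)]
      exact ENNReal.ofReal_le_ofReal h3
    · filter_upwards [hlim] with x hx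
      have h1 : Tendsto (fun i => Φ i x - Φ₀ x) l (𝓝 0) := by
        simpa using hx.sub_const (Φ₀ x)
      have h2 := (ENNReal.continuous_pow 2).tendsto _ |>.comp ((continuous_enorm.tendsto _).comp h1)
      simpa [Function.comp_def] using h2
  have h1 : Tendsto (fun i => eLpNorm (fun x => Φ i x - Φ₀ x) 2 volume) l (𝓝 0) := by
    simp only [eLpNorm_two_eq]
    rw [lintegral_zero] at hlint
    have := (ENNReal.continuous_rpow_const (y := (1 / 2 : ℝ))).tendsto 0 |>.comp hlint
    simpa [Function.comp_def] using this
  refine ⟨h1, ?_⟩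
  rw [tendsto_iff_edist_tendsto_0]
  have hm₀ : MemLp Φ₀ 2 volume := hD.mono hΦ₀.aestronglyMeasurable (by
    filter_upwards [hle₀] with x hx using hx.trans (le_abs_self _))
  refine h1.congr' ?_
  filter_upwards [hle] with i hi
  have hm : MemLp (Φ i) 2 volume := hD.mono (hΦ i).aestronglyMeasurable (by
    filter_upwards [hi] with x hx using hx.trans (le_abs_self _))
  rw [edist_eq_enorm_sub, enorm_toL2_sub hm hm₀]

theorem tendsto_mulL2 {ι : Type*} {l : Filter ι} [l.IsCountablyGenerated] {m : ι → ℝ → ℂ}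
    {m₀ : ℝ → ℂ} {C : ℝ} (hm : ∀ i, Measurable (m i)) (hC : ∀ i x, ‖m i x‖ ≤ C)
    (hm₀ : Measurable m₀) (hC₀ : ∀ x, ‖m₀ x‖ ≤ C) (f : L2R)
    (hlim : ∀ x, Tendsto (fun i => m i x) l (𝓝 (m₀ x))) :
    Tendsto (fun i => mulL2 (m i) f) l (𝓝 (mulL2 m₀ f)) := by
  have h := (tendsto_toL2_of_dominated (l := l) (Φ := fun i x => m i x * f x)
    (Φ₀ := fun x => m₀ x * f x) (D := fun x => C * ‖f x‖) ((Lp.memLp f).norm.const_mul C)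
    (fun i => (hm i).mul (Lp.stronglyMeasurable f).measurable)
    (Eventually.of_forall fun i => ae_of_all _ fun x => by
      rw [norm_mul]; exact mul_le_mul_of_nonneg_right (hC i x) (norm_nonneg _))
    (hm₀.mul (Lp.stronglyMeasurable f).measurable)
    (ae_of_all _ fun x => by
      rw [norm_mul]; exact mul_le_mul_of_nonneg_right (hC₀ x) (norm_nonneg _))
    (ae_of_all _ fun x => (hlim x).mul_const _)).2
  rw [mulL2_apply ⟨hm₀, C, hC₀⟩]
  refine h.congr fun i => ?_
  rw [mulL2_apply ⟨hm i, C, hC i⟩]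

theorem mulL2_add {m m' : ℝ → ℂ} (h : IsBddMeas m) (h' : IsBddMeas m') (f : L2R) :
    mulL2 (fun x => m x + m' x) f = mulL2 m f + mulL2 m' f := by
  have h2 : IsBddMeas fun x => m x + m' x := by
    obtain ⟨h, C, hC⟩ := h
    obtain ⟨h', C', hC'⟩ := h'
    exact ⟨h.add h', C + C', fun x => (norm_add_le _ _).trans (add_le_add (hC x) (hC' x))⟩
  refine Lp.ext ?_
  filter_upwards [coeFn_mulL2 h f, coeFn_mulL2 h' f, coeFn_mulL2 h2 f,
    Lp.coeFn_add (mulL2 m f) (mulL2 m' f)] with x h1 h2 h3 h4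
  rw [h3, h4, Pi.add_apply, h1, h2, add_mul]

theorem mulL2_const_mul {m : ℝ → ℂ} (h : IsBddMeas m) (c : ℂ) (f : L2R) :
    mulL2 (fun x => c * m x) f = c • mulL2 m f := by
  have h2 : IsBddMeas fun x => c * m x := IsBddMeas.mul ⟨measurable_const, ‖c‖, fun _ => le_rfl⟩ h
  refine Lp.ext ?_
  filter_upwards [coeFn_mulL2 h f, coeFn_mulL2 h2 f, Lp.coeFn_smul c (mulL2 m f)] with x h1 h2 h3
  rw [h2, h3, Pi.smul_apply, h1, smul_eq_mul, mul_assoc]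

/-- Integration of a family of multiplication operators. -/
theorem integral_mulL2 {m : ℝ → ℝ → ℂ} (hm : Measurable fun p : ℝ × ℝ => m p.1 p.2)
    {μ : Measure ℝ} [SFinite μ] {C : ℝ → ℝ} (hC : Integrable C μ)
    (hmC : ∀ᵐ y ∂μ, ∀ x, ‖m x y‖ ≤ C y) (f : L2R) :
    Integrable (fun y => mulL2 (fun x => m x y) f) μ ∧ IsBddMeas (fun x => ∫ y, m x y ∂μ) ∧
    ∫ y, mulL2 (fun x => m x y) f ∂μ = mulL2 (fun x => ∫ y, m x y ∂μ) f := by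
  have hbdd : ∀ᵐ y ∂μ, IsBddMeas fun x => m x y := by
    filter_upwards [hmC] with y hy using ⟨measurable_slice hm y, C y, hy⟩
  have hΦ : Measurable fun p : ℝ × ℝ => m p.1 p.2 * f p.1 :=
    hm.mul ((Lp.stronglyMeasurable f).measurable.comp measurable_fst)
  have hint : Integrable (fun y => mulL2 (fun x => m x y) f) μ := by
    refine Integrable.mono' (hC.mul_const ‖f‖) ?_ ?_
    · refine (stronglyMeasurable_toL2 (Φ := fun x y => m x y * f x) hΦ).aestronglyMeasurable.congr ?_
      filter_upwards [hbdd] with y hy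
      rw [mulL2_apply hy]
    · filter_upwards [hmC] with y hy
      exact norm_mulL2_apply_le (measurable_slice hm y) hy f
  have hb : IsBddMeas fun x => ∫ y, m x y ∂μ := by
    refine ⟨(hm.stronglyMeasurable.integral_prod_right' (ν := μ)).measurable, ∫ y, C y ∂μ,
      fun x => ?_⟩
    refine norm_integral_le_of_norm_le hC ?_
    filter_upwards [hmC] with y hy using hy x
  refine ⟨hint, hb, ?_⟩
  refine integral_toL2_eq (Φ := fun x y => m x y * f x) hΦ hint ?_ ?_
  · filter_upwards [hbdd] with y hy using coeFn_mulL2 hy f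
  · filter_upwards [coeFn_mulL2 hb f] with x hx
    rw [hx, integral_mul_const]

namespace OperatorL

variable (L : OperatorL)

theorem measurable_B : Measurable L.B := by
  have h : ∀ S : Set (ℝ × ℝ), MeasurableSet S →
      Measurable fun y : ℝ => ∫ r, S.indicator (fun p => L.b p.2) (y, r) := fun S hS =>
    (((L.b_measurable.comp measurable_snd).indicator hS).stronglyMeasurable.integral_prod_right'
      (ν := volume)).measurable
  have h1 := h {p | 0 < p.2 ∧ p.2 ≤ p.1} ((measurableSet_lt measurable_const measurable_snd).inter
    (measurableSet_le measurable_snd measurable_fst))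
  have h2 := h {p | p.1 < p.2 ∧ p.2 ≤ 0} ((measurableSet_lt measurable_fst measurable_snd).inter
    (measurableSet_le measurable_snd measurable_const))
  convert h1.sub h2 using 1
  funext y
  rw [B, intervalIntegral, ← integral_indicator measurableSet_Ioc,
    ← integral_indicator measurableSet_Ioc]
  rfl

theorem measurable_phase : Measurable fun p : ℝ × ℝ => L.phase p.1 p.2 := by
  have := L.measurable_B
  unfold phase
  fun_prop

/-! ### Frequency truncation -/

/-- The set of frequencies `η` such that both `2πη` and the symbol at `2πη` are at most `N`. -/
def cut (N : ℕ) : Set ℝ := {η | |2 * Real.pi * η| ≤ N ∧ ‖L.symbol (2 * Real.pi * η)‖ ≤ N}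

theorem measurableSet_cut (N : ℕ) : MeasurableSet (L.cut N) := by
  have := L.measurable_symbol
  have h1 : Measurable fun η : ℝ => |2 * Real.pi * η| := by fun_prop
  have h2 : Measurable fun η : ℝ => ‖L.symbol (2 * Real.pi * η)‖ := by fun_prop
  exact (measurableSet_le h1 measurable_const).inter (measurableSet_le h2 measurable_const)

/-- Truncation of a function of the frequency. -/
def trunc (N : ℕ) (m : ℝ → ℂ) : ℝ → ℂ := (L.cut N).indicator m

variable {L}

theorem isBddMeas_trunc {N : ℕ} {m : ℝ → ℂ} (hm : Measurable m) {C : ℝ}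
    (hC : ∀ η ∈ L.cut N, ‖m η‖ ≤ C) : IsBddMeas (L.trunc N m) := by
  refine ⟨hm.indicator (L.measurableSet_cut N), max C 0, fun η => ?_⟩
  by_cases h : η ∈ L.cut N
  · rw [trunc, indicator_of_mem h]
    exact (hC η h).trans (le_max_left _ _)
  · rw [trunc, indicator_of_notMem h]
    simp

theorem norm_freq_le {N : ℕ} {η : ℝ} (h : η ∈ L.cut N) : ‖((2 * Real.pi * η : ℝ) : ℂ)‖ ≤ N := by
  rw [Complex.norm_real]
  exact h.1

variable (L)

/-- The projection onto the truncated frequencies. -/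
def cutL2 (N : ℕ) : L2R →L[ℂ] L2R := mulL2 (L.trunc N fun _ => 1)

/-- The operator of multiplication by the frequency `2πη`, truncated. -/
def freqL2 (N : ℕ) : L2R →L[ℂ] L2R := mulL2 (L.trunc N fun η => ((2 * Real.pi * η : ℝ) : ℂ))

theorem isBddMeas_cut (N : ℕ) : IsBddMeas (L.trunc N fun _ => 1) :=
  isBddMeas_trunc measurable_const (C := 1) (by simp)

theorem isBddMeas_freq (N : ℕ) :
    IsBddMeas (L.trunc N fun η => ((2 * Real.pi * η : ℝ) : ℂ)) :=
  isBddMeas_trunc (by fun_prop) fun _ h => norm_freq_le h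

theorem freqL2_symm (N : ℕ) (x y : L2R) :
    inner ℂ (L.freqL2 N x) y = inner ℂ x (L.freqL2 N y) := by
  rw [freqL2, inner_mulL2_left (L.isBddMeas_freq N)]
  congr 3
  funext η
  simp only [trunc, indicator]
  split_ifs
  · rw [Complex.conj_ofReal]
  · simp

theorem freqL2_mulL2 (N : ℕ) {m : ℝ → ℂ} (hm : IsBddMeas (L.trunc N m)) (f : L2R) :
    L.freqL2 N (mulL2 (L.trunc N m) f) =
      mulL2 (L.trunc N fun η => ((2 * Real.pi * η : ℝ) : ℂ) * m η) f := by
  rw [freqL2, mulL2_mulL2 (L.isBddMeas_freq N) hm]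
  congr 2
  funext η
  simp only [trunc, indicator]
  split_ifs <;> simp

variable {L}

/-- The truncated Weyl solutions form a solution with values in `L²(ℝ)`. -/
theorem solvesOn_weyl_mulL2 (N : ℕ) (f : L2R) {t : ℝ} (ht : t ∈ L.dom) :
    L.SolvesOn (L.freqL2 N)
      (fun y => mulL2 (L.trunc N fun η => L.weyl (2 * Real.pi * η, y)) f)
      (fun y => mulL2 (L.trunc N fun η => L.dweyl (2 * Real.pi * η, y)) f) 0 t := by
  have hmw := L.measurable_weyl
  have hmd := L.measurable_dweyl
  have hb0 := L.b_measurable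
  have hN : (0 : ℝ) ≤ N := N.cast_nonneg
  have hw : ∀ η, ∀ y ∈ Icc 0 t, ‖L.weyl (2 * Real.pi * η, y)‖ ≤ 1 := fun η y hy =>
    norm_weyl_le_one _ (Icc_subset_dom le_rfl ht hy)
  -- This is the reason for cutting off the symbol as well as the frequency: |φ'| ≤ |k| ≤ N
  -- uniformly in η and y.
  have hd : ∀ η ∈ L.cut N, ∀ y ∈ Icc 0 t, ‖L.dweyl (2 * Real.pi * η, y)‖ ≤ N := fun η hη y hy =>
    (norm_dweyl_le _ (Icc_subset_dom le_rfl ht hy)).trans hη.2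
  have bw : ∀ y ∈ Icc 0 t, IsBddMeas (L.trunc N fun η => L.weyl (2 * Real.pi * η, y)) :=
    fun y hy => isBddMeas_trunc (by fun_prop) fun η _ => hw η y hy
  have bd : ∀ y ∈ Icc 0 t, IsBddMeas (L.trunc N fun η => L.dweyl (2 * Real.pi * η, y)) :=
    fun y hy => isBddMeas_trunc (by fun_prop) fun η hη => hd η hη y hy
  have hcutm : MeasurableSet {p : ℝ × ℝ | p.1 ∈ L.cut N} := measurable_fst (L.measurableSet_cut N)
  have hjoint : ∀ m : ℝ → ℝ → ℂ, (Measurable fun p : ℝ × ℝ => m p.1 p.2) →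
      Measurable fun p : ℝ × ℝ => L.trunc N (fun η => m η p.2) p.1 := fun m hm => by
    have : (fun p : ℝ × ℝ => L.trunc N (fun η => m η p.2) p.1) =
        {p : ℝ × ℝ | p.1 ∈ L.cut N}.indicator fun p => m p.1 p.2 := by
      funext p
      by_cases h : p.1 ∈ L.cut N <;> simp [trunc, indicator, h]
    rw [this]
    exact hm.indicator hcutm
  have hbound : ∀ (m : ℝ → ℝ → ℂ) (C : ℝ → ℝ), (∀ y, 0 ≤ C y) →
      (∀ η ∈ L.cut N, ∀ y ∈ Icc 0 t, ‖m η y‖ ≤ C y) → ∀ y ∈ Icc 0 t, ∀ η,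
      ‖L.trunc N (fun η => m η y) η‖ ≤ C y := fun m C hC h y hy η => by
    by_cases hη : η ∈ L.cut N
    · rw [trunc, indicator_of_mem hη]
      exact h η hη y hy
    · rw [trunc, indicator_of_notMem hη, norm_zero]
      exact hC y
  have hfin : IsFiniteMeasure (L.a.restrict (Icc 0 t)) := ⟨by
    rw [Measure.restrict_apply_univ]; exact a_Icc_lt_top le_rfl ht⟩
  -- Truncation commutes with integration in r, so the Bochner integral of the multipliers is the
  -- multiplier by the pointwise integral. The three uses below are the three integrals of the
  -- equation.
  have key : ∀ (m : ℝ → ℝ → ℂ) (C : ℝ → ℝ) (μ : Measure ℝ) [SFinite μ],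
      (Measurable fun p : ℝ × ℝ => m p.1 p.2) → (∀ y, 0 ≤ C y) → IntegrableOn C (Icc 0 t) μ →
      (∀ η ∈ L.cut N, ∀ y ∈ Icc 0 t, ‖m η y‖ ≤ C y) → ∀ y ∈ Icc 0 t,
      IsBddMeas (L.trunc N fun η => ∫ r in Ico 0 y, m η r ∂μ) ∧
      ∫ r in Ico 0 y, mulL2 (L.trunc N fun η => m η r) f ∂μ =
        mulL2 (L.trunc N fun η => ∫ r in Ico 0 y, m η r ∂μ) f := by
    intro m C μ _ hm hC0 hCi hmC y hy
    have hsub : Ico 0 y ⊆ Icc 0 t := Ico_subset_Icc_self.trans (Icc_subset_Icc_right hy.2)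
    have e : (fun η => ∫ r in Ico 0 y, L.trunc N (fun η => m η r) η ∂μ) =
        L.trunc N fun η => ∫ r in Ico 0 y, m η r ∂μ := by
      funext η
      by_cases h : η ∈ L.cut N <;> simp [trunc, indicator, h]
    have := (integral_mulL2 (m := fun η r => L.trunc N (fun η => m η r) η) (hjoint m hm)
      (hCi.mono_set hsub) (ae_restrict_of_forall_mem measurableSet_Ico fun r hr =>
        hbound m C hC0 hmC r (hsub hr)) f).2
    rw [e] at this
    exact this
  have key1 := key (fun η r => L.dweyl (2 * Real.pi * η, r)) (fun _ => N) volume (by fun_prop)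
    (fun _ => hN) (by simp) hd
  have key2 := key (fun η r => ((2 * Real.pi * η : ℝ) : ℂ) *
      (((2 * Real.pi * η : ℝ) : ℂ) * L.weyl (2 * Real.pi * η, r))) (fun _ => N * (N * 1)) L.a
    (by fun_prop) (fun _ => by positivity) (integrable_const _) fun η hη y hy => by
      rw [norm_mul, norm_mul]
      gcongr
      · exact norm_freq_le hη
      · exact norm_freq_le hη
      · exact hw η y hy
  have key3 := key (fun η r => (-(2 * Complex.I * L.b r)) * (((2 * Real.pi * η : ℝ) : ℂ) *
      L.dweyl (2 * Real.pi * η, r))) (fun r => (2 * |L.b r|) * (N * N)) volume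
    (by fun_prop) (fun _ => by positivity)
    (((integrableOn_b le_rfl ht).abs.const_mul 2).mul_const _) fun η hη y hy => by
      rw [norm_mul, norm_mul, norm_neg, norm_mul, norm_mul, Complex.norm_I, Complex.norm_real,
        Complex.norm_ofNat, mul_one, Real.norm_eq_abs]
      gcongr
      · exact norm_freq_le hη
      · exact hd η hη y hy
  refine ⟨?_, ⟨N * ‖f‖, fun y hy => ?_⟩, fun y hy => ?_, fun y hy => ?_⟩
  · have hm := stronglyMeasurable_toL2
      (Φ := fun η y => L.trunc N (fun η => L.dweyl (2 * Real.pi * η, y)) η * f η)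
      ((hjoint (fun η y => L.dweyl (2 * Real.pi * η, y)) (by fun_prop)).mul ((Lp.stronglyMeasurable f).measurable.comp measurable_fst))
    refine hm.aestronglyMeasurable.congr (ae_restrict_of_forall_mem measurableSet_Icc fun y hy => ?_)
    exact (mulL2_apply (bd y hy) f).symm
  · exact norm_mulL2_apply_le (bd y hy).1
      (hbound (fun η y => L.dweyl (2 * Real.pi * η, y)) (fun _ => N) (fun _ => hN) hd y hy) f
  · rw [(key1 y hy).2, ← mulL2_add (bw 0 ⟨le_rfl, ht.1⟩) (key1 y hy).1]
    congr 2
    funext η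
    by_cases h : η ∈ L.cut N
    · simpa [trunc, indicator, h] using (solvesOn_weyl (2 * Real.pi * η) ht).eq_fst y hy
    · simp [trunc, indicator, h]
  · have e2 : ∫ r in Ico 0 y, L.freqL2 N (L.freqL2 N
        (mulL2 (L.trunc N fun η => L.weyl (2 * Real.pi * η, r)) f)) ∂L.a = _ :=
      Eq.trans (setIntegral_congr_fun measurableSet_Ico fun r hr => by
        have hr' : r ∈ Icc 0 t := ⟨hr.1, hr.2.le.trans hy.2⟩
        rw [L.freqL2_mulL2 N (bw r hr'), L.freqL2_mulL2 N]
        refine isBddMeas_trunc (by fun_prop) (C := N * 1) fun η hη => ?_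
        rw [norm_mul]
        gcongr
        · exact norm_freq_le hη
        · exact hw η r hr') (key2 y hy).2
    have e3 : ∫ r in Ico 0 y, (-(2 * Complex.I * L.b r)) • L.freqL2 N
        (mulL2 (L.trunc N fun η => L.dweyl (2 * Real.pi * η, r)) f) = _ :=
      Eq.trans (setIntegral_congr_fun measurableSet_Ico fun r hr => by
        have hr' : r ∈ Icc 0 t := ⟨hr.1, hr.2.le.trans hy.2⟩
        have hbb : IsBddMeas (L.trunc N fun η =>
            ((2 * Real.pi * η : ℝ) : ℂ) * L.dweyl (2 * Real.pi * η, r)) := by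
          refine isBddMeas_trunc (by fun_prop) (C := N * N) fun η hη => ?_
          rw [norm_mul]
          gcongr
          · exact norm_freq_le hη
          · exact hd η hη r hr'
        rw [L.freqL2_mulL2 N (bd r hr'), ← mulL2_const_mul hbb]
        congr 2
        funext η
        by_cases h : η ∈ L.cut N <;> simp [trunc, indicator, h]) (key3 y hy).2
    rw [e2, e3, ← mulL2_add (bd 0 ⟨le_rfl, ht.1⟩) (key2 y hy).1,
      ← mulL2_add ?_ (key3 y hy).1]
    · congr 2
      funext η
      by_cases h : η ∈ L.cut N
      · have := (solvesOn_weyl (2 * Real.pi * η) ht).eq_snd y hy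
        simp only [mulC_apply, smul_eq_mul] at this
        simp only [trunc, indicator, h, if_true]
        rw [this]
      · simp [trunc, indicator, h]
    · obtain ⟨h1, C1, hC1⟩ := bd 0 ⟨le_rfl, ht.1⟩
      obtain ⟨h2, C2, hC2⟩ := (key2 y hy).1
      exact ⟨h1.add h2, C1 + C2, fun η => (norm_add_le _ _).trans (add_le_add (hC1 η) (hC2 η))⟩

end OperatorL

/-! ### Slices of functions of two variables -/

/-- Uniform boundedness of the multipliers together with strong convergence allows both the
multiplier and its argument to vary. -/
theorem continuousOn_mulL2 {S : Set ℝ} {m : ℝ → ℝ → ℂ} {C : ℝ} (hm : ∀ y, Measurable (m y))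
    (hC : ∀ y x, ‖m y x‖ ≤ C) (hlim : ∀ x, ContinuousOn (fun y => m y x) S) {F : ℝ → L2R}
    (hF : ContinuousOn F S) : ContinuousOn (fun y => mulL2 (m y) (F y)) S := by
  intro z hz
  have h1 : Tendsto (fun y => mulL2 (m y) (F z)) (𝓝[S] z) (𝓝 (mulL2 (m z) (F z))) :=
    tendsto_mulL2 hm hC (hm z) (hC z) (F z) fun x => hlim x z hz
  have h2 : Tendsto (fun y => mulL2 (m y) (F y - F z)) (𝓝[S] z) (𝓝 0) := by
    refine squeeze_zero_norm (fun y => norm_mulL2_apply_le (hm y) (hC y) _) ?_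
    have := (tendsto_iff_norm_sub_tendsto_zero.1 (hF z hz)).const_mul C
    simpa using this
  have := h1.add h2
  rw [add_zero] at this
  refine this.congr fun y => ?_
  rw [map_sub, add_sub_cancel]

/-- The operators act continuously on the argument and depend measurably on y for a fixed argument,
so the composition is measurable (Carathéodory). -/
theorem stronglyMeasurable_mulL2 {m : ℝ → ℝ → ℂ} {C : ℝ}
    (hm : Measurable fun p : ℝ × ℝ => m p.1 p.2) (hC : ∀ x y, ‖m x y‖ ≤ C) {F : ℝ → L2R}
    (hF : StronglyMeasurable F) : StronglyMeasurable fun y => mulL2 (fun x => m x y) (F y) := by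
  have : SecondCountableTopology L2R := by
    have : Fact ((2 : ℝ≥0∞) ≠ ⊤) := ⟨by simp⟩
    infer_instance
  borelize L2R
  have h := stronglyMeasurable_uncurry_of_continuous_of_stronglyMeasurable
    (u := fun (c : L2R) (y : ℝ) => mulL2 (fun x => m x y) c)
    (fun y => (mulL2 fun x => m x y).continuous) fun c => by
      have := stronglyMeasurable_toL2 (Φ := fun x y => m x y * c x)
        (hm.mul ((Lp.stronglyMeasurable c).measurable.comp measurable_fst))
      convert! this using 2 with y
      exact mulL2_apply ⟨measurable_slice hm y, C, fun x => hC x y⟩ c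
  exact h.comp_measurable (hF.measurable.prodMk measurable_id)

/-- The slice `u(·, y)`, as an element of `L²(ℝ)`. -/
def slice (u : ℝ → ℝ → ℂ) (y : ℝ) : L2R := toL2 fun x => u x y

/-- The Fourier transform of the slice `u(·, y)`. -/
def fslice (u : ℝ → ℝ → ℂ) (y : ℝ) : L2R := 𝓕 (slice u y)

theorem continuous_fourierL2 : Continuous fun f : L2R => (𝓕 f : L2R) :=
  (Lp.fourierTransformₗᵢ ℝ ℂ).continuous

theorem norm_fslice (u : ℝ → ℝ → ℂ) (y : ℝ) : ‖fslice u y‖ = ‖slice u y‖ := Lp.norm_fourier_eq _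

theorem stronglyMeasurable_slice {u : ℝ → ℝ → ℂ} (hu : Measurable fun p : ℝ × ℝ => u p.1 p.2) :
    StronglyMeasurable (slice u) := stronglyMeasurable_toL2 hu

theorem stronglyMeasurable_fslice {u : ℝ → ℝ → ℂ} (hu : Measurable fun p : ℝ × ℝ => u p.1 p.2) :
    StronglyMeasurable (fslice u) :=
  continuous_fourierL2.comp_stronglyMeasurable (stronglyMeasurable_slice hu)

/-- The functional `f ↦ ∫ f(η) p̌(η) dη`. -/
def pairF (p : ℝ → ℂ) : L2R →L[ℂ] ℂ := innerSL ℂ (toL2 fun η => conj (invFT p η))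

theorem pairF_apply {p : ℝ → ℂ} (hp : ContDiff ℝ ∞ p) (hc : HasCompactSupport p) (f : L2R) :
    pairF p f = ∫ η, f η * invFT p η := by
  rw [integral_mul_eq_inner f (memLp_invFT hp hc)]
  rfl

theorem integral_slice_mul {u : ℝ → ℝ → ℂ} {y : ℝ} (hu : MemLp (fun x => u x y) 2 volume)
    {p : ℝ → ℂ} (hp : ContDiff ℝ ∞ p) (hc : HasCompactSupport p) :
    ∫ x, u x y * p x = pairF p (fslice u y) := by
  rw [pairF_apply hp hc, fslice, ← integral_mul_test _ hp hc]
  refine integral_congr_ae ?_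
  filter_upwards [coeFn_toL2 hu] with x hx
  rw [slice, hx]

/-- The multiplier of the translation by `c`. -/
def transL2 (c : ℝ) : L2R →L[ℂ] L2R :=
  mulL2 fun η => Complex.exp (((2 * Real.pi * η : ℝ) : ℂ) * c * Complex.I)

theorem isBddMeas_trans (c : ℝ) :
    IsBddMeas fun η : ℝ => Complex.exp (((2 * Real.pi * η : ℝ) : ℂ) * c * Complex.I) :=
  ⟨by fun_prop, 1, fun η => by beta_reduce; rw [← Complex.ofReal_mul, Complex.norm_exp_ofReal_mul_I]⟩

theorem contDiff_comp_sub {p : ℝ → ℂ} (hp : ContDiff ℝ ∞ p) (c : ℝ) :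
    ContDiff ℝ ∞ fun x => p (x - c) := hp.comp (contDiff_id.sub contDiff_const)

theorem hasCompactSupport_comp_sub {p : ℝ → ℂ} (hp : HasCompactSupport p) (c : ℝ) :
    HasCompactSupport fun x => p (x - c) := hp.comp_homeomorph (Homeomorph.subRight c)

theorem pairF_comp_sub {p : ℝ → ℂ} (hp : ContDiff ℝ ∞ p) (hc : HasCompactSupport p) (c : ℝ)
    (f : L2R) : pairF (fun x => p (x - c)) f = pairF p (transL2 c f) := by
  rw [pairF_apply hp hc, pairF_apply (contDiff_comp_sub hp c) (hasCompactSupport_comp_sub hc c)]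
  refine integral_congr_ae ?_
  filter_upwards [coeFn_mulL2 (isBddMeas_trans c) f] with η hη
  rw [transL2, hη, invFT_sub_right]
  ring

theorem integral_slice_translate_mul {u : ℝ → ℝ → ℂ} {y : ℝ}
    (hu : MemLp (fun x => u x y) 2 volume) {p : ℝ → ℂ} (hp : ContDiff ℝ ∞ p)
    (hc : HasCompactSupport p) (c : ℝ) :
    ∫ x, u (x + c) y * p x = pairF p (transL2 c (fslice u y)) := by
  rw [← pairF_comp_sub hp hc,
    ← integral_slice_mul hu (contDiff_comp_sub hp c) (hasCompactSupport_comp_sub hc c),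
    ← integral_add_right_eq_self (μ := volume) (fun x : ℝ => u x y * p (x - c)) c]
  simp

/-- The transforms of test functions separate points of L²: the case of the weighted statement in
which the coefficients of η and η² vanish. -/
theorem eq_zero_of_pairF_eq_zero {G : L2R}
    (h : ∀ p : ℝ → ℂ, ContDiff ℝ ∞ p → HasCompactSupport p → pairF p G = 0) : G = 0 := by
  have h0 : ∀ᵐ η : ℝ, ((0 : L2R) : ℝ → ℂ) η = 0 := Lp.coeFn_zero ℂ 2 volume
  have := ae_eq_zero_of_integral_mul_invFT_eq_zero G 0 0 fun p hp hc => by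
    rw [← h p hp hc, pairF_apply hp hc]
    refine integral_congr_ae ?_
    filter_upwards [h0] with η hη
    rw [hη]
    ring
  refine Lp.ext ?_
  filter_upwards [this, h0] with η h1 h2
  rw [h2] at h1 ⊢
  simpa using h1

theorem integrable_mul_memLp (f : L2R) {q : ℝ → ℂ} (hq : MemLp q 2 volume) :
    Integrable fun η => f η * q η := by
  refine (integrable_conj_mul (toL2 fun x => conj (q x)) f).congr ?_
  filter_upwards [coeFn_toL2 (g := fun x => conj (q x)) hq.star] with x hx
  rw [hx, Complex.conj_conj, mul_comm]

/-- An identity in the frequency domain follows from the corresponding identity tested with smooth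
functions. -/
theorem ae_eq_zero_of_pairF {G₀ G₁ G₂ : L2R} (h : ∀ p : ℝ → ℂ, ContDiff ℝ ∞ p →
    HasCompactSupport p → pairF (deriv (deriv p)) G₂ - 2 * pairF (deriv p) G₁ + pairF p G₀ = 0) :
    ∀ᵐ η : ℝ, G₀ η + 2 * Complex.I * (((2 * Real.pi * η : ℝ) : ℂ) * G₁ η) -
      ((2 * Real.pi * η : ℝ) : ℂ) * (((2 * Real.pi * η : ℝ) : ℂ) * G₂ η) = 0 := by
  have c1 := Lp.coeFn_smul (4 * (Real.pi : ℂ) * Complex.I) G₁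
  have c2 := Lp.coeFn_smul (-(4 * (Real.pi : ℂ) ^ 2)) G₂
  have key := ae_eq_zero_of_integral_mul_invFT_eq_zero G₀ ((4 * (Real.pi : ℂ) * Complex.I) • G₁)
    ((-(4 * (Real.pi : ℂ) ^ 2)) • G₂) fun p hp hc => by
    have hp1 := contDiff_deriv_infty hp
    have h1 := h p hp hc
    rw [pairF_apply (contDiff_deriv_infty hp1) hc.deriv.deriv, pairF_apply hp1 hc.deriv,
      pairF_apply hp hc, ← integral_const_mul, ← integral_sub, ← integral_add] at h1
    · rw [← h1]
      refine integral_congr_ae ?_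
      filter_upwards [c1, c2] with η h1 h2
      rw [h1, h2, invFT_deriv_test hp1 hc.deriv, invFT_deriv_test hp hc]
      simp only [Pi.smul_apply, smul_eq_mul]
      push_cast
      ring_nf
      simp only [Complex.I_sq]
      ring
    · exact (integrable_mul_memLp G₂ (memLp_invFT (contDiff_deriv_infty hp1) hc.deriv.deriv)).sub
        ((integrable_mul_memLp G₁ (memLp_invFT hp1 hc.deriv)).const_mul 2)
    · exact integrable_mul_memLp G₀ (memLp_invFT hp hc)
    · exact integrable_mul_memLp G₂ (memLp_invFT (contDiff_deriv_infty hp1) hc.deriv.deriv)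
    · exact (integrable_mul_memLp G₁ (memLp_invFT hp1 hc.deriv)).const_mul 2
  filter_upwards [key, c1, c2] with η h1 h2 h3
  rw [h2, h3] at h1
  rw [← h1]
  simp only [Pi.smul_apply, smul_eq_mul]
  push_cast
  ring

namespace OperatorL

variable {L : OperatorL}

theorem isTest_mul {p : ℝ → ℂ} (hp : ContDiff ℝ ∞ p) (hc : HasCompactSupport p) {q : ℝ → ℝ}
    {s t : ℝ} (hq : IsTestOn q s t) (hs : 0 ≤ s) (ht : t ∈ L.dom) :
    L.IsTest fun x y => p x * (q y : ℂ) := by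
  have hsub : tsupport (fun z : ℝ × ℝ => p z.1 * (q z.2 : ℂ)) ⊆ tsupport p ×ˢ tsupport q := by
    refine closure_minimal (fun z hz => ?_) ((isClosed_tsupport p).prod (isClosed_tsupport q))
    refine ⟨subset_tsupport p fun h => hz (by simp [h]), subset_tsupport q fun h => hz (by simp [h])⟩
  refine ⟨?_, ?_, hsub.trans ?_⟩
  · exact (hp.comp contDiff_fst).mul
      (Complex.ofRealCLM.contDiff.comp (hq.smooth.comp contDiff_snd))
  · exact (hc.isCompact.prod hq.compact.isCompact).of_isClosed_subset (isClosed_tsupport _) hsub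
  · intro z hz
    have := hq.supp hz.2
    exact ⟨trivial, hs.trans_lt this.1, (mem_dom_of_le ht (hs.trans this.1.le) this.2.le).2⟩

theorem Ico_subset_int {s t : ℝ} (hs : 0 < s) (ht : t ∈ L.dom) : Ico s t ⊆ L.int := fun _ hy =>
  ⟨hs.trans_le hy.1, (mem_dom_of_le ht (hs.le.trans hy.1) hy.2.le).2⟩

/-- Since F is supported in the open interval, atoms of μ at s or t are harmless. -/
theorem setIntegral_int_eq {s t : ℝ} (hs : 0 < s) (ht : t ∈ L.dom) {μ : Measure ℝ} {F : ℝ → ℂ}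
    (hF : ∀ y, y ∉ Ioo s t → F y = 0) : ∫ y in L.int, F y ∂μ = ∫ y in Ico s t, F y ∂μ :=
  setIntegral_eq_of_subset_of_forall_sdiff_eq_zero L.measurableSet_int (Ico_subset_int hs ht)
    fun _ hy => hF _ fun h => hy.2 (Ioo_subset_Ico_self h)

theorem IsHarmonic.continuousOn_slice {u : ℝ → ℝ → ℂ} (hu : L.IsHarmonic u) :
    ContinuousOn (slice u) L.dom := by
  intro y hy
  rw [ContinuousWithinAt, tendsto_iff_edist_tendsto_0]
  refine (hu.continuous y hy).congr' ?_
  filter_upwards [self_mem_nhdsWithin] with z hz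
  rw [edist_eq_enorm_sub, slice, slice, enorm_toL2_sub (hu.memLp z hz) (hu.memLp y hy)]

theorem IsHarmonic.continuousOn_fslice {u : ℝ → ℝ → ℂ} (hu : L.IsHarmonic u) :
    ContinuousOn (fslice u) L.dom :=
  continuous_fourierL2.comp_continuousOn hu.continuousOn_slice

/-- Square integrable functions have square integrable slices. -/
theorem slice_sq_integrable {w : ℝ → ℝ → ℂ} (hwm : Measurable fun p : ℝ × ℝ => w p.1 p.2)
    (hw : ∀ y₁ y₂ : ℝ, 0 < y₁ → y₁ < y₂ → (y₂ : EReal) < L.R →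
      IntegrableOn (fun p : ℝ × ℝ => ‖w p.1 p.2‖ ^ 2) (univ ×ˢ Ioo y₁ y₂) volume)
    {s t : ℝ} (hs : 0 < s) (hst : s ≤ t) (ht : t ∈ L.dom) :
    (∀ᵐ y ∂volume.restrict (Icc s t), MemLp (fun x => w x y) 2 volume) ∧
      IntegrableOn (fun y => ‖slice w y‖ ^ 2) (Icc s t) := by
  obtain ⟨t', ht', htt'⟩ := exists_gt_mem_dom ht
  have h := hw (s / 2) t' (by linarith) (by linarith) ht'.2
  have hsub : Icc s t ⊆ Ioo (s / 2) t' := fun y hy => ⟨by linarith [hy.1], hy.2.trans_lt htt'⟩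
  rw [IntegrableOn, Measure.volume_eq_prod, ← Measure.prod_restrict, Measure.restrict_univ] at h
  have h1 : ∀ᵐ y ∂volume.restrict (Ioo (s / 2) t'), MemLp (fun x => w x y) 2 volume := by
    filter_upwards [h.prod_left_ae] with y hy
    exact (memLp_two_iff_integrable_sq_norm (measurable_slice hwm y).aestronglyMeasurable).2 hy
  have h2 : IntegrableOn (fun y => ‖slice w y‖ ^ 2) (Ioo (s / 2) t') := by
    refine h.integral_prod_right.congr ?_
    filter_upwards [h1] with y hy
    rw [norm_sq_eq_integral]
    refine integral_congr_ae ?_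
    filter_upwards [coeFn_toL2 hy] with x hx
    rw [slice, hx]
  exact ⟨ae_restrict_of_ae_restrict_of_subset hsub h1, h2.mono_set hsub⟩

end OperatorL

/-! ### Harmonic functions in the frequency domain -/

theorem deriv_const_mul_ofReal {q : ℝ → ℝ} (hq : Differentiable ℝ q) (c : ℂ) :
    deriv (fun y => c * (q y : ℂ)) = fun y => c * ((deriv q y : ℝ) : ℂ) :=
  funext fun y => (((hq y).hasDerivAt.ofReal_comp).const_mul c).deriv

theorem iteratedDeriv_two {q : ℝ → ℂ} : iteratedDeriv 2 q = deriv (deriv q) := by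
  rw [iteratedDeriv_succ, iteratedDeriv_one]

theorem deriv_deriv_mul_const (p : ℝ → ℂ) (c : ℂ) :
    deriv (deriv fun x => p x * c) = fun x => deriv (deriv p) x * c := by
  have : (deriv fun x => p x * c) = fun x => deriv p x * c :=
    funext fun x => deriv_mul_const_field c
  rw [this]
  exact funext fun x => deriv_mul_const_field c

namespace OperatorL

variable {L : OperatorL} {u w : ℝ → ℝ → ℂ} {s t : ℝ}

theorem integrableOn_fslice_w (hwm : Measurable fun p : ℝ × ℝ => w p.1 p.2)
    (hw : ∀ y₁ y₂ : ℝ, 0 < y₁ → y₁ < y₂ → (y₂ : EReal) < L.R →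
      IntegrableOn (fun p : ℝ × ℝ => ‖w p.1 p.2‖ ^ 2) (univ ×ˢ Ioo y₁ y₂) volume)
    (hs : 0 < s) (hst : s ≤ t) (ht : t ∈ L.dom) : IntegrableOn (fslice w) (Icc s t) := by
  have h := (slice_sq_integrable hwm hw hs hst ht).2
  refine Integrable.mono' ((integrable_const (1 : ℝ)).add h)
    (stronglyMeasurable_fslice hwm).aestronglyMeasurable (ae_of_all _ fun y => ?_)
  rw [norm_fslice, Pi.add_apply]
  nlinarith [sq_nonneg (‖slice w y‖ - 1), norm_nonneg (slice w y)]

/-- A bounded family of multipliers applied to the slices of `w`, times `b`. -/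
theorem integrableOn_b_mulL2_fslice (hwm : Measurable fun p : ℝ × ℝ => w p.1 p.2)
    (hw : ∀ y₁ y₂ : ℝ, 0 < y₁ → y₁ < y₂ → (y₂ : EReal) < L.R →
      IntegrableOn (fun p : ℝ × ℝ => ‖w p.1 p.2‖ ^ 2) (univ ×ˢ Ioo y₁ y₂) volume)
    (hs : 0 < s) (hst : s ≤ t) (ht : t ∈ L.dom) {m : ℝ → ℝ → ℂ}
    (hm : Measurable fun p : ℝ × ℝ => m p.1 p.2) (hm1 : ∀ x y, ‖m x y‖ ≤ 1) :
    IntegrableOn (fun y => mulL2 (fun x => m x y) (fslice w y)) (Icc s t) ∧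
    IntegrableOn (fun y => (L.b y : ℂ) • mulL2 (fun x => m x y) (fslice w y)) (Icc s t) := by
  have h := (slice_sq_integrable hwm hw hs hst ht).2
  have hb := L.b_measurable
  have hsm := stronglyMeasurable_mulL2 hm hm1 (stronglyMeasurable_fslice hwm)
  have hle : ∀ y, ‖mulL2 (fun x => m x y) (fslice w y)‖ ≤ ‖slice w y‖ := fun y => by
    have := norm_mulL2_apply_le (measurable_slice hm y) (fun x => hm1 x y) (fslice w y)
    rwa [one_mul, norm_fslice] at this
  refine ⟨Integrable.mono' ((integrable_const (1 : ℝ)).add h) hsm.aestronglyMeasurable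
    (ae_of_all _ fun y => (hle y).trans ?_),
    Integrable.mono' ((integrableOn_b_sq hs.le ht).add h) ?_ (ae_of_all _ fun y => ?_)⟩
  · rw [Pi.add_apply]
    nlinarith [sq_nonneg (‖slice w y‖ - 1), norm_nonneg (slice w y)]
  · have : Measurable fun y => (L.b y : ℂ) := by fun_prop
    exact this.aestronglyMeasurable.smul hsm.aestronglyMeasurable
  · rw [norm_smul, Complex.norm_real, Real.norm_eq_abs, Pi.add_apply]
    refine (mul_le_mul_of_nonneg_left (hle y) (abs_nonneg _)).trans ?_
    nlinarith [sq_nonneg (‖slice w y‖ - |L.b y|), norm_nonneg (slice w y), sq_abs (L.b y),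
      sq_nonneg (L.b y), sq_nonneg ‖slice w y‖]

/-- Translation by B(y) becomes multiplication by a phase that is continuous in y at each frequency
and has modulus 1. -/
theorem IsHarmonic.continuousOn_trans (hu : L.IsHarmonic u) (ht : t ∈ L.dom) :
    ContinuousOn (fun y => transL2 (L.B y) (fslice u y)) (Icc 0 t) :=
  continuousOn_mulL2 (C := 1) (fun y => (isBddMeas_trans (L.B y)).1) (fun y η => by
      rw [← Complex.ofReal_mul, Complex.norm_exp_ofReal_mul_I])
    (fun η => continuousOn_phase (2 * Real.pi * η) ht)
    (hu.continuousOn_fslice.mono (Icc_subset_dom le_rfl ht))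

/-- The weak derivative in the frequency domain. -/
theorem IsHarmonic.integral_smul_fslice (hu : L.IsHarmonic u)
    (hw : L.IsWeakDerivY (fun x y => u (x + L.B y) y) w)
    (hw2 : ∀ y₁ y₂ : ℝ, 0 < y₁ → y₁ < y₂ → (y₂ : EReal) < L.R →
      IntegrableOn (fun p : ℝ × ℝ => ‖w p.1 p.2‖ ^ 2) (univ ×ˢ Ioo y₁ y₂) volume)
    (hs : 0 < s) (hst : s ≤ t) (ht : t ∈ L.dom) {q : ℝ → ℝ} (hq : IsTestOn q s t) :
    (∫ y in Ico s t, q y • fslice w y) +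
      ∫ y in Ico s t, deriv q y • transL2 (L.B y) (fslice u y) = 0 := by
  have hI : Ico s t ⊆ Icc s t := Ico_subset_Icc_self
  have iW : IntegrableOn (fslice w) (Ico s t) :=
    (integrableOn_fslice_w hw.measurable hw2 hs hst ht).mono_set hI
  have iK : IntegrableOn (fun y => transL2 (L.B y) (fslice u y)) (Ico s t) :=
    (((hu.continuousOn_trans ht).mono (Icc_subset_Icc_left hs.le)).integrableOn_Icc).mono_set hI
  refine eq_zero_of_pairF_eq_zero fun p hp hc => ?_
  have h := hw.eq _ (isTest_mul hp hc hq hs.le ht)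
  have hqd := hq.smooth.differentiable (by simp)
  simp only [deriv_const_mul_ofReal hqd] at h
  rw [setIntegral_int_eq hs ht fun y hy => by simp [hq.eq_zero hy],
    setIntegral_int_eq hs ht fun y hy => by simp [hq.deriv.eq_zero hy]] at h
  rw [map_add, ← (pairF p).integral_comp_comm (hq.integrableOn_smul iW),
    ← (pairF p).integral_comp_comm (hq.deriv.integrableOn_smul iK)]
  have e1 : ∫ y in Ico s t, ∫ x, w x y * (p x * (q y : ℂ)) =
      ∫ y in Ico s t, pairF p (q y • fslice w y) := by
    refine integral_congr_ae ?_
    filter_upwards [ae_restrict_of_ae_restrict_of_subset hI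
      (slice_sq_integrable hw.measurable hw2 hs hst ht).1] with y hy
    simp only [← mul_assoc]
    rw [integral_mul_const, integral_slice_mul hy hp hc, ContinuousLinearMap.map_smul_of_tower,
      Complex.real_smul, mul_comm]
  have e2 : ∫ y in Ico s t, ∫ x, u (x + L.B y) y * (p x * ((deriv q y : ℝ) : ℂ)) =
      ∫ y in Ico s t, pairF p (deriv q y • transL2 (L.B y) (fslice u y)) := by
    refine setIntegral_congr_fun measurableSet_Ico fun y hy => ?_
    have hy' := hu.memLp y (Icc_subset_dom hs.le ht (hI hy))
    simp only [← mul_assoc]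
    rw [integral_mul_const, integral_slice_translate_mul hy' hp hc,
      ContinuousLinearMap.map_smul_of_tower, Complex.real_smul, mul_comm]
  rw [← e1, ← e2, h]
  ring

/-- The weak equation in the frequency domain. -/
theorem IsHarmonic.ae_weakEquation (hu : L.IsHarmonic u)
    (hwm : Measurable fun p : ℝ × ℝ => w p.1 p.2)
    (hw2 : ∀ y₁ y₂ : ℝ, 0 < y₁ → y₁ < y₂ → (y₂ : EReal) < L.R →
      IntegrableOn (fun p : ℝ × ℝ => ‖w p.1 p.2‖ ^ 2) (univ ×ˢ Ioo y₁ y₂) volume)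
    (hweq : L.WeakEquation u w) (hs : 0 < s) (hst : s ≤ t) (ht : t ∈ L.dom) {q : ℝ → ℝ}
    (hq : IsTestOn q s t) :
    ∀ᵐ η : ℝ, (∫ y in Ico s t, deriv (deriv q) y • fslice u y : L2R) η +
      2 * Complex.I * (((2 * Real.pi * η : ℝ) : ℂ) *
        (∫ y in Ico s t, q y • (L.b y : ℂ) • transL2 (-L.B y) (fslice w y) : L2R) η) -
      ((2 * Real.pi * η : ℝ) : ℂ) * (((2 * Real.pi * η : ℝ) : ℂ) *
        ((∫ y in Ico s t, q y • fslice u y ∂L.a) -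
          (2 : ℂ) • ∫ y in Ico s t, q y • (L.b y : ℂ) ^ 2 • fslice u y : L2R) η) = 0 := by
  have hI : Ico s t ⊆ Icc s t := Ico_subset_Icc_self
  have hfin : IsFiniteMeasure (L.a.restrict (Icc s t)) := ⟨by
    rw [Measure.restrict_apply_univ]; exact a_Icc_lt_top hs.le ht⟩
  have hcU : ContinuousOn (fslice u) (Icc s t) :=
    hu.continuousOn_fslice.mono (Icc_subset_dom hs.le ht)
  obtain ⟨CU, hCU⟩ := isCompact_Icc.exists_bound_of_continuousOn hcU
  have iU : IntegrableOn (fslice u) (Ico s t) := hcU.integrableOn_Icc.mono_set hI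
  have iUa' : IntegrableOn (fslice u) (Icc s t) L.a :=
    Integrable.of_bound (hcU.aestronglyMeasurable measurableSet_Icc) CU
      (ae_restrict_of_forall_mem measurableSet_Icc hCU)
  have iUa : IntegrableOn (fslice u) (Ico s t) L.a := iUa'.mono_set hI
  have hbm := L.b_measurable
  have iUb' : IntegrableOn (fun y => (L.b y : ℂ) ^ 2 • fslice u y) (Icc s t) := by
    refine Integrable.mono' ((integrableOn_b_sq hs.le ht).mul_const CU) ?_
      (ae_restrict_of_forall_mem measurableSet_Icc fun y hy => ?_)
    · have : Measurable fun y => (L.b y : ℂ) ^ 2 := by fun_prop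
      exact this.aestronglyMeasurable.smul (hcU.aestronglyMeasurable measurableSet_Icc)
    · rw [norm_smul, norm_pow, Complex.norm_real, Real.norm_eq_abs, sq_abs]
      exact mul_le_mul_of_nonneg_left (hCU y hy) (sq_nonneg _)
  have iUb := iUb'.mono_set hI
  have hBm := L.measurable_B
  have iW : IntegrableOn (fun y => (L.b y : ℂ) • transL2 (-L.B y) (fslice w y)) (Ico s t) :=
    (integrableOn_b_mulL2_fslice hwm hw2 hs hst ht (m := fun η y => Complex.exp
      (((2 * Real.pi * η : ℝ) : ℂ) * ((-L.B y : ℝ) : ℂ) * Complex.I)) (by fun_prop) fun η y => by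
        rw [← Complex.ofReal_mul, Complex.norm_exp_ofReal_mul_I]).2.mono_set hI
  -- Testing with p(x) q(y): for fixed q, the dependence on p gives an identity between functions of
  -- the frequency. The exceptional null set depends on q.
  refine ae_eq_zero_of_pairF fun p hp hc => ?_
  have hp1 := contDiff_deriv_infty hp
  have hp2 := contDiff_deriv_infty hp1
  have h := hweq _ (isTest_mul hp hc hq hs.le ht)
  have hqd := hq.smooth.differentiable (by simp)
  have hqd1 := hq.deriv.smooth.differentiable (by simp)
  simp only [iteratedDeriv_two, deriv_const_mul_ofReal hqd, deriv_const_mul_ofReal hqd1,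
    deriv_deriv_mul_const, deriv_mul_const_field] at h
  rw [setIntegral_int_eq hs ht fun y hy => by simp [hq.eq_zero hy],
    setIntegral_int_eq hs ht fun y hy => by simp [hq.eq_zero hy],
    setIntegral_int_eq hs ht fun y hy => by simp [hq.eq_zero hy],
    setIntegral_int_eq hs ht fun y hy => by simp [hq.deriv.deriv.eq_zero hy]] at h
  have hmem : ∀ y ∈ Ico s t, MemLp (fun x => u x y) 2 volume := fun y hy =>
    hu.memLp y (Icc_subset_dom hs.le ht (hI hy))
  have e1 : ∫ y in Ico s t, (∫ x, u x y * (deriv (deriv p) x * (q y : ℂ))) ∂L.a =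
      ∫ y in Ico s t, pairF (deriv (deriv p)) (q y • fslice u y) ∂L.a := by
    refine setIntegral_congr_fun measurableSet_Ico fun y hy => ?_
    simp only [← mul_assoc]
    rw [integral_mul_const, integral_slice_mul (hmem y hy) hp2 hc.deriv.deriv,
      ContinuousLinearMap.map_smul_of_tower, Complex.real_smul, mul_comm]
  have e2 : ∫ y in Ico s t, (∫ x, u x y * (deriv (deriv p) x * (q y : ℂ))) * (L.b y : ℂ) ^ 2 =
      ∫ y in Ico s t, pairF (deriv (deriv p)) (q y • (L.b y : ℂ) ^ 2 • fslice u y) := by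
    refine setIntegral_congr_fun measurableSet_Ico fun y hy => ?_
    simp only [← mul_assoc]
    rw [integral_mul_const, integral_slice_mul (hmem y hy) hp2 hc.deriv.deriv,
      ContinuousLinearMap.map_smul_of_tower, Complex.real_smul, map_smul, smul_eq_mul]
    ring
  have e3 : ∫ y in Ico s t, (∫ x, w (x - L.B y) y * (deriv p x * (q y : ℂ))) * (L.b y : ℂ) =
      ∫ y in Ico s t, pairF (deriv p) (q y • (L.b y : ℂ) • transL2 (-L.B y) (fslice w y)) := by
    refine integral_congr_ae ?_
    filter_upwards [ae_restrict_of_ae_restrict_of_subset hI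
      (slice_sq_integrable hwm hw2 hs hst ht).1] with y hy
    simp only [← mul_assoc, sub_eq_add_neg]
    rw [integral_mul_const, integral_slice_translate_mul hy hp1 hc.deriv,
      ContinuousLinearMap.map_smul_of_tower, Complex.real_smul, map_smul, smul_eq_mul]
    ring
  have e4 : ∫ y in Ico s t, ∫ x, u x y * (p x * ((deriv (deriv q) y : ℝ) : ℂ)) =
      ∫ y in Ico s t, pairF p (deriv (deriv q) y • fslice u y) := by
    refine setIntegral_congr_fun measurableSet_Ico fun y hy => ?_
    simp only [← mul_assoc]
    rw [integral_mul_const, integral_slice_mul (hmem y hy) hp hc,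
      ContinuousLinearMap.map_smul_of_tower, Complex.real_smul, mul_comm]
  rw [e1, e2, e3, e4, (pairF _).integral_comp_comm (hq.integrableOn_smul iUa),
    (pairF _).integral_comp_comm (hq.integrableOn_smul iUb),
    (pairF _).integral_comp_comm (hq.integrableOn_smul iW),
    (pairF _).integral_comp_comm (hq.deriv.deriv.integrableOn_smul iU)] at h
  rw [map_sub, map_smul, smul_eq_mul]
  exact h

end OperatorL

/-- A continuous function with an integrable weak derivative is a primitive of the latter. -/
theorem eq_primitive_of_weak {X : Type*} [NormedAddCommGroup X] [NormedSpace ℝ X] [CompleteSpace X]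
    {s t : ℝ} (hst : s < t) {K G : ℝ → X} (hK : ContinuousOn K (Icc s t))
    (hG : IntegrableOn G (Icc s t)) (h : ∀ q, IsTestOn q s t →
      (∫ y in Ico s t, q y • G y) + ∫ y in Ico s t, deriv q y • K y = 0) :
    ∀ y ∈ Icc s t, K y = K s + ∫ r in Ico s y, G r := by
  have hI : Ico s t ⊆ Icc s t := Ico_subset_Icc_self
  set v : ℝ → X := fun y => ∫ r in Ico s y, G r with hv
  have hvc : ContinuousOn v (Icc s t) := by
    refine (intervalIntegral.continuousOn_primitive hG).congr fun y hy => ?_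
    simp only [hv]
    rw [← OperatorL.intervalIntegral_eq_Ico hy.1, intervalIntegral.integral_of_le hy.1]
  have hvs : v s = 0 := by simp [hv]
  have hKi : IntegrableOn K (Ico s t) := hK.integrableOn_Icc.mono_set hI
  have hvi : IntegrableOn v (Ico s t) := hvc.integrableOn_Icc.mono_set hI
  obtain ⟨c, hc⟩ := ae_eq_const_of_integral_deriv_smul_eq_zero (g := fun y => K y - v y) hst
    (hKi.sub hvi) fun q hq => by
      have h1 := hq.integral_deriv_smul (α := (0 : Measure ℝ)) (v := v) (g₁ := 0) (g₂ := G) hst.le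
        (fun y _ => by simp [hv]) integrableOn_zero (hG.mono_set hI)
      have h2 := h q hq
      simp only [smul_sub]
      rw [integral_sub (hq.deriv.integrableOn_smul hKi) (hq.deriv.integrableOn_smul hvi), h1]
      simpa [add_comm] using h2
  have hc' : (fun y => K y - v y) =ᵐ[volume.restrict (Icc s t)] fun _ => c := by
    rw [← restrict_Ico_eq_restrict_Icc]
    exact hc
  -- Two continuous functions that agree almost everywhere on a nondegenerate interval agree
  -- everywhere on it.
  have key := Measure.eqOn_Icc_of_ae_eq volume hst.ne hc' (hK.sub hvc) continuousOn_const
  intro y hy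
  have h1 := key hy
  have h2 := key (left_mem_Icc.2 hst.le)
  simp only at h1 h2
  rw [hvs, sub_zero] at h2
  rw [h2, ← h1]
  simp [hv]

/-! ### The differential equation for the truncated partial Fourier transform -/

namespace OperatorL

variable {L : OperatorL} {u w : ℝ → ℝ → ℂ} {s t : ℝ}

theorem measurable_trunc {N : ℕ} {m : ℝ → ℝ → ℂ} (hm : Measurable fun p : ℝ × ℝ => m p.1 p.2) :
    Measurable fun p : ℝ × ℝ => L.trunc N (fun η => m η p.2) p.1 := by
  have : (fun p : ℝ × ℝ => L.trunc N (fun η => m η p.2) p.1) =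
      {p : ℝ × ℝ | p.1 ∈ L.cut N}.indicator fun p => m p.1 p.2 := by
    funext p
    by_cases h : p.1 ∈ L.cut N <;> simp [trunc, indicator, h]
  rw [this]
  exact hm.indicator (measurable_fst (L.measurableSet_cut N))

theorem norm_trunc_le {N : ℕ} {m : ℝ → ℂ} {C : ℝ} (hC0 : 0 ≤ C) (hC : ∀ η ∈ L.cut N, ‖m η‖ ≤ C)
    (η : ℝ) : ‖L.trunc N m η‖ ≤ C := by
  by_cases hη : η ∈ L.cut N
  · rw [trunc, indicator_of_mem hη]
    exact hC η hη
  · rw [trunc, indicator_of_notMem hη, norm_zero]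
    exact hC0

theorem phase_eq_add {y : ℝ} (ξ : ℝ) (hs : 0 ≤ s) (hsy : s ≤ y) (hy : y ∈ L.dom) :
    L.phase ξ y = L.phase ξ s + ∫ r in Ico s y, ξ * L.b r * Complex.I * L.phase ξ r := by
  have hi := integrableOn_phase_deriv ξ hy
  rw [phase_eq ξ hy, phase_eq ξ (mem_dom_of_le hy hs hsy), add_assoc,
    ← setIntegral_union Ico_disjoint_Ico_same measurableSet_Ico
      (hi.mono_set (Ico_subset_Ico_right hsy)) (hi.mono_set (Ico_subset_Ico_left hs)),
    Ico_union_Ico_eq_Ico hs hsy]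

theorem conj_phase_mul_phase (ξ y : ℝ) : conj (L.phase ξ y) * L.phase ξ y = 1 := by
  rw [mul_comm, Complex.mul_conj, Complex.normSq_eq_norm_sq, norm_phase]
  simp

/-- The derivative of the truncated phase factors. -/
theorem trunc_phase_eq (N : ℕ) (P : L2R) (hs : 0 ≤ s) (ht : t ∈ L.dom) :
    IntegrableOn (fun r => mulL2 (L.trunc N fun η => ((2 * Real.pi * η : ℝ) : ℂ) * L.b r *
      Complex.I * L.phase (2 * Real.pi * η) r) P) (Ico s t) ∧
    ∀ y ∈ Icc s t, mulL2 (L.trunc N fun η => L.phase (2 * Real.pi * η) y) P =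
      mulL2 (L.trunc N fun η => L.phase (2 * Real.pi * η) s) P +
        ∫ r in Ico s y, mulL2 (L.trunc N fun η => ((2 * Real.pi * η : ℝ) : ℂ) * L.b r *
          Complex.I * L.phase (2 * Real.pi * η) r) P := by
  have hbm := L.b_measurable
  have hphm := L.measurable_phase
  have hjm : Measurable fun p : ℝ × ℝ => ((2 * Real.pi * p.1 : ℝ) : ℂ) * L.b p.2 *
      Complex.I * L.phase (2 * Real.pi * p.1) p.2 := by
    have : Measurable fun p : ℝ × ℝ => L.phase (2 * Real.pi * p.1) p.2 :=
      hphm.comp (((measurable_const.mul measurable_fst)).prodMk measurable_snd)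
    fun_prop
  have hbi : ∀ y ∈ Icc s t, IntegrableOn (fun r => (N : ℝ) * |L.b r|) (Ico s y) := fun y hy =>
    IntegrableOn.mono_set ((integrableOn_b hs (mem_dom_of_le (s := y) ht (hs.trans hy.1)
      hy.2)).abs.const_mul (N : ℝ)) Ico_subset_Icc_self
  have hb := fun y (hy : y ∈ Icc s t) => (integral_mulL2 (μ := volume.restrict (Ico s y))
    (m := fun η r => L.trunc N (fun η => ((2 * Real.pi * η : ℝ) : ℂ) * L.b r *
      Complex.I * L.phase (2 * Real.pi * η) r) η) (C := fun r => N * |L.b r|)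
    (measurable_trunc (m := fun η r => ((2 * Real.pi * η : ℝ) : ℂ) * L.b r *
      Complex.I * L.phase (2 * Real.pi * η) r) hjm)
    (hbi y hy)
    (ae_of_all _ fun r => norm_trunc_le (by positivity) fun η hη => by
      rw [norm_mul, norm_mul, norm_mul, norm_phase, Complex.norm_I, mul_one, mul_one,
        Complex.norm_real (L.b r), Real.norm_eq_abs]
      exact mul_le_mul_of_nonneg_right (norm_freq_le hη) (abs_nonneg _)) P)
  have hph : ∀ y, IsBddMeas (L.trunc N fun η => L.phase (2 * Real.pi * η) y) := fun y =>
    isBddMeas_trunc (hphm.comp (by fun_prop : Measurable fun η : ℝ => (2 * Real.pi * η, y)))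
      (C := 1) fun η _ => (norm_phase _ _).le
  have e : ∀ y, (fun η => ∫ r in Ico s y, L.trunc N (fun η => ((2 * Real.pi * η : ℝ) : ℂ) * L.b r *
      Complex.I * L.phase (2 * Real.pi * η) r) η) = L.trunc N fun η => ∫ r in Ico s y,
        ((2 * Real.pi * η : ℝ) : ℂ) * L.b r * Complex.I * L.phase (2 * Real.pi * η) r := fun y => by
    funext η
    by_cases h : η ∈ L.cut N <;> simp [trunc, indicator, h]
  refine ⟨?_, fun y hy => ?_⟩
  · rcases le_or_gt s t with hst | hst
    · exact (hb t ⟨hst, le_rfl⟩).1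
    · simp [Ico_eq_empty_of_le hst.le]
  have h1 := (hb y hy).2
  rw [e y] at h1
  rw [h1.2, ← mulL2_add (hph s) h1.1]
  congr 2
  funext η
  by_cases h : η ∈ L.cut N
  · simp only [trunc, indicator, h, if_true]
    exact phase_eq_add _ hs hy.1 (mem_dom_of_le ht (hs.trans hy.1) hy.2)
  · simp [trunc, indicator, h]

theorem freqL2_cutL2 (N : ℕ) (f : L2R) : L.freqL2 N (L.cutL2 N f) = L.freqL2 N f := by
  rw [cutL2, L.freqL2_mulL2 N (L.isBddMeas_cut N)]
  simp [freqL2]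

/-- The truncated Fourier transform of a harmonic function solves the differential equation. -/
theorem IsHarmonic.exists_solvesOn (hu : L.IsHarmonic u) (N : ℕ) (hs : 0 < s) (hst : s < t)
    (ht : t ∈ L.dom) :
    ∃ h, L.SolvesOn (L.freqL2 N) (fun y => L.cutL2 N (fslice u y)) h s t := by
  obtain ⟨w, hw, hw2, hweq⟩ := hu.equation
  have hwm := hw.measurable
  have hI : Ico s t ⊆ Icc s t := Ico_subset_Icc_self
  have hbm := L.b_measurable
  have hBm := L.measurable_B
  have hphm := L.measurable_phase
  have hcU : ContinuousOn (fslice u) (Icc s t) :=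
    hu.continuousOn_fslice.mono (Icc_subset_dom hs.le ht)
  set E := L.cutL2 N with hE
  set M := L.freqL2 N with hM
  set H : ℝ → L2R := fun y => E (fslice u y) with hH
  have hHc : ContinuousOn H (Icc s t) := E.continuous.comp_continuousOn hcU
  -- Wt is the truncated transform of ∂ᵧũ moved back to the original coordinates, whereas K below is
  -- that of ũ itself.
  set Wt : ℝ → L2R := fun y => E (transL2 (-L.B y) (fslice w y)) with hWt
  set K : ℝ → L2R := fun y => E (transL2 (L.B y) (fslice u y)) with hK
  have hKc : ContinuousOn K (Icc s t) := E.continuous.comp_continuousOn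
    ((hu.continuousOn_trans ht).mono (Icc_subset_Icc_left hs.le))
  have iW := integrableOn_fslice_w hwm hw2 hs hst.le ht
  have iEW : IntegrableOn (fun y => E (fslice w y)) (Icc s t) := E.integrable_comp iW
  have hKeq : ∀ y ∈ Icc s t, K y = K s + ∫ r in Ico s y, E (fslice w r) := by
    refine eq_primitive_of_weak hst hKc iEW fun q hq => ?_
    have h := congrArg E (hu.integral_smul_fslice hw hw2 hs hst.le ht hq)
    rw [map_zero, map_add, ← E.integral_comp_comm (hq.integrableOn_smul (iW.mono_set hI)),
      ← E.integral_comp_comm (hq.deriv.integrableOn_smul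
        ((((hu.continuousOn_trans ht).mono (Icc_subset_Icc_left hs.le)).integrableOn_Icc).mono_set
          hI))] at h
    simpa only [ContinuousLinearMap.map_smul_of_tower] using h
  have iWt0 := integrableOn_b_mulL2_fslice hwm hw2 hs hst.le ht (m := fun η y => Complex.exp
      (((2 * Real.pi * η : ℝ) : ℂ) * ((-L.B y : ℝ) : ℂ) * Complex.I)) (by fun_prop) fun η y => by
        rw [← Complex.ofReal_mul, Complex.norm_exp_ofReal_mul_I]
  have iWt : IntegrableOn Wt (Icc s t) := E.integrable_comp iWt0.1
  have ibT : IntegrableOn (fun y => (L.b y : ℂ) • transL2 (-L.B y) (fslice w y)) (Icc s t) := iWt0.2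
  have ibWt : IntegrableOn (fun y => (L.b y : ℂ) • Wt y) (Icc s t) := by
    have := E.integrable_comp ibT
    simpa only [map_smul] using! this
  -- continuous functions multiplied by powers of `b`
  have hbint : ∀ (c : ℝ → ℂ) (C : ℝ → ℝ) (F : ℝ → L2R), Measurable c →
      IntegrableOn C (Icc s t) → (∀ y, ‖c y‖ ≤ C y) → ContinuousOn F (Icc s t) →
      IntegrableOn (fun y => c y • F y) (Icc s t) := by
    intro c C F hc hC hcC hF
    obtain ⟨D, hD⟩ := isCompact_Icc.exists_bound_of_continuousOn hF
    refine Integrable.mono' (hC.mul_const D) (hc.aestronglyMeasurable.smul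
      (hF.aestronglyMeasurable measurableSet_Icc))
      (ae_restrict_of_forall_mem measurableSet_Icc fun y hy => ?_)
    rw [norm_smul]
    exact mul_le_mul (hcC y) (hD y hy) (norm_nonneg _) ((norm_nonneg _).trans (hcC y))
  have hMH : ContinuousOn (fun y => M (H y)) (Icc s t) := M.continuous.comp_continuousOn hHc
  have hMMH : ContinuousOn (fun y => M (M (H y))) (Icc s t) := M.continuous.comp_continuousOn hMH
  have ibMH : IntegrableOn (fun y => (Complex.I * L.b y) • M (H y)) (Icc s t) :=
    hbint _ (fun y => |L.b y|) _ (by fun_prop) (integrableOn_b hs.le ht).abs (fun y => by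
      rw [norm_mul, Complex.norm_I, one_mul, Complex.norm_real, Real.norm_eq_abs]) hMH
  have ib2 : IntegrableOn (fun y => (L.b y : ℂ) ^ 2 • M (M (H y))) (Icc s t) :=
    hbint _ (fun y => L.b y ^ 2) _ (by fun_prop) (integrableOn_b_sq hs.le ht) (fun y => by
      rw [norm_pow, Complex.norm_real, Real.norm_eq_abs, sq_abs]) hMMH
  -- Formally ∂ᵧu = w(x - B(y), y) - b ∂ₓu; this is its transform.
  set h : ℝ → L2R := fun y => Wt y - (Complex.I * L.b y) • M (H y) with hh
  have ih : IntegrableOn h (Icc s t) := iWt.sub ibMH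
  -- The first order term written with Wt: the correction -ibMH in h produces the term in b², which
  -- matches the -2b² dy in the weak form of the equation.
  have ibMh : ∀ y, (-(2 * Complex.I * L.b y)) • M (h y) =
      (-(2 * Complex.I)) • M ((L.b y : ℂ) • Wt y) - (2 : ℂ) • (L.b y : ℂ) ^ 2 • M (M (H y)) := by
    intro y
    simp only [hh, map_sub, map_smul, smul_sub, smul_smul]
    congr 1
    · congr 1; ring
    · congr 1
      linear_combination (-(2 * (L.b y : ℂ) ^ 2)) * Complex.I_sq
  have hHeq : ∀ y ∈ Icc s t, H y = H s + ∫ r in Ico s y, h r := by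
    intro y hy
    have hIy : Ico s y ⊆ Icc s t := (Ico_subset_Ico_right hy.2).trans hI
    -- H is e^{-iξB} times K. The product rule is applied to ⟨e^{iξB} P, K⟩, with the phase acting
    -- on a fixed vector P, where its derivative is explicit.
    refine ext_inner_left ℂ fun P => ?_
    have hyd : y ∈ L.dom := mem_dom_of_le ht (hs.le.trans hy.1) hy.2
    obtain ⟨iP, hP⟩ := trunc_phase_eq (L := L) N P hs.le hyd
    have key := integral_bilin_by_parts_mixed (α := 0) (innerRealL L2R) hy.1 (v := K) (g₁ := 0)
      (g₂ := fun r => E (fslice w r)) hP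
      (fun z hz => by simpa using hKeq z ⟨hz.1, hz.2.trans hy.2⟩) iP integrableOn_zero
      (iEW.mono_set hIy)
    simp only [innerRealL_apply, Measure.restrict_zero, integral_zero_measure, add_zero] at key
    have hphb : ∀ r, IsBddMeas (L.trunc N fun η => L.phase (2 * Real.pi * η) r) := fun r =>
      isBddMeas_trunc (hphm.comp (by fun_prop : Measurable fun η : ℝ => (2 * Real.pi * η, r)))
        (C := 1) fun η _ => (norm_phase _ _).le
    have hconjb : ∀ m : ℝ → ℂ, IsBddMeas m → IsBddMeas fun η => conj (m η) := fun m hm =>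
      ⟨Complex.continuous_conj.measurable.comp hm.1, hm.2.choose,
        fun x => by simpa using hm.2.choose_spec x⟩
    have hcomp : ∀ (m : ℝ → ℂ) (c : ℝ) (f : L2R), IsBddMeas m →
        mulL2 m (E (transL2 c f)) = mulL2 (fun η => m η * (L.trunc N (fun _ => 1) η *
          Complex.exp (((2 * Real.pi * η : ℝ) : ℂ) * c * Complex.I))) f := fun m c f hm => by
      rw [hE, cutL2, transL2, mulL2_mulL2 (L.isBddMeas_cut N) (isBddMeas_trans c),
        mulL2_mulL2 hm ((L.isBddMeas_cut N).mul (isBddMeas_trans c))]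
    have t1 : ∀ r, inner ℂ (mulL2 (L.trunc N fun η => L.phase (2 * Real.pi * η) r) P) (K r) =
        inner ℂ P (H r) := fun r => by
      rw [inner_mulL2_left (hphb r), hK]
      simp only
      rw [hcomp _ _ _ (hconjb _ (hphb r)), hH, hE, cutL2]
      congr 3
      funext η
      by_cases hη : η ∈ L.cut N
      · simp only [trunc, indicator, hη, if_true, one_mul]
        exact conj_phase_mul_phase _ _
      · simp [trunc, indicator, hη]
    have t2 : ∀ r, inner ℂ (mulL2 (L.trunc N fun η => ((2 * Real.pi * η : ℝ) : ℂ) * L.b r *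
        Complex.I * L.phase (2 * Real.pi * η) r) P) (K r) =
        inner ℂ P (-((Complex.I * L.b r) • M (H r))) := fun r => by
      have hb1 : IsBddMeas (L.trunc N fun η => ((2 * Real.pi * η : ℝ) : ℂ) * L.b r *
          Complex.I * L.phase (2 * Real.pi * η) r) := by
        refine isBddMeas_trunc (C := N * |L.b r|) ?_ fun η hη => ?_
        · have : Measurable fun η : ℝ => L.phase (2 * Real.pi * η) r :=
            hphm.comp (by fun_prop : Measurable fun η : ℝ => (2 * Real.pi * η, r))
          fun_prop
        · rw [norm_mul, norm_mul, norm_mul, norm_phase, Complex.norm_I, mul_one, mul_one,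
            Complex.norm_real (L.b r), Real.norm_eq_abs]
          exact mul_le_mul_of_nonneg_right (norm_freq_le hη) (abs_nonneg _)
      rw [inner_mulL2_left hb1, hK]
      simp only
      rw [hcomp _ _ _ (hconjb _ hb1), hH, hM, hE]
      simp only
      rw [freqL2_cutL2, freqL2, ← neg_smul, ← mulL2_const_mul (L.isBddMeas_freq N)]
      congr 3
      funext η
      by_cases hη : η ∈ L.cut N
      · have hc := conj_phase_mul_phase (L := L) (2 * Real.pi * η) r
        simp only [trunc, indicator, hη, if_true, one_mul]
        rw [map_mul, map_mul, map_mul, Complex.conj_ofReal, Complex.conj_ofReal, Complex.conj_I,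
          mul_assoc]
        refine Eq.trans (congrArg _ hc) ?_
        ring
      · simp [trunc, indicator, hη]
    have t3 : ∀ r, inner ℂ (mulL2 (L.trunc N fun η => L.phase (2 * Real.pi * η) r) P)
        (E (fslice w r)) = inner ℂ P (Wt r) := fun r => by
      simp only [hWt]
      rw [inner_mulL2_left (hphb r), hE, cutL2, transL2,
        mulL2_mulL2 (hconjb _ (hphb r)) (L.isBddMeas_cut N),
        mulL2_mulL2 (L.isBddMeas_cut N) (isBddMeas_trans _)]
      congr 3
      funext η
      by_cases hη : η ∈ L.cut N
      · simp only [trunc, indicator, hη, if_true, one_mul, mul_one, phase]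
        rw [← Complex.exp_conj, map_mul, map_mul, Complex.conj_ofReal, Complex.conj_ofReal,
          Complex.conj_I]
        congr 1
        push_cast
        ring
      · simp [trunc, indicator, hη]
    simp only [t1, t2, t3] at key
    rw [key, inner_add_right]
    have e : inner ℂ P (∫ r in Ico s y, h r) = ∫ r in Ico s y, inner ℂ P (h r) := by
      simpa using ((innerSL ℂ P).integral_comp_comm (ih.mono_set hIy)).symm
    rw [e, add_assoc, ← integral_add]
    · congr 1
      refine integral_congr_ae (ae_of_all _ fun r => ?_)
      simp only [hh, inner_sub_right, inner_neg_right]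
      ring
    · exact (innerSL ℂ P).integrable_comp (ibMH.mono_set hIy).neg
    · exact (innerSL ℂ P).integrable_comp (iWt.mono_set hIy)
  have iMbWt : IntegrableOn (fun y => M ((L.b y : ℂ) • Wt y)) (Icc s t) := M.integrable_comp ibWt
  have ibMh' : IntegrableOn (fun r => (-(2 * Complex.I * L.b r)) • M (h r)) (Ico s t) := by
    simp only [ibMh]
    exact IntegrableOn.mono_set ((iMbWt.smul (-(2 * Complex.I))).sub (ib2.smul (2 : ℂ))) hI
  refine exists_solvesOn_of_weak hs.le hst ht hHc (ih.mono_set hI) ibMh' hHeq fun q hq => ?_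
  have hfin : IsFiniteMeasure (L.a.restrict (Icc s t)) := ⟨by
    rw [Measure.restrict_apply_univ]; exact a_Icc_lt_top hs.le ht⟩
  obtain ⟨CU, hCU⟩ := isCompact_Icc.exists_bound_of_continuousOn hcU
  have iU : IntegrableOn (fslice u) (Ico s t) := hcU.integrableOn_Icc.mono_set hI
  have iUa' : IntegrableOn (fslice u) (Icc s t) L.a :=
    Integrable.of_bound (hcU.aestronglyMeasurable measurableSet_Icc) CU
      (ae_restrict_of_forall_mem measurableSet_Icc hCU)
  have iUa : IntegrableOn (fslice u) (Ico s t) L.a := iUa'.mono_set hI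
  have iUb : IntegrableOn (fun y => (L.b y : ℂ) ^ 2 • fslice u y) (Ico s t) :=
    (hbint _ (fun y => L.b y ^ 2) _ (by fun_prop) (integrableOn_b_sq hs.le ht) (fun y => by
      rw [norm_pow, Complex.norm_real, Real.norm_eq_abs, sq_abs]) hcU).mono_set hI
  have hae := hu.ae_weakEquation hwm hw2 hweq hs hst.le ht hq
  set G₀ : L2R := ∫ y in Ico s t, deriv (deriv q) y • fslice u y with hG₀
  set G₁ : L2R := ∫ y in Ico s t, q y • (L.b y : ℂ) • transL2 (-L.B y) (fslice w y) with hG₁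
  set G₂ : L2R := (∫ y in Ico s t, q y • fslice u y ∂L.a) -
          (2 : ℂ) • ∫ y in Ico s t, q y • (L.b y : ℂ) ^ 2 • fslice u y with hG₂
  -- On the cut this is the almost everywhere identity; off the cut every term is zero. As an
  -- identity in L² it no longer involves a null set depending on q.
  have hid : E G₀ + (2 * Complex.I) • M G₁ - M (M G₂) = 0 := by
    refine Lp.ext ?_
    filter_upwards [hae, coeFn_mulL2 (L.isBddMeas_cut N) G₀, coeFn_mulL2 (L.isBddMeas_freq N) G₁,
      coeFn_mulL2 (L.isBddMeas_freq N) G₂, coeFn_mulL2 (L.isBddMeas_freq N) (M G₂),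
      Lp.coeFn_sub (E G₀ + (2 * Complex.I) • M G₁) (M (M G₂)),
      Lp.coeFn_add (E G₀) ((2 * Complex.I) • M G₁), Lp.coeFn_smul (2 * Complex.I) (M G₁),
      Lp.coeFn_zero ℂ 2 (volume : Measure ℝ)] with η h1 h2 h3 h4 h5 h6 h7 h8 h9
    have h3' : (M G₁) η = _ := h3
    have h4' : (M G₂) η = _ := h4
    have h5' : (M (M G₂)) η = _ := h5
    have h2' : (E G₀) η = _ := h2
    rw [h6, h9, Pi.sub_apply, h7, Pi.add_apply, h8, Pi.smul_apply, h2', h3', h5', h4']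
    by_cases hη : η ∈ L.cut N
    · simpa [trunc, indicator, hη] using h1
    · simp [trunc, indicator, hη]
  have hME : ∀ x, M (E x) = M x := freqL2_cutL2 N
  -- One derivative is moved from q'' onto H, which gives the weak form with q' tested against h.
  have r0 : E G₀ = -∫ y in Ico s t, deriv q y • h y := by
    have h1 := hq.deriv.integral_deriv_smul (α := (0 : Measure ℝ)) (v := H) (g₁ := 0) (g₂ := h)
      hst.le (fun y hy => by simpa using hHeq y hy) integrableOn_zero (ih.mono_set hI)
    rw [hG₀, ← E.integral_comp_comm (hq.deriv.deriv.integrableOn_smul iU)]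
    simp only [ContinuousLinearMap.map_smul_of_tower]
    simpa using! h1
  have r1 : M G₁ = ∫ y in Ico s t, q y • M ((L.b y : ℂ) • Wt y) := by
    rw [hG₁, ← M.integral_comp_comm (hq.integrableOn_smul (ibT.mono_set hI))]
    simp only [ContinuousLinearMap.map_smul_of_tower, map_smul, hWt, hME]
  have r2 : M (M G₂) = (∫ y in Ico s t, q y • M (M (H y)) ∂L.a) -
      (2 : ℂ) • ∫ y in Ico s t, q y • (L.b y : ℂ) ^ 2 • M (M (H y)) := by
    have hMM : ∀ x, M (M x) = (M.comp M) x := fun _ => rfl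
    rw [hG₂, map_sub, map_sub, map_smul, map_smul, hMM, hMM,
      ← (M.comp M).integral_comp_comm (hq.integrableOn_smul iUa),
      ← (M.comp M).integral_comp_comm (hq.integrableOn_smul iUb)]
    simp only [ContinuousLinearMap.map_smul_of_tower, map_smul, hH, ← hMM, hME]
  have r3 : ∫ y in Ico s t, q y • (-(2 * Complex.I * L.b y)) • M (h y) =
      (-(2 * Complex.I)) • (∫ y in Ico s t, q y • M ((L.b y : ℂ) • Wt y)) -
        (2 : ℂ) • ∫ y in Ico s t, q y • (L.b y : ℂ) ^ 2 • M (M (H y)) := by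
    rw [← integral_smul, ← integral_smul, ← integral_sub]
    · refine integral_congr_ae (ae_of_all _ fun y => ?_)
      simp only
      rw [ibMh, smul_sub, smul_comm (q y), smul_comm (q y)]
    · exact (hq.integrableOn_smul (iMbWt.mono_set hI)).smul (-(2 * Complex.I))
    · exact (hq.integrableOn_smul (ib2.mono_set hI)).smul (2 : ℂ)
  rw [r0, r1, r2] at hid
  rw [r3]
  have := sub_eq_zero.1 hid
  rw [neg_add_eq_iff_eq_add] at this
  rw [eq_comm, ← sub_eq_zero] at this
  rw [← sub_eq_zero, ← this]
  module

end OperatorL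

/-! ### Identification of the partial Fourier transform of a harmonic function -/

namespace OperatorL

variable {L : OperatorL} {u : ℝ → ℝ → ℂ} {f : L2R}

theorem exists_mem_cut (η : ℝ) : ∃ N, η ∈ L.cut N := by
  obtain ⟨N, hN⟩ := exists_nat_ge (max |2 * Real.pi * η| ‖L.symbol (2 * Real.pi * η)‖)
  exact ⟨N, (le_max_left _ _).trans hN, (le_max_right _ _).trans hN⟩

theorem norm_cutL2_le (N : ℕ) (f : L2R) : ‖L.cutL2 N f‖ ≤ ‖f‖ := by
  have := norm_mulL2_apply_le (L.isBddMeas_cut N).1 (norm_trunc_le zero_le_one (by simp)) f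
  rwa [one_mul] at this

theorem IsHarmonicExtension.slice_zero (hu : L.IsHarmonicExtension f u) : slice u 0 = f := by
  rw [slice, toL2_congr hu.2, toL2_coeFn]

theorem norm_slice_le_of_eLpNorm_le {y C : ℝ} (hC : 0 ≤ C)
    (h : eLpNorm (fun x => u x y) 2 volume ≤ ENNReal.ofReal C) : ‖slice u y‖ ≤ C := by
  by_cases hm : MemLp (fun x => u x y) 2 volume
  · rw [slice, ← toReal_enorm, enorm_toL2 hm]
    exact ENNReal.toReal_le_of_le_ofReal hC h
  · rw [slice, toL2_of_not_memLp hm, norm_zero]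
    exact hC

theorem IsHarmonic.tendsto_norm_slice (hu : L.IsHarmonic u) (hR : L.R < ⊤) :
    Tendsto (fun y => ‖slice u y‖) (𝓝[<] L.R.toReal) (𝓝 0) := by
  have h := (ENNReal.tendsto_toReal ENNReal.zero_ne_top).comp (hu.vanishing hR)
  rw [ENNReal.toReal_zero] at h
  refine squeeze_zero (fun y => norm_nonneg _) (fun y => ?_) h
  by_cases hm : MemLp (fun x => u x y) 2 volume
  · rw [slice, ← toReal_enorm, enorm_toL2 hm]
    exact le_rfl
  · rw [slice, toL2_of_not_memLp hm, norm_zero]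
    exact ENNReal.toReal_nonneg

theorem eventually_mem_dom (hR : L.R < ⊤) : ∀ᶠ y in 𝓝[<] L.R.toReal, y ∈ L.dom := by
  have hfin : ((L.R.toReal : ℝ) : EReal) = L.R := EReal.coe_toReal hR.ne (ne_bot_of_gt L.R_pos)
  have hpos : 0 < L.R.toReal := by
    have := L.R_pos
    rw [← hfin] at this
    exact_mod_cast this
  filter_upwards [Ioo_mem_nhdsLT hpos] with y hy
  refine ⟨hy.1.le, ?_⟩
  rw [← hfin]
  exact_mod_cast hy.2

/-- The norm bound for the Weyl solutions that gives the decay at a finite `R`. -/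
theorem norm_mulL2_weyl_le (hR : L.R < ⊤) {y : ℝ} (hy : y ∈ L.dom) {m : ℝ → ℂ} (hm : Measurable m)
    (hmw : ∀ η, ‖m η‖ ≤ ‖L.weyl (2 * Real.pi * η, y)‖) (f : L2R) :
    ‖mulL2 m f‖ ≤ √(1 - y / L.R.toReal) * ‖f‖ :=
  norm_mulL2_apply_le hm (fun η => (hmw η).trans (Real.le_sqrt_of_sq_le (norm_sq_weyl_le hR _ hy))) f

theorem tendsto_sqrt_R (hR : L.R < ⊤) (C : ℝ) :
    Tendsto (fun y => √(1 - y / L.R.toReal) * C) (𝓝[<] L.R.toReal) (𝓝 0) := by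
  have hfin : ((L.R.toReal : ℝ) : EReal) = L.R := EReal.coe_toReal hR.ne (ne_bot_of_gt L.R_pos)
  have hpos : 0 < L.R.toReal := by
    have := L.R_pos
    rw [← hfin] at this
    exact_mod_cast this
  have hc : Continuous fun y : ℝ => √(1 - y / L.R.toReal) * C := by fun_prop
  have := (hc.tendsto L.R.toReal).mono_left (nhdsWithin_le_nhds (s := Iio L.R.toReal))
  simpa [div_self hpos.ne'] using this

/-- The Fourier transform of a harmonic function. -/
theorem IsHarmonicExtension.fslice_eq (hu : L.IsHarmonicExtension f u) {y : ℝ} (hy : y ∈ L.dom) :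
    fslice u y = mulL2 (fun η => L.weyl (2 * Real.pi * η, y)) (𝓕 f : L2R) := by
  have hmw := L.measurable_weyl
  have hH := hu.1
  have hb : IsBddMeas fun η => L.weyl (2 * Real.pi * η, y) :=
    ⟨by fun_prop, 1, fun η => norm_weyl_le_one _ hy⟩
  have hbt : ∀ N, ∀ y ∈ L.dom, IsBddMeas (L.trunc N fun η => L.weyl (2 * Real.pi * η, y)) :=
    fun N y hy => isBddMeas_trunc (by fun_prop) fun η _ => norm_weyl_le_one _ hy
  have hF0 : fslice u 0 = 𝓕 f := by rw [fslice, hu.slice_zero]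
  have key : ∀ N : ℕ, L.cutL2 N (fslice u y) =
      mulL2 (L.trunc N fun η => L.weyl (2 * Real.pi * η, y)) (𝓕 f : L2R) := by
    intro N
    set V : ℝ → L2R := fun y => mulL2 (L.trunc N fun η => L.weyl (2 * Real.pi * η, y)) (𝓕 f : L2R)
      with hV
    set D : ℝ → L2R := fun y => L.cutL2 N (fslice u y) - V y with hD
    have hVle : ∀ y ∈ L.dom, ‖V y‖ ≤ ‖f‖ := fun y hy => by
      have := norm_mulL2_apply_le (hbt N y hy).1
        (norm_trunc_le zero_le_one fun η _ => norm_weyl_le_one (2 * Real.pi * η) hy) (𝓕 f : L2R)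
      rwa [one_mul, Lp.norm_fourier_eq] at this
    have hD0 : D 0 = 0 := by
      simp only [hD, hV, hF0, weyl_zero, cutL2, sub_self]
    have hDle : ∀ y ∈ L.dom, ‖D y‖ ≤ ‖slice u y‖ + ‖V y‖ := fun y hy => by
      refine (norm_sub_le _ _).trans (add_le_add ((norm_cutL2_le N _).trans ?_) le_rfl)
      rw [norm_fslice]
    have hconv : ∀ t ∈ L.dom, ∀ y ∈ Icc 0 t, t * ‖D y‖ ^ 2 ≤ y * ‖D t‖ ^ 2 := by
      intro t ht y hy
      rcases eq_or_lt_of_le hy.1 with rfl | hy0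
      · simp [hD0]
      have hSV := solvesOn_weyl_mulL2 N (𝓕 f : L2R) ht
      have hDc : ContinuousOn D (Icc 0 t) :=
        ((L.cutL2 N).continuous.comp_continuousOn
          (hH.continuousOn_fslice.mono (Icc_subset_dom le_rfl ht))).sub hSV.continuousOn
      have hlim : Tendsto (fun s => ‖D s‖ ^ 2) (𝓝[>] 0) (𝓝 0) := by
        have h1 : Tendsto D (𝓝[Icc 0 t] 0) (𝓝 (D 0)) := hDc 0 ⟨le_rfl, ht.1⟩
        rw [hD0] at h1
        have h2 : 𝓝[>] (0 : ℝ) ≤ 𝓝[Icc 0 t] 0 := by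
          rw [← nhdsWithin_Ioo_eq_nhdsGT (hy0.trans_le hy.2)]
          exact nhdsWithin_mono _ Ioo_subset_Icc_self
        simpa using (h1.mono_left h2).norm.pow 2
      -- The equation for u is available only on [s, t] with s > 0. The convexity inequality passes
      -- to the limit s → 0⁺ because D is continuous down to 0 and D(0) = 0.
      have hineq : ∀ᶠ s in 𝓝[>] (0 : ℝ), (t - s) * ‖D y‖ ^ 2 ≤
          (t - y) * ‖D s‖ ^ 2 + (y - s) * ‖D t‖ ^ 2 := by
        filter_upwards [Ioo_mem_nhdsGT hy0] with s hs
        have hst : s < t := hs.2.trans_le hy.2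
        obtain ⟨h, hS⟩ := hH.exists_solvesOn N hs.1 hst ht
        exact (hS.sub (hSV.mono le_rfl ht hs.1.le hst.le le_rfl) hs.1.le ht).norm_sq_convex hs.1.le ht
          (L.freqL2_symm N) ⟨hs.2.le, hy.2⟩
      have hid : Tendsto (fun s : ℝ => s) (𝓝[>] 0) (𝓝 0) := tendsto_nhdsWithin_of_tendsto_nhds
        tendsto_id
      have l1 : Tendsto (fun s => (t - s) * ‖D y‖ ^ 2) (𝓝[>] 0) (𝓝 (t * ‖D y‖ ^ 2)) := by
        simpa using (hid.const_sub t).mul_const (‖D y‖ ^ 2)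
      have l2 : Tendsto (fun s => (t - y) * ‖D s‖ ^ 2 + (y - s) * ‖D t‖ ^ 2) (𝓝[>] 0)
          (𝓝 (y * ‖D t‖ ^ 2)) := by
        simpa using (hlim.const_mul (t - y)).add ((hid.const_sub y).mul_const (‖D t‖ ^ 2))
      exact le_of_tendsto_of_tendsto l1 l2 hineq
    have hzero := eq_zero_of_convex (L := L) (G := fun y => ‖D y‖ ^ 2) (fun y => by positivity) hconv
      (fun hR => by
        obtain ⟨C, hC⟩ := hH.bounded hR
        refine ⟨(C + ‖f‖) ^ 2, fun t ht => ?_⟩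
        refine pow_le_pow_left₀ (norm_nonneg _) ((hDle t ht).trans (add_le_add ?_ (hVle t ht))) 2
        refine norm_slice_le_of_eLpNorm_le C.2 ((hC t ht).trans (le_of_eq ?_))
        exact (ENNReal.ofReal_coe_nnreal).symm)
      (fun hR => by
        have h1 := ((hH.tendsto_norm_slice hR).add (tendsto_sqrt_R hR ‖(𝓕 f : L2R)‖)).pow 2
        simp only [add_zero, ne_eq, OfNat.ofNat_ne_zero, not_false_eq_true, zero_pow] at h1
        refine squeeze_zero' (Eventually.of_forall fun y => by positivity) ?_ h1
        filter_upwards [eventually_mem_dom hR] with y hy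
        refine pow_le_pow_left₀ (norm_nonneg _) ((hDle y hy).trans (add_le_add le_rfl ?_)) 2
        refine norm_mulL2_weyl_le hR hy (hbt N y hy).1 (fun η => ?_) _
        by_cases hη : η ∈ L.cut N <;> simp [trunc, indicator, hη])
      y hy
    exact sub_eq_zero.1 (norm_eq_zero.1 (pow_eq_zero_iff two_ne_zero |>.1 hzero))
  refine Lp.ext ?_
  -- There are countably many cut-offs, and each frequency belongs to one of them.
  have hae : ∀ᵐ η, ∀ N : ℕ, L.trunc N (fun _ => 1) η * fslice u y η =
      L.trunc N (fun η => L.weyl (2 * Real.pi * η, y)) η * (𝓕 f : L2R) η := by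
    rw [ae_all_iff]
    intro N
    have h1 := coeFn_mulL2 (L.isBddMeas_cut N) (fslice u y)
    have h2 := coeFn_mulL2 (hbt N y hy) (𝓕 f : L2R)
    rw [← key N] at h2
    filter_upwards [h1, h2] with η h1 h2
    rw [← h1, ← h2]
    rfl
  filter_upwards [hae, coeFn_mulL2 hb (𝓕 f : L2R)] with η h1 h2
  obtain ⟨N, hN⟩ := exists_mem_cut (L := L) η
  have := h1 N
  simp only [trunc, indicator, hN, if_true, one_mul] at this
  rw [this, h2]

end OperatorL

/-! ### Difference quotients at the boundary -/

namespace OperatorL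

variable {L : OperatorL} {u : ℝ → ℝ → ℂ} {f : L2R}

theorem exists_pos_mem_dom : ∃ t ∈ L.dom, 0 < t := exists_gt_mem_dom L.zero_mem_dom

theorem eventually_pos_mem_dom : ∀ᶠ y in 𝓝[>] (0 : ℝ), y ∈ L.dom ∧ 0 < y := by
  obtain ⟨t, ht, h0⟩ := exists_pos_mem_dom (L := L)
  filter_upwards [Ioo_mem_nhdsGT h0] with y hy
  exact ⟨mem_dom_of_le ht hy.1.le hy.2.le, hy.1⟩

/-- Integration of |φ'| ≤ |k| from 0 to y. -/
theorem norm_weyl_sub_one_le (ξ : ℝ) {y : ℝ} (hy : y ∈ L.dom) :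
    ‖L.weyl (ξ, y) - 1‖ ≤ ‖L.symbol ξ‖ * y := by
  have h := (solvesOn_weyl (L := L) ξ hy).eq_fst y ⟨hy.1, le_rfl⟩
  simp only [weyl_zero] at h
  rw [h, add_sub_cancel_left]
  refine (norm_setIntegral_le_of_norm_le_const (C := ‖L.symbol ξ‖) (by simp) fun r hr =>
    norm_dweyl_le ξ (mem_dom_of_le hy hr.1 hr.2.le)).trans (le_of_eq ?_)
  simp [measureReal_def, hy.1]

/-- The domination of the difference quotients by |k|, uniform in y: multiplied by f̂ it is square
integrable exactly when k f̂ is. -/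
theorem norm_weyl_sub_one_div_le (ξ : ℝ) {y : ℝ} (hy : y ∈ L.dom) (h0 : 0 < y) :
    ‖(L.weyl (ξ, y) - 1) / (y : ℂ)‖ ≤ ‖L.symbol ξ‖ := by
  rw [norm_div, Complex.norm_real, Real.norm_of_nonneg h0.le, div_le_iff₀ h0]
  exact norm_weyl_sub_one_le ξ hy

/-- The jump of φ' at 0 is ξ² a({0}), which is zero for the class considered. The contribution of b
tends to zero since b is integrable near 0 and φ' is bounded. -/
theorem tendsto_dweyl_zero (hL : L.IsStar) (ξ : ℝ) :
    Tendsto (fun y => L.dweyl (ξ, y)) (𝓝[>] 0) (𝓝 (-L.symbol ξ)) := by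
  obtain ⟨t, ht, h0⟩ := exists_pos_mem_dom (L := L)
  have ha : Tendsto (fun r => L.a (Ico 0 r)) (𝓝[>] 0) (𝓝 0) := by
    have := tendsto_measure_biInter_gt (μ := L.a) (s := fun r : ℝ => Ico 0 r) (a := 0)
      (fun r _ => measurableSet_Ico.nullMeasurableSet) (fun i j _ hij => Ico_subset_Ico_right hij)
      ⟨t, h0, (a_Ico_lt_top le_rfl ht).ne⟩
    -- The half-open intervals [0, r) shrink to the point 0, not to the empty set.
    have e : (⋂ r > (0 : ℝ), Ico 0 r) = {0} := by
      ext x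
      simp only [mem_iInter, mem_Ico, mem_singleton_iff]
      refine ⟨fun h => le_antisymm (le_of_forall_gt_imp_ge_of_dense fun r hr => (h r hr).2.le)
        (h 1 one_pos).1, fun h r hr => by subst h; exact ⟨le_rfl, hr⟩⟩
    rw [e, hL] at this
    exact this
  have ha' : Tendsto (fun r => L.a.real (Ico 0 r)) (𝓝[>] 0) (𝓝 0) := by
    have := (ENNReal.tendsto_toReal ENNReal.zero_ne_top).comp ha
    simpa using! this
  have hb : Tendsto (fun r => ∫ y in Ico 0 r, |L.b y|) (𝓝[>] 0) (𝓝 0) := by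
    have h1 := intervalIntegral.continuousOn_primitive (integrableOn_b le_rfl ht).abs 0
      ⟨le_rfl, ht.1⟩
    have h2 : 𝓝[>] (0 : ℝ) ≤ 𝓝[Icc 0 t] 0 := by
      rw [← nhdsWithin_Ioo_eq_nhdsGT h0]
      exact nhdsWithin_mono _ Ioo_subset_Icc_self
    have h3 := Tendsto.mono_left h1 h2
    simp only [Ioc_self, Measure.restrict_empty, integral_zero_measure] at h3
    refine h3.congr' ?_
    filter_upwards [self_mem_nhdsWithin] with r hr
    rw [← intervalIntegral_eq_Ico (le_of_lt hr), intervalIntegral.integral_of_le (le_of_lt hr)]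
  rw [tendsto_iff_norm_sub_tendsto_zero]
  have hbd : Tendsto (fun r => (|ξ| * (|ξ| * 1)) * L.a.real (Ico 0 r) +
      (2 * (|ξ| * ‖L.symbol ξ‖)) * ∫ y in Ico 0 r, |L.b y|) (𝓝[>] 0) (𝓝 0) := by
    simpa using (ha'.const_mul (|ξ| * (|ξ| * 1))).add (hb.const_mul (2 * (|ξ| * ‖L.symbol ξ‖)))
  refine squeeze_zero' (Eventually.of_forall fun _ => norm_nonneg _) ?_ hbd
  filter_upwards [eventually_pos_mem_dom (L := L)] with r hr
  have h := (solvesOn_weyl (L := L) ξ hr.1).eq_snd r ⟨hr.1.1, le_rfl⟩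
  simp only [dweyl_zero, mulC_apply, smul_eq_mul] at h
  rw [h, add_assoc, add_sub_cancel_left]
  refine (norm_add_le _ _).trans (add_le_add ?_ ?_)
  · refine (norm_setIntegral_le_of_norm_le_const (a_Ico_lt_top le_rfl hr.1) fun y hy => ?_)
    rw [norm_mul, norm_mul, Complex.norm_real, Real.norm_eq_abs]
    gcongr
    exact norm_weyl_le_one ξ (mem_dom_of_le hr.1 hy.1 hy.2.le)
  · rw [← integral_const_mul]
    refine norm_integral_le_of_norm_le (IntegrableOn.mono_set
      ((integrableOn_b le_rfl hr.1).abs.const_mul _) Ico_subset_Icc_self) ?_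
    refine ae_restrict_of_forall_mem measurableSet_Ico fun y hy => ?_
    rw [norm_mul, norm_mul, norm_neg, norm_mul, norm_mul, Complex.norm_I, Complex.norm_ofNat,
      Complex.norm_real, Complex.norm_real, Real.norm_eq_abs, Real.norm_eq_abs, mul_one]
    calc 2 * |L.b y| * (|ξ| * ‖L.dweyl (ξ, y)‖) ≤ 2 * |L.b y| * (|ξ| * ‖L.symbol ξ‖) := by
          gcongr
          exact norm_dweyl_le ξ (mem_dom_of_le hr.1 hy.1 hy.2.le)
      _ = _ := by ring

/-- The quotient is the mean of φ' over [0, y), so it converges to the right limit of φ' at 0. -/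
theorem tendsto_weyl_sub_one_div (hL : L.IsStar) (ξ : ℝ) :
    Tendsto (fun y : ℝ => (L.weyl (ξ, y) - 1) / (y : ℂ)) (𝓝[>] 0) (𝓝 (-L.symbol ξ)) := by
  rw [Metric.tendsto_nhds]
  intro ε hε
  have h := tendsto_dweyl_zero hL ξ
  rw [Metric.tendsto_nhds] at h
  have h1 := h (ε / 2) (half_pos hε)
  rw [eventually_nhdsWithin_iff, Metric.eventually_nhds_iff] at h1
  obtain ⟨δ, hδ, hδ'⟩ := h1
  filter_upwards [eventually_pos_mem_dom (L := L), Ioo_mem_nhdsGT hδ] with y hy hyδ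
  have S := solvesOn_weyl (L := L) ξ hy.1
  have he := S.eq_fst y ⟨hy.1.1, le_rfl⟩
  simp only [weyl_zero] at he
  have hi : IntegrableOn (fun r => L.dweyl (ξ, r)) (Ico 0 y) :=
    S.integrableOn_snd.mono_set Ico_subset_Icc_self
  have hvol : volume.real (Ico 0 y) = y := by simp [measureReal_def, hy.1.1]
  have hy0 : (y : ℂ) ≠ 0 := by exact_mod_cast hy.2.ne'
  have e : (L.weyl (ξ, y) - 1) / (y : ℂ) - -L.symbol ξ =
      -- The open interval excludes r = 0, about which the one-sided limit says nothing.
      (∫ r in Ioo 0 y, (L.dweyl (ξ, r) - -L.symbol ξ)) / (y : ℂ) := by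
    rw [← integral_Ico_eq_integral_Ioo, integral_sub hi (integrableOn_const (by simp)),
      setIntegral_const, hvol, he]
    rw [Complex.real_smul]
    field_simp
    ring
  rw [dist_eq_norm, e, norm_div, Complex.norm_real, Real.norm_of_nonneg hy.2.le,
    div_lt_iff₀ hy.2]
  refine (norm_setIntegral_le_of_norm_le_const (C := ε / 2) (by simp) fun r hr => ?_).trans_lt ?_
  · rw [← dist_eq_norm]
    refine (hδ' ?_ hr.1).le
    rw [Real.dist_eq, sub_zero, abs_of_pos hr.1]
    exact hr.2.trans hyδ.2
  · have : volume.real (Ioo 0 y) = y := by simp [measureReal_def, hy.1.1]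
    rw [this]
    nlinarith [hy.2]

/-- The difference quotients in the frequency domain. -/
theorem IsHarmonicExtension.eLpNorm_eq (hu : L.IsHarmonicExtension f u) (g : L2R) {y : ℝ}
    (hy : y ∈ L.dom) : eLpNorm (fun x => (u x y - u x 0) / (y : ℂ) - g x) 2 volume =
      eLpNorm (fun η => (L.weyl (2 * Real.pi * η, y) - 1) / (y : ℂ) * (𝓕 f : L2R) η
        - (𝓕 g : L2R) η) 2 volume := by
  have hb : IsBddMeas fun η => L.weyl (2 * Real.pi * η, y) := by
    have := L.measurable_weyl
    exact ⟨by fun_prop, 1, fun η => norm_weyl_le_one _ hy⟩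
  have h1 : eLpNorm (fun x => (u x y - u x 0) / (y : ℂ) - g x) 2 volume =
      ‖(y : ℂ)⁻¹ • (slice u y - f) - g‖ₑ := by
    rw [Lp.enorm_def]
    refine eLpNorm_congr_ae ?_
    filter_upwards [Lp.coeFn_sub ((y : ℂ)⁻¹ • (slice u y - f)) g,
      Lp.coeFn_smul (y : ℂ)⁻¹ (slice u y - f), Lp.coeFn_sub (slice u y) f,
      coeFn_toL2 (hu.1.memLp y hy), hu.2] with x e1 e2 e3 e4 e5
    rw [e1, Pi.sub_apply, e2, Pi.smul_apply, e3, Pi.sub_apply, slice, e4, e5, smul_eq_mul]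
    ring
  have h2 : ‖(y : ℂ)⁻¹ • (slice u y - f) - g‖ₑ =
      ‖(y : ℂ)⁻¹ • (fslice u y - (𝓕 f : L2R)) - (𝓕 g : L2R)‖ₑ := by
    have e : (y : ℂ)⁻¹ • (fslice u y - (𝓕 f : L2R)) - (𝓕 g : L2R) =
        Lp.fourierTransformₗᵢ ℝ ℂ ((y : ℂ)⁻¹ • (slice u y - f) - g) := by
      rw [map_sub, map_smul, map_sub]
      rfl
    rw [e, ← ofReal_norm, ← ofReal_norm, LinearIsometryEquiv.norm_map]
  rw [h1, h2, Lp.enorm_def]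
  refine eLpNorm_congr_ae ?_
  filter_upwards [Lp.coeFn_sub ((y : ℂ)⁻¹ • (fslice u y - (𝓕 f : L2R))) (𝓕 g : L2R),
    Lp.coeFn_smul (y : ℂ)⁻¹ (fslice u y - (𝓕 f : L2R)), Lp.coeFn_sub (fslice u y) (𝓕 f : L2R),
    coeFn_mulL2 hb (𝓕 f : L2R)] with x e1 e2 e3 e4
  rw [e1, Pi.sub_apply, e2, Pi.smul_apply, e3, Pi.sub_apply, hu.fslice_eq hy, e4, smul_eq_mul]
  ring

/-- Convergence in L² along a sequence y → 0⁺ gives almost everywhere convergence along a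
subsequence, and the pointwise limit of the quotients is -k f̂. -/
theorem IsHarmonicExtension.fourier_normalDerivative (hL : L.IsStar)
    (hu : L.IsHarmonicExtension f u) {g : L2R} (hg : HasNormalDerivative u g) :
    (𝓕 g : L2R) =ᵐ[volume] fun η => -L.symbol (2 * Real.pi * η) * (𝓕 f : L2R) η := by
  obtain ⟨t, ht, h0⟩ := exists_pos_mem_dom (L := L)
  have hmw := L.measurable_weyl
  have hmf := (Lp.stronglyMeasurable (𝓕 f : L2R)).measurable
  set yy : ℕ → ℝ := fun n => t / ((n : ℝ) + 1) with hyy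
  have hyy0 : ∀ n, 0 < yy n := fun n => by positivity
  have hyyt : ∀ n, yy n ∈ L.dom := fun n => mem_dom_of_le ht (hyy0 n).le (by
    simp only [hyy]
    rw [div_le_iff₀ (by positivity)]
    nlinarith [n.cast_nonneg (α := ℝ)])
  have hyylim : Tendsto yy atTop (𝓝[>] 0) := by
    refine tendsto_nhdsWithin_iff.2 ⟨?_, Eventually.of_forall hyy0⟩
    have := tendsto_one_div_add_atTop_nhds_zero_nat (𝕜 := ℝ)
    simpa [hyy, div_eq_mul_inv] using this.const_mul t
  have h1 := (hg : Tendsto _ _ _).comp hyylim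
  simp only [Function.comp_def] at h1
  simp only [hu.eLpNorm_eq g (hyyt _)] at h1
  have h2 : TendstoInMeasure volume (fun n η => (L.weyl (2 * Real.pi * η, yy n) - 1) / (yy n : ℂ) *
      (𝓕 f : L2R) η) atTop (𝓕 g : L2R) := by
    refine tendstoInMeasure_of_tendsto_eLpNorm (p := 2) (by simp) (fun n => ?_)
      (Lp.aestronglyMeasurable _) h1
    have : Measurable fun η => (L.weyl (2 * Real.pi * η, yy n) - 1) / (yy n : ℂ) *
      (𝓕 f : L2R) η := by fun_prop
    exact this.aestronglyMeasurable
  obtain ⟨ns, hns, hlim⟩ := h2.exists_seq_tendsto_ae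
  filter_upwards [hlim] with η hη
  refine tendsto_nhds_unique hη ?_
  have h3 := (tendsto_weyl_sub_one_div hL (2 * Real.pi * η)).comp
    (hyylim.comp hns.tendsto_atTop)
  exact h3.mul_const _

/-- Dominated convergence in L²: the quotients converge at every frequency and are dominated by |k
f̂|, which is square integrable because -k f̂ is the transform of g. -/
theorem IsHarmonicExtension.hasNormalDerivative (hL : L.IsStar) (hu : L.IsHarmonicExtension f u)
    {g : L2R}
    (hg : (𝓕 g : L2R) =ᵐ[volume] fun η => -L.symbol (2 * Real.pi * η) * (𝓕 f : L2R) η) :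
    HasNormalDerivative u g := by
  have hmw := L.measurable_weyl
  have hms := L.measurable_symbol
  have hmf := (Lp.stronglyMeasurable (𝓕 f : L2R)).measurable
  have hD : MemLp (fun η => ‖-L.symbol (2 * Real.pi * η) * (𝓕 f : L2R) η‖) 2 volume :=
    ((memLp_congr_ae hg).1 (Lp.memLp _)).norm
  have h := (tendsto_toL2_of_dominated (l := 𝓝[>] (0 : ℝ))
    (Φ := fun y η => (L.weyl (2 * Real.pi * η, y) - 1) / (y : ℂ) * (𝓕 f : L2R) η)
    (Φ₀ := fun η => -L.symbol (2 * Real.pi * η) * (𝓕 f : L2R) η) hD (fun y => by fun_prop)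
    (by
      filter_upwards [eventually_pos_mem_dom (L := L)] with y hy
      refine ae_of_all _ fun η => ?_
      rw [norm_mul, norm_mul, norm_neg]
      exact mul_le_mul_of_nonneg_right (norm_weyl_sub_one_div_le _ hy.1 hy.2) (norm_nonneg _))
    (by fun_prop) (ae_of_all _ fun η => le_rfl)
    (ae_of_all _ fun η => (tendsto_weyl_sub_one_div hL _).mul_const _)).1
  refine h.congr' ?_
  filter_upwards [eventually_pos_mem_dom (L := L)] with y hy
  rw [hu.eLpNorm_eq g hy.1]
  refine eLpNorm_congr_ae ?_
  filter_upwards [hg] with η hη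
  rw [hη]

end OperatorL

/-! ### Rescaling of the frequency -/

/-- The passage from ξ to η multiplies Lebesgue measure by a positive finite constant, so null sets
and square integrability are unaffected. -/
theorem map_volume_div_two_pi : ∃ c : ℝ≥0∞, c ≠ 0 ∧ c ≠ ⊤ ∧
    Measure.map (fun ξ : ℝ => ξ / (2 * Real.pi)) volume = c • volume := by
  have h : (2 * Real.pi)⁻¹ ≠ 0 := by positivity
  refine ⟨ENNReal.ofReal |((2 * Real.pi)⁻¹)⁻¹|, by simp, ENNReal.ofReal_ne_top, ?_⟩
  rw [← Real.map_volume_mul_left h]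
  congr 1
  funext ξ
  rw [div_eq_inv_mul]

theorem measurableEmbedding_div_two_pi :
    MeasurableEmbedding fun ξ : ℝ => ξ / (2 * Real.pi) := by
  have h : (2 * Real.pi)⁻¹ ≠ 0 := by positivity
  have := (Homeomorph.mulRight₀ _ h).measurableEmbedding
  simpa only [Homeomorph.coe_mulRight₀, ← div_eq_mul_inv] using! this

theorem memLp_comp_div_two_pi {Φ : ℝ → ℂ} :
    MemLp (fun ξ => Φ (ξ / (2 * Real.pi))) 2 volume ↔ MemLp Φ 2 volume := by
  obtain ⟨c, hc0, hct, hc⟩ := map_volume_div_two_pi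
  have h := measurableEmbedding_div_two_pi.memLp_map_measure_iff (g := Φ) (p := 2) (μ := volume)
  rw [hc] at h
  refine h.symm.trans ⟨fun h' => ?_, fun h' => h'.smul_measure hct⟩
  have := h'.smul_measure (c := c⁻¹) (by simpa using hc0)
  rwa [smul_smul, ENNReal.inv_mul_cancel hc0 hct, one_smul] at this

theorem ae_div_two_pi {P : ℝ → Prop} : (∀ᵐ ξ : ℝ, P (ξ / (2 * Real.pi))) ↔ ∀ᵐ η : ℝ, P η := by
  obtain ⟨c, hc0, hct, hc⟩ := map_volume_div_two_pi
  have h := measurableEmbedding_div_two_pi.ae_map_iff (p := P) (μ := volume)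
  rw [hc, Measure.ae_ennreal_smul_measure_iff hc0] at h
  exact h.symm

namespace OperatorL

variable {L : OperatorL} {f g : L2R}

/-- The frequency 0, where the two functions may differ, is a null set. -/
theorem k_ae_eq : ∀ᵐ ξ : ℝ, L.k ξ = L.symbol (2 * Real.pi * (ξ / (2 * Real.pi))) := by
  have hne : ∀ᵐ ξ : ℝ, ξ ≠ 0 := by simp [ae_iff]
  filter_upwards [hne] with ξ hξ
  rw [mul_div_cancel₀ _ (by positivity), k_eq_symbol hξ]

theorem memLp_k_hat_iff : MemLp (fun ξ => L.k ξ * hat f ξ) 2 volume ↔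
    MemLp (fun η => L.symbol (2 * Real.pi * η) * (𝓕 f : L2R) η) 2 volume := by
  rw [← memLp_comp_div_two_pi
    (Φ := fun η => L.symbol (2 * Real.pi * η) * (𝓕 f : L2R) η)]
  refine memLp_congr_ae ?_
  filter_upwards [k_ae_eq (L := L)] with ξ hξ
  rw [hξ, hat]

theorem hat_eq_iff : (hat g =ᵐ[volume] fun ξ => -L.k ξ * hat f ξ) ↔
    (𝓕 g : L2R) =ᵐ[volume] fun η => -L.symbol (2 * Real.pi * η) * (𝓕 f : L2R) η := by
  have h1 : ((𝓕 g : L2R) =ᵐ[volume] fun η => -L.symbol (2 * Real.pi * η) * (𝓕 f : L2R) η) ↔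
      ∀ᵐ ξ : ℝ, hat g ξ = -L.symbol (2 * Real.pi * (ξ / (2 * Real.pi))) * hat f ξ :=
    (ae_div_two_pi (P := fun η => (𝓕 g : L2R) η =
      -L.symbol (2 * Real.pi * η) * (𝓕 f : L2R) η)).symm
  rw [h1]
  constructor
  · intro h
    filter_upwards [h, k_ae_eq (L := L)] with ξ h1 h2
    rw [h1, h2]
  · intro h
    filter_upwards [h, k_ae_eq (L := L)] with ξ h1 h2
    rw [h1, h2]

/-- The Fourier multiplier applied to a function in its domain. -/
def neumann (L : OperatorL) (f : L2R) : L2R :=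
  𝓕⁻ (toL2 fun η => -L.symbol (2 * Real.pi * η) * (𝓕 f : L2R) η)

theorem fourier_neumann
    (h : MemLp (fun η => L.symbol (2 * Real.pi * η) * (𝓕 f : L2R) η) 2 volume) :
    (𝓕 (L.neumann f) : L2R) =ᵐ[volume] fun η => -L.symbol (2 * Real.pi * η) * (𝓕 f : L2R) η := by
  rw [neumann, FourierTransform.fourier_fourierInv_eq]
  refine coeFn_toL2 (h.neg.ae_eq (Eventually.of_forall fun η => ?_))
  simp

theorem eq_of_fourier_ae_eq (h : (𝓕 f : L2R) =ᵐ[volume] (𝓕 g : L2R)) : f = g :=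
  (Lp.fourierTransformₗᵢ ℝ ℂ).injective (Lp.ext h)

end OperatorL

/-! ### Jointly measurable versions of `L²`-valued functions -/

theorem locallyIntegrable_coeFn (f : L2R) : LocallyIntegrable (f : ℝ → ℂ) volume :=
  (Lp.memLp f).locallyIntegrable (by simp)

/-- The integral over a bounded interval is the inner product with its indicator, a continuous
functional on L². -/
theorem stronglyMeasurable_intervalIntegral_coeFn {F : ℝ → L2R} (hF : StronglyMeasurable F)
    {s t : ℝ} (hst : s ≤ t) : StronglyMeasurable fun y => ∫ r in s..t, F y r := by
  have e : (fun y => ∫ r in s..t, F y r) = fun y => inner ℂ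
      (indicatorConstLp 2 (measurableSet_Ioc (a := s) (b := t)) measure_Ioc_lt_top.ne (1 : ℂ))
      (F y) := by
    funext y
    rw [intervalIntegral.integral_of_le hst, L2.inner_indicatorConstLp_one]
  rw [e]
  exact (innerSL ℂ (indicatorConstLp 2 (measurableSet_Ioc (a := s) (b := t))
    measure_Ioc_lt_top.ne (1 : ℂ))).continuous.comp_stronglyMeasurable hF

/-- A measurable `L²`-valued function has a jointly measurable version. -/
theorem exists_measurable_version {F : ℝ → L2R} (hF : StronglyMeasurable F) :
    ∃ u : ℝ → ℝ → ℂ, (Measurable fun p : ℝ × ℝ => u p.1 p.2) ∧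
      ∀ y, (fun x => u x y) =ᵐ[volume] F y := by
  let ε : ℕ → ℝ := fun n => 1 / ((n : ℝ) + 1)
  have hε : ∀ n, 0 < ε n := fun n => by positivity
  -- Forward averages do not depend on the representative of F(y). They are continuous in x and
  -- measurable in y, hence jointly measurable, and Lebesgue differentiation recovers F(y) almost
  -- everywhere.
  let m : ℕ → ℝ → ℝ → ℂ := fun n x y => (ε n)⁻¹ • ∫ r in x..x + ε n, F y r
  have hint : ∀ y a b, IntervalIntegrable (F y) volume a b := fun y a b =>
    intervalIntegrable_iff.2 (((locallyIntegrable_coeFn (F y)).integrableOn_isCompact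
      isCompact_uIcc).mono_set uIoc_subset_uIcc)
  have hm : ∀ n, StronglyMeasurable fun p : ℝ × ℝ => m n p.1 p.2 := fun n => by
    refine stronglyMeasurable_uncurry_of_continuous_of_stronglyMeasurable (u := m n)
      (fun y => ?_) fun x => ?_
    · have e : (fun x => m n x y) =
          fun x => (ε n)⁻¹ • ((∫ r in (0 : ℝ)..x + ε n, F y r) - ∫ r in (0 : ℝ)..x, F y r) := by
        funext x
        simp only [m]
        rw [intervalIntegral.integral_interval_sub_left (hint y _ _) (hint y _ _)]
      have hc : Continuous fun x => ∫ r in (0 : ℝ)..x, F y r :=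
        intervalIntegral.continuous_primitive (hint y) 0
      rw [e]
      have hc' := hc.comp (continuous_id.add (continuous_const (y := ε n)))
      exact (hc'.sub hc).const_smul (ε n)⁻¹
    · exact (stronglyMeasurable_intervalIntegral_coeFn hF
        (le_add_of_nonneg_right (hε n).le : x ≤ x + ε n)).const_smul (ε n)⁻¹
  refine ⟨fun x y => limUnder atTop fun n => m n x y,
    (StronglyMeasurable.limUnder (f := fun n (p : ℝ × ℝ) => m n p.1 p.2) hm).measurable,
    fun y => ?_⟩
  filter_upwards [LocallyIntegrable.ae_hasDerivAt_integral (locallyIntegrable_coeFn (F y))] with x hx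
  refine Tendsto.limUnder_eq ?_
  have h := (hasDerivAt_iff_tendsto_slope_zero.1 (hx x)).comp (f := ε) (x := atTop)
    (tendsto_nhdsWithin_iff.2 ⟨tendsto_one_div_add_atTop_nhds_zero_nat,
      Eventually.of_forall fun n => (hε n).ne'⟩)
  refine h.congr fun n => ?_
  simp [m]

/-- Functions of two variables with a prescribed partial Fourier transform. -/
theorem exists_fslice_eq {Φ : ℝ → ℝ → ℂ} (hΦ : Measurable fun p : ℝ × ℝ => Φ p.1 p.2) :
    ∃ u : ℝ → ℝ → ℂ, (Measurable fun p : ℝ × ℝ => u p.1 p.2) ∧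
      (∀ y, MemLp (fun x => u x y) 2 volume) ∧ ∀ y, fslice u y = toL2 fun η => Φ η y := by
  have hF : StronglyMeasurable fun y => (𝓕⁻ (toL2 fun η => Φ η y) : L2R) :=
    (Lp.fourierTransformₗᵢ ℝ ℂ).symm.continuous.comp_stronglyMeasurable
      (stronglyMeasurable_toL2 hΦ)
  obtain ⟨u, hu, hu'⟩ := exists_measurable_version hF
  refine ⟨u, hu, fun y => (memLp_congr_ae (hu' y)).2 (Lp.memLp _), fun y => ?_⟩
  rw [fslice, slice, toL2_congr (hu' y), toL2_coeFn, FourierTransform.fourier_fourierInv_eq]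

/-! ### Partial Fourier transforms of test functions -/

namespace OperatorL.IsTest

variable {L : OperatorL} {v : ℝ → ℝ → ℂ}

theorem hasDerivAt_fst (hv : L.IsTest v) (x y : ℝ) : HasDerivAt (fun x' => v x' y)
    (fderiv ℝ (fun p : ℝ × ℝ => v p.1 p.2) (x, y) (1, 0)) x := by
  have h := (hv.smooth.differentiable (by simp) (x, y)).hasFDerivAt
  exact h.comp_hasDerivAt x ((hasDerivAt_id x).prodMk (hasDerivAt_const x y))

theorem hasDerivAt_snd (hv : L.IsTest v) (x y : ℝ) : HasDerivAt (fun y' => v x y')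
    (fderiv ℝ (fun p : ℝ × ℝ => v p.1 p.2) (x, y) (0, 1)) y := by
  have h := (hv.smooth.differentiable (by simp) (x, y)).hasFDerivAt
  exact h.comp_hasDerivAt y ((hasDerivAt_const y x).prodMk (hasDerivAt_id y))

theorem fderiv_apply (hv : L.IsTest v) (e : ℝ × ℝ) :
    L.IsTest fun x y => fderiv ℝ (fun p : ℝ × ℝ => v p.1 p.2) (x, y) e := by
  have hsub : tsupport (fun p => fderiv ℝ (fun p : ℝ × ℝ => v p.1 p.2) p e) ⊆
      tsupport fun p : ℝ × ℝ => v p.1 p.2 := tsupport_fderiv_apply_subset ℝ e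
  exact ⟨(hv.smooth.fderiv_right (m := ∞) (by simp)).clm_apply contDiff_const,
    hv.compact.isCompact.of_isClosed_subset (isClosed_tsupport _) hsub, hsub.trans hv.supp⟩

theorem deriv_fst (hv : L.IsTest v) : L.IsTest fun x y => deriv (fun x' => v x' y) x := by
  simpa only [(hv.hasDerivAt_fst _ _).deriv] using hv.fderiv_apply (1, 0)

theorem deriv_snd (hv : L.IsTest v) : L.IsTest fun x y => deriv (fun y' => v x y') y := by
  simpa only [(hv.hasDerivAt_snd _ _).deriv] using hv.fderiv_apply (0, 1)

theorem contDiff_fst (hv : L.IsTest v) (y : ℝ) : ContDiff ℝ ∞ fun x => v x y :=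
  hv.smooth.comp (contDiff_id.prodMk contDiff_const)

theorem contDiff_snd (hv : L.IsTest v) (x : ℝ) : ContDiff ℝ ∞ fun y => v x y :=
  hv.smooth.comp (contDiff_const.prodMk contDiff_id)

theorem exists_bound_fst (hv : L.IsTest v) : ∃ r, 0 ≤ r ∧ ∀ x y, x ∉ Icc (-r) r → v x y = 0 := by
  obtain ⟨r, hr⟩ := hv.compact.isCompact.isBounded.subset_closedBall 0
  refine ⟨|r|, abs_nonneg r, fun x y hx => ?_⟩
  by_contra h
  have h1 := hr (subset_tsupport (fun p : ℝ × ℝ => v p.1 p.2) (show (x, y) ∈ _ from h))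
  rw [mem_closedBall_zero_iff] at h1
  exact hx (abs_le.1 (((norm_fst_le (x, y)).trans h1).trans (le_abs_self r)))

theorem hasCompactSupport_fst (hv : L.IsTest v) (y : ℝ) : HasCompactSupport fun x => v x y := by
  obtain ⟨r, -, hr⟩ := hv.exists_bound_fst
  exact HasCompactSupport.intro isCompact_Icc fun x hx => hr x y hx

/-- The projection of the support to `(0, R)` is contained in a compact interval. -/
theorem exists_interval (hv : L.IsTest v) : ∃ s t, 0 < s ∧ s ≤ t ∧ t ∈ L.dom ∧
    ∀ x y, y ∉ Ioo s t → v x y = 0 := by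
  have hK : IsCompact (Prod.snd '' tsupport fun p : ℝ × ℝ => v p.1 p.2) :=
    hv.compact.isCompact.image continuous_snd
  have hsub : (Prod.snd '' tsupport fun p : ℝ × ℝ => v p.1 p.2) ⊆ L.int := by
    rintro _ ⟨p, hp, rfl⟩
    exact (hv.supp hp).2
  rcases (Prod.snd '' tsupport fun p : ℝ × ℝ => v p.1 p.2).eq_empty_or_nonempty with h | h
  · obtain ⟨t, ht, h0⟩ := exists_pos_mem_dom (L := L)
    refine ⟨t, t, h0, le_rfl, ht, fun x y _ => ?_⟩
    by_contra h1
    have : y ∈ (∅ : Set ℝ) := h ▸ ⟨(x, y), subset_tsupport _ h1, rfl⟩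
    exact this
  · obtain ⟨s, hs, hs'⟩ := hK.exists_isLeast h
    obtain ⟨t, ht, ht'⟩ := hK.exists_isGreatest h
    obtain ⟨T, hT, htT⟩ := exists_gt_mem_dom (int_subset_dom (hsub ht))
    have hs0 := (hsub hs).1
    refine ⟨s / 2, T, by linarith, by linarith [hs' ht], hT, fun x y hy => ?_⟩
    by_contra h1
    have hm : y ∈ Prod.snd '' tsupport fun p : ℝ × ℝ => v p.1 p.2 :=
      ⟨(x, y), subset_tsupport _ h1, rfl⟩
    exact hy ⟨by linarith [hs' hm], (ht' hm).trans_lt htT⟩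

theorem integral_norm_le (hv : L.IsTest v) : ∃ C, 0 ≤ C ∧ ∀ y, ∫ x, ‖v x y‖ ≤ C := by
  obtain ⟨M, hM⟩ := hv.smooth.continuous.bounded_above_of_compact_support hv.compact
  have hM0 : 0 ≤ M := (norm_nonneg _).trans (hM 0)
  obtain ⟨r, hr0, hr⟩ := hv.exists_bound_fst
  refine ⟨M * (2 * r), by positivity, fun y => ?_⟩
  have e : ∫ x, ‖v x y‖ = ∫ x in Icc (-r) r, ‖v x y‖ :=
    (setIntegral_eq_integral_of_forall_compl_eq_zero fun x hx => by simp [hr x y hx]).symm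
  rw [e]
  refine (Real.le_norm_self _).trans ((norm_setIntegral_le_of_norm_le_const (C := M)
    measure_Icc_lt_top fun x _ => ?_).trans (le_of_eq ?_))
  · simpa using hM (x, y)
  · rw [Measure.real, Real.volume_Icc, ENNReal.toReal_ofReal (by linarith)]
    ring

theorem invFT_deriv_fst (hv : L.IsTest v) (y η : ℝ) :
    invFT (fun x => deriv (fun x' => v x' y) x) η =
      -(((2 * Real.pi * η : ℝ) : ℂ) * Complex.I) * invFT (fun x => v x y) η :=
  invFT_deriv_test (hv.contDiff_fst y) (hv.hasCompactSupport_fst y) η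

/-- Bounding the transforms of v and ∂ₓ²v gives quadratic decay, uniformly in y. The weight is in
L², so its product with an L² function is integrable. -/
theorem norm_invFT_le (hv : L.IsTest v) : ∃ C, 0 ≤ C ∧ ∀ η y,
    ‖invFT (fun x => v x y) η‖ ≤ C * (1 + (2 * Real.pi * η) ^ 2)⁻¹ := by
  obtain ⟨C, hC0, hC⟩ := hv.integral_norm_le
  obtain ⟨D, hD0, hD⟩ := hv.deriv_fst.deriv_fst.integral_norm_le
  refine ⟨C + D, by positivity, fun η y => ?_⟩
  rw [← div_eq_mul_inv, le_div_iff₀ (by positivity)]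
  have h1 := (_root_.norm_invFT_le (fun x => v x y) η).trans (hC y)
  have h2 := (_root_.norm_invFT_le _ η).trans (hD y)
  rw [hv.deriv_fst.invFT_deriv_fst, hv.invFT_deriv_fst] at h2
  generalize 2 * Real.pi * η = ξ at h2 ⊢
  rw [norm_mul, norm_mul, norm_neg, norm_mul, Complex.norm_I, mul_one, Complex.norm_real,
    Real.norm_eq_abs, ← mul_assoc, abs_mul_abs_self] at h2
  nlinarith

theorem measurable_invFT (hv : L.IsTest v) :
    Measurable fun p : ℝ × ℝ => invFT (fun x => v x p.2) p.1 := by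
  have hc := hv.smooth.continuous
  have h : Continuous fun q : (ℝ × ℝ) × ℝ =>
      Complex.exp (((2 * Real.pi * q.1.1 : ℝ) : ℂ) * q.2 * Complex.I) * v q.2 q.1.2 :=
    Continuous.mul (by fun_prop)
      (hc.comp (continuous_snd.prodMk (continuous_snd.comp continuous_fst)))
  exact h.stronglyMeasurable.integral_prod_right'.measurable

theorem continuous_invFT (hv : L.IsTest v) (η : ℝ) :
    Continuous fun y => invFT (fun x => v x y) η := by
  obtain ⟨r, -, hr⟩ := hv.exists_bound_fst
  have e : (fun y => invFT (fun x => v x y) η) = fun y => ∫ x in Icc (-r) r,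
      Complex.exp (((2 * Real.pi * η : ℝ) : ℂ) * x * Complex.I) * v x y := by
    funext y
    exact (setIntegral_eq_integral_of_forall_compl_eq_zero fun x hx => by simp [hr x y hx]).symm
  rw [e]
  refine continuous_parametric_integral_of_continuous ?_ isCompact_Icc
  have hc := hv.smooth.continuous
  exact Continuous.mul (by fun_prop) (hc.comp (continuous_snd.prodMk continuous_fst))

theorem invFT_eq_zero {s t : ℝ} (hst : ∀ x y, y ∉ Ioo s t → v x y = 0) {y : ℝ} (hy : y ∉ Ioo s t)
    (η : ℝ) : invFT (fun x => v x y) η = 0 := by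
  simp [invFT, hst _ y hy]

/-- Fubini and the fundamental theorem of calculus: at a fixed frequency the transform of v is a
primitive of that of ∂ᵧv, as the integrations by parts in y require. -/
theorem invFT_eq_add_integral (hv : L.IsTest v) {s y : ℝ} (hsy : s ≤ y) (η : ℝ) :
    invFT (fun x => v x y) η = invFT (fun x => v x s) η +
      ∫ r in Ico s y, invFT (fun x => deriv (fun y' => v x y') r) η := by
  have hint : ∀ r, Integrable fun x : ℝ =>
      Complex.exp (((2 * Real.pi * η : ℝ) : ℂ) * x * Complex.I) * v x r := fun r =>
    Continuous.integrable_of_hasCompactSupport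
      (Continuous.mul (by fun_prop) (hv.contDiff_fst r).continuous)
      (hv.hasCompactSupport_fst r).mul_left
  have hv' := hv.deriv_snd
  have hc : Continuous fun p : ℝ × ℝ => Complex.exp (((2 * Real.pi * η : ℝ) : ℂ) * p.2 * Complex.I) *
      deriv (fun y' => v p.2 y') p.1 :=
    Continuous.mul (by fun_prop) (hv'.smooth.continuous.comp continuous_swap)
  have hswap : ∫ r in Ico s y, invFT (fun x => deriv (fun y' => v x y') r) η =
      ∫ x : ℝ, ∫ r in Ico s y, Complex.exp (((2 * Real.pi * η : ℝ) : ℂ) * x * Complex.I) *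
        deriv (fun y' => v x y') r := by
    simp only [invFT]
    refine integral_integral_swap ?_
    refine (Continuous.integrable_of_hasCompactSupport hc ?_).mono_measure
      (Measure.prod_mono Measure.restrict_le_self le_rfl)
    exact HasCompactSupport.mul_left (hv'.compact.comp_homeomorph (Homeomorph.prodComm ℝ ℝ))
  rw [hswap, invFT, invFT, ← sub_eq_iff_eq_add', ← integral_sub (hint y) (hint s)]
  refine integral_congr_ae (Eventually.of_forall fun x => ?_)
  simp only
  rw [integral_const_mul, ← intervalIntegral_eq_Ico hsy,
    intervalIntegral.integral_deriv_eq_sub (fun z _ => (hv.contDiff_snd x).differentiable (by simp) z)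
      ((hv'.contDiff_snd x).continuous.intervalIntegrable _ _)]
  ring

end OperatorL.IsTest

/-! ### Integrals over frequency and position -/

theorem memLp_inv_one_add_sq :
    MemLp (fun η : ℝ => (((1 + (2 * Real.pi * η) ^ 2)⁻¹ : ℝ) : ℂ)) 2 volume := by
  have hi : Integrable fun η : ℝ => (1 + (2 * Real.pi * η) ^ 2)⁻¹ :=
    integrable_inv_one_add_sq.comp_mul_left' (by positivity : 2 * Real.pi ≠ 0)
  have hc : Continuous fun η : ℝ => (1 + (2 * Real.pi * η) ^ 2)⁻¹ :=
    Continuous.inv₀ (by fun_prop) fun η => by positivity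
  refine MemLp.ofReal ((memLp_two_iff_integrable_sq hc.aestronglyMeasurable).2 ?_)
  refine hi.mono' (hc.pow 2).aestronglyMeasurable (Eventually.of_forall fun η => ?_)
  have h1 : (1 + (2 * Real.pi * η) ^ 2)⁻¹ ≤ 1 := inv_le_one_of_one_le₀ (by nlinarith [sq_nonneg (2 * Real.pi * η)])
  have h0 : 0 ≤ (1 + (2 * Real.pi * η) ^ 2)⁻¹ := by positivity
  rw [Real.norm_of_nonneg (by positivity)]
  nlinarith

/-- A bound by a product of a function of η and a function of y suffices for all the exchanges of
integrals below. -/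
theorem integrable_prod_of_norm_le {μ : Measure ℝ} [SFinite μ] {S : Set ℝ} (hS : MeasurableSet S)
    {Φ : ℝ → ℝ → ℂ} (hΦ : Measurable fun p : ℝ × ℝ => Φ p.1 p.2) {E g : ℝ → ℝ}
    (hE : Integrable E) (hg : IntegrableOn g S μ) (h : ∀ η, ∀ y ∈ S, ‖Φ η y‖ ≤ E η * g y) :
    Integrable (fun p : ℝ × ℝ => Φ p.1 p.2) (volume.prod (μ.restrict S)) := by
  refine (hE.mul_prod hg).mono' hΦ.aestronglyMeasurable ?_
  filter_upwards [Measure.quasiMeasurePreserving_snd.ae (ae_restrict_mem hS)] with p hp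
  exact h p.1 p.2 hp

/-! ### One-dimensional identities and energy bounds for the Weyl solution -/

namespace OperatorL

variable {L : OperatorL} {f : L2R}

/-- The interval is enlarged down to 0, where the Weyl solution has its initial values, without
changing the integral. -/
theorem setIntegral_int_eq_Ico_zero {s t : ℝ} (hs : 0 < s) (ht : t ∈ L.dom)
    {μ : Measure ℝ} {F : ℝ → ℂ} (hF : ∀ y, y ∉ Ioo s t → F y = 0) :
    ∫ y in L.int, F y ∂μ = ∫ y in Ico 0 t, F y ∂μ := by
  rw [setIntegral_int_eq hs ht hF]
  exact (setIntegral_eq_of_subset_of_forall_sdiff_eq_zero measurableSet_Ico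
    (Ico_subset_Ico_left hs.le) fun _ hy => hF _ fun h => hy.2 (Ioo_subset_Ico_self h)).symm

variable (L) in
/-- The derivative of the Weyl solution along the characteristics of the first order term. -/
def weylGrad (p : ℝ × ℝ) : ℂ := L.dweyl p + Complex.I * L.b p.2 * (p.1 * L.weyl p)

variable (L) in
theorem measurable_weylGrad : Measurable L.weylGrad := by
  have := L.measurable_weyl
  have := L.measurable_dweyl
  have := L.b_measurable
  unfold weylGrad
  fun_prop

theorem norm_weylGrad_le (ξ : ℝ) {y : ℝ} (hy : y ∈ L.dom) :
    ‖L.weylGrad (ξ, y)‖ ≤ ‖L.symbol ξ‖ + |L.b y| * |ξ| := by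
  refine (norm_add_le _ _).trans (add_le_add (norm_dweyl_le ξ hy) ?_)
  simp only [norm_mul, Complex.norm_I, one_mul, Complex.norm_real, Real.norm_eq_abs]
  exact mul_le_mul_of_nonneg_left
    (mul_le_of_le_one_right (abs_nonneg ξ) (norm_weyl_le_one ξ hy)) (abs_nonneg _)

theorem continuousOn_weyl (ξ : ℝ) {t : ℝ} (ht : t ∈ L.dom) :
    ContinuousOn (fun y => L.weyl (ξ, y)) (Icc 0 t) :=
  (solvesOn_weyl ξ ht).continuousOn

theorem integrableOn_phase_mul_weylGrad (ξ : ℝ) {t : ℝ} (ht : t ∈ L.dom) :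
    IntegrableOn (fun r => L.phase ξ r * L.weylGrad (ξ, r)) (Ico 0 t) := by
  have hm : Measurable fun r => L.phase ξ r * L.weylGrad (ξ, r) :=
    (L.measurable_phase.comp measurable_prodMk_left).mul
      (L.measurable_weylGrad.comp measurable_prodMk_left)
  have hb : IntegrableOn (fun r => ‖L.symbol ξ‖ + |L.b r| * |ξ|) (Ico 0 t) :=
    (integrableOn_const measure_Ico_lt_top.ne).add
      (IntegrableOn.mono_set ((integrableOn_b le_rfl ht).abs.mul_const _) Ico_subset_Icc_self)
  refine Integrable.mono' hb hm.aestronglyMeasurable ?_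
  refine (ae_restrict_iff' measurableSet_Ico).2 (ae_of_all _ fun r hr => ?_)
  rw [norm_mul, norm_phase, one_mul]
  exact norm_weylGrad_le ξ (mem_dom_of_le ht hr.1 hr.2.le)

/-- Product rule for e^{iξB} φ, which is the transform of ũ relative to f̂: its derivative
e^{iξB}(φ' + ibξφ) is the transform of ∂ᵧũ. -/
theorem phase_mul_weyl_eq (ξ : ℝ) {t : ℝ} (ht : t ∈ L.dom) :
    L.phase ξ t * L.weyl (ξ, t) = L.phase ξ 0 * L.weyl (ξ, 0) +
      ∫ r in Ico 0 t, L.phase ξ r * L.weylGrad (ξ, r) := by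
  have S := solvesOn_weyl (L := L) ξ ht
  have hd : IntegrableOn (fun y => L.dweyl (ξ, y)) (Ico 0 t) :=
    S.integrableOn_snd.mono_set Ico_subset_Icc_self
  have key := integral_bilin_by_parts_mixed (ContinuousLinearMap.mul ℝ ℂ) (α := 0) ht.1
    (fun z hz => phase_eq (L := L) ξ (mem_dom_of_le ht hz.1 hz.2))
    (g₁ := 0) (fun z hz => by simpa using S.eq_fst z hz)
    (integrableOn_phase_deriv ξ ht) integrableOn_zero hd
  simp only [ContinuousLinearMap.mul_apply', Measure.restrict_zero, integral_zero_measure,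
    add_zero] at key
  rw [key, add_assoc, ← integral_add]
  · congr 2
    funext r
    rw [weylGrad]
    ring
  · refine (integrableOn_phase_deriv ξ ht).mul_bdd (c := 1) ?_ ?_
    · exact (L.measurable_weyl.comp measurable_prodMk_left).aestronglyMeasurable
    · exact (ae_restrict_iff' measurableSet_Ico).2 (ae_of_all _ fun r hr =>
        norm_weyl_le_one ξ (mem_dom_of_le ht hr.1 hr.2.le))
  · refine hd.bdd_mul (c := 1) ?_ ?_
    · exact (L.measurable_phase.comp measurable_prodMk_left).aestronglyMeasurable
    · exact ae_of_all _ fun r => (norm_phase ξ r).le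

/-- Integration by parts in the weak formulation, for a fixed frequency. -/
theorem integral_weylGrad_mul (ξ : ℝ) {t : ℝ} (ht : t ∈ L.dom) {V V' : ℝ → ℂ}
    (hV : ∀ y ∈ Icc 0 t, V y = V 0 + ∫ r in Ico 0 y, V' r) (hV' : Continuous V') (h0 : V 0 = 0)
    (h1 : V t = 0) : ∫ y in Ico 0 t, L.phase ξ y * L.weylGrad (ξ, y) * V y =
      -∫ y in Ico 0 t, L.phase ξ y * L.weyl (ξ, y) * V' y := by
  have key := integral_bilin_by_parts_mixed (ContinuousLinearMap.mul ℝ ℂ) (α := 0) ht.1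
    (u := fun y => L.phase ξ y * L.weyl (ξ, y))
    (fun z hz => phase_mul_weyl_eq (L := L) ξ (mem_dom_of_le ht hz.1 hz.2))
    (g₁ := 0) (fun z hz => by simpa using hV z hz)
    (integrableOn_phase_mul_weylGrad ξ ht) integrableOn_zero
    (hV'.integrableOn_Icc.mono_set Ico_subset_Icc_self)
  simp only [ContinuousLinearMap.mul_apply', Measure.restrict_zero, integral_zero_measure,
    add_zero, h0, h1, mul_zero, zero_add] at key
  exact eq_neg_of_add_eq_zero_left key.symm

/-- Two integrations by parts: the first moves a derivative from V' to φ, the second moves one from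
V to φ' and inserts the differential equation. -/
theorem integral_weyl_mul_deriv_deriv (ξ : ℝ) {t : ℝ} (ht : t ∈ L.dom) {V V' V'' : ℝ → ℂ}
    (hV : ∀ y ∈ Icc 0 t, V y = V 0 + ∫ r in Ico 0 y, V' r)
    (hV' : ∀ y ∈ Icc 0 t, V' y = V' 0 + ∫ r in Ico 0 y, V'' r) (hc' : Continuous V')
    (hc'' : Continuous V'') (h0 : V 0 = 0) (h1 : V t = 0) (h0' : V' 0 = 0) (h1' : V' t = 0) :
    ∫ y in Ico 0 t, L.weyl (ξ, y) * V'' y = (∫ y in Ico 0 t, V y * (ξ * (ξ * L.weyl (ξ, y))) ∂L.a) +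
      ∫ y in Ico 0 t, V y * (-(2 * Complex.I * L.b y) * (ξ * L.dweyl (ξ, y))) := by
  have S := solvesOn_weyl (L := L) ξ ht
  have hd : IntegrableOn (fun y => L.dweyl (ξ, y)) (Ico 0 t) :=
    S.integrableOn_snd.mono_set Ico_subset_Icc_self
  have k1 := integral_bilin_by_parts_mixed (ContinuousLinearMap.mul ℝ ℂ) (α := 0) ht.1
    (fun z hz => S.eq_fst z hz) (g₁ := 0) (fun z hz => by simpa using hV' z hz) hd integrableOn_zero
    (hc''.integrableOn_Icc.mono_set Ico_subset_Icc_self)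
  have k2 := integral_bilin_by_parts_mixed (ContinuousLinearMap.mul ℝ ℂ) ht.1 hV S.eq_snd
    (hc'.integrableOn_Icc.mono_set Ico_subset_Icc_self)
    ((S.integrableOn_a le_rfl ht).mono_set Ico_subset_Icc_self)
    ((S.integrableOn_b_smul le_rfl ht).mono_set Ico_subset_Icc_self)
  simp only [ContinuousLinearMap.mul_apply', Measure.restrict_zero, integral_zero_measure,
    add_zero, h0', h1', mul_zero, zero_add] at k1
  simp only [ContinuousLinearMap.mul_apply', h0, h1, zero_mul, zero_add, mulC_apply,
    smul_eq_mul] at k2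
  simp only [mul_comm (V' _)] at k2
  linear_combination k2 - k1

/-- The energy of the harmonic extension is finite. -/
theorem lintegral_weylGrad_lt_top
    (hs : MemLp (fun η => L.symbol (2 * Real.pi * η) * (𝓕 f : L2R) η) 2 volume) {t : ℝ}
    (ht : t ∈ L.dom) : ∫⁻ y in Ico 0 t, ∫⁻ η, ‖L.phase (2 * Real.pi * η) y *
      L.weylGrad (2 * Real.pi * η, y) * (𝓕 f : L2R) η‖ₑ ^ 2 < ⊤ := by
  have hF : Measurable ((𝓕 f : L2R) : ℝ → ℂ) := (Lp.stronglyMeasurable _).measurable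
  have hw := L.measurable_weylGrad
  have hw' : Measurable fun p : ℝ × ℝ => L.weylGrad (2 * Real.pi * p.2, p.1) := by fun_prop
  have e : ∀ y η, ‖L.phase (2 * Real.pi * η) y * L.weylGrad (2 * Real.pi * η, y) *
      (𝓕 f : L2R) η‖ₑ ^ 2 = ‖L.weylGrad (2 * Real.pi * η, y)‖ₑ ^ 2 * ‖(𝓕 f : L2R) η‖ₑ ^ 2 := by
    intro y η
    rw [enorm_mul, enorm_mul, ← ofReal_norm, norm_phase, ENNReal.ofReal_one, one_mul, mul_pow]
  simp only [e]
  rw [lintegral_lintegral_swap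
    ((hw'.enorm.pow_const 2).mul ((hF.comp measurable_snd).enorm.pow_const 2)).aemeasurable]
  -- After Tonelli, the energy at a fixed frequency is at most Re k ≤ |k|, and |k| |f̂|² is the
  -- product of the L² functions f̂ and k f̂.
  refine lt_of_le_of_lt (lintegral_mono (g := fun η => ‖(𝓕 f : L2R) η *
    (L.symbol (2 * Real.pi * η) * (𝓕 f : L2R) η)‖ₑ) fun η => ?_)
    (integrable_mul_memLp (𝓕 f : L2R) hs).hasFiniteIntegral
  obtain ⟨h1, h2⟩ := weyl_energy_le (L := L) (2 * Real.pi * η) ht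
  have h3 := ofReal_integral_eq_lintegral_ofReal h1 (ae_of_all _ fun r => by positivity)
  have h4 : ∫⁻ y in Ico 0 t, ‖L.weylGrad (2 * Real.pi * η, y)‖ₑ ^ 2 ≤
      ‖L.symbol (2 * Real.pi * η)‖ₑ := by
    calc _ = ∫⁻ y in Ico 0 t, ENNReal.ofReal (‖L.weylGrad (2 * Real.pi * η, y)‖ ^ 2) := by
          refine lintegral_congr fun y => ?_
          rw [ENNReal.ofReal_pow (norm_nonneg _), ofReal_norm]
      _ ≤ _ := by
          refine h3.symm.le.trans ?_
          rw [← ofReal_norm]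
          exact ENNReal.ofReal_le_ofReal (h2.trans (Complex.re_le_norm _))
  beta_reduce
  rw [lintegral_mul_const _ (by fun_prop), enorm_mul, enorm_mul]
  calc _ ≤ ‖L.symbol (2 * Real.pi * η)‖ₑ * ‖(𝓕 f : L2R) η‖ₑ ^ 2 := by gcongr
    _ = _ := by ring

end OperatorL

/-! ### Existence of the harmonic extension -/

theorem integral_mul_of_fslice {u : ℝ → ℝ → ℂ} {y : ℝ} (hu : MemLp (fun x => u x y) 2 volume)
    {Φ : ℝ → ℂ} (hΦ : fslice u y =ᵐ[volume] Φ) {p : ℝ → ℂ} (hp : ContDiff ℝ ∞ p)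
    (hc : HasCompactSupport p) : ∫ x, u x y * p x = ∫ η, Φ η * invFT p η := by
  rw [integral_slice_mul hu hp hc, pairF_apply hp hc]
  refine integral_congr_ae ?_
  filter_upwards [hΦ] with η hη
  rw [hη]

theorem integral_translate_mul_of_fslice {u : ℝ → ℝ → ℂ} {y : ℝ}
    (hu : MemLp (fun x => u x y) 2 volume) {Φ : ℝ → ℂ} (hΦ : fslice u y =ᵐ[volume] Φ)
    {p : ℝ → ℂ} (hp : ContDiff ℝ ∞ p) (hc : HasCompactSupport p) (c : ℝ) :
    ∫ x, u (x + c) y * p x =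
      ∫ η, Complex.exp (((2 * Real.pi * η : ℝ) : ℂ) * c * Complex.I) * Φ η * invFT p η := by
  rw [integral_slice_translate_mul hu hp hc, pairF_apply hp hc]
  refine integral_congr_ae ?_
  filter_upwards [hΦ, coeFn_mulL2 (isBddMeas_trans c) (fslice u y)] with η h1 h2
  rw [transL2, h2, h1]

namespace OperatorL

variable {L : OperatorL} {f : L2R} {v : ℝ → ℝ → ℂ}

theorem integrable_norm_mul_weight (G : L2R) :
    Integrable fun η => ‖G η‖ * (1 + (2 * Real.pi * η) ^ 2)⁻¹ := by
  refine (integrable_mul_memLp G memLp_inv_one_add_sq).norm.congr (ae_of_all _ fun η => ?_)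
  simp only [norm_mul, Complex.norm_real]
  rw [Real.norm_of_nonneg (by positivity)]

/-- Fubini for the terms containing φ, whose modulus is at most 1; the decay of the transform of v
gives integrability in the frequency. -/
theorem integrable_bounded_term (hv : L.IsTest v) (G : L2R) {t : ℝ} {μ : Measure ℝ} [SFinite μ]
    {m : ℝ → ℝ → ℂ} (hm : Measurable fun p : ℝ × ℝ => m p.1 p.2)
    (hm1 : ∀ η, ∀ y ∈ Ico 0 t, ‖m η y‖ ≤ 1) {c : ℝ → ℂ} (hc : Measurable c)
    (hci : IntegrableOn c (Ico 0 t) μ) :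
    Integrable (fun p : ℝ × ℝ => m p.1 p.2 * G p.1 * invFT (fun x => v x p.2) p.1 * c p.2)
      (volume.prod (μ.restrict (Ico 0 t))) := by
  have hG : Measurable (G : ℝ → ℂ) := (Lp.stronglyMeasurable G).measurable
  obtain ⟨C, hC0, hC⟩ := hv.norm_invFT_le
  refine integrable_prod_of_norm_le measurableSet_Ico
    (Φ := fun η y => m η y * G η * invFT (fun x => v x y) η * c y)
    (((hm.mul (hG.comp measurable_fst)).mul hv.measurable_invFT).mul (hc.comp measurable_snd))
    ((integrable_norm_mul_weight G).const_mul C) hci.norm fun η y hy => ?_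
  simp only [norm_mul]
  refine mul_le_mul_of_nonneg_right ?_ (norm_nonneg _)
  calc _ ≤ 1 * ‖G η‖ * (C * (1 + (2 * Real.pi * η) ^ 2)⁻¹) := by
        gcongr
        · exact hm1 η y hy
        · exact hC η y
    _ = _ := by ring

/-- Fubini for the terms containing φ' + ibξφ, which is at most |k| + |b| |ξ|. The factor |k| goes
to f̂, and |ξ| is absorbed by the transform of ∂ₓv. -/
theorem integrable_weylGrad_term (hv : L.IsTest v)
    (hs : MemLp (fun η => L.symbol (2 * Real.pi * η) * (𝓕 f : L2R) η) 2 volume) {t : ℝ}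
    (ht : t ∈ L.dom) {m : ℝ → ℝ → ℂ} (hm : Measurable fun p : ℝ × ℝ => m p.1 p.2)
    (hm1 : ∀ η y, ‖m η y‖ ≤ ‖L.weylGrad (2 * Real.pi * η, y)‖) {c : ℝ → ℂ} (hc : Measurable c)
    (hci : IntegrableOn (fun y => (1 + |L.b y|) * ‖c y‖) (Ico 0 t)) :
    Integrable (fun p : ℝ × ℝ => m p.1 p.2 * (𝓕 f : L2R) p.1 * invFT (fun x => v x p.2) p.1 * c p.2)
      (volume.prod (volume.restrict (Ico 0 t))) := by
  have hG : Measurable ((𝓕 f : L2R) : ℝ → ℂ) := (Lp.stronglyMeasurable _).measurable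
  obtain ⟨C, hC0, hC⟩ := hv.norm_invFT_le
  obtain ⟨D, hD0, hD⟩ := hv.deriv_fst.norm_invFT_le
  have hw : Integrable fun η => ‖L.symbol (2 * Real.pi * η) * (𝓕 f : L2R) η‖ *
      (1 + (2 * Real.pi * η) ^ 2)⁻¹ := by
    refine (integrable_norm_mul_weight
      (toL2 fun η => L.symbol (2 * Real.pi * η) * (𝓕 f : L2R) η)).congr ?_
    filter_upwards [coeFn_toL2 hs] with η hη
    rw [hη]
  refine integrable_prod_of_norm_le measurableSet_Ico
    (Φ := fun η y => m η y * (𝓕 f : L2R) η * invFT (fun x => v x y) η * c y)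
    (((hm.mul (hG.comp measurable_fst)).mul hv.measurable_invFT).mul (hc.comp measurable_snd))
    ((hw.const_mul C).add ((integrable_norm_mul_weight (𝓕 f : L2R)).const_mul D)) hci
    fun η y hy => ?_
  have h1 := (hm1 η y).trans (norm_weylGrad_le _ (mem_dom_of_le ht hy.1 hy.2.le))
  have h2 := hC η y
  have h3 := hD η y
  rw [hv.invFT_deriv_fst, norm_mul, norm_neg, norm_mul, Complex.norm_I, mul_one, Complex.norm_real,
    Real.norm_eq_abs] at h3
  simp only [norm_mul, Pi.add_apply]
  rw [← mul_assoc]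
  refine mul_le_mul_of_nonneg_right ?_ (norm_nonneg _)
  set ρ := (1 + (2 * Real.pi * η) ^ 2)⁻¹
  set N := ‖invFT (fun x => v x y) η‖
  set A := ‖L.symbol (2 * Real.pi * η)‖
  set H := ‖(𝓕 f : L2R) η‖
  have hρ : 0 ≤ ρ := by positivity
  have hA : 0 ≤ A := norm_nonneg _
  have hH : 0 ≤ H := norm_nonneg _
  have hb : 0 ≤ |L.b y| := abs_nonneg _
  calc _ ≤ (A + |L.b y| * |2 * Real.pi * η|) * H * N := by gcongr
    _ = (A * H) * N + |L.b y| * H * (|2 * Real.pi * η| * N) := by ring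
    _ ≤ (A * H) * (C * ρ) + |L.b y| * H * (D * ρ) := by gcongr
    -- The missing mixed terms are added so that the bound becomes a function of η times 1 + |b|.
    _ ≤ (A * H) * (C * ρ) + |L.b y| * H * (D * ρ) +
        (|L.b y| * ((A * H) * (C * ρ)) + H * (D * ρ)) := le_add_of_nonneg_right (by positivity)
    _ = _ := by ring

theorem integral_Ico_swap {Φ : ℝ → ℝ → ℂ} {μ : Measure ℝ} [SFinite μ] {t : ℝ}
    (h : Integrable (fun p : ℝ × ℝ => Φ p.1 p.2) (volume.prod (μ.restrict (Ico 0 t)))) :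
    ∫ y in Ico 0 t, ∫ η, Φ η y ∂volume ∂μ = ∫ η, ∫ y in Ico 0 t, Φ η y ∂μ :=
  (integral_integral_swap h).symm

theorem IsTest.zero_notMem {s t : ℝ} (hs : 0 < s) : (0 : ℝ) ∉ Ioo s t := fun h => h.1.not_gt hs

/-- At the endpoints s and t the function vanishes on one side only, so the derivative is computed
as a one-sided one, on a closed half-line outside the interval. -/
theorem IsTest.deriv_snd_eq_zero (hv : L.IsTest v) {s t : ℝ}
    (hst : ∀ x y, y ∉ Ioo s t → v x y = 0) (x : ℝ) {y : ℝ} (hy : y ∉ Ioo s t) :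
    deriv (fun y' => v x y') y = 0 := by
  have hd := ((hv.contDiff_snd x).differentiable (by simp) y).hasDerivAt
  have h0 : ∀ S : Set ℝ, y ∈ S → UniqueDiffWithinAt ℝ S y → (∀ z ∈ S, z ∉ Ioo s t) →
      deriv (fun y' => v x y') y = 0 := fun S hyS hS hz =>
    hS.eq_deriv _ hd.hasDerivWithinAt
      ((hasDerivWithinAt_const y S 0).congr (fun z h => hst x z (hz z h)) (hst x y hy))
  rcases le_or_gt y s with h | h
  · exact h0 (Iic y) self_mem_Iic (uniqueDiffWithinAt_Iic y) fun z hz hz' =>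
      (hz'.1.trans_le (mem_Iic.1 hz)).not_ge h
  · exact h0 (Ici y) self_mem_Ici (uniqueDiffWithinAt_Ici y) fun z hz hz' =>
      hy ⟨h, (mem_Ici.1 hz).trans_lt hz'.2⟩

variable {u w : ℝ → ℝ → ℂ}

/-- The pairing in x is carried to the frequency side, Fubini exchanges η and y, and at each
frequency the claim is integration by parts for e^{iξB} φ against a function vanishing at both ends.
-/
theorem isWeakDerivY_eq (hs : MemLp (fun η => L.symbol (2 * Real.pi * η) * (𝓕 f : L2R) η) 2 volume)
    (hu : ∀ y, MemLp (fun x => u x y) 2 volume) (hw : ∀ y, MemLp (fun x => w x y) 2 volume)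
    (hfu : ∀ y ∈ L.dom, fslice u y =ᵐ[volume] fun η =>
      L.weyl (2 * Real.pi * η, y) * (𝓕 f : L2R) η)
    (hfw : ∀ t ∈ L.dom, ∀ᵐ y ∂volume.restrict (Ico 0 t), fslice w y =ᵐ[volume] fun η =>
      L.phase (2 * Real.pi * η) y * L.weylGrad (2 * Real.pi * η, y) * (𝓕 f : L2R) η)
    (hv : L.IsTest v) :
    ∫ y in L.int, ∫ x : ℝ, w x y * v x y =
      -∫ y in L.int, ∫ x : ℝ, u (x + L.B y) y * deriv (fun y' => v x y') y := by
  have hmw := L.measurable_weyl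
  have hmg := L.measurable_weylGrad
  have hmp := L.measurable_phase
  have hmp' : Measurable fun p : ℝ × ℝ => L.phase (2 * Real.pi * p.1) p.2 :=
    hmp.comp (by fun_prop : Measurable fun p : ℝ × ℝ => (2 * Real.pi * p.1, p.2))
  obtain ⟨s, t, hs0, hst, ht, hz⟩ := hv.exists_interval
  have hz' : ∀ x y, y ∉ Ioo s t → deriv (fun y' => v x y') y = 0 := fun x y hy =>
    hv.deriv_snd_eq_zero hz x hy
  have h1 := integrable_weylGrad_term hv hs ht
    (m := fun η y => L.phase (2 * Real.pi * η) y * L.weylGrad (2 * Real.pi * η, y))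
    (hmp'.mul (by fun_prop)) (fun η y => by rw [norm_mul, norm_phase, one_mul])
    (c := fun _ => 1) measurable_const (by
      simp only [norm_one, mul_one]
      exact (integrableOn_const measure_Ico_lt_top.ne).add
        (IntegrableOn.mono_set (integrableOn_b le_rfl ht).abs Ico_subset_Icc_self))
  have h2 := integrable_bounded_term hv.deriv_snd (𝓕 f : L2R) (t := t) (μ := volume)
    (m := fun η y => L.phase (2 * Real.pi * η) y * L.weyl (2 * Real.pi * η, y))
    (hmp'.mul (by fun_prop)) (fun η y hy => by
      rw [norm_mul, norm_phase, one_mul]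
      exact norm_weyl_le_one _ (mem_dom_of_le ht hy.1 hy.2.le))
    (c := fun _ => 1) measurable_const (integrableOn_const measure_Ico_lt_top.ne)
  simp only [mul_one] at h1 h2
  rw [setIntegral_int_eq_Ico_zero hs0 ht fun y hy => by simp [hz _ y hy],
    setIntegral_int_eq_Ico_zero hs0 ht fun y hy => by simp [hz' _ y hy]]
  calc _ = ∫ y in Ico 0 t, ∫ η, L.phase (2 * Real.pi * η) y * L.weylGrad (2 * Real.pi * η, y) *
        (𝓕 f : L2R) η * invFT (fun x => v x y) η := by
        refine integral_congr_ae ?_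
        filter_upwards [hfw t ht] with y hy
        exact integral_mul_of_fslice (hw y) hy (hv.contDiff_fst y) (hv.hasCompactSupport_fst y)
    _ = ∫ η, ∫ y in Ico 0 t, L.phase (2 * Real.pi * η) y * L.weylGrad (2 * Real.pi * η, y) *
        (𝓕 f : L2R) η * invFT (fun x => v x y) η := integral_Ico_swap h1
    _ = -∫ η, ∫ y in Ico 0 t, L.phase (2 * Real.pi * η) y * L.weyl (2 * Real.pi * η, y) *
        (𝓕 f : L2R) η * invFT (fun x => deriv (fun y' => v x y') y) η := by
        rw [← integral_neg]
        refine integral_congr_ae (ae_of_all _ fun η => ?_)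
        have key := integral_weylGrad_mul (L := L) (2 * Real.pi * η) ht
          (V := fun y => invFT (fun x => v x y) η)
          (fun y hy => hv.invFT_eq_add_integral hy.1 η) (hv.deriv_snd.continuous_invFT η)
          (IsTest.invFT_eq_zero hz (IsTest.zero_notMem hs0) η) (IsTest.invFT_eq_zero hz (by simp) η)
        simp only [mul_right_comm _ ((𝓕 f : L2R) η)]
        rw [integral_mul_const, integral_mul_const, key, neg_mul]
    _ = -∫ y in Ico 0 t, ∫ η, L.phase (2 * Real.pi * η) y * L.weyl (2 * Real.pi * η, y) *
        (𝓕 f : L2R) η * invFT (fun x => deriv (fun y' => v x y') y) η := by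
        rw [integral_Ico_swap h2]
    _ = _ := by
        refine congrArg Neg.neg (setIntegral_congr_fun measurableSet_Ico fun y hy => ?_)
        have := integral_translate_mul_of_fslice (hu y) (hfu y (mem_dom_of_le ht hy.1 hy.2.le))
          (hv.deriv_snd.contDiff_fst y) (hv.deriv_snd.hasCompactSupport_fst y) (L.B y)
        rw [this]
        simp only [← mul_assoc]
        rfl

/-- All four terms are carried to the frequency side and exchanged by Fubini; at a fixed frequency
their sum is zero by the equation of φ tested against the transform of v. -/
theorem weakEquation_of_fslice
    (hs : MemLp (fun η => L.symbol (2 * Real.pi * η) * (𝓕 f : L2R) η) 2 volume)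
    (hu : ∀ y, MemLp (fun x => u x y) 2 volume) (hw : ∀ y, MemLp (fun x => w x y) 2 volume)
    (hfu : ∀ y ∈ L.dom, fslice u y =ᵐ[volume] fun η =>
      L.weyl (2 * Real.pi * η, y) * (𝓕 f : L2R) η)
    (hfw : ∀ t ∈ L.dom, ∀ᵐ y ∂volume.restrict (Ico 0 t), fslice w y =ᵐ[volume] fun η =>
      L.phase (2 * Real.pi * η) y * L.weylGrad (2 * Real.pi * η, y) * (𝓕 f : L2R) η) :
    L.WeakEquation u w := by
  intro v hv
  have hmw := L.measurable_weyl
  have hmg := L.measurable_weylGrad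
  have hmb := L.b_measurable
  have hσ := L.sigmaFinite_a
  obtain ⟨s, t, hs0, hst, ht, hz⟩ := hv.exists_interval
  have hz1 : ∀ x y, y ∉ Ioo s t → deriv (fun x' => v x' y) x = 0 := fun x y hy => by
    simp [hz _ y hy]
  have hz2 : ∀ x y, y ∉ Ioo s t → deriv (fun x' => deriv (fun x'' => v x'' y) x') x = 0 :=
    fun x y hy => by simp [hz _ y hy]
  have hy1 : ∀ x y, y ∉ Ioo s t → deriv (fun y' => v x y') y = 0 := fun x y hy =>
    hv.deriv_snd_eq_zero hz x hy
  have hy2 : ∀ x y, y ∉ Ioo s t → deriv (fun y' => deriv (fun y'' => v x y'') y') y = 0 :=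
    fun x y hy => hv.deriv_snd.deriv_snd_eq_zero hy1 x hy
  have hdom : ∀ y ∈ Ico 0 t, y ∈ L.dom := fun y hy => mem_dom_of_le ht hy.1 hy.2.le
  have hm1 : ∀ η : ℝ, ∀ y ∈ Ico 0 t, ‖L.weyl (2 * Real.pi * η, y)‖ ≤ 1 := fun η y hy =>
    norm_weyl_le_one _ (hdom y hy)
  have hb1 : IntegrableOn (fun y => |L.b y|) (Ico 0 t) :=
    IntegrableOn.mono_set (integrableOn_b le_rfl ht).abs Ico_subset_Icc_self
  have hb2 : IntegrableOn (fun y => L.b y ^ 2) (Ico 0 t) :=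
    IntegrableOn.mono_set (integrableOn_b_sq le_rfl ht) Ico_subset_Icc_self
  have i1 := integrable_bounded_term hv.deriv_fst.deriv_fst (𝓕 f : L2R) (t := t) (μ := L.a)
    (m := fun η y => L.weyl (2 * Real.pi * η, y)) (by fun_prop) hm1
    (c := fun _ => 1) measurable_const (integrableOn_const (a_Ico_lt_top le_rfl ht).ne)
  have i2 := integrable_bounded_term hv.deriv_fst.deriv_fst (𝓕 f : L2R) (t := t) (μ := volume)
    (m := fun η y => L.weyl (2 * Real.pi * η, y)) (by fun_prop) hm1
    (c := fun y => (L.b y : ℂ) ^ 2) (by fun_prop) (by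
      have := hb2.ofReal (𝕜 := ℂ)
      exact this.congr (ae_of_all _ fun y => by simp))
  have i3 := integrable_weylGrad_term hv.deriv_fst hs ht
    (m := fun η y => L.weylGrad (2 * Real.pi * η, y)) (by fun_prop) (fun η y => le_rfl)
    (c := fun y => (L.b y : ℂ)) (by fun_prop) (by
      refine (hb1.add hb2).congr (ae_of_all _ fun y => ?_)
      simp only [Pi.add_apply, Complex.norm_real, Real.norm_eq_abs]
      rw [← sq_abs]
      ring)
  have i4 := integrable_bounded_term hv.deriv_snd.deriv_snd (𝓕 f : L2R) (t := t) (μ := volume)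
    (m := fun η y => L.weyl (2 * Real.pi * η, y)) (by fun_prop) hm1
    (c := fun _ => 1) measurable_const (integrableOn_const measure_Ico_lt_top.ne)
  simp only [mul_one] at i1 i4
  simp only [iteratedDeriv_two]
  rw [setIntegral_int_eq_Ico_zero hs0 ht fun y hy => by simp [hz _ y hy],
    setIntegral_int_eq_Ico_zero hs0 ht fun y hy => by simp [hz _ y hy],
    setIntegral_int_eq_Ico_zero hs0 ht fun y hy => by simp [hz _ y hy],
    setIntegral_int_eq_Ico_zero hs0 ht fun y hy => by
      simp only [show ∀ x, deriv (deriv fun y' => v x y') y = 0 from fun x => hy2 x y hy]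
      simp]
  have e12 : ∀ y ∈ Ico 0 t, ∫ x, u x y * deriv (deriv fun x' => v x' y) x =
      ∫ η, L.weyl (2 * Real.pi * η, y) * (𝓕 f : L2R) η *
        invFT (fun x => deriv (fun x' => deriv (fun x'' => v x'' y) x') x) η := fun y hy =>
    integral_mul_of_fslice (hu y) (hfu y (hdom y hy)) (hv.deriv_fst.deriv_fst.contDiff_fst y)
      (hv.deriv_fst.deriv_fst.hasCompactSupport_fst y)
  have e3 : ∀ᵐ y ∂volume.restrict (Ico 0 t), ∫ x, w (x - L.B y) y * deriv (fun x' => v x' y) x =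
      ∫ η, L.weylGrad (2 * Real.pi * η, y) * (𝓕 f : L2R) η *
        invFT (fun x => deriv (fun x' => v x' y) x) η := by
    filter_upwards [hfw t ht] with y hy
    have := integral_translate_mul_of_fslice (hw y) hy (hv.deriv_fst.contDiff_fst y)
      (hv.deriv_fst.hasCompactSupport_fst y) (-L.B y)
    simp only [← sub_eq_add_neg] at this
    rw [this]
    refine integral_congr_ae (ae_of_all _ fun η => ?_)
    beta_reduce
    rw [mul_assoc (L.phase _ _), ← mul_assoc (Complex.exp _), phase, ← Complex.exp_add]
    push_cast
    ring_nf
    simp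
  have e4 : ∀ y ∈ Ico 0 t, ∫ x, u x y * deriv (deriv fun y' => v x y') y =
      ∫ η, L.weyl (2 * Real.pi * η, y) * (𝓕 f : L2R) η *
        invFT (fun x => deriv (fun y' => deriv (fun y'' => v x y'') y') y) η := fun y hy =>
    integral_mul_of_fslice (hu y) (hfu y (hdom y hy)) (hv.deriv_snd.deriv_snd.contDiff_fst y)
      (hv.deriv_snd.deriv_snd.hasCompactSupport_fst y)
  have e3' : ∫ y in Ico 0 t, (∫ x, w (x - L.B y) y * deriv (fun x' => v x' y) x) * (L.b y : ℂ) =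
      ∫ y in Ico 0 t, ∫ η, L.weylGrad (2 * Real.pi * η, y) * (𝓕 f : L2R) η *
        invFT (fun x => deriv (fun x' => v x' y) x) η * (L.b y : ℂ) := by
    refine integral_congr_ae ?_
    filter_upwards [e3] with y hy
    rw [hy, integral_mul_const]
  have e2' : ∫ y in Ico 0 t, (∫ x, u x y * deriv (deriv fun x' => v x' y) x) * (L.b y : ℂ) ^ 2 =
      ∫ y in Ico 0 t, ∫ η, L.weyl (2 * Real.pi * η, y) * (𝓕 f : L2R) η *
        invFT (fun x => deriv (fun x' => deriv (fun x'' => v x'' y) x') x) η * (L.b y : ℂ) ^ 2 :=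
    setIntegral_congr_fun measurableSet_Ico fun y hy => by
      rw [e12 y hy, integral_mul_const]
  rw [setIntegral_congr_fun measurableSet_Ico e12, e2', e3',
    setIntegral_congr_fun measurableSet_Ico e4]
  rw [integral_Ico_swap i1, integral_Ico_swap i2, integral_Ico_swap i3, integral_Ico_swap i4]
  rw [← integral_const_mul, ← integral_const_mul, ← integral_sub, ← integral_sub, ← integral_add]
  rotate_left
  · exact (i1.integral_prod_left.sub (i2.integral_prod_left.const_mul 2)).sub
      (i3.integral_prod_left.const_mul 2)
  · exact i4.integral_prod_left
  · exact i1.integral_prod_left.sub (i2.integral_prod_left.const_mul 2)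
  · exact i3.integral_prod_left.const_mul 2
  · exact i1.integral_prod_left
  · exact i2.integral_prod_left.const_mul 2
  rw [← integral_zero ℝ ℂ]
  refine integral_congr_ae ?_
  filter_upwards [i2.prod_right_ae, i3.prod_right_ae] with η j2 j3
  have key := integral_weyl_mul_deriv_deriv (L := L) (2 * Real.pi * η) ht
    (V := fun y => invFT (fun x => v x y) η)
    (fun y hy => hv.invFT_eq_add_integral hy.1 η)
    (fun y hy => hv.deriv_snd.invFT_eq_add_integral hy.1 η)
    (hv.deriv_snd.continuous_invFT η) (hv.deriv_snd.deriv_snd.continuous_invFT η)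
    (IsTest.invFT_eq_zero hz (IsTest.zero_notMem hs0) η) (IsTest.invFT_eq_zero hz (by simp) η)
    (IsTest.invFT_eq_zero hy1 (IsTest.zero_notMem hs0) η) (IsTest.invFT_eq_zero hy1 (by simp) η)
  have k1 : ∫ y in Ico 0 t, L.weyl (2 * Real.pi * η, y) * (𝓕 f : L2R) η *
      invFT (fun x => deriv (fun x' => deriv (fun x'' => v x'' y) x') x) η ∂L.a =
      -(∫ y in Ico 0 t, invFT (fun x => v x y) η * (((2 * Real.pi * η : ℝ) : ℂ) *
        (((2 * Real.pi * η : ℝ) : ℂ) * L.weyl (2 * Real.pi * η, y))) ∂L.a) * (𝓕 f : L2R) η := by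
    rw [← integral_neg, ← integral_mul_const]
    refine integral_congr_ae (ae_of_all _ fun y => ?_)
    simp only [hv.deriv_fst.invFT_deriv_fst, hv.invFT_deriv_fst]
    ring_nf
    simp only [Complex.I_sq]
    ring
  have k4 : ∫ y in Ico 0 t, L.weyl (2 * Real.pi * η, y) * (𝓕 f : L2R) η *
      invFT (fun x => deriv (fun y' => deriv (fun y'' => v x y'') y') y) η =
      (∫ y in Ico 0 t, L.weyl (2 * Real.pi * η, y) *
        invFT (fun x => deriv (fun y' => deriv (fun y'' => v x y'') y') y) η) * (𝓕 f : L2R) η := by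
    rw [← integral_mul_const]
    refine integral_congr_ae (ae_of_all _ fun y => ?_)
    beta_reduce
    ring
  -- In the b² term and the term with ∂ᵧũ, the contributions of b²ξ²φ cancel. What remains is
  -- -iξbφ', half of the first order term of the differential equation.
  have k23 : (∫ y in Ico 0 t, L.weyl (2 * Real.pi * η, y) * (𝓕 f : L2R) η *
        invFT (fun x => deriv (fun x' => deriv (fun x'' => v x'' y) x') x) η * (L.b y : ℂ) ^ 2) +
      (∫ y in Ico 0 t, L.weylGrad (2 * Real.pi * η, y) * (𝓕 f : L2R) η *
        invFT (fun x => deriv (fun x' => v x' y) x) η * (L.b y : ℂ)) =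
      (∫ y in Ico 0 t, invFT (fun x => v x y) η * (-(2 * Complex.I * L.b y) *
        (((2 * Real.pi * η : ℝ) : ℂ) * L.dweyl (2 * Real.pi * η, y)))) * (𝓕 f : L2R) η / 2 := by
    rw [← integral_add j2 j3, ← integral_mul_const, ← integral_div]
    refine integral_congr_ae (ae_of_all _ fun y => ?_)
    simp only [hv.deriv_fst.invFT_deriv_fst, hv.invFT_deriv_fst, weylGrad]
    ring_nf
  simp only [k1, k4, key]
  linear_combination (-2 : ℂ) * k23

end OperatorL

/-! ### Construction of the harmonic extension -/

namespace OperatorL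

variable {L : OperatorL} {f : L2R} {u w : ℝ → ℝ → ℂ}

theorem eLpNorm_slice_sub {y z : ℝ} (hy : MemLp (fun x => u x y) 2 volume)
    (hz : MemLp (fun x => u x z) 2 volume) :
    eLpNorm (fun x => u x z - u x y) 2 volume = ‖fslice u z - fslice u y‖ₑ := by
  rw [← enorm_toL2_sub hz hy]
  have : fslice u z - fslice u y = Lp.fourierTransformₗᵢ ℝ ℂ (slice u z - slice u y) := by
    rw [map_sub]
    rfl
  rw [this, LinearIsometryEquiv.enorm_map]
  rfl

theorem eLpNorm_slice {y : ℝ} (hy : MemLp (fun x => u x y) 2 volume) :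
    eLpNorm (fun x => u x y) 2 volume = ‖fslice u y‖ₑ := by
  rw [← enorm_toL2 hy, ← ofReal_norm, ← ofReal_norm, norm_fslice]
  rfl

variable (L) in
/-- The Weyl solution, extended by zero. -/
def weylExt (η y : ℝ) : ℂ := L.dom.indicator (fun y => L.weyl (2 * Real.pi * η, y)) y

theorem weylExt_of_mem {η y : ℝ} (hy : y ∈ L.dom) :
    L.weylExt η y = L.weyl (2 * Real.pi * η, y) := indicator_of_mem hy _

variable (L) in
theorem measurable_weylExt : Measurable fun p : ℝ × ℝ => L.weylExt p.1 p.2 := by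
  have hm := L.measurable_weyl
  have : (fun p : ℝ × ℝ => L.weylExt p.1 p.2) = (Prod.snd ⁻¹' L.dom).indicator
      fun p : ℝ × ℝ => L.weyl (2 * Real.pi * p.1, p.2) := by
    funext p
    by_cases hp : p.2 ∈ L.dom <;> simp [weylExt, hp]
  rw [this]
  exact Measurable.indicator (by fun_prop) (measurable_snd L.measurableSet_dom)

theorem norm_weylExt_le (η y : ℝ) : ‖L.weylExt η y‖ ≤ 1 := by
  by_cases hy : y ∈ L.dom
  · rw [weylExt_of_mem hy]
    exact norm_weyl_le_one _ hy
  · simp [weylExt, hy]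

theorem continuousOn_weylExt (η : ℝ) : ContinuousOn (L.weylExt η) L.dom := by
  refine ContinuousOn.congr (f := fun y => L.weyl (2 * Real.pi * η, y)) (fun y hy => ?_)
    fun y hy => weylExt_of_mem hy
  obtain ⟨t, ht, hyt⟩ := exists_gt_mem_dom hy
  refine ((continuousOn_weyl (2 * Real.pi * η) ht) y ⟨hy.1, hyt.le⟩).mono_of_mem_nhdsWithin ?_
  filter_upwards [self_mem_nhdsWithin, mem_nhdsWithin_of_mem_nhds (Iio_mem_nhds hyt)] with z hz hz'
  exact ⟨hz.1, (mem_Iio.1 hz').le⟩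

theorem isBddMeas_weylExt (y : ℝ) : IsBddMeas fun η => L.weylExt η y :=
  ⟨measurable_slice L.measurable_weylExt y, 1, fun η => norm_weylExt_le η y⟩

/-- Plancherel on each slice followed by Tonelli. A slice whose prescribed transform is not in L² is
zero by convention, so the bound persists there. -/
theorem integrableOn_norm_sq_of_fslice (hwm : Measurable fun p : ℝ × ℝ => w p.1 p.2)
    (hw : ∀ y, MemLp (fun x => w x y) 2 volume) {Φ : ℝ → ℝ → ℂ}
    (hΦ : ∀ y, fslice w y = toL2 fun η => Φ η y) {S : Set ℝ}
    (hfin : ∫⁻ y in S, ∫⁻ η, ‖Φ η y‖ₑ ^ 2 < ⊤) :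
    IntegrableOn (fun p : ℝ × ℝ => ‖w p.1 p.2‖ ^ 2) (univ ×ˢ S) volume := by
  rw [IntegrableOn, Measure.volume_eq_prod, ← Measure.prod_restrict, Measure.restrict_univ]
  refine ⟨(hwm.norm.pow_const 2).aestronglyMeasurable, ?_⟩
  have e : ∀ g : ℝ → ℂ, eLpNorm g 2 volume ^ 2 = ∫⁻ x, ‖g x‖ₑ ^ 2 := fun g => by
    rw [eLpNorm_two_eq, ← ENNReal.rpow_natCast, ← ENNReal.rpow_mul]
    norm_num
  rw [hasFiniteIntegral_iff_enorm, lintegral_prod_symm _ (by fun_prop)]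
  refine lt_of_le_of_lt (lintegral_mono fun y => ?_) hfin
  simp only [enorm_pow, enorm_norm]
  rw [← e, ← e, eLpNorm_slice (hw y), hΦ]
  gcongr
  by_cases h : MemLp (fun η => Φ η y) 2 volume
  · rw [enorm_toL2 h]
  · simp [toL2_of_not_memLp h]

theorem locallyIntegrableOn_of_norm_sq (hwm : Measurable fun p : ℝ × ℝ => w p.1 p.2)
    (hw : ∀ t ∈ L.dom, IntegrableOn (fun p : ℝ × ℝ => ‖w p.1 p.2‖ ^ 2) (univ ×ˢ Ico 0 t) volume) :
    LocallyIntegrableOn (fun p : ℝ × ℝ => w p.1 p.2) (univ ×ˢ L.int) volume := by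
  rintro ⟨x, y⟩ ⟨-, hy⟩
  obtain ⟨t, ht, hyt⟩ := exists_gt_mem_dom (int_subset_dom hy)
  refine ⟨Ioo (x - 1) (x + 1) ×ˢ Ioo 0 t, mem_nhdsWithin_of_mem_nhds
    (prod_mem_nhds (Ioo_mem_nhds (by linarith) (by linarith)) (Ioo_mem_nhds hy.1 hyt)), ?_⟩
  have h1 : IntegrableOn (fun p : ℝ × ℝ => 1 + ‖w p.1 p.2‖ ^ 2)
      (Ioo (x - 1) (x + 1) ×ˢ Ioo 0 t) volume := by
    refine Integrable.add (integrableOn_const ?_)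
      ((hw t ht).mono_set (prod_mono (subset_univ _) Ioo_subset_Ico_self))
    rw [Measure.volume_eq_prod, Measure.prod_prod]
    exact ENNReal.mul_ne_top measure_Ioo_lt_top.ne measure_Ioo_lt_top.ne
  refine Integrable.mono' h1 hwm.aestronglyMeasurable (ae_of_all _ fun p => ?_)
  nlinarith [sq_nonneg (‖w p.1 p.2‖ - 1), norm_nonneg (w p.1 p.2)]

/-- Existence of the harmonic extension. -/
theorem exists_isHarmonicExtension
    (hs : MemLp (fun η => L.symbol (2 * Real.pi * η) * (𝓕 f : L2R) η) 2 volume) :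
    ∃ u, L.IsHarmonicExtension f u := by
  have hF : Measurable ((𝓕 f : L2R) : ℝ → ℂ) := (Lp.stronglyMeasurable _).measurable
  have hmg := L.measurable_weylGrad
  have hmp : Measurable fun p : ℝ × ℝ => L.phase (2 * Real.pi * p.1) p.2 :=
    L.measurable_phase.comp (by fun_prop : Measurable fun p : ℝ × ℝ => (2 * Real.pi * p.1, p.2))
  have hκ : Measurable fun p : ℝ × ℝ => L.phase (2 * Real.pi * p.1) p.2 *
      L.weylGrad (2 * Real.pi * p.1, p.2) * (𝓕 f : L2R) p.1 :=
    (hmp.mul (by fun_prop)).mul (hF.comp measurable_fst)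
  -- Both u and w = ∂ᵧũ are defined through their partial Fourier transforms; jointly measurable
  -- versions exist.
  obtain ⟨u, hum, hu, hfu⟩ := exists_fslice_eq (Φ := fun η y => L.weylExt η y * (𝓕 f : L2R) η)
    (L.measurable_weylExt.mul (hF.comp measurable_fst))
  obtain ⟨w, hwm, hw, hfw⟩ := exists_fslice_eq (Φ := fun η y => L.phase (2 * Real.pi * η) y *
    L.weylGrad (2 * Real.pi * η, y) * (𝓕 f : L2R) η) hκ
  have hU : ∀ y, fslice u y = mulL2 (fun η => L.weylExt η y) (𝓕 f : L2R) := fun y => by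
    rw [hfu, mulL2_apply (isBddMeas_weylExt y)]
  have hU' : ∀ y ∈ L.dom, fslice u y =ᵐ[volume] fun η =>
      L.weyl (2 * Real.pi * η, y) * (𝓕 f : L2R) η := fun y hy => by
    rw [hU]
    filter_upwards [coeFn_mulL2 (isBddMeas_weylExt y) (𝓕 f : L2R)] with η hη
    rw [hη, weylExt_of_mem hy]
  have hfin : ∀ t ∈ L.dom, ∫⁻ y in Ico 0 t, ∫⁻ η, ‖L.phase (2 * Real.pi * η) y *
      L.weylGrad (2 * Real.pi * η, y) * (𝓕 f : L2R) η‖ₑ ^ 2 < ⊤ := fun t ht =>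
    lintegral_weylGrad_lt_top hs ht
  have hsq := fun t ht => integrableOn_norm_sq_of_fslice hwm hw hfw (hfin t ht)
  have hW : ∀ t ∈ L.dom, ∀ᵐ y ∂volume.restrict (Ico 0 t), fslice w y =ᵐ[volume] fun η =>
      L.phase (2 * Real.pi * η) y * L.weylGrad (2 * Real.pi * η, y) * (𝓕 f : L2R) η := by
    intro t ht
    have hm : Measurable fun y => ∫⁻ η, ‖L.phase (2 * Real.pi * η) y *
        L.weylGrad (2 * Real.pi * η, y) * (𝓕 f : L2R) η‖ₑ ^ 2 :=
      Measurable.lintegral_prod_left' (hκ.enorm.pow_const 2)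
    filter_upwards [ae_lt_top hm (hfin t ht).ne] with y hy
    rw [hfw]
    refine coeFn_toL2 ⟨(measurable_slice (Φ := fun η y => L.phase (2 * Real.pi * η) y *
      L.weylGrad (2 * Real.pi * η, y) * (𝓕 f : L2R) η) hκ y).aestronglyMeasurable, ?_⟩
    rw [eLpNorm_two_eq]
    exact ENNReal.rpow_lt_top_of_nonneg (by norm_num) hy.ne
  have hcont : ContinuousOn (fslice u) L.dom := by
    rw [show fslice u = fun y => mulL2 (fun η => L.weylExt η y) (𝓕 f : L2R) from funext hU]
    exact continuousOn_mulL2 (fun y => (isBddMeas_weylExt y).1) (fun y η => norm_weylExt_le η y)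
      continuousOn_weylExt continuousOn_const
  refine ⟨u, ⟨hum, fun y _ => hu y, fun y hy => ?_, fun _ => ?_, fun hR => ?_,
    w, ⟨hwm, locallyIntegrableOn_of_norm_sq hwm hsq, fun v hv => isWeakDerivY_eq hs hu hw hU' hW hv⟩,
    fun y₁ y₂ h1 h12 h2 => ?_, weakEquation_of_fslice hs hu hw hU' hW⟩, ?_⟩
  · have := tendsto_iff_edist_tendsto_0.1 (hcont y hy)
    refine this.congr fun z => ?_
    rw [edist_eq_enorm_sub, eLpNorm_slice_sub (hu y) (hu z)]
  · refine ⟨‖(𝓕 f : L2R)‖₊, fun y _ => ?_⟩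
    rw [eLpNorm_slice (hu y), ← enorm_eq_nnnorm, hU, ← ofReal_norm, ← ofReal_norm]
    refine ENNReal.ofReal_le_ofReal ?_
    simpa using norm_mulL2_apply_le (isBddMeas_weylExt (L := L) y).1
      (fun η => norm_weylExt_le η y) (𝓕 f : L2R)
  · have h := ENNReal.tendsto_ofReal (tendsto_sqrt_R hR ‖(𝓕 f : L2R)‖)
    rw [ENNReal.ofReal_zero] at h
    refine tendsto_of_tendsto_of_tendsto_of_le_of_le' tendsto_const_nhds h
      (Eventually.of_forall fun y => zero_le) ?_
    filter_upwards [eventually_mem_dom hR] with y hy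
    rw [eLpNorm_slice (hu y), hU, ← ofReal_norm]
    exact ENNReal.ofReal_le_ofReal (norm_mulL2_weyl_le hR hy (isBddMeas_weylExt y).1
      (fun η => by rw [weylExt_of_mem hy]) _)
  · exact (hsq y₂ ⟨(h1.trans h12).le, h2⟩).mono_set
      (prod_mono_right fun z hz => ⟨(h1.trans hz.1).le, hz.2⟩)
  · have h0 : slice u 0 = f := eq_of_fourier_ae_eq (by
      filter_upwards [hU' 0 L.zero_mem_dom] with η hη
      rw [← fslice, hη, weyl_zero, one_mul])
    have := coeFn_toL2 (hu 0)
    rw [← slice, h0] at this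
    exact this.symm

end OperatorL

/-! ### The Dirichlet-to-Neumann operator -/

theorem coeFn_fourier_add (f g : L2R) :
    (𝓕 (f + g) : L2R) =ᵐ[volume] fun η => (𝓕 f : L2R) η + (𝓕 g : L2R) η := by
  rw [show (𝓕 (f + g) : L2R) = 𝓕 f + 𝓕 g from map_add (Lp.fourierTransformₗᵢ ℝ ℂ) f g]
  exact Lp.coeFn_add _ _

theorem coeFn_fourier_smul (c : ℂ) (f : L2R) :
    (𝓕 (c • f) : L2R) =ᵐ[volume] fun η => c * (𝓕 f : L2R) η := by
  rw [show (𝓕 (c • f) : L2R) = c • 𝓕 f from map_smul (Lp.fourierTransformₗᵢ ℝ ℂ) c f]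
  exact Lp.coeFn_smul _ _

namespace OperatorL

variable {f : L2R}

/-- The domain of the Dirichlet-to-Neumann operator. -/
def neumannDomain (L : OperatorL) : Submodule ℂ L2R where
  carrier := {f | MemLp (fun η => L.symbol (2 * Real.pi * η) * (𝓕 f : L2R) η) 2 volume}
  zero_mem' := by
    refine (memLp_congr_ae (g := fun _ => 0) ?_).2 MemLp.zero
    filter_upwards [coeFn_fourier_smul 0 0] with η hη
    rw [← zero_smul ℂ (0 : L2R), hη, zero_mul, mul_zero]
  add_mem' {f g} hf hg := by
    refine (memLp_congr_ae ?_).2 (MemLp.add hf hg)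
    filter_upwards [coeFn_fourier_add f g] with η hη
    rw [hη, Pi.add_apply, mul_add]
  smul_mem' c f hf := by
    refine (memLp_congr_ae ?_).2 (MemLp.const_mul hf c)
    filter_upwards [coeFn_fourier_smul c f] with η hη
    rw [hη, mul_left_comm]

/-- The Dirichlet-to-Neumann operator. -/
def neumannOp (L : OperatorL) : L2R →ₗ.[ℂ] L2R where
  domain := L.neumannDomain
  toFun :=
    { toFun := fun f => L.neumann f
      map_add' := fun f g => by
        refine eq_of_fourier_ae_eq ?_
        filter_upwards [fourier_neumann f.2, fourier_neumann g.2, fourier_neumann (f + g).2,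
          coeFn_fourier_add (L.neumann f) (L.neumann g), coeFn_fourier_add (f : L2R) g]
          with η h1 h2 h3 h4 h5
        rw [h3, h4, h1, h2, Submodule.coe_add, h5]
        ring
      map_smul' := fun c f => by
        refine eq_of_fourier_ae_eq ?_
        filter_upwards [fourier_neumann f.2, fourier_neumann (c • f).2,
          coeFn_fourier_smul c (L.neumann f), coeFn_fourier_smul c (f : L2R)]
          with η h1 h2 h3 h4
        rw [h2, RingHom.id_apply, h3, h1, Submodule.coe_smul, h4]
        ring }

theorem IsHarmonicExtension.exists_hasNormalDerivative_iff {L : OperatorL} (hL : L.IsStar)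
    {u : ℝ → ℝ → ℂ} (hu : L.IsHarmonicExtension f u) :
    (∃ g : L2R, HasNormalDerivative u g) ↔
      MemLp (fun η => L.symbol (2 * Real.pi * η) * (𝓕 f : L2R) η) 2 volume := by
  refine ⟨fun ⟨g, hg⟩ => ?_, fun h => ⟨L.neumann f, hu.hasNormalDerivative hL (fourier_neumann h)⟩⟩
  refine (Lp.memLp (𝓕 g : L2R)).neg.ae_eq ?_
  filter_upwards [hu.fourier_normalDerivative hL hg] with η hη
  rw [Pi.neg_apply, hη]
  ring

theorem isDirichletToNeumann_neumannOp {L : OperatorL} (hL : L.IsStar) :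
    L.IsDirichletToNeumann L.neumannOp := by
  intro f g
  rw [LinearPMap.mem_graph_iff]
  constructor
  · rintro ⟨f', rfl, rfl⟩
    obtain ⟨u, hu⟩ := exists_isHarmonicExtension f'.2
    exact ⟨u, hu, hu.hasNormalDerivative hL (fourier_neumann f'.2)⟩
  · rintro ⟨u, hu, hg⟩
    have h := (hu.exists_hasNormalDerivative_iff hL).1 ⟨g, hg⟩
    exact ⟨⟨f, h⟩, rfl, eq_of_fourier_ae_eq
      ((fourier_neumann h).trans (hu.fourier_normalDerivative hL hg).symm)⟩

theorem isFourierMultiplier_neumannOp (L : OperatorL) :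
    IsFourierMultiplier L.neumannOp fun ξ => -L.k ξ := by
  refine ⟨fun f => ?_, fun f => hat_eq_iff.2 (fourier_neumann f.2)⟩
  refine (memLp_k_hat_iff (L := L) (f := f)).symm.trans (memLp_neg_iff.symm.trans ?_)
  refine memLp_congr_ae (ae_of_all _ fun ξ => ?_)
  simp

end OperatorL
end

theorem lemma3p3 (L : OperatorL) (hL : L.IsStar) :
    (∀ (f : L2R) (u : ℝ → ℝ → ℂ), L.IsHarmonicExtension f u →
      ((∃ g : L2R, HasNormalDerivative u g) ↔
        MemLp (fun ξ => L.k ξ * hat f ξ) 2 volume) ∧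
      ∀ g : L2R, HasNormalDerivative u g →
        hat g =ᵐ[volume] fun ξ => -L.k ξ * hat f ξ) ∧
    ∃ K : L2R →ₗ.[ℂ] L2R, L.IsDirichletToNeumann K ∧
      IsFourierMultiplier K (fun ξ => -L.k ξ) :=
  ⟨fun _ _ hu => ⟨(hu.exists_hasNormalDerivative_iff hL).trans OperatorL.memLp_k_hat_iff.symm,
      fun _ hg => OperatorL.hat_eq_iff.2 (hu.fourier_normalDerivative hL hg)⟩,
    L.neumannOp, OperatorL.isDirichletToNeumann_neumannOp hL,
    OperatorL.isFourierMultiplier_neumannOp L⟩
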